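/- A *diagram* is a finite, simply connected, 2-dimensional CW complex with an embedding in the plane, up to orientation-preserving homeomorphism of the plane; it is *simple* if it is homeomorphic to a closed disc. An *arc* is a maximal path of length at least $1$ all of whose interior vertices have valence $2$; it is *exterior* if it lies in the boundary of the diagram and *interior* if its interior lies in the interior of the diagram. For a face $\Pi$ (the image of a closed 2-cell) let $i(\Pi)$ and $e(\Pi)$ be the numbers of interior and exterior arcs in its boundary. A *combinatorial geodesic $n$-gon* is a diagram $D$ in which every interior vertex has valence at least $3$ and every face with $e(\Pi)=0$ has $i(\Pi)\ge 7$, whose positively oriented boundary is written as a concatenation of $n$ immersed paths (*sides*, ordered up to cyclic permutation), such that every face whose exterior part is a single arc contained in one side has $i(\Pi)\ge 4$. A *distinguished vertex* is a vertex of valence $2$ that belongs to more than one side. The $n$-gon is *degenerate* if concatenating two cyclically consecutive sides gives a combinatorial geodesic $(n-1)$-gon. It is *reducible* if one of the following holds: (vertex reduction) there is a separating vertex that lies on exactly two faces, on no other maximal cell, and on exactly two sides; (edge reduction) there is an interior edge with both ends on $\partial D$ such that the two faces along it are the only maximal cells meeting it and each of its ends lies on exactly one side; (face reduction) there are a face $\Pi$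 with $e(\Pi)\ge 2$ and distinct edges $e,e'$ of $\partial\Pi\cap\partial D$, each belonging to only one side, such that removing the interiors of $\Pi,e,e'$ leaves two components, each containing a distinguished vertex. A combinatorial geodesic $n$-gon with $n>2$ is *special* if it is simple, non-degenerate, irreducible, and every non-distinguished vertex has valence $3$. In the following configurations every vertex of valence other than $2$ has valence $3$, the four vertices of valence $2$ (the corners) lie in the boundaries of the four faces called *corner faces*, one in each, and no face has more than one exterior arc. Such a configuration is given by naming its faces, saying which triples of faces meet at an interior vertex (each listed triple at exactly one vertex), and naming the corner faces. A *strip* $v_1,\dots,v_n$ means the triples $v_kv_{k+1}v_{k+2}$ for $1\le k\le n-2$; a *wheel* with hub $c$ and rim $r_1,\dots,r_d$ means the triples $c\,r_j\,r_{j+1}$, indices modulo $d$. *Extraordinary configurations.* - $E_5$: strip $v_1,\dots,v_6$ and triples $v_2v_4a$, $v_3v_5b$; corner faces $v_1,v_6,a,b$. - $E_6$: strip $v_1,\dots,v_7$ and triples $v_2v_4a$, $v_4v_6b$; corner faces $v_1,v_7,a,b$. - $E_{7a}$: wheel with hub $c$ and rim $r_1,\dots,r_7$ and triples $r_2r_3x_1$,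 $r_4r_5x_2$, $r_6r_7x_3$; corner faces $r_1,x_1,x_2,x_3$. - $E_{7b}$: wheel with hub $c$ and rim $c',r_1,\dots,r_6$, wheel with hub $c'$ and rim $c,r_1,s_1,s_2,s_3,s_4,r_6$ (the two triples $c\,c'\,r_1$ and $c\,c'\,r_6$ occurring in both are taken once), and triples $r_2r_3x_1$, $r_4r_5x_2$, $s_1s_2x_3$, $s_3s_4x_4$; corner faces $x_1,\dots,x_4$. - $E_{7c}$: wheel with hub $c$ and rim $r_1,\dots,r_7$ and triples $r_1r_2x_1$, $r_3r_4x_2$, $r_5r_6x_3$, $r_7r_1x_4$; corner faces $x_1,\dots,x_4$. - $E_8$: wheel with hub $c$ and rim $r_1,\dots,r_8$ and triples $r_1r_2x_1$, $r_3r_4x_2$, $r_5r_6x_3$, $r_7r_8x_4$; corner faces $x_1,\dots,x_4$. *Zippered configurations with $t\ge 0$ teeth.* A zipper has two ends, each of one of two types. - Both ends of type 1: strip $v_1,\dots,v_{t+4}$; corner faces $v_1,v_2,v_{t+3},v_{t+4}$; teeth $v_3,\dots,v_{t+2}$. - Ends of types 1 and 2: strip $v_1,\dots,v_{t+6}$ and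 the triple $v_{t+3}v_{t+5}b$; corner faces $v_1,v_2,v_{t+6},b$; teeth $v_3,\dots,v_{t+2}$. - Both ends of type 2: strip $v_1,\dots,v_{t+8}$ and the triples $v_2v_4a$, $v_{t+5}v_{t+7}b$; corner faces $v_1,v_{t+8},a,b$; teeth $v_5,\dots,v_{t+4}$. The pair of end types together with the parity of $t$ distinguishes six infinite *zippered families*. **Theorem.** Every special combinatorial geodesic quadrangle is, up to homeomorphism (possibly reversing orientation), one of the six extraordinary configurations $E_5,E_6,E_{7a},E_{7b},E_{7c},E_8$ or a member of one of the six infinite zippered families. -/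

import Mathlib

/-- A planar disc diagram with at least one edge: a finite, connected and simply connected
2-complex embedded in the plane, up to orientation-preserving homeomorphism of the plane, given by
its rotation system.  The elements of `D` are the darts (oriented edges), `flip` reverses a dart and
`rot` turns a dart counterclockwise to the next dart with the same initial vertex.
Vertices, edges and complementary regions are the cycles of `rot`, `flip` and
`flip.trans rot` (which sends `d` to `rot (flip d)`, the next dart along the boundary of the region
to the right of `d`).  Connectedness and Euler's formula say that the surface is the sphere; `root`
is a dart of the unbounded region.  All other regions are the 2-cells (faces) of the diagram. -/
structure Diagram (D : Type*) [Finite D] where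
  rot : Equiv.Perm D
  flip : Equiv.Perm D
  flip_flip : ∀ d, flip (flip d) = d
  flip_ne : ∀ d, flip d ≠ d
  connected : ∀ a b : D, Relation.ReflTransGen (fun x y => y = rot x ∨ y = flip x) a b
  euler : Nat.card (Quotient (Equiv.Perm.SameCycle.setoid rot)) +
      Nat.card (Quotient (Equiv.Perm.SameCycle.setoid (flip.trans rot))) =
    Nat.card (Quotient (Equiv.Perm.SameCycle.setoid flip)) + 2
  root : D

namespace Diagram

section

variable {D : Type*} [Finite D] (M : Diagram D)

/-- The dart following `d` along the boundary of the region to the right of `d`. -/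
def next : Equiv.Perm D := M.flip.trans M.rot

/-- Vertices. -/
def Vertex : Type _ := Quotient (Equiv.Perm.SameCycle.setoid M.rot)

/-- Regions of the plane: the 2-cells of the diagram and the unbounded region. -/
def Region : Type _ := Quotient (Equiv.Perm.SameCycle.setoid M.next)

/-- The initial vertex of a dart; the terminal vertex of `d` is `M.vert (M.flip d)`. -/
def vert (d : D) : M.Vertex := Quotient.mk _ d

/-- The region to the right of a dart. -/
def region (d : D) : M.Region := Quotient.mk _ d

/-- The unbounded region.  Faces are the regions different from it. -/
def outer : M.Region := M.region M.root

/-- The valence of a vertex (a loop counts twice). -/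
noncomputable def valence (v : M.Vertex) : ℕ := Nat.card {d : D // M.vert d = v}

/-- The vertex lies on the boundary of the diagram. -/
def IsBoundaryVertex (v : M.Vertex) : Prop := ∃ d, M.vert d = v ∧ M.region d = M.outer

/-- The edge of `d` lies on the boundary of the diagram. -/
def IsExterior (d : D) : Prop := M.region d = M.outer ∨ M.region (M.flip d) = M.outer

/-- Arcs: maximal paths of edges all of whose interior vertices have valence 2.  An arc is
recorded as the class of the darts of its edges. -/
def Arc : Type _ := Quotient (Relation.EqvGen.setoid
  (fun d d' : D => d' = M.flip d ∨ (d' = M.next d ∧ M.valence (M.vert d') = 2)))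

/-- The arc that contains the edge of `d`. -/
def arc (d : D) : M.Arc := Quotient.mk _ d

/-- The number of interior arcs in the boundary of a face. -/
noncomputable def interiorDegree (f : M.Region) : ℕ :=
  Nat.card {a : M.Arc // ∃ d, M.arc d = a ∧ M.region d = f ∧ ¬ M.IsExterior d}

/-- The number of exterior arcs in the boundary of a face. -/
noncomputable def exteriorDegree (f : M.Region) : ℕ :=
  Nat.card {a : M.Arc // ∃ d, M.arc d = a ∧ M.region d = f ∧ M.IsExterior d}

/-- A (3,7)-diagram: interior vertices have valence at least three and interior faces (those
without exterior arcs) have interior degree at least seven. -/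
def IsThreeSeven : Prop :=
  (∀ v, ¬ M.IsBoundaryVertex v → 3 ≤ M.valence v) ∧
  ∀ f, f ≠ M.outer → M.exteriorDegree f = 0 → 7 ≤ M.interiorDegree f

/-- `l` runs once around the boundary of the region `f`, starting at an arbitrary dart. -/
def Traces (f : M.Region) (l : List D) : Prop :=
  l.Nodup ∧ (∀ d, d ∈ l ↔ M.region d = f) ∧ l.IsChain (fun a b => b = M.next a)

/-- `(M, sides)` is a combinatorial geodesic polygon, with `sides.length` sides: `M` is a
(3,7)-diagram, its positively oriented boundary is the concatenation of the sides, which are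
immersed paths, and each face whose exterior part is a single arc contained in one side
has interior degree at least four. -/
def IsGeodesicPolygon (sides : List (List D)) : Prop :=
  M.IsThreeSeven ∧
  M.Traces M.outer sides.flatten ∧
  (∀ s ∈ sides, s.IsChain (fun a b => b ≠ M.flip a)) ∧
  ∀ f, f ≠ M.outer → M.exteriorDegree f = 1 →
    (∃ s ∈ sides, ∀ d, M.region d = f → M.region (M.flip d) = M.outer → M.flip d ∈ s) →
    4 ≤ M.interiorDegree f

/-- Concatenating some pair of cyclically consecutive sides gives a combinatorial geodesic polygon
with one side less. -/
def IsDegenerate (sides : List (List D)) : Prop :=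
  ∃ (a b : List D) (rest : List (List D)),
    sides.IsRotated (a :: b :: rest) ∧ M.IsGeodesicPolygon ((a ++ b) :: rest)

/-- The vertex `v` lies on the side `s`. -/
def OnSide (v : M.Vertex) (s : List D) : Prop :=
  ∃ d ∈ s, M.vert d = v ∨ M.vert (M.flip d) = v

/-- A distinguished vertex: a vertex of valence 2 that belongs to more than one side. -/
def IsDistinguished (sides : List (List D)) (v : M.Vertex) : Prop :=
  M.valence v = 2 ∧ ∃ s ∈ sides, ∃ t ∈ sides, s ≠ t ∧ M.OnSide v s ∧ M.OnSide v t

/-- The diagram is homeomorphic to a disc: its boundary is a simple closed curve (the unbounded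
region has no repeated vertex, and every edge is in the boundary of a face). -/
def IsSimple : Prop :=
  (∀ d d', M.region d = M.outer → M.region d' = M.outer → M.vert d = M.vert d' → d = d') ∧
  ∀ d, M.region d = M.outer → M.region (M.flip d) ≠ M.outer

/-- A vertex reduction is possible: some separating vertex `v` (one which the unbounded region
meets in more than one corner) lies on exactly two faces, which are the only maximal cells
containing it, and on exactly two sides. -/
def VertexReducible (sides : List (List D)) : Prop :=
  ∃ v : M.Vertex,
    (∃ d d', d ≠ d' ∧ M.vert d = v ∧ M.vert d' = v ∧
      M.region d = M.outer ∧ M.region d' = M.outer) ∧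
    Nat.card {f : M.Region // f ≠ M.outer ∧ ∃ d, M.vert d = v ∧ M.region d = f} = 2 ∧
    (∀ d, M.vert d = v → ¬ (M.region d = M.outer ∧ M.region (M.flip d) = M.outer)) ∧
    Nat.card {s : List D // s ∈ sides ∧ M.OnSide v s} = 2

/-- An edge reduction is possible: some interior edge `e` has both ends on the boundary, the two
faces along `e` are the only maximal cells meeting `e`, and each end lies on exactly one side. -/
def EdgeReducible (sides : List (List D)) : Prop :=
  ∃ e : D, ¬ M.IsExterior e ∧ M.region e ≠ M.region (M.flip e) ∧
    ∀ v, (v = M.vert e ∨ v = M.vert (M.flip e)) →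
      M.IsBoundaryVertex v ∧
      (∀ d, M.vert d = v →
        (M.region d = M.outer ∨ M.region d = M.region e ∨ M.region d = M.region (M.flip e)) ∧
        ¬ (M.region d = M.outer ∧ M.region (M.flip d) = M.outer)) ∧
      ∃! s, s ∈ sides ∧ M.OnSide v s

/-- Adjacency of vertices after the open edges `e` and `e'` have been removed. -/
def AdjAway (e e' : D) (v w : M.Vertex) : Prop :=
  ∃ d, d ≠ e ∧ d ≠ M.flip e ∧ d ≠ e' ∧ d ≠ M.flip e' ∧ M.vert d = v ∧ M.vert (M.flip d) = w

/-- A face reduction is possible: some face `f` with at least two exterior arcs has two distinct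
boundary edges `e`, `e'` in the boundary of the diagram, each in only one side, such that removing
the open cells `f`, `e`, `e'` leaves exactly two components, each of which contains a
distinguished vertex.  (The boundaries of the other faces avoid `e` and `e'`, so components can be
computed in the 1-skeleton.) -/
def FaceReducible (sides : List (List D)) : Prop :=
  ∃ (f : M.Region) (e e' : D), f ≠ M.outer ∧ 2 ≤ M.exteriorDegree f ∧ e ≠ e' ∧
    M.region e = f ∧ M.region e' = f ∧
    M.region (M.flip e) = M.outer ∧ M.region (M.flip e') = M.outer ∧
    (∃! s, s ∈ sides ∧ M.flip e ∈ s) ∧ (∃! s, s ∈ sides ∧ M.flip e' ∈ s) ∧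
    Nat.card (Quot (M.AdjAway e e')) = 2 ∧
    ∀ c : Quot (M.AdjAway e e'), ∃ v, M.IsDistinguished sides v ∧ Quot.mk _ v = c

/-- The polygon admits a vertex, edge or face reduction. -/
def IsReducible (sides : List (List D)) : Prop :=
  M.VertexReducible sides ∨ M.EdgeReducible sides ∨ M.FaceReducible sides

/-- Special combinatorial geodesic polygons: more than two sides, simple, non-degenerate,
irreducible, and every non-distinguished vertex has valence 3. -/
def IsSpecial (sides : List (List D)) : Prop :=
  2 < sides.length ∧ M.IsGeodesicPolygon sides ∧ M.IsSimple ∧ ¬ M.IsDegenerate sides ∧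
  ¬ M.IsReducible sides ∧ ∀ v, ¬ M.IsDistinguished sides v → M.valence v = 3

/-- The diagram is glued from polygons according to the table `T`: its faces can be numbered
`1, …, T.length` such that, running around the face `k`, one sees across the consecutive edges the
regions listed in the `k`-th entry of `T`, where `0` stands for the unbounded region. -/
def Realizes (T : List (List ℕ)) : Prop :=
  ∃ label : M.Region → ℕ, Function.Injective label ∧ label M.outer = 0 ∧
    (∀ k, (∃ f, label f = k) ↔ k ≤ T.length) ∧
    ∀ f, f ≠ M.outer → ∃ l : List D, M.Traces f l ∧
      T[label f - 1]? = some (l.map fun d => label (M.region (M.flip d)))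

/-- The diagram or its mirror image is glued from polygons according to the table `T`. -/
def HasShape (T : List (List ℕ)) : Prop :=
  M.Realizes T ∨ M.Realizes (T.map List.reverse)

end

end Diagram

/- In the tables below, the entry of a face lists the regions met across its consecutive edges.  Two
faces share at most one edge, so that the table determines a simple diagram up to homeomorphism.
A face `[0, 0, …]` has a valence 2 vertex (a corner of the quadrangle) between its two boundary
edges. -/

/-- The six extraordinary configurations. -/
inductive Extraordinary where
  | E5 | E6 | E7a | E7b | E7c | E8

/-- The gluing tables of the extraordinary configurations. -/
def Extraordinary.table : Extraordinary → List (List ℕ)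
  /- Faces 3 and 4 have interior degree 5 and share an edge. -/
  | .E5 => [[0, 0, 2, 3], [0, 7, 4, 3, 1], [0, 1, 2, 4, 5, 8], [0, 6, 5, 3, 2, 7],
      [0, 8, 3, 4, 6], [0, 0, 5, 4], [0, 0, 4, 2], [0, 0, 3, 5]]
  /- Face 4 has interior degree 6. -/
  | .E6 => [[0, 0, 2, 3], [0, 8, 4, 3, 1], [0, 1, 2, 4, 5], [0, 9, 6, 5, 3, 2, 8],
      [0, 3, 4, 6, 7], [0, 7, 5, 4, 9], [0, 0, 5, 6], [0, 0, 4, 2], [0, 0, 6, 4]]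
  /- Face 1 is an interior heptagon, face 2 is a corner of interior degree 3 adjacent to it. -/
  | .E7a => [[2, 3, 4, 5, 6, 7, 8], [0, 0, 3, 1, 8], [0, 9, 4, 1, 2], [0, 5, 1, 3, 9],
      [0, 10, 6, 1, 4], [0, 7, 1, 5, 10], [0, 11, 8, 1, 6], [0, 2, 1, 7, 11],
      [0, 0, 4, 3], [0, 0, 6, 5], [0, 0, 8, 7]]
  /- Faces 1 and 2 are interior heptagons sharing an edge. -/
  | .E7b => [[2, 3, 4, 5, 6, 7, 8], [1, 8, 12, 11, 10, 9, 3], [0, 4, 1, 2, 9],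
      [0, 13, 5, 1, 3], [0, 6, 1, 4, 13], [0, 14, 7, 1, 5], [0, 8, 1, 6, 14],
      [0, 12, 2, 1, 7], [0, 3, 2, 10, 15], [0, 15, 9, 2, 11], [0, 10, 2, 12, 16],
      [0, 16, 11, 2, 8], [0, 0, 5, 4], [0, 0, 7, 6], [0, 0, 9, 10], [0, 0, 11, 12]]
  /- Face 1 is an interior heptagon, adjacent to the exterior face 2 of interior degree 5. -/
  | .E7c => [[2, 3, 4, 5, 6, 7, 8], [0, 9, 3, 1, 8, 12], [0, 4, 1, 2, 9], [0, 10, 5, 1, 3],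
      [0, 6, 1, 4, 10], [0, 11, 7, 1, 5], [0, 8, 1, 6, 11], [0, 12, 2, 1, 7],
      [0, 0, 3, 2], [0, 0, 5, 4], [0, 0, 7, 6], [0, 0, 2, 8]]
  /- Face 1 is an interior octagon. -/
  | .E8 => [[2, 3, 4, 5, 6, 7, 8, 9], [0, 10, 3, 1, 9], [0, 4, 1, 2, 10], [0, 11, 5, 1, 3],
      [0, 6, 1, 4, 11], [0, 12, 7, 1, 5], [0, 8, 1, 6, 12], [0, 13, 9, 1, 7],
      [0, 2, 1, 8, 13], [0, 0, 3, 2], [0, 0, 5, 4], [0, 0, 7, 6], [0, 0, 9, 8]]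

namespace Zipper

/-- In a zipper, the faces `1, 2, 3, …` lie alternately on its two sides.  Faces on opposite sides
run along the zipper in opposite directions. -/
def turn (k : ℕ) (l : List ℕ) : List ℕ := if k % 2 = 1 then l else l.reverse

/-- A face of the zipper which is adjacent exactly to the two preceding and the two following
faces, as is every tooth. -/
def tooth (k : ℕ) : List ℕ := turn k [0, k - 2, k - 1, k + 1, k + 2]

/-- The teeth numbered `k, …, k + t - 1`. -/
def teeth (k t : ℕ) : List (List ℕ) := (List.range t).map fun j => tooth (k + j)

/-- The pair of ends of a zipper.  At an end of the first kind, the face with two edges on the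
zipper is a corner of interior degree 3, and there is one other face, a corner of interior degree 2.
At an end of the second kind, the face `P` with two edges on the zipper has interior degree 5;
the next two faces `Q`, `R` along the zipper have interior degree 4, and the last two faces are
corners of interior degree 2, one adjacent to `P` and `R`, the other to `Q` and `R`. -/
inductive Ends where
  | oneOne | oneTwo | twoTwo

/-- The gluing table of the quadrangle that contains a zipper with given ends and `t` teeth. -/
def table : Ends → ℕ → List (List ℕ)
  | .oneOne, t =>
      [turn 1 [0, 0, 2, 3], turn 2 [0, 0, 1, 3, 4]] ++ teeth 3 t ++
      [turn (t + 3) [0, 0, t + 1, t + 2, t + 4], turn (t + 4) [0, 0, t + 2, t + 3]]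
  | .oneTwo, t =>
      [turn 1 [0, 0, 2, 3], turn 2 [0, 0, 1, 3, 4]] ++ teeth 3 t ++
      [turn (t + 3) [0, t + 1, t + 2, t + 4, t + 5, t + 7], tooth (t + 4),
       turn (t + 5) [0, t + 7, t + 3, t + 4, t + 6], turn (t + 6) [0, 0, t + 4, t + 5],
       turn (t + 3) [0, 0, t + 3, t + 5]]
  | .twoTwo, t =>
      [turn 1 [0, 0, 2, 3], turn 2 [0, 1, 3, 4, t + 9], tooth 3,
       turn 4 [0, t + 9, 2, 3, 5, 6]] ++ teeth 5 t ++
      [turn (t + 5) [0, t + 3, t + 4, t + 6, t + 7, t + 10], tooth (t + 6),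
       turn (t + 7) [0, t + 10, t + 5, t + 6, t + 8], turn (t + 8) [0, 0, t + 6, t + 7],
       turn 4 [0, 0, 2, 4], turn (t + 5) [0, 0, t + 5, t + 7]]

end Zipper

/-- The zippered families: one for each choice of the ends and of the parity of the
number of teeth. -/
def zipperedFamily (ends : Zipper.Ends) (parity : Fin 2) : Set (List (List ℕ)) :=
  {T | ∃ m : ℕ, T = Zipper.table ends (2 * m + parity)}

/-!
The classification is proved on the dual side.  Take a vertex for every face of the diagram and a
triangle for every interior vertex, which has valence 3 in a special quadrangle.  The result is a
triangulated disc.  A face with an exterior arc becomes a boundary vertex, whose number of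
neighbours is the number of interior arcs of the face; a face without exterior arcs becomes an
interior vertex, which has at least seven neighbours.  The four sides leave exactly four boundary
vertices with at most three neighbours: the faces at the corners.  So the theorem follows from a
classification of such triangulated discs, and from a proof that the dual has this form.

*Triangulated discs.*  A disc is recorded by its boundary word, the list of its boundary vertices
with their lists of neighbours, together with its interior vertices.  The predicate `TriSystem` says
what is needed of such words: curvature satisfies `∑ (4 - d) = 6 + ∑ (d - 6)`, summed over boundary
vertices on the left and over interior vertices on the right, and a triangle at the boundary can be
cut off.  Call a boundary vertex with two neighbours an *ear*.  If exactly four boundary vertices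
have at most three neighbours, then curvature allows seven combinations of the number of ears and
the degrees of the interior vertices (`TriSystem.degree_cases`).  Without interior vertices, there
are two, three or four ears.  After cutting off ears, a disc with two ears remains in which no
vertex has more than four neighbours, and such a disc is a strip (`TriSystem.exists_strip`); this gives the
zippered families and `E5`, `E6`.  With one or two interior vertices, cutting off the ears leaves a
wheel or two overlapping wheels (`TriSystem.wheel`, `TriSystem.double_wheel`), which gives `E7a`,
`E7c`, `E8` and `E7b`.  The outcome is `TriSystem.hasListedShape`.

*Special quadrangles.*  A side that starts at a vertex of valence 3 could be concatenated with the
side before it, and the condition on faces along one side would survive.  Hence non-degeneracy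
puts a corner at the start of each side, on a face with at most three interior arcs
(`Diagram.IsSpecial.corner`).  Two boundary edges of one face meet at a corner, for otherwise a face
reduction would be possible (`Diagram.IsSpecial.eq_or_corner`): removing the face and the two edges
separates the diagram, and by Gauss–Bonnet a part without a distinguished vertex cannot consist of
faces that satisfy the conditions on their arcs (`Diagram.component_contradiction`).  The number of
components and the Gauss–Bonnet estimate both come from Euler's formula for `M` and the inequality
`genus_inequality`, which holds for any pair of permutations and thus for parts of diagrams.

*Patches.*  A patch is a set of faces whose dual is a disc with a given boundary word.  Patches form
a `TriSystem` (`Diagram.triSystem`); the main point is that an interior face next to the boundary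
can be opened, which moves it to the boundary (`Diagram.IsPatch.exists_opening`).  All faces of a
special quadrangle form a patch (`Diagram.IsSpecial.exists_patch`), whose curvature identity is Euler's
formula.  The description found for its boundary word is the gluing table that the theorem asks for.
-/

/-! ### Cycle counts and the genus inequality -/

section Genus

variable {D : Type*}

theorem card_quot_congr {r s : D → D → Prop}
    (h : ∀ x y, r x y → Quot.mk s x = Quot.mk s y) (h' : ∀ x y, s x y → Quot.mk r x = Quot.mk r y) :
    Nat.card (Quot r) = Nat.card (Quot s) :=
  Nat.card_congr
    { toFun := Quot.lift (Quot.mk s) h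
      invFun := Quot.lift (Quot.mk r) h'
      left_inv := by rintro ⟨x⟩; rfl
      right_inv := by rintro ⟨x⟩; rfl }

theorem card_quot_insert_of_eq {r : D → D → Prop} {a b : D}
    (h : Quot.mk r a = Quot.mk r b) :
    Nat.card (Quot fun x y => r x y ∨ (x = a ∧ y = b)) = Nat.card (Quot r) := by
  refine card_quot_congr ?_ fun x y hxy => Quot.sound (Or.inl hxy)
  rintro x y (hxy | ⟨rfl, rfl⟩)
  exacts [Quot.sound hxy, h]

/-- Adding one relation between two different classes merges these two classes. -/
theorem card_quot_insert_of_ne [Finite D] {r : D → D → Prop} {a b : D}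
    (h : Quot.mk r a ≠ Quot.mk r b) :
    Nat.card (Quot fun x y => r x y ∨ (x = a ∧ y = b)) + 1 = Nat.card (Quot r) := by
  classical
  set r' : D → D → Prop := fun x y => r x y ∨ (x = a ∧ y = b) with hr'
  let e : Quot r' ≃ {q : Quot r // q ≠ Quot.mk r b} :=
    { toFun := Quot.lift (fun x => if hx : Quot.mk r x = Quot.mk r b then ⟨Quot.mk r a, h⟩
          else ⟨Quot.mk r x, hx⟩) (by
        rintro x y (hxy | ⟨rfl, rfl⟩)
        · have := Quot.sound hxy
          simp only [this]
        · simp [h])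
      invFun := fun q => Quot.lift (Quot.mk r') (fun x y hxy => Quot.sound (Or.inl hxy)) q.1
      left_inv := by
        rintro ⟨x⟩
        by_cases hx : Quot.mk r x = Quot.mk r b
        · simp only [hx, dite_true]
          have h1 : Quot.mk r' a = Quot.mk r' b := Quot.sound (Or.inr ⟨rfl, rfl⟩)
          have h2 : Quot.mk r' x = Quot.mk r' b := congrArg
            (Quot.lift (Quot.mk r') (fun x y hxy => Quot.sound (Or.inl hxy))) hx
          exact h1.trans h2.symm
        · simp only [hx, dite_false]
      right_inv := by
        rintro ⟨⟨x⟩, hx⟩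
        exact dif_neg hx }
  have h1 := Nat.card_congr e
  have h2 := Nat.card_congr (Equiv.sumCompl (fun q : Quot r => q = Quot.mk r b))
  rw [Nat.card_sum, Nat.card_unique] at h2
  rw [h1, ← h2, add_comm]

theorem card_quot_le_insert [Finite D] (r : D → D → Prop) (a b : D) :
    Nat.card (Quot r) ≤ Nat.card (Quot fun x y => r x y ∨ (x = a ∧ y = b)) + 1 := by
  by_cases h : Quot.mk r a = Quot.mk r b
  · rw [card_quot_insert_of_eq h]; omega
  · rw [card_quot_insert_of_ne h]

/-- The number of cycles of a permutation, fixed points included. -/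
noncomputable def numCycles (π : Equiv.Perm D) : ℕ := Nat.card (Quot fun x y => y = π x)

theorem mk_zpow (π : Equiv.Perm D) (x : D) (n : ℤ) :
    (Quot.mk (fun x y => y = π x) ((π ^ n) x)) = Quot.mk _ x := by
  induction n with
  | zero => simp
  | succ n ih =>
    rw [← ih]
    refine (Quot.sound ?_).symm
    rw [add_comm, zpow_add, zpow_one, Equiv.Perm.mul_apply]
  | pred n ih =>
    rw [← ih]
    refine Quot.sound ?_
    rw [sub_eq_neg_add, zpow_add, zpow_neg_one, Equiv.Perm.mul_apply]
    exact (Equiv.apply_symm_apply π _).symm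

theorem mk_eq_iff_sameCycle {π : Equiv.Perm D} {x y : D} :
    Quot.mk (fun x y => y = π x) x = Quot.mk _ y ↔ π.SameCycle x y := by
  constructor
  · intro h
    have : Relation.EqvGen (fun x y => y = π x) x y := Quot.eqvGen_exact h
    induction this with
    | rel x y hxy => exact ⟨1, by simp [hxy]⟩
    | refl x => exact Equiv.Perm.SameCycle.refl _ _
    | symm x y _ ih => exact (ih (Quot.eqvGen_sound ‹_›)).symm
    | trans x y z _ _ ih1 ih2 =>
      exact (ih1 (Quot.eqvGen_sound ‹_›)).trans (ih2 (Quot.eqvGen_sound ‹_›))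
  · rintro ⟨n, rfl⟩
    exact (mk_zpow π x n).symm

theorem numCycles_eq (π : Equiv.Perm D) :
    numCycles π = Nat.card (Quotient (Equiv.Perm.SameCycle.setoid π)) := by
  refine Nat.card_congr
    { toFun := Quot.lift (Quotient.mk _) ?_
      invFun := Quotient.lift (Quot.mk _) ?_
      left_inv := by rintro ⟨x⟩; rfl
      right_inv := by rintro ⟨x⟩; rfl }
  · rintro x _ rfl
    exact Quotient.sound (s := Equiv.Perm.SameCycle.setoid π) ⟨1, by simp⟩
  · intro x y h
    exact mk_eq_iff_sameCycle.2 h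

/-- Composing with a transposition of two points in different cycles joins these cycles. -/
theorem mk_mul_swap_of_ne [Finite D] [DecidableEq D] {π : Equiv.Perm D} {a b : D}
    (h : Quot.mk (fun x y => y = π x) a ≠ Quot.mk _ b) :
    Quot.mk (fun x y => y = (π * Equiv.swap a b) x) a = Quot.mk _ b := by
  by_contra hne
  have hab : a ≠ b := fun hab => h (by rw [hab])
  have key : ∀ j : ℕ, Quot.mk (fun x y => y = (π * Equiv.swap a b) x) ((π ^ (j + 1)) a)
      = Quot.mk _ b := by
    intro j
    induction j with
    | zero => exact (Quot.sound (r := fun x y => y = (π * Equiv.swap a b) x) (by simp)).symm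
    | succ j ih =>
      rw [← ih]
      refine (Quot.sound ?_).symm
      have h1 : (π ^ (j + 1)) a ≠ a := fun h1 => hne (by rw [h1] at ih; exact ih)
      have h2 : (π ^ (j + 1)) a ≠ b := by
        intro h2
        apply h
        rw [mk_eq_iff_sameCycle]
        exact ⟨(j + 1 : ℕ), by rw [zpow_natCast, h2]⟩
      rw [Equiv.Perm.mul_apply, Equiv.swap_apply_of_ne_of_ne h1 h2, pow_succ' π (j + 1),
        Equiv.Perm.mul_apply]
  have := key (orderOf π - 1)
  rw [Nat.sub_add_cancel (orderOf_pos π), pow_orderOf_eq_one] at this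
  exact hne this

theorem card_insert_mul_swap [DecidableEq D] (π : Equiv.Perm D) (a b : D) :
    Nat.card (Quot fun x y => y = (π * Equiv.swap a b) x ∨ (x = a ∧ y = b)) =
    Nat.card (Quot fun x y => y = π x ∨ (x = a ∧ y = b)) := by
  have main : ∀ π : Equiv.Perm D, ∀ x y, y = (π * Equiv.swap a b) x ∨ (x = a ∧ y = b) →
      Quot.mk (fun x y => y = π x ∨ (x = a ∧ y = b)) x = Quot.mk _ y := by
    rintro π x y (rfl | h)
    · have hab : Quot.mk (fun x y => y = π x ∨ (x = a ∧ y = b)) a = Quot.mk _ b :=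
        Quot.sound (Or.inr ⟨rfl, rfl⟩)
      by_cases hxa : x = a
      · subst hxa
        rw [hab]
        exact Quot.sound (Or.inl (by simp))
      by_cases hxb : x = b
      · subst hxb
        rw [← hab]
        exact Quot.sound (Or.inl (by simp))
      exact Quot.sound (Or.inl (by simp [Equiv.swap_apply_of_ne_of_ne hxa hxb]))
    · exact Quot.sound (Or.inr h)
  refine card_quot_congr (main π) fun x y h => main (π * Equiv.swap a b) x y ?_
  rwa [mul_assoc, Equiv.swap_mul_self, mul_one]

/-- The number of orbits of the group generated by two permutations. -/
noncomputable def numOrbits (σ α : Equiv.Perm D) : ℕ :=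
  Nat.card (Quot fun x y => y = σ x ∨ y = α x)

theorem numOrbits_mul_swap [DecidableEq D] (σ α : Equiv.Perm D) {a b : D}
    (ha : α a = b) (hb : α b = a) :
    numOrbits σ α = Nat.card (Quot fun x y => (y = σ x ∨ y = (α * Equiv.swap a b) x) ∨
      (x = a ∧ y = b)) := by
  refine card_quot_congr ?_ ?_
  · rintro x y (h | rfl)
    · exact Quot.sound (Or.inl (Or.inl h))
    · by_cases hxa : x = a
      · subst hxa; exact Quot.sound (Or.inr ⟨rfl, ha⟩)
      by_cases hxb : x = b
      · subst hxb
        rw [hb]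
        exact (Quot.sound (r := fun u v => (v = σ u ∨ v = (α * Equiv.swap a x) u) ∨
          (u = a ∧ v = x)) (Or.inr ⟨rfl, rfl⟩)).symm
      exact Quot.sound (Or.inl (Or.inr (by simp [Equiv.swap_apply_of_ne_of_ne hxa hxb])))
  · rintro x y ((h | rfl) | ⟨rfl, rfl⟩)
    · exact Quot.sound (Or.inl h)
    · by_cases hxa : x = a
      · subst hxa; simp [hb]
      by_cases hxb : x = b
      · subst hxb; simp [ha]
      exact Quot.sound (Or.inr (by simp [Equiv.swap_apply_of_ne_of_ne hxa hxb]))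
    · exact Quot.sound (Or.inr ha.symm)

/-- The genus inequality: vertices plus regions number at most twice the components plus the edges.
The involution `α` may have fixed points, which are loose half-edges. -/
theorem genus_inequality [Finite D] (σ α : Equiv.Perm D) (hα : ∀ x, α (α x) = x) :
    2 * numCycles σ + 2 * numCycles (σ * α) ≤
      4 * numOrbits σ α + Nat.card {x // α x ≠ x} := by
  classical
  -- remove one edge `{a, b}` of `α` at a time
  induction hn : Nat.card {x // α x ≠ x} using Nat.strong_induction_on generalizing α with
  | _ n ih =>
  by_cases hfix : ∀ x, α x = x
  · have h1 : α = 1 := Equiv.ext hfix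
    subst h1
    have : numOrbits σ 1 = numCycles σ := by
      refine card_quot_congr ?_ fun x y h => Quot.sound (Or.inl h)
      rintro x y (h | h)
      · exact Quot.sound h
      · rw [h]; rfl
    rw [mul_one, this]; omega
  push Not at hfix
  obtain ⟨a, ha⟩ := hfix
  obtain ⟨b, hb⟩ : ∃ b, α a = b := ⟨_, rfl⟩
  have hb' : α b = a := by rw [← hb, hα]
  have hab : a ≠ b := fun h => ha (by rw [hb, ← h])
  obtain ⟨α₀, hα₀⟩ : ∃ α₀, α₀ = α * Equiv.swap a b := ⟨_, rfl⟩
  have e1 : α₀ a = a := by simp [hα₀, hb']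
  have e2 : α₀ b = b := by simp [hα₀, hb]
  have e3 : ∀ x, x ≠ a → x ≠ b → α₀ x = α x := fun x h1 h2 => by
    simp [hα₀, Equiv.swap_apply_of_ne_of_ne h1 h2]
  have hinv : ∀ x, α₀ (α₀ x) = x := by
    intro x
    by_cases hxa : x = a
    · rw [hxa, e1, e1]
    by_cases hxb : x = b
    · rw [hxb, e2, e2]
    rw [e3 x hxa hxb, e3 _ ?_ ?_, hα]
    · intro h; exact hxb (by rw [← hα x, h, hb])
    · intro h; exact hxa (by rw [← hα x, h, hb'])
  have hcard : Nat.card {x // α x ≠ x} = Nat.card {x // α₀ x ≠ x} + 2 := by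
    have h1 : ({x | α x ≠ x} : Set D) = insert a (insert b {x | α₀ x ≠ x}) := by
      ext x
      simp only [Set.mem_ofPred_eq, Set.mem_insert_iff]
      by_cases hxa : x = a
      · subst hxa; simp [ha]
      by_cases hxb : x = b
      · subst hxb; simp [hb', hab]
      simp [hxa, hxb, e3 x hxa hxb]
    have h2 : ∀ p : D → Prop, Nat.card {x // p x} = Set.ncard {x | p x} := fun p => rfl
    rw [h2, h2, h1, Set.ncard_insert_of_notMem _ (Set.toFinite _),
      Set.ncard_insert_of_notMem _ (Set.toFinite _)]
    · simp [e2]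
    · simp [e1, hab]
  have IH := ih _ (by omega) α₀ hinv rfl
  have hπ : σ * α₀ = (σ * α) * Equiv.swap a b := by rw [hα₀, mul_assoc]
  have hπ' : σ * α = (σ * α₀) * Equiv.swap a b := by
    rw [hπ, mul_assoc, Equiv.swap_mul_self, mul_one]
  have hO := numOrbits_mul_swap σ α hb hb'
  rw [← hα₀] at hO
  have hC := card_insert_mul_swap (σ * α₀) a b
  rw [← hπ'] at hC
  by_cases hr : Quot.mk (fun x y => y = σ x ∨ y = α₀ x) a = Quot.mk _ b
  -- if the ends of the edge remain connected, the number of regions changes by at most one;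
  -- otherwise its removal separates one component into two, and one region into two
  · rw [card_quot_insert_of_eq hr] at hO
    have h1 : numCycles (σ * α) ≤ numCycles (σ * α₀) + 1 := by
      refine (card_quot_le_insert _ a b).trans ?_
      rw [hC]
      by_cases h : Quot.mk (fun x y => y = (σ * α₀) x) a = Quot.mk _ b
      · rw [card_quot_insert_of_eq h]; rfl
      · have := card_quot_insert_of_ne h
        unfold numCycles
        omega
    have h2 : numOrbits σ α = numOrbits σ α₀ := hO
    omega
  · have h0 := card_quot_insert_of_ne hr
    have h1 : Quot.mk (fun x y => y = (σ * α₀) x) a ≠ Quot.mk _ b := by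
      intro h
      apply hr
      have := congrArg (Quot.lift (Quot.mk (fun x y => y = σ x ∨ y = α₀ x)) (by
        rintro x _ rfl
        exact (Quot.sound (r := fun x y => y = σ x ∨ y = α₀ x) (Or.inr rfl)).trans
          (Quot.sound (Or.inl rfl)))) h
      exact this
    have h2 := card_quot_insert_of_ne h1
    have h3 := mk_mul_swap_of_ne h1
    rw [← hπ'] at h3
    rw [← hC, card_quot_insert_of_eq h3] at h2
    unfold numOrbits numCycles at *
    omega

end Genus

/-! ### Boundary words of triangulated discs -/

section Words

variable {α : Type*}

theorem exists_isRotated_cons {β : Type*} {w : List β} (hw : 3 ≤ w.length) {e : β}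
    (he : e ∈ w) : ∃ y mid x, w ~r (e :: y :: (mid ++ [x])) := by
  obtain ⟨s, t, rfl⟩ := List.append_of_mem he
  have h1 : (s ++ e :: t) ~r (e :: (t ++ s)) := by
    simpa using List.isRotated_append (l := s) (l' := e :: t)
  rcases hts : t ++ s with _ | ⟨y, r⟩
  · have := congrArg List.length hts
    simp only [List.length_append, List.length_cons, List.length_nil] at this hw
    omega
  rcases List.eq_nil_or_concat r with rfl | ⟨mid, x, rfl⟩
  · have := congrArg List.length hts
    simp only [List.length_append, List.length_cons, List.length_nil] at this hw
    omega
  exact ⟨y, mid, x, by rw [hts] at h1; simpa using h1⟩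

/-- The boundary words of a family of triangulated discs, closed under cutting off pieces.

In `P w H`, the list `w` runs once around the boundary of a disc, and `H` lists its interior
vertices.  Every vertex comes with the list of its neighbours.  For a boundary vertex this list
starts with the preceding and ends with the following vertex of the boundary; for an interior vertex
it is a cyclic list.  A boundary vertex with two neighbours is called an ear.  (The vertices are
the faces of a diagram, and the triangles are its interior vertices.) -/
structure TriSystem (P : List (α × List α) → List (α × List α) → Prop) : Prop where
  rotate : ∀ {e w H}, P (e :: w) H → P (w ++ [e]) H
  nodup : ∀ {w H}, P w H → ((w ++ H).map Prod.fst).Nodup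
  two_le_length : ∀ {w H}, P w H → 2 ≤ w.length
  two_le : ∀ {w H}, P w H → 3 ≤ w.length → ∀ e ∈ w, 2 ≤ e.2.length
  seven_le : ∀ {w H}, P w H → ∀ e ∈ H, 7 ≤ e.2.length
  adj : ∀ {x y w H}, P (x :: y :: w) H → x.2.getLast? = some y.1 ∧ y.2.head? = some x.1
  /-- A vertex with only two neighbours can be cut off. -/
  ear : ∀ {z y mid x H}, P (z :: y :: (mid ++ [x])) H → z.2.length = 2 →
    P ((y.1, y.2.tail) :: (mid ++ [(x.1, x.2.dropLast)])) H
  sum : ∀ {w H}, P w H → (w.map fun e => (4 : ℤ) - e.2.length).sum =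
    6 + (H.map fun e => (e.2.length : ℤ) - 6).sum
  /-- Some triangle at the boundary can be cut off: either the triangle at a vertex with two
  neighbours, or a triangle with an interior vertex `h`, which then becomes a boundary vertex. -/
  exists_step : ∀ {w H}, P w H → 3 ≤ w.length → (∃ e ∈ w, e.2.length = 2) ∨
    ∃ y mid x h nh H₁ H₂, w ~r (y :: (mid ++ [x])) ∧ H = H₁ ++ h :: H₂ ∧ nh ~r h.2 ∧
      P ((h.1, nh) :: (y.1, y.2.tail) :: (mid ++ [(x.1, x.2.dropLast)])) (H₁ ++ H₂)

/-- The reflected entry of a boundary word. -/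
def mirrorEntry (e : α × List α) : α × List α := (e.1, e.2.reverse)

/-- The reflected boundary word. -/
def mirrorWord (w : List (α × List α)) : List (α × List α) := (w.map mirrorEntry).reverse

@[simp] theorem mirrorEntry_mirrorEntry (e : α × List α) : mirrorEntry (mirrorEntry e) = e := by
  simp [mirrorEntry]

@[simp] theorem mirrorWord_mirrorWord (w : List (α × List α)) :
    mirrorWord (mirrorWord w) = w := by
  simp [mirrorWord, Function.comp_def]

@[simp] theorem length_mirrorWord (w : List (α × List α)) : (mirrorWord w).length = w.length := by
  simp [mirrorWord]

@[simp] theorem mem_mirrorWord {w : List (α × List α)} {e : α × List α} :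
    e ∈ mirrorWord w ↔ mirrorEntry e ∈ w := by
  simp only [mirrorWord, List.mem_reverse, List.mem_map]
  constructor
  · rintro ⟨e, he, rfl⟩; simpa
  · intro h; exact ⟨_, h, by simp⟩

theorem sum_map_mirrorWord (w : List (α × List α)) (f : ℕ → ℤ) :
    ((mirrorWord w).map fun e => f e.2.length).sum = (w.map fun e => f e.2.length).sum := by
  simp [mirrorWord, mirrorEntry, Function.comp_def]

namespace TriSystem

variable {P : List (α × List α) → List (α × List α) → Prop}

theorem isRotated (hP : TriSystem P) {w w' H} (h : P w H) (hw : w ~r w') : P w' H := by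
  obtain ⟨n, rfl⟩ := hw
  induction n with
  | zero => simpa
  | succ n ih =>
    rw [← List.rotate_rotate]
    generalize w.rotate n = v at ih
    cases v with
    | nil => simpa using ih
    | cons a v => simpa using hP.rotate ih

theorem append_comm (hP : TriSystem P) {l l' H} (h : P (l ++ l') H) : P (l' ++ l) H :=
  hP.isRotated h List.isRotated_append

theorem ne_nil (hP : TriSystem P) {w H} (h : P w H) : ∀ e ∈ w, e.2 ≠ [] := by
  intro e he
  obtain ⟨s, t, rfl⟩ := List.append_of_mem he
  have h1 := hP.append_comm h
  have h2 := hP.two_le_length h1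
  rcases hts : t ++ s with _ | ⟨y, r⟩
  · have := congrArg List.length hts
    simp only [List.length_append, List.length_cons, List.length_nil] at this h2
    omega
  · rw [List.cons_append, hts] at h1
    intro h0
    have := (hP.adj h1).1
    simp [h0] at this

/-- At an ear, the lists of the two neighbouring vertices are determined. -/
theorem ear_data (hP : TriSystem P) {z y mid x H} (h : P (z :: y :: (mid ++ [x])) H)
    (hz : z.2.length = 2) :
    z.2 = [x.1, y.1] ∧ y.2 = z.1 :: y.2.tail ∧ x.2 = x.2.dropLast ++ [z.1] := by
  obtain ⟨h1, h2⟩ := hP.adj h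
  have h' : P (x :: z :: y :: mid) H :=
    hP.append_comm (l := z :: y :: mid) (l' := [x]) (by simpa using h)
  obtain ⟨h3, h4⟩ := hP.adj h'
  refine ⟨?_, ?_, ?_⟩
  · obtain ⟨z, l⟩ := z
    rcases l with _ | ⟨a, _ | ⟨b, _ | _⟩⟩ <;> simp_all
  · cases hy : y.2 <;> simp_all
  · have := List.dropLast_append_getLast? z.1 (by rw [h3]; rfl)
    exact this.symm

theorem mirror (hP : TriSystem P) :
    TriSystem fun w H => P (mirrorWord w) (H.map mirrorEntry) where
  rotate {e w H} h := by
    have h' : P (mirrorWord w ++ [mirrorEntry e]) (H.map mirrorEntry) := by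
      simpa [mirrorWord] using h
    have := hP.append_comm h'
    simpa [mirrorWord] using this
  nodup {w H} h := by
    have := hP.nodup h
    have h1 : ((mirrorWord w ++ H.map mirrorEntry).map Prod.fst).Perm ((w ++ H).map Prod.fst) := by
      simp only [mirrorWord, List.map_append, List.map_reverse, List.map_map, Function.comp_def,
        mirrorEntry]
      exact List.Perm.append_right _ (List.reverse_perm _)
    exact h1.nodup_iff.1 this
  two_le_length {w H} h := by simpa using hP.two_le_length h
  two_le {w H} h hw e he := by
    have := hP.two_le h (by simpa) (mirrorEntry e) (by simpa)
    simpa [mirrorEntry] using this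
  seven_le {w H} h e he := by
    have := hP.seven_le h (mirrorEntry e) (List.mem_map_of_mem he)
    simpa [mirrorEntry] using this
  adj {x y w H} h := by
    have h' : P (mirrorWord w ++ [mirrorEntry y, mirrorEntry x]) (H.map mirrorEntry) := by
      simpa [mirrorWord] using h
    have := hP.adj (hP.append_comm h')
    simpa [mirrorEntry, and_comm] using this
  ear {z y mid x H} h hz := by
    have h' : P ((mirrorEntry x :: (mirrorWord mid ++ [mirrorEntry y])) ++ [mirrorEntry z])
        (H.map mirrorEntry) := by
      simpa [mirrorWord] using h
    have := hP.ear (hP.append_comm h') (by simpa [mirrorEntry] using hz)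
    simpa [mirrorWord, mirrorEntry] using this
  sum {w H} h := by
    have := hP.sum h
    rw [sum_map_mirrorWord w (fun n => (4 : ℤ) - n)] at this
    simpa [Function.comp_def, mirrorEntry] using this
  exists_step {w H} h hw := by
    rcases hP.exists_step h (by simpa) with ⟨e, he, h2⟩ |
      ⟨y, mid, x, e, ne, H₁, H₂, h1, h2, h3, h4⟩
    · exact Or.inl ⟨mirrorEntry e, by simpa using he, by simpa [mirrorEntry] using h2⟩
    · right
      refine ⟨mirrorEntry x, mirrorWord mid, mirrorEntry y, mirrorEntry e, ne.reverse,
        H₁.map mirrorEntry, H₂.map mirrorEntry, ?_, ?_, ?_, ?_⟩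
      · have := (h1.map mirrorEntry).reverse
        simpa [mirrorWord, Function.comp_def] using this
      · have := congrArg (List.map mirrorEntry) h2
        simpa [Function.comp_def] using this
      · simpa [mirrorEntry] using h3.reverse
      · have h5 : P ([(e.1, ne)] ++ ((y.1, y.2.tail) :: (mid ++ [(x.1, x.2.dropLast)])))
            (H₁ ++ H₂) := by simpa using h4
        have := hP.append_comm h5
        simpa [mirrorWord, mirrorEntry, Function.comp_def] using this

theorem length_le_sum (hP : TriSystem P) {w H} (h : P w H) :
    (H.length : ℤ) ≤ (H.map fun e => (e.2.length : ℤ) - 6).sum := by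
  have h7 := hP.seven_le h
  clear h
  induction H with
  | nil => simp
  | cons a H ih =>
    have h1 := h7 a (by simp)
    have h2 := ih fun e he => h7 e (by simp [he])
    simp only [List.length_cons, List.map_cons, List.sum_cons]
    omega

/-- A word of length two bounds no triangle. -/
theorem digon (hP : TriSystem P) {x y H} (h : P [x, y] H) :
    x.2 = [y.1] ∧ y.2 = [x.1] ∧ H = [] := by
  have h1 := hP.sum h
  have h2 := hP.length_le_sum h
  have hx := hP.ne_nil h x (by simp)
  have hy := hP.ne_nil h y (by simp)
  have h3 := hP.adj h
  rw [← List.length_pos_iff] at hx hy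
  simp only [List.map_cons, List.map_nil, List.sum_cons, List.sum_nil] at h1
  have hH : H.length = 0 := by omega
  have hx1 : x.2.length = 1 := by omega
  have hy1 : y.2.length = 1 := by omega
  rw [List.length_eq_one_iff] at hx1 hy1
  obtain ⟨a, ha⟩ := hx1
  obtain ⟨b, hb⟩ := hy1
  simp_all

/-- No vertex of the triangulation is its own neighbour. -/
theorem notMem_self (hP : TriSystem P) {w H} (h : P w H) : ∀ e ∈ w, e.1 ∉ e.2 := by
  induction hn : w.length + 2 * H.length using Nat.strong_induction_on generalizing w H with
  | _ n ih =>
  have h2 := hP.two_le_length h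
  have hnd := hP.nodup h
  rcases Nat.lt_or_ge w.length 3 with h3 | h3
  · obtain ⟨x, y, rfl⟩ : ∃ x y, w = [x, y] := List.length_eq_two.1 (by omega)
    obtain ⟨hx, hy, -⟩ := hP.digon h
    have hxy : x.1 ≠ y.1 := by
      intro hxy; simp [hxy] at hnd
    intro e he
    simp only [List.mem_cons, List.not_mem_nil, or_false] at he
    rcases he with rfl | rfl
    · simpa [hx] using hxy
    · simpa [hy] using hxy.symm
  rcases hP.exists_step h h3 with ⟨z, hz, hz2⟩ | ⟨y, mid, x, g, ng, H₁, H₂, hr, rfl, -, hg⟩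
  · obtain ⟨y, mid, x, hr⟩ := exists_isRotated_cons h3 hz
    have h' := hP.isRotated h hr
    obtain ⟨e1, e2, e3⟩ := hP.ear_data h' hz2
    have hlen := hr.perm.length_eq
    have IH := ih _ (by simp at hlen ⊢; omega) (hP.ear h' hz2) rfl
    have hnd' := hP.nodup h'
    intro e he
    rw [hr.mem_iff] at he
    simp only [List.mem_cons, List.mem_append, List.not_mem_nil, or_false] at he
    simp only [List.map_append, List.map_cons, List.cons_append, List.nodup_cons, List.mem_cons,
      List.mem_append, List.map_nil, List.append_assoc] at hnd'
    rcases he with rfl | rfl | he | rfl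
    · rw [e1]; simp; tauto
    · have := IH (e.1, e.2.tail) (by simp)
      rw [e2]; simp at this ⊢; tauto
    · exact IH e (by simp [he])
    · have := IH (e.1, e.2.dropLast) (by simp)
      rw [e3]; simp at this ⊢; tauto
  · have h' := hP.isRotated h hr
    have h'' : P (x :: y :: mid) (H₁ ++ g :: H₂) :=
      hP.append_comm (l := y :: mid) (l' := [x]) (by simpa using h')
    obtain ⟨a1, a2⟩ := hP.adj h''
    have e3 := List.dropLast_append_getLast? y.1 (by rw [a1]; rfl)
    have e2 : y.2 = x.1 :: y.2.tail := by cases hy : y.2 <;> simp_all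
    have hlen := hr.perm.length_eq
    have IH := ih _ (by simp at hlen hn ⊢; omega) hg rfl
    have hnd' := hP.nodup h'
    have hxy : x.1 ≠ y.1 := by
      intro hxy; simp [hxy] at hnd'
    intro e he
    rw [hr.mem_iff] at he
    simp only [List.mem_cons, List.mem_append, List.not_mem_nil, or_false] at he
    rcases he with rfl | he | rfl
    · have := IH (e.1, e.2.tail) (by simp)
      rw [e2]; simp at this ⊢; tauto
    · exact IH e (by simp [he])
    · have := IH (e.1, e.2.dropLast) (by simp)
      rw [← e3]; simp at this ⊢; tauto

end TriSystem

end Words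

/-! ### Degree words -/

section Degrees

variable {α : Type*}

/-- `ds` is the list of the numbers of neighbours along some boundary word of the system,
and `hs` that of the interior vertices. -/
def DegreeWord (P : List (α × List α) → List (α × List α) → Prop) (ds hs : List ℕ) : Prop :=
  ∃ w H, P w H ∧ w.map (fun e => e.2.length) = ds ∧ H.map (fun e => e.2.length) = hs

/-- The total excess of the entries of a word over four. -/
def excess (l : List ℕ) : ℕ := (l.map (· - 4)).sum

@[simp] theorem excess_nil : excess [] = 0 := rfl

@[simp] theorem excess_cons (a : ℕ) (l : List ℕ) : excess (a :: l) = (a - 4) + excess l := by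
  simp [excess]

@[simp] theorem excess_append (l l' : List ℕ) : excess (l ++ l') = excess l + excess l' := by
  simp [excess]

theorem le_four_of_excess {l : List ℕ} (h : excess l = 0) : ∀ a ∈ l, a ≤ 4 := by
  induction l with
  | nil => simp
  | cons b l ih =>
    rw [excess_cons] at h
    intro a ha
    rcases List.mem_cons.1 ha with rfl | ha
    · omega
    · exact ih (by omega) a ha

theorem sum_four_sub {l : List ℕ} (h : ∀ a ∈ l, 2 ≤ a) :
    (l.map fun a : ℕ => (4 : ℤ) - a).sum = 2 * l.count 2 + l.count 3 - excess l := by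
  induction l with
  | nil => simp
  | cons b l ih =>
    have hb := h b (by simp)
    simp only [List.map_cons, List.sum_cons, ih fun a ha => h a (by simp [ha]), excess_cons,
      List.count_cons, beq_iff_eq]
    split_ifs <;> push_cast <;> omega

theorem exists_snoc {β : Type*} {l : List β} (h : l ≠ []) : ∃ m x, l = m ++ [x] := by
  rcases List.eq_nil_or_concat l with rfl | ⟨m, x, rfl⟩
  · exact absurd rfl h
  · exact ⟨m, x, by simp⟩

/-- Lower the first entry by one. -/
def decHead (l : List ℕ) : List ℕ := l.modifyHead (· - 1)

/-- Lower the last entry by one. -/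
def decLast (l : List ℕ) : List ℕ := (decHead l.reverse).reverse

@[simp] theorem decHead_cons (a : ℕ) (l : List ℕ) : decHead (a :: l) = (a - 1) :: l := rfl

@[simp] theorem decLast_snoc (a : ℕ) (l : List ℕ) : decLast (l ++ [a]) = l ++ [a - 1] := by
  simp [decLast]

@[simp] theorem decLast_singleton (a : ℕ) : decLast [a] = [a - 1] := rfl

@[simp] theorem length_decHead (l : List ℕ) : (decHead l).length = l.length := by
  simp [decHead]

@[simp] theorem length_decLast (l : List ℕ) : (decLast l).length = l.length := by
  simp [decLast]

theorem decLast_append (l : List ℕ) {l' : List ℕ} (h : l' ≠ []) :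
    decLast (l ++ l') = l ++ decLast l' := by
  obtain ⟨m, x, rfl⟩ := exists_snoc h
  rw [← List.append_assoc, decLast_snoc, decLast_snoc, List.append_assoc]

theorem decLast_cons (a : ℕ) {l : List ℕ} (h : l ≠ []) : decLast (a :: l) = a :: decLast l :=
  decLast_append [a] h

theorem decHead_append {l : List ℕ} (l' : List ℕ) (h : l ≠ []) :
    decHead (l ++ l') = decHead l ++ l' := by
  cases l <;> simp_all

theorem decHead_ne_nil {l : List ℕ} (h : l ≠ []) : decHead l ≠ [] := by
  cases l <;> simp_all

theorem decLast_ne_nil {l : List ℕ} (h : l ≠ []) : decLast l ≠ [] := by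
  obtain ⟨m, x, rfl⟩ := exists_snoc h
  simp

namespace TriSystem

variable {P : List (α × List α) → List (α × List α) → Prop} {ds hs : List ℕ}

theorem degree_isRotated (hP : TriSystem P) {ds' : List ℕ} (h : DegreeWord P ds hs)
    (hr : ds ~r ds') : DegreeWord P ds' hs := by
  obtain ⟨w, H, hw, rfl, rfl⟩ := h
  obtain ⟨n, rfl⟩ := hr
  exact ⟨w.rotate n, H, hP.isRotated hw ⟨n, rfl⟩, by rw [List.map_rotate], rfl⟩

theorem degree_append_comm (hP : TriSystem P) {l l' : List ℕ} (h : DegreeWord P (l ++ l') hs) :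
    DegreeWord P (l' ++ l) hs :=
  hP.degree_isRotated h List.isRotated_append

theorem degree_two_le (hP : TriSystem P) (h : DegreeWord P ds hs) (hn : 3 ≤ ds.length) :
    ∀ a ∈ ds, 2 ≤ a := by
  obtain ⟨w, H, hw, rfl, rfl⟩ := h
  intro a ha
  obtain ⟨e, he, rfl⟩ := List.mem_map.1 ha
  exact hP.two_le hw (by simpa using hn) e he

theorem degree_ear (hP : TriSystem P) {y x : ℕ} {mid : List ℕ}
    (h : DegreeWord P (2 :: y :: (mid ++ [x])) hs) :
    DegreeWord P ((y - 1) :: (mid ++ [x - 1])) hs := by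
  obtain ⟨w, H, hw, h1, rfl⟩ := h
  simp only [List.map_eq_cons_iff, List.map_eq_append_iff, List.map_eq_nil_iff] at h1
  obtain ⟨z, _, rfl, hz, y, _, rfl, rfl, mid, _, rfl, rfl, x, _, rfl, rfl, rfl⟩ := h1
  exact ⟨_, H, hP.ear hw hz, by simp, rfl⟩

theorem degree_sum (hP : TriSystem P) (h : DegreeWord P ds hs) :
    (ds.map fun a : ℕ => (4 : ℤ) - a).sum = 6 + (hs.map fun a : ℕ => (a : ℤ) - 6).sum := by
  obtain ⟨w, H, hw, rfl, rfl⟩ := h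
  simpa [Function.comp_def] using hP.sum hw

theorem degree_seven_le (hP : TriSystem P) (h : DegreeWord P ds hs) : ∀ a ∈ hs, 7 ≤ a := by
  obtain ⟨w, H, hw, rfl, rfl⟩ := h
  intro a ha
  obtain ⟨e, he, rfl⟩ := List.mem_map.1 ha
  exact hP.seven_le hw e he

theorem degree_length_le (hP : TriSystem P) (h : DegreeWord P ds hs) :
    (hs.length : ℤ) ≤ (hs.map fun a : ℕ => (a : ℤ) - 6).sum := by
  obtain ⟨w, H, hw, rfl, rfl⟩ := h
  simpa [Function.comp_def] using hP.length_le_sum hw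

theorem degree_exists_ear (hP : TriSystem P) (h : DegreeWord P ds []) (hn : 3 ≤ ds.length) :
    2 ∈ ds := by
  obtain ⟨w, H, hw, rfl, hH⟩ := h
  rw [List.map_eq_nil_iff] at hH
  subst hH
  rcases hP.exists_step hw (by simpa using hn) with ⟨e, he, h2⟩ | ⟨_, _, _, _, _, _, _, _, h0, _⟩
  · exact List.mem_map.2 ⟨e, he, h2⟩
  · simp at h0

/-- Two ears are never adjacent. -/
theorem degree_ears_not_adjacent (hP : TriSystem P) {r : List ℕ} (hr : 2 ≤ r.length) :
    ¬ DegreeWord P (2 :: 2 :: r) hs := by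
  intro h
  obtain ⟨m, x, rfl⟩ := exists_snoc (l := r) (by rintro rfl; simp at hr)
  have h1 := hP.degree_ear h
  have := hP.degree_two_le h1 (by simpa using hr) 1 (by simp)
  omega

theorem degree_neighbors_of_ear (hP : TriSystem P) {y x : ℕ} {mid : List ℕ} (hm : mid ≠ [])
    (h : DegreeWord P (2 :: y :: (mid ++ [x])) hs) : 3 ≤ y ∧ 3 ≤ x := by
  have hm' : 1 ≤ mid.length := List.length_pos_iff.2 hm
  have h2 := hP.degree_two_le h (by simp)
  have hy := h2 y (by simp)
  have hx := h2 x (by simp)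
  constructor
  · by_contra hlt
    obtain rfl : y = 2 := by omega
    exact hP.degree_ears_not_adjacent (by simp; omega) h
  · by_contra hlt
    obtain rfl : x = 2 := by omega
    refine hP.degree_ears_not_adjacent (r := y :: mid) (by simp; omega) (hs := hs) ?_
    exact hP.degree_append_comm (l := 2 :: y :: mid) (l' := [2]) (by simpa using h)

/-- A triangulated disc without interior vertices has at least two ears. -/
theorem two_le_count_ears (hP : TriSystem P) (h : DegreeWord P ds []) (hn : 4 ≤ ds.length) :
    2 ≤ ds.count 2 := by
  induction hk : ds.length generalizing ds with
  | zero => omega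
  | succ k ih =>
    obtain ⟨y, mid, x, hr⟩ := exists_isRotated_cons (by omega) (hP.degree_exists_ear h (by omega))
    have h' := hP.degree_isRotated h hr
    have hlen := hr.perm.length_eq
    simp only [List.length_cons, List.length_append, List.length_nil] at hlen
    rw [hr.perm.count_eq]
    have hm : mid ≠ [] := by rintro rfl; simp at hlen; omega
    obtain ⟨hy, hx⟩ := hP.degree_neighbors_of_ear hm h'
    have h1 := hP.degree_ear h'
    suffices hc : 1 ≤ mid.count 2 by
      simp only [List.count_cons, List.count_append, beq_self_eq_true, if_true]
      omega
    by_cases h3 : mid.length = 1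
    · obtain ⟨m, rfl⟩ := List.length_eq_one_iff.1 h3
      have h2 := hP.degree_two_le h1 (by simp)
      have hs := hP.degree_sum h1
      have a1 := h2 (y - 1) (by simp)
      have a2 := h2 m (by simp)
      have a3 := h2 (x - 1) (by simp)
      simp at hs
      have : m = 2 := by omega
      simp [this]
    · have h2 := ih h1 (by simp; omega) (by simp; omega)
      by_contra hc
      simp only [List.count_cons, List.count_append, List.count_nil, beq_iff_eq] at h2
      have hy2 : y - 1 = 2 := by
        by_contra hne; rw [if_neg hne] at h2; split_ifs at h2 <;> omega
      have hx2 : x - 1 = 2 := by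
        by_contra hne; rw [if_neg hne] at h2; split_ifs at h2; omega
      rw [hy2, hx2] at h1
      exact hP.degree_ears_not_adjacent (r := mid) (by have := List.length_pos_iff.2 hm; omega)
        (hP.degree_append_comm (l := 2 :: mid) (l' := [2]) (by simpa using h1))

/-- In a triangulated disc with two ears and without interior vertices, exactly one neighbour of
an ear has three neighbours. -/
theorem degree_two_ears (hP : TriSystem P) {y x : ℕ} {mid : List ℕ} (hm : 2 ≤ mid.length)
    (hc : mid.count 2 = 1) (h : DegreeWord P (2 :: y :: (mid ++ [x])) []) :
    (y = 3 ∧ 4 ≤ x) ∨ (x = 3 ∧ 4 ≤ y) := by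
  obtain ⟨hy, hx⟩ := hP.degree_neighbors_of_ear (by rintro rfl; simp at hm) h
  have h1 := hP.degree_ear h
  have h2 := hP.two_le_count_ears h1 (by simp; omega)
  simp only [List.count_cons, List.count_append, List.count_nil, beq_iff_eq] at h2
  have h3 : ¬ (y - 1 = 2 ∧ x - 1 = 2) := by
    rintro ⟨hy2, hx2⟩
    rw [hy2, hx2] at h1
    exact hP.degree_ears_not_adjacent hm
      (hP.degree_append_comm (l := 2 :: mid) (l' := [2]) (by simpa using h1))
  split_ifs at h2 <;> omega

/-- If there are interior vertices and no boundary vertex has more than four neighbours, then the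
neighbours of an ear have four neighbours. -/
theorem degree_neighbors_eq_four (hP : TriSystem P) (hH : hs ≠ []) {y x : ℕ} {mid : List ℕ}
    (h : DegreeWord P (2 :: y :: (mid ++ [x])) hs) (h4 : ∀ a ∈ y :: (mid ++ [x]), a ≤ 4) :
    y = 4 ∧ x = 4 := by
  induction hk : mid.length generalizing y x mid with
  | zero =>
    obtain rfl := List.length_eq_zero_iff.1 hk
    have h1 := hP.degree_sum h
    have h2 := hP.degree_length_le h
    have h3 := List.length_pos_iff.2 hH
    have h5 := hP.degree_two_le h (by simp)
    have a1 := h5 y (by simp)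
    have a2 := h5 x (by simp)
    simp at h1
    omega
  | succ k ih =>
    have hm : mid ≠ [] := by rintro rfl; simp at hk
    obtain ⟨hy, hx⟩ := hP.degree_neighbors_of_ear hm h
    have hy4 := h4 y (by simp)
    have hx4 := h4 x (by simp)
    have h1 := hP.degree_ear h
    constructor
    · by_contra hne
      obtain rfl : y = 3 := by omega
      obtain ⟨m, mid, rfl⟩ := List.exists_cons_of_ne_nil hm
      have := ih (y := m) (mid := mid) (x := x - 1) h1 (by
        intro a ha
        simp only [List.mem_cons, List.mem_append, List.not_mem_nil, or_false] at ha
        rcases ha with rfl | ha | rfl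
        · exact h4 _ (by simp)
        · exact h4 _ (by simp [ha])
        · omega) (by simpa using hk)
      omega
    · by_contra hne
      obtain rfl : x = 3 := by omega
      obtain ⟨mid, m, rfl⟩ := exists_snoc hm
      have := ih (y := y - 1) (mid := mid) (x := m)
        (hP.degree_append_comm (l := (y - 1) :: (mid ++ [m])) (l' := [2]) (by simpa using h1)) (by
        intro a ha
        simp only [List.mem_cons, List.mem_append, List.not_mem_nil, or_false] at ha
        rcases ha with rfl | ha | rfl
        · omega
        · exact h4 _ (by simp [ha])
        · exact h4 _ (by simp)) (by simpa using hk)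
      omega

/-- Cutting off an ear, for a word given in two pieces. -/
theorem degree_cut (hP : TriSystem P) {A B : List ℕ} (hA : A ≠ []) (hB : B ≠ [])
    (h : DegreeWord P (2 :: (A ++ B)) hs) : DegreeWord P (decHead A ++ decLast B) hs := by
  obtain ⟨y, A, rfl⟩ := List.exists_cons_of_ne_nil hA
  obtain ⟨B, x, rfl⟩ := exists_snoc hB
  have := hP.degree_ear (y := y) (mid := A ++ B) (x := x) (by simpa using h)
  simpa using this

/-- Cutting off two ears at distance two. -/
theorem degree_cut_two (hP : TriSystem P) {A B C : List ℕ} (hA : A ≠ []) (hB : B ≠ [])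
    (hC : C ≠ []) (h : DegreeWord P (2 :: (A ++ 2 :: (B ++ C))) hs) :
    DegreeWord P (decHead (decLast A) ++ (decHead B ++ decLast C)) hs := by
  have h1 := hP.degree_cut (A := A) (B := 2 :: (B ++ C)) hA (by simp) h
  rw [decLast_cons _ (by simp [hB]), decLast_append _ hC] at h1
  have h2 := hP.degree_cut (A := B) (B := decLast C ++ decHead A) hB
    (by simp [decHead_ne_nil hA]) (hs := hs)
    (hP.degree_isRotated h1 (by
      simpa using List.isRotated_append (l := decHead A) (l' := 2 :: (B ++ decLast C))))
  rw [decLast_append _ (decHead_ne_nil hA)] at h2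
  have h3 : decLast (decHead A) = decHead (decLast A) := by
    obtain ⟨y, A, rfl⟩ := List.exists_cons_of_ne_nil hA
    rcases List.eq_nil_or_concat A with rfl | ⟨A, x, rfl⟩
    · rfl
    · simp only [List.concat_eq_append, decHead_cons]
      rw [decLast_cons _ (by simp), decLast_cons _ (by simp), decHead_cons]
  rw [h3] at h2
  exact hP.degree_isRotated h2 (by
    simpa using List.isRotated_append (l := decHead B ++ decLast C) (l' := decHead (decLast A)))

end TriSystem

end Degrees

/-! ### Strips and wheels -/

section Strips

variable {α : Type*}

/-- The neighbours of the `k`-th vertex in a strip of `n` vertices. -/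
def stripRow (n k : ℕ) : List ℕ :=
  Zipper.turn k ([k - 2, k - 1, k + 1, k + 2].filter fun j => 1 ≤ j ∧ j ≤ n)

theorem turn_succ (k : ℕ) (l : List ℕ) : Zipper.turn (k + 1) l = (Zipper.turn k l).reverse := by
  unfold Zipper.turn
  rcases Nat.mod_two_eq_zero_or_one k with h | h
  · rw [if_pos (by omega), if_neg (by omega), List.reverse_reverse]
  · rw [if_neg (by omega), if_pos (by omega)]

theorem turn_map (k : ℕ) (l : List ℕ) (f : ℕ → ℕ) :
    Zipper.turn k (l.map f) = (Zipper.turn k l).map f := by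
  unfold Zipper.turn
  split_ifs <;> simp

theorem mem_turn {k j : ℕ} {l : List ℕ} : j ∈ Zipper.turn k l ↔ j ∈ l := by
  unfold Zipper.turn
  split_ifs <;> simp

theorem mem_stripRow {n k j : ℕ} (h : j ∈ stripRow n k) : 1 ≤ j ∧ j ≤ n := by
  rw [stripRow, mem_turn, List.mem_filter] at h
  simpa using h.2

theorem stripRow_one {n : ℕ} (hn : 3 ≤ n) : stripRow n 1 = [2, 3] := by
  have h2 : 2 ≤ n := by omega
  simp [stripRow, Zipper.turn, h2, hn]

theorem stripRow_two {n : ℕ} (hn : 4 ≤ n) : stripRow n 2 = [4, 3, 1] := by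
  have h1 : 1 ≤ n := by omega
  have h3 : 3 ≤ n := by omega
  simp [stripRow, Zipper.turn, h1, h3, hn]

theorem stripRow_three {n : ℕ} (hn : 5 ≤ n) : stripRow n 3 = [1, 2, 4, 5] := by
  have h1 : 1 ≤ n := by omega
  have h2 : 2 ≤ n := by omega
  have h4 : 4 ≤ n := by omega
  simp [stripRow, Zipper.turn, h1, h2, h4, hn]

theorem stripRow_succ {n k : ℕ} (hk : 3 ≤ k) :
    stripRow (n + 1) (k + 1) = ((stripRow n k).map (· + 1)).reverse := by
  have h : [k + 1 - 2, k + 1 - 1, k + 1 + 1, k + 1 + 2] =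
      [k - 2, k - 1, k + 1, k + 2].map (· + 1) := by
    simp; omega
  rw [stripRow, stripRow, turn_succ, ← turn_map, h, List.filter_map]
  congr 3
  apply List.filter_congr
  intro j hj
  simp only [List.mem_cons, List.not_mem_nil, or_false] at hj
  simp only [Function.comp_apply, decide_eq_decide]
  omega

theorem map_congr_of_pos {f : ℕ → α} {g : ℕ → α} {l : List ℕ} (hl : ∀ j ∈ l, 1 ≤ j)
    (h : ∀ j, 1 ≤ j → f (j + 1) = g j) : (l.map (· + 1)).map f = l.map g := by
  rw [List.map_map]
  exact List.map_congr_left fun j hj => h j (hl j hj)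

theorem eq_of_fst_eq {β γ : Type*} {l : List (β × γ)} (hl : (l.map Prod.fst).Nodup) {e e' : β × γ}
    (he : e ∈ l) (he' : e' ∈ l) (h : e.1 = e'.1) : e = e' :=
  List.inj_on_of_nodup_map hl he he' h

theorem injOn_four {a b c d : α} (h₁ : a ≠ b) (h₂ : a ≠ c) (h₃ : a ≠ d) (h₄ : b ≠ c)
    (h₅ : b ≠ d) (h₆ : c ≠ d) :
    Set.InjOn (fun k => if k = 1 then a else if k = 2 then b else if k = 3 then c else d)
      (Set.Icc 1 (0 + 3 + 1)) := by
  rintro i ⟨hi1, hi2⟩ j ⟨hj1, hj2⟩ hij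
  interval_cases i <;> interval_cases j <;> first | rfl | (exfalso; simp at hij; tauto)

namespace TriSystem

variable {P : List (α × List α) → List (α × List α) → Prop}

theorem nodup_word (hP : TriSystem P) {w H} (h : P w H) : (w.map Prod.fst).Nodup := by
  have := hP.nodup h
  rw [List.map_append] at this
  exact this.of_append_left

theorem degreeWord {w H} (h : P w H) :
    DegreeWord P (w.map fun e => e.2.length) (H.map fun e => e.2.length) := ⟨w, H, h, rfl, rfl⟩

/-- A triangulated disc without interior vertices, with two ears and all other vertices having at
most four neighbours, is a strip.  Cutting off an ear leaves a shorter strip, in which the two sides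
have changed their roles. -/
theorem exists_strip (hP : TriSystem P) {s y x : α × List α} {mid : List (α × List α)}
    (h : P (s :: y :: (mid ++ [x])) []) (hs : s.2.length = 2) (hx : x.2.length = 3)
    (h4 : ∀ e ∈ y :: (mid ++ [x]), e.2.length ≤ 4)
    (hc : (mid.map fun e => e.2.length).count 2 = 1) :
    ∃ v : ℕ → α, v 1 = s.1 ∧ v 2 = x.1 ∧ Set.InjOn v (Set.Icc 1 (mid.length + 3)) ∧
      ∀ k, 1 ≤ k → k ≤ mid.length + 3 →
        (v k, (stripRow (mid.length + 3) k).map v) ∈ s :: y :: (mid ++ [x]) := by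
  induction hk : mid.length generalizing P s y x mid with
  | zero =>
    obtain rfl := List.length_eq_zero_iff.1 hk
    simp at hc
  | succ k ih =>
    have hm : mid ≠ [] := by rintro rfl; simp at hk
    obtain ⟨mid, m, rfl⟩ := exists_snoc hm
    have hD := degreeWord h
    simp only [List.map_cons, List.map_append, List.map_nil, hs] at hD
    obtain ⟨d1, d2, d3⟩ := hP.ear_data h hs
    have hpeel := hP.ear h hs
    have hnd := hP.nodup_word hpeel
    have hnd0 := hP.nodup_word h
    have hsn : s.1 ∉
        (((y.1, y.2.tail) :: ((mid ++ [m]) ++ [(x.1, x.2.dropLast)])).map Prod.fst) := by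
      simp at hnd0 ⊢; tauto
    have hx' : x.2.dropLast.length = 2 := by simp [hx]
    by_cases hk0 : k = 0
    · subst hk0
      have : mid = [] := by simpa using hk
      subst this
      have e1 := hP.ear_data (z := (x.1, x.2.dropLast)) (mid := [])
        (hP.append_comm (l := [_, _]) (l' := [_]) (by simpa using hpeel)) hx'
      have hD' := degreeWord hpeel
      have hsum := hP.degree_sum hD'
      have h2 := hP.degree_two_le hD' (by simp)
      have hm2 : m.2.length = 2 := by
        simp only [List.nil_append, List.map_cons, List.map_nil, List.count_singleton,
          beq_iff_eq] at hc
        by_contra hne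
        rw [if_neg hne] at hc
        omega
      have hy2 : y.2.tail.length = 2 := by
        simp [hm2, hx] at hsum; simp; omega
      have e2 := hP.ear_data (z := (y.1, y.2.tail)) (mid := []) (by simpa using hpeel) hy2
      have e3 := hP.ear_data (z := m) (mid := [])
        (hP.append_comm (l := [_]) (l' := [_, _]) (by simpa using hpeel)) hm2
      obtain ⟨e1, -, -⟩ := e1
      obtain ⟨e2, -, -⟩ := e2
      obtain ⟨e3, -, -⟩ := e3
      simp only at e1 e2 e3
      rw [e2] at d2
      rw [e1] at d3
      refine ⟨fun k => if k = 1 then s.1 else if k = 2 then x.1 else if k = 3 then y.1 else m.1,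
        rfl, rfl, ?_, ?_⟩
      · simp at hnd0
        obtain ⟨⟨n1, n2, n3⟩, ⟨n4, n5⟩, n6⟩ := hnd0
        exact injOn_four n3 n1 n2 (Ne.symm n5) (Ne.symm n6) n4
      · have q1 : s = (s.1, [x.1, y.1]) := Prod.ext rfl d1
        have q2 : x = (x.1, [m.1, y.1, s.1]) := Prod.ext rfl (by simpa using d3)
        have q3 : y = (y.1, [s.1, x.1, m.1]) := Prod.ext rfl d2
        have q4 : m = (m.1, [y.1, x.1]) := Prod.ext rfl e3
        intro k h1 h2
        simp only [List.nil_append, List.cons_append, List.mem_cons, List.not_mem_nil, or_false]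
        interval_cases k
        · exact Or.inl q1.symm
        · exact Or.inr (Or.inr (Or.inr q2.symm))
        · exact Or.inr (Or.inl q3.symm)
        · exact Or.inr (Or.inr (Or.inl q4.symm))
    · have hlen : mid.length = k := by simpa using hk
      have hC := hP.degree_two_ears (mid := (mid ++ [m]).map fun e => e.2.length)
        (by simp; omega) hc (by simpa using hD)
      have hy4 : y.2.length = 4 := by have := h4 y (by simp); omega
      have hpeel' : P ((x.1, x.2.dropLast) :: (y.1, y.2.tail) :: (mid ++ [m])) [] :=
        hP.append_comm (l' := [_]) (by simpa using hpeel)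
      have hm3 : 3 ≤ m.2.length := by
        have hD' := degreeWord hpeel'
        simp only [List.map_cons, List.map_append, List.map_nil, hx'] at hD'
        exact (hP.degree_neighbors_of_ear (by
          rintro h0; rw [List.map_eq_nil_iff] at h0; simp [h0] at hlen; omega) hD').2
      have hq : P (mirrorWord (mirrorEntry (x.1, x.2.dropLast) :: mirrorEntry m ::
          (mirrorWord mid ++ [mirrorEntry (y.1, y.2.tail)])))
          (([] : List (α × List α)).map mirrorEntry) := by
        have e : mirrorWord (mirrorEntry (x.1, x.2.dropLast) :: mirrorEntry m ::
          (mirrorWord mid ++ [mirrorEntry (y.1, y.2.tail)])) =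
          (y.1, y.2.tail) :: (mid ++ [m] ++ [(x.1, x.2.dropLast)]) := by
          simp [mirrorWord, Function.comp_def]
        rw [e]
        simpa using hpeel
      obtain ⟨v, v1, v2, vinj, hv⟩ := ih hP.mirror hq (by simp [mirrorEntry, hx])
        (by simp [mirrorEntry, hy4]) (by
          intro e he
          simp only [List.mem_cons, List.mem_append, mem_mirrorWord, List.not_mem_nil,
            or_false] at he
          rcases he with rfl | he | rfl
          · simpa [mirrorEntry] using h4 m (by simp)
          · simpa [mirrorEntry] using h4 (mirrorEntry e) (by simp [he])
          · simp [mirrorEntry, hy4]) (by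
          have : (mirrorWord mid).map (fun e => e.2.length) =
              (mid.map fun e => e.2.length).reverse := by
            simp [mirrorWord, mirrorEntry, Function.comp_def]
          rw [this, List.count_reverse]
          simp only [List.map_append, List.map_cons, List.map_nil, List.count_append,
            List.count_singleton, beq_iff_eq] at hc
          rw [if_neg (by omega)] at hc
          simpa using hc) (by simpa using hlen)
      have hv' : ∀ j, 1 ≤ j → j ≤ k + 3 → (v j, ((stripRow (k + 3) j).map v).reverse) ∈
          (y.1, y.2.tail) :: (mid ++ [m] ++ [(x.1, x.2.dropLast)]) := by
        intro j h1 h2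
        have := hv j h1 h2
        rw [← mirrorEntry_mirrorEntry (v j, _), ← mem_mirrorWord] at this
        simpa [mirrorWord, Function.comp_def, mirrorEntry] using this
      have v1' : v 1 = x.1 := v1
      have v2' : v 2 = y.1 := v2
      have w1 := hv' 1 le_rfl (by omega)
      have w2 := hv' 2 (by omega) (by omega)
      rw [stripRow_one (by omega)] at w1
      rw [stripRow_two (by omega)] at w2
      have w1' := eq_of_fst_eq hnd w1 (e' := (x.1, x.2.dropLast)) (by simp) v1
      have w2' := eq_of_fst_eq hnd w2 (e' := (y.1, y.2.tail)) (by simp) v2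
      simp only [Prod.mk.injEq] at w1' w2'
      rw [← w1'.2] at d3
      rw [← w2'.2] at d2
      refine ⟨fun j => if j ≤ 1 then s.1 else v (j - 1), by simp, by simpa using v1', ?_, ?_⟩
      · have hs' : ∀ j, 1 ≤ j → j ≤ k + 3 → s.1 ≠ v j := by
          intro j h1 h2 he
          exact hsn (he ▸ List.mem_map_of_mem (f := Prod.fst) (hv' j h1 h2))
        intro i hi j hj hij
        simp only [Set.mem_Icc] at hi hj
        simp only at hij
        split_ifs at hij with hi1 hj1 hj1
        · omega
        · exact absurd hij (hs' _ (by omega) (by omega))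
        · exact absurd hij.symm (hs' _ (by omega) (by omega))
        · have := vinj (x₁ := i - 1) (x₂ := j - 1) (by simp; omega) (by simp; omega) hij
          omega
      · intro j h1 h2
        rcases Nat.lt_or_ge j 4 with h3 | h3
        · have q1 : s = (s.1, [v 1, v 2]) := Prod.ext rfl (by rw [d1, v1', v2'])
          have q2 : x = (v 1, [v 3, v 2, s.1]) := Prod.ext v1'.symm (by simpa using d3)
          have q3 : y = (v 2, [s.1, v 1, v 3, v 4]) := Prod.ext v2'.symm (by simpa using d2)
          simp only [List.mem_cons, List.mem_append, List.not_mem_nil, or_false]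
          interval_cases j
          · rw [stripRow_one (by omega)]
            exact Or.inl q1.symm
          · rw [stripRow_two (by omega)]
            exact Or.inr (Or.inr (Or.inr q2.symm))
          · rw [stripRow_three (by omega)]
            exact Or.inr (Or.inl q3.symm)
        · obtain ⟨j, rfl⟩ : ∃ i, j = i + 1 := ⟨j - 1, by omega⟩
          have hj := hv' j (by omega) (by omega)
          have e : (stripRow (k + 1 + 3) (j + 1)).map (fun j => if j ≤ 1 then s.1 else v (j - 1)) =
              ((stripRow (k + 3) j).map v).reverse := by
            rw [show k + 1 + 3 = k + 3 + 1 from rfl, stripRow_succ (by omega), List.map_reverse,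
              map_congr_of_pos (g := v) (fun i hi => (mem_stripRow hi).1)]
            intro i hi
            rw [if_neg (by omega), Nat.add_sub_cancel]
          simp only [e]
          rw [if_neg (by omega), Nat.add_sub_cancel]
          simp only [List.mem_cons, List.mem_append, List.not_mem_nil, or_false] at hj ⊢
          have n1 : v j ≠ y.1 := by
            rw [← v2']
            intro he
            have := vinj (x₁ := j) (x₂ := 2) (by simp; omega) (by simp) he
            omega
          have n2 : v j ≠ x.1 := by
            rw [← v1']
            intro he
            have := vinj (x₁ := j) (x₂ := 1) (by simp; omega) (by simp) he
            omega
          rcases hj with hj | hj | hj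
          · exact absurd (congrArg Prod.fst hj) n1
          · exact Or.inr (Or.inr (Or.inl hj))
          · exact absurd (congrArg Prod.fst hj) n2

end TriSystem

end Strips

section Wheels

variable {α : Type*}

theorem eq_cons_tail {a : α} {l : List α} (h : l.head? = some a) : l = a :: l.tail := by
  cases l <;> simp_all

namespace TriSystem

variable {P : List (α × List α) → List (α × List α) → Prop}

theorem degree_eq_two_of_triangle (hP : TriSystem P) {x y z : α × List α} (h : P [x, y, z] []) :
    x.2.length = 2 ∧ y.2.length = 2 ∧ z.2.length = 2 := by
  have h1 := hP.sum h
  have h2 := hP.two_le h (by simp)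
  have hx := h2 x (by simp)
  have hy := h2 y (by simp)
  have hz := h2 z (by simp)
  simp at h1
  omega

/-- A disc without interior vertices in which all ears are adjacent to the vertex `h` consists of
triangles around `h`. -/
theorem fan (hP : TriSystem P) {h : α} {nh : List α} {y x : α × List α} {mid : List (α × List α)}
    (hw : P ((h, nh) :: y :: (mid ++ [x])) []) (hm : ∀ e ∈ mid, 3 ≤ e.2.length) :
    nh = ((y :: (mid ++ [x])).map Prod.fst).reverse ∧ (∃ q, y.2 = [h, q]) ∧ (∃ p, x.2 = [p, h]) ∧
      ∀ e ∈ mid, ∃ p q, e.2 = [p, h, q] := by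
  induction mid generalizing nh y with
  | nil =>
    obtain ⟨h1, h2, h3⟩ := hP.degree_eq_two_of_triangle hw
    have e1 := (hP.ear_data (mid := []) hw h1).1
    have e2 := (hP.ear_data (mid := []) (hP.rotate hw) h2).1
    have e3 := (hP.ear_data (mid := []) (hP.rotate (hP.rotate hw)) h3).1
    exact ⟨by simpa using e1, ⟨_, e2⟩, ⟨_, e3⟩, by simp⟩
  | cons m mid ih =>
    have hD := degreeWord hw
    have hc := hP.two_le_count_ears hD (by simp)
    have hmid : (m :: mid).map (fun e => e.2.length) ≠ [] := by simp
    have hcm : ((m :: mid).map (fun e => e.2.length)).count 2 = 0 := by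
      rw [List.count_eq_zero]
      intro h2
      obtain ⟨e, he, h2⟩ := List.mem_map.1 h2
      have := hm e he
      omega
    have hy2 : y.2.length = 2 ∧ x.2.length = 2 := by
      by_cases hh : nh.length = 2
      · have := hP.degree_neighbors_of_ear hmid (by simpa [hh] using hD)
        simp only [List.map_cons, List.map_append, List.map_nil] at hcm hc
        rw [List.count_cons, List.count_cons, List.count_append, hcm, List.count_singleton] at hc
        simp only [beq_iff_eq] at hc
        split_ifs at hc <;> omega
      · simp only [List.map_cons, List.map_append, List.map_nil] at hcm hc
        rw [List.count_cons, List.count_cons, List.count_append, hcm, List.count_singleton] at hc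
        simp only [beq_iff_eq] at hc
        split_ifs at hc <;> omega
    have hw' : P (y :: m :: ((mid ++ [x]) ++ [(h, nh)])) [] := by simpa using hP.rotate hw
    obtain ⟨e1, e2, e3⟩ := hP.ear_data hw' hy2.1
    have hq := hP.ear hw' hy2.1
    have hq' : P ((h, nh.dropLast) :: (m.1, m.2.tail) :: (mid ++ [x])) [] :=
      hP.append_comm (l' := [_]) (by simpa using hq)
    obtain ⟨i1, ⟨q, i2⟩, i3, i4⟩ := ih hq' fun e he => hm e (by simp [he])
    simp only at e1 e3 i2
    refine ⟨?_, ⟨_, e1⟩, i3, ?_⟩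
    · rw [e3, i1]; simp
    · intro e he
      rcases List.mem_cons.1 he with rfl | he
      · exact ⟨_, q, by rw [e2, i2]⟩
      · exact i4 e he

/-- A disc with one interior vertex and without ears is a wheel. -/
theorem wheel (hP : TriSystem P) {h : α} {nh : List α} {w : List (α × List α)}
    (hw : P w [(h, nh)]) (hn : 3 ≤ w.length) (h2 : ∀ e ∈ w, e.2.length ≠ 2) :
    (∀ e ∈ w, ∃ p q, e.2 = [p, h, q]) ∧ nh ~r (w.map Prod.fst).reverse := by
  rcases hP.exists_step hw hn with ⟨e, he, h3⟩ | ⟨y, mid, x, g, ng, H₁, H₂, hr, hH, hg, hstep⟩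
  · exact absurd h3 (h2 e he)
  obtain ⟨rfl, rfl, rfl⟩ : H₁ = [] ∧ H₂ = [] ∧ g = (h, nh) := by
    rcases H₁ with _ | ⟨a, H₁⟩
    · simp at hH; tauto
    · have := congrArg List.length hH; simp at this
  have hw' := hP.isRotated hw hr
  have hw'' : P (x :: y :: mid) [(h, nh)] :=
    hP.append_comm (l := y :: mid) (l' := [x]) (by simpa using hw')
  obtain ⟨a1, a2⟩ := hP.adj hw''
  have e3 := List.dropLast_append_getLast? y.1 (by rw [a1]; rfl)
  have e2 := eq_cons_tail a2
  have h3 : ∀ e ∈ y :: (mid ++ [x]), 3 ≤ e.2.length := by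
    intro e he
    have h4 := hP.two_le hw hn e (hr.mem_iff.2 he)
    have h5 := h2 e (hr.mem_iff.2 he)
    omega
  obtain ⟨i1, ⟨q, i2⟩, ⟨p, i3⟩, i4⟩ := hP.fan hstep fun e he => h3 e (by simp [he])
  simp only at i2 i3
  constructor
  · intro e he
    rw [hr.mem_iff] at he
    simp only [List.mem_cons, List.mem_append, List.not_mem_nil, or_false] at he
    rcases he with rfl | he | rfl
    · exact ⟨_, _, by rw [e2, i2]⟩
    · exact i4 e he
    · exact ⟨_, _, by rw [← e3, i3]; rfl⟩
  · refine hg.symm.trans ?_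
    rw [i1]
    have := (hr.map Prod.fst).symm.reverse
    simpa using this

/-- The double wheel with hubs `h` and `g`, opened at a triangle at `h`: that triangle has been cut
off, so that `h` lies on the boundary, and `a`, `b` are the neighbours which its other two corners
have lost. -/
theorem double_fan (hP : TriSystem P) {h g : α} {nh ng : List α} {y x : α × List α}
    {mid : List (α × List α)} (a b : α)
    (hw : P ((h, nh) :: y :: (mid ++ [x])) [(g, ng)])
    (hm : ∀ e ∈ mid, 3 ≤ e.2.length ∧ e.2.length ≤ 4)
    (hy : 2 ≤ y.2.length ∧ y.2.length ≤ 3) (hx : 2 ≤ x.2.length ∧ x.2.length ≤ 3)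
    (hh : 3 ≤ nh.length) :
    ∃ A c R c' B, (y.1, a :: y.2) :: (mid ++ [(x.1, x.2 ++ [b])]) = A ++ c :: (R ++ c' :: B) ∧
      (∀ e ∈ A ++ B, ∃ p q, e.2 = [p, h, q]) ∧ (∃ p q, c.2 = [p, h, g, q]) ∧
      (∃ p q, c'.2 = [p, g, h, q]) ∧ (∀ e ∈ R, ∃ p q, e.2 = [p, g, q]) ∧
      nh = (B.map Prod.fst).reverse ++ [c'.1, g, c.1] ++ (A.map Prod.fst).reverse ∧
      ng ~r c'.1 :: ((R.map Prod.fst).reverse ++ [c.1, h]) := by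
  have hm0 : mid ≠ [] := by
    rintro rfl
    have h1 := hP.sum hw
    have h2 := hP.seven_le hw (g, ng) (by simp)
    simp at h1 h2
    omega
  induction hk : mid.length generalizing nh y x mid a b with
  | zero => exact absurd (List.length_eq_zero_iff.1 hk) hm0
  | succ k ih =>
  by_cases hy2 : y.2.length = 2
  · obtain ⟨m, mid, rfl⟩ := List.exists_cons_of_ne_nil hm0
    have hw' : P (y :: m :: ((mid ++ [x]) ++ [(h, nh)])) [(g, ng)] := by simpa using hP.rotate hw
    obtain ⟨e1, e2, e3⟩ := hP.ear_data hw' hy2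
    have hq := hP.ear hw' hy2
    have hq' : P ((h, nh.dropLast) :: (m.1, m.2.tail) :: (mid ++ [x])) [(g, ng)] :=
      hP.append_comm (l' := [_]) (by simpa using hq)
    have hh4 : 4 ≤ nh.length := by
      by_contra hlt
      have := hP.degree_neighbors_eq_four (y := m.2.length)
        (mid := (mid ++ [x]).map fun e => e.2.length) (x := nh.length) (hs := [ng.length])
        (by simp) (by have := degreeWord hw'; simpa [hy2] using this) (by
          intro d hd
          simp only [List.mem_cons, List.mem_append, List.mem_map, List.not_mem_nil, or_false] at hd
          rcases hd with rfl | ⟨e, he | rfl, rfl⟩ | rfl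
          · exact (hm m (by simp)).2
          · exact (hm e (by simp [he])).2
          · omega
          · omega)
      omega
    have hmm := hm m (by simp)
    have hmid : mid ≠ [] := by
      rintro rfl
      have h1 := hP.sum hq'
      have h2 := hP.seven_le hw (g, ng) (by simp)
      simp at h1 h2
      omega
    obtain ⟨A, c, R, c', B, i1, i2, i3, i4, i5, i6, i7⟩ := ih y.1 b hq'
      (fun e he => hm e (by simp [he])) (by simp; omega) hx (by simp; omega)
      hmid (by simpa using hk)
    have e2' : (m.1, y.1 :: m.2.tail) = m := Prod.ext rfl e2.symm
    rw [e2'] at i1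
    refine ⟨(y.1, a :: y.2) :: A, c, R, c', B, ?_, ?_, i3, i4, i5, ?_, i7⟩
    · exact congrArg (List.cons _) i1
    · intro e he
      rw [List.cons_append, List.mem_cons] at he
      rcases he with rfl | he
      · exact ⟨a, m.1, by rw [e1]⟩
      · exact i2 e he
    · simp only at e3
      rw [e3, i6]; simp
  by_cases hx2 : x.2.length = 2
  · obtain ⟨mid, m, rfl⟩ := exists_snoc hm0
    have hw' : P (x :: (h, nh) :: ((y :: mid) ++ [m])) [(g, ng)] :=
      hP.append_comm (l' := [_]) (by simpa using hw)
    obtain ⟨e1, e2, e3⟩ := hP.ear_data hw' hx2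
    have hq := hP.ear hw' hx2
    have hh4 : 4 ≤ nh.length := by
      by_contra hlt
      have := hP.degree_neighbors_eq_four (y := nh.length)
        (mid := (y :: mid).map fun e => e.2.length) (x := m.2.length) (hs := [ng.length])
        (by simp) (by have := degreeWord hw'; simpa [hx2] using this) (by
          intro d hd
          simp only [List.mem_cons, List.mem_append, List.mem_map, List.not_mem_nil, or_false] at hd
          rcases hd with rfl | ⟨e, rfl | he, rfl⟩ | rfl
          · omega
          · omega
          · exact (hm e (by simp [he])).2
          · exact (hm m (by simp)).2)
      omega
    have hmm := hm m (by simp)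
    have hmid : mid ≠ [] := by
      rintro rfl
      have h1 := hP.sum hq
      have h2 := hP.seven_le hw (g, ng) (by simp)
      simp at h1 h2
      omega
    obtain ⟨A, c, R, c', B, i1, i2, i3, i4, i5, i6, i7⟩ := ih a x.1 (x := (m.1, m.2.dropLast))
      (mid := mid) (y := y) (nh := nh.tail) hq
      (fun e he => hm e (by simp [he])) hy (by simp; omega) (by simp; omega)
      hmid (by simpa using hk)
    have e3' : (m.1, m.2.dropLast ++ [x.1]) = m := Prod.ext rfl e3.symm
    rw [e3'] at i1
    refine ⟨A, c, R, c', B ++ [(x.1, x.2 ++ [b])], ?_, ?_, i3, i4, i5, ?_, i7⟩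
    · have : A ++ c :: (R ++ c' :: (B ++ [(x.1, x.2 ++ [b])])) =
          (A ++ c :: (R ++ c' :: B)) ++ [(x.1, x.2 ++ [b])] := by simp
      rw [this, ← i1]; simp
    · intro e he
      rw [← List.append_assoc, List.mem_append, List.mem_singleton] at he
      rcases he with he | rfl
      · exact i2 e he
      · exact ⟨m.1, b, by rw [e1]; rfl⟩
    · simp only at e2
      rw [e2, i6]; simp
  · obtain ⟨i1, i2⟩ := hP.wheel hw (by simp) (by
      intro e he
      simp only [List.mem_cons, List.mem_append, List.not_mem_nil, or_false] at he
      rcases he with rfl | rfl | he | rfl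
      · simp only; omega
      · exact hy2
      · have := hm e he; omega
      · exact hx2)
    obtain ⟨p1, q1, j1⟩ := i1 (h, nh) (by simp)
    obtain ⟨p2, q2, j2⟩ := i1 y (by simp)
    obtain ⟨p3, q3, j3⟩ := i1 x (by simp)
    simp only at j1
    obtain ⟨a1, a2⟩ := hP.adj hw
    obtain ⟨a3, a4⟩ := hP.adj (hP.append_comm (l := (h, nh) :: y :: mid) (l' := [x])
      (by simpa using hw))
    rw [j1] at a1 a4
    rw [j2] at a2
    rw [j3] at a3
    simp at a1 a2 a3 a4
    rw [a2] at j2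
    rw [a3] at j3
    rw [a1, a4] at j1
    refine ⟨[], (y.1, a :: y.2), mid, (x.1, x.2 ++ [b]), [], by simp, by simp,
      ⟨a, q2, by rw [j2]⟩, ⟨p3, b, by rw [j3]; rfl⟩, fun e he => i1 e (by simp [he]),
      by rw [j1]; simp, ?_⟩
    refine i2.trans ?_
    simp only [List.map_cons, List.map_append, List.map_nil, List.reverse_cons, List.reverse_append,
      List.append_assoc, List.cons_append, List.nil_append, List.reverse_nil]
    exact List.IsRotated.refl _

/-- A disc without ears, in which the two interior vertices have seven neighbours and no boundary
vertex has more than four, is the union of two wheels. -/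
theorem double_wheel (hP : TriSystem P) {w : List (α × List α)} {e₁ e₂ : α × List α}
    (hw : P w [e₁, e₂]) (hn : 3 ≤ w.length) (h2 : ∀ e ∈ w, e.2.length ≠ 2)
    (h4 : ∀ e ∈ w, e.2.length ≤ 4) (h₁ : e₁.2.length = 7) (h₂ : e₂.2.length = 7) :
    ∃ h g c c' : α × List α, ∃ R S : List (α × List α),
      ((h = e₁ ∧ g = e₂) ∨ (h = e₂ ∧ g = e₁)) ∧ w ~r (c :: (R ++ c' :: S)) ∧
      R.length = 4 ∧ S.length = 4 ∧
      (∃ p q, c.2 = [p, h.1, g.1, q]) ∧ (∃ p q, c'.2 = [p, g.1, h.1, q]) ∧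
      (∀ e ∈ R, ∃ p q, e.2 = [p, g.1, q]) ∧ (∀ e ∈ S, ∃ p q, e.2 = [p, h.1, q]) ∧
      h.2 ~r c'.1 :: g.1 :: c.1 :: (S.map Prod.fst).reverse ∧
      g.2 ~r c'.1 :: ((R.map Prod.fst).reverse ++ [c.1, h.1]) := by
  rcases hP.exists_step hw hn with ⟨e, he, h3⟩ | ⟨y, mid, x, h, nh, H₁, H₂, hr, hH, hg, hstep⟩
  · exact absurd h3 (h2 e he)
  obtain ⟨g, hHg, hhg⟩ : ∃ g, H₁ ++ H₂ = [g] ∧ ((h = e₁ ∧ g = e₂) ∨ (h = e₂ ∧ g = e₁)) := by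
    rcases H₁ with _ | ⟨a, _ | ⟨b, H₁⟩⟩
    · simp at hH
      exact ⟨e₂, by simp [← hH.2], Or.inl ⟨hH.1.symm, rfl⟩⟩
    · simp at hH
      obtain ⟨rfl, rfl, rfl⟩ := hH
      exact ⟨_, rfl, Or.inr ⟨rfl, rfl⟩⟩
    · have := congrArg List.length hH; simp at this
  rw [hHg] at hstep
  have hh7 : h.2.length = 7 := by rcases hhg with ⟨rfl, -⟩ | ⟨rfl, -⟩ <;> assumption
  have hg7 : g.2.length = 7 := by rcases hhg with ⟨-, rfl⟩ | ⟨-, rfl⟩ <;> assumption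
  have hw' := hP.isRotated hw hr
  have hw'' : P (x :: y :: mid) [e₁, e₂] :=
    hP.append_comm (l := y :: mid) (l' := [x]) (by simpa using hw')
  obtain ⟨a1, a2⟩ := hP.adj hw''
  have e3 := List.dropLast_append_getLast? y.1 (by rw [a1]; rfl)
  have e2 := eq_cons_tail a2
  have h3 : ∀ e ∈ y :: (mid ++ [x]), 3 ≤ e.2.length ∧ e.2.length ≤ 4 := by
    intro e he
    have h5 := hP.two_le hw hn e (hr.mem_iff.2 he)
    have h6 := h2 e (hr.mem_iff.2 he)
    have h7 := h4 e (hr.mem_iff.2 he)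
    omega
  have hy := h3 y (by simp)
  have hx := h3 x (by simp)
  have hnh : nh.length = 7 := by rw [hg.perm.length_eq, hh7]
  obtain ⟨A, c, R, c', B, i1, i2, i3, i4, i5, i6, i7⟩ :=
    hP.double_fan (g := g.1) (ng := g.2) x.1 y.1 hstep (fun e he => h3 e (by simp [he]))
      (by simp; omega) (by simp; omega) (by omega)
  simp only at i1
  rw [← e2, e3] at i1
  have hlR := i7.perm.length_eq
  have hlS := congrArg List.length i6
  simp at hlR hlS
  refine ⟨h, g, c, c', R, B ++ A, hhg, ?_, by omega, by simp; omega, i3, i4, i5, ?_, ?_, i7⟩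
  · refine hr.trans ?_
    have e : y :: (mid ++ [x]) = A ++ c :: (R ++ c' :: B) := i1
    rw [e]
    simpa using List.isRotated_append (l := A) (l' := c :: (R ++ c' :: B))
  · intro e he
    exact i2 e (by simp only [List.mem_append] at he ⊢; tauto)
  · refine hg.symm.trans ?_
    rw [i6]
    simpa using List.isRotated_append (l := (B.map Prod.fst).reverse)
      (l' := [c'.1, g.1, c.1] ++ (A.map Prod.fst).reverse)

end TriSystem

end Wheels

/-! ### Degree words with four entries at most three -/

section DegreeClassification

variable {α : Type*}

/-- Lower the first and the last entry by one each. -/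
def trim (l : List ℕ) : List ℕ := decHead (decLast l)

@[simp] theorem trim_singleton (a : ℕ) : trim [a] = [a - 2] := rfl

@[simp] theorem trim_cons_snoc (a b : ℕ) (l : List ℕ) :
    trim (a :: (l ++ [b])) = (a - 1) :: (l ++ [b - 1]) := by
  rw [trim, decLast_cons _ (by simp), decLast_snoc, decHead_cons]

theorem decLast_decHead (l : List ℕ) : decLast (decHead l) = trim l := by
  rcases l with _ | ⟨a, l⟩
  · rfl
  · rcases List.eq_nil_or_concat l with rfl | ⟨l, b, rfl⟩
    · rfl
    · simp only [List.concat_eq_append, decHead_cons, trim_cons_snoc]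
      rw [decLast_cons _ (by simp), decLast_snoc]

@[simp] theorem length_trim (l : List ℕ) : (trim l).length = l.length := by simp [trim]

theorem trim_ne_nil {l : List ℕ} (h : l ≠ []) : trim l ≠ [] := decHead_ne_nil (decLast_ne_nil h)

theorem decHead_reverse (l : List ℕ) : decHead l.reverse = (decLast l).reverse := by
  simp [decLast]

theorem decLast_reverse (l : List ℕ) : decLast l.reverse = (decHead l).reverse := by
  simp [decLast]

theorem trim_reverse (l : List ℕ) : trim l.reverse = (trim l).reverse := by
  rw [trim, decLast_reverse, decHead_reverse, decLast_decHead]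

theorem eq_singleton_or {l : List ℕ} (h : l ≠ []) :
    (∃ a, l = [a]) ∨ ∃ a m b, l = a :: (m ++ [b]) := by
  obtain ⟨a, l, rfl⟩ := List.exists_cons_of_ne_nil h
  rcases List.eq_nil_or_concat l with rfl | ⟨m, b, rfl⟩
  · exact Or.inl ⟨a, rfl⟩
  · exact Or.inr ⟨a, m, b, by simp⟩

theorem exists_first_two {l : List ℕ} {k : ℕ} (h : l.count 2 = k + 1) :
    ∃ A R, l = A ++ 2 :: R ∧ A.count 2 = 0 ∧ R.count 2 = k := by
  obtain ⟨A, R, rfl, hA⟩ := List.eq_append_cons_of_mem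
    (List.count_pos_iff.1 (by omega : 0 < l.count 2))
  have hA' := List.count_eq_zero.2 hA
  refine ⟨A, R, rfl, hA', ?_⟩
  simp [hA'] at h
  exact h

theorem exists_three_segments {l : List ℕ} (h : l.count 2 = 3) :
    ∃ A B C, l ~r 2 :: (A ++ 2 :: (B ++ 2 :: C)) ∧
      A.count 2 = 0 ∧ B.count 2 = 0 ∧ C.count 2 = 0 := by
  obtain ⟨X, R, rfl, hX, hR⟩ := exists_first_two h
  obtain ⟨A, R, rfl, hA, hR⟩ := exists_first_two hR
  obtain ⟨B, R, rfl, hB, hR⟩ := exists_first_two hR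
  refine ⟨A, B, R ++ X, ?_, hA, hB, by simp [hR, hX]⟩
  simpa using List.isRotated_append (l := X) (l' := 2 :: (A ++ 2 :: (B ++ 2 :: R)))

theorem exists_four_segments {l : List ℕ} (h : l.count 2 = 4) :
    ∃ A B C D, l ~r 2 :: (A ++ 2 :: (B ++ 2 :: (C ++ 2 :: D))) ∧
      A.count 2 = 0 ∧ B.count 2 = 0 ∧ C.count 2 = 0 ∧ D.count 2 = 0 := by
  obtain ⟨X, R, rfl, hX, hR⟩ := exists_first_two h
  obtain ⟨A, R, rfl, hA, hR⟩ := exists_first_two hR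
  obtain ⟨B, R, rfl, hB, hR⟩ := exists_first_two hR
  obtain ⟨C, R, rfl, hC, hR⟩ := exists_first_two hR
  refine ⟨A, B, C, R ++ X, ?_, hA, hB, hC, by simp [hR, hX]⟩
  simpa using List.isRotated_append (l := X) (l' := 2 :: (A ++ 2 :: (B ++ 2 :: (C ++ 2 :: R))))

/-- Only a segment that consists of a single `4`, or the entries `3`, give rise to new ears when the
ears on both sides are cut off. -/
theorem count_trim {l : List ℕ} (h : ∀ a ∈ l, 3 ≤ a) (h2 : ∀ a ∈ trim l, 2 ≤ a) :
    (trim l).count 2 ≤ if l = [4] then 1 else l.count 3 := by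
  rcases eq_or_ne l [] with rfl | hl
  · simp [trim, decLast, decHead]
  rcases eq_singleton_or hl with ⟨a, rfl⟩ | ⟨a, m, b, rfl⟩
  · simp at h h2 ⊢
    rcases eq_or_ne a 4 with rfl | h4
    · simp
    · have : a - 2 ≠ 2 := by omega
      simp [this]
  · have hm : m.count 2 = 0 := by
      rw [List.count_eq_zero]
      intro hc
      have := h 2 (by simp [hc])
      omega
    rw [if_neg (by
      intro he
      have := congrArg List.length he
      simp at this)]
    simp only [trim_cons_snoc, List.count_cons, List.count_append, List.count_nil, hm, beq_iff_eq]
    split_ifs <;> omega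

namespace TriSystem

variable {P : List (α × List α) → List (α × List α) → Prop} {ds hs : List ℕ}

theorem degree_cut_three (hP : TriSystem P) {A B C : List ℕ} (hA : A ≠ []) (hB : B ≠ [])
    (hC : C ≠ []) (h : DegreeWord P (2 :: (A ++ 2 :: (B ++ 2 :: C))) hs) :
    DegreeWord P (trim A ++ (trim B ++ trim C)) hs := by
  have h1 := hP.degree_cut_two hA hB (C := 2 :: C) (by simp) h
  rw [decLast_cons _ hC] at h1
  have h2 := hP.degree_cut (A := decLast C) (B := trim A ++ decHead B) (decLast_ne_nil hC)
    (by simp [trim_ne_nil hA]) (hs := hs)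
    (hP.degree_isRotated h1 (by
      simpa [trim] using List.isRotated_append (l := trim A ++ decHead B) (l' := 2 :: decLast C)))
  rw [decLast_append _ (decHead_ne_nil hB), decLast_decHead] at h2
  exact hP.degree_isRotated h2 (by
    simpa [trim] using List.isRotated_append (l := trim C) (l' := trim A ++ trim B))

theorem degree_cut_four (hP : TriSystem P) {A B C D : List ℕ} (hA : A ≠ []) (hB : B ≠ [])
    (hC : C ≠ []) (hD : D ≠ []) (h : DegreeWord P (2 :: (A ++ 2 :: (B ++ 2 :: (C ++ 2 :: D)))) hs) :
    DegreeWord P (trim A ++ (trim B ++ (trim C ++ trim D))) hs := by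
  have h1 := hP.degree_cut_two hA hB (C := 2 :: (C ++ 2 :: D)) (by simp) h
  rw [decLast_cons _ (by simp), decLast_append _ (by simp), decLast_cons _ hD] at h1
  have h2 := hP.degree_cut_two (A := C) (B := decLast D) (C := trim A ++ decHead B) hC
    (decLast_ne_nil hD) (by simp [trim_ne_nil hA]) (hs := hs)
    (hP.degree_isRotated h1 (by
      simpa [trim] using List.isRotated_append (l := trim A ++ decHead B)
        (l' := 2 :: (C ++ 2 :: decLast D))))
  rw [decLast_append _ (decHead_ne_nil hB), decLast_decHead] at h2
  exact hP.degree_isRotated h2 (by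
    simpa [trim] using List.isRotated_append (l := trim C ++ trim D) (l' := trim A ++ trim B))

theorem degree_segment_ne_nil (hP : TriSystem P) {A R : List ℕ} (hR : A = [] → 2 ≤ R.length)
    (h : DegreeWord P (2 :: (A ++ 2 :: R)) hs) : A ≠ [] := by
  rintro rfl
  exact hP.degree_ears_not_adjacent (hR rfl) (by simpa using h)

theorem degree_last_segment_ne_nil (hP : TriSystem P) {A R : List ℕ} (hR : A = [] → 2 ≤ R.length)
    (h : DegreeWord P (2 :: (R ++ 2 :: A)) hs) : A ≠ [] := by
  rintro rfl
  exact hP.degree_ears_not_adjacent (hR rfl)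
    (hP.degree_append_comm (l := 2 :: R) (l' := [2]) (by simpa using h))

theorem degree_three_segments (hP : TriSystem P) {l : List ℕ} (h : DegreeWord P l hs)
    (hn : 4 ≤ l.length) (h2 : l.count 2 = 3) :
    ∃ A B C, l ~r 2 :: (A ++ 2 :: (B ++ 2 :: C)) ∧
      (A ≠ [] ∧ B ≠ [] ∧ C ≠ []) ∧
      ((∀ a ∈ A, 3 ≤ a) ∧ (∀ a ∈ B, 3 ≤ a) ∧ (∀ a ∈ C, 3 ≤ a)) ∧
      DegreeWord P (2 :: (A ++ 2 :: (B ++ 2 :: C))) hs := by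
  obtain ⟨A, B, C, hr, hA, hB, hC⟩ := exists_three_segments h2
  have h' := hP.degree_isRotated h hr
  have hlen := hr.perm.length_eq
  simp only [List.length_cons, List.length_append] at hlen
  have hge := hP.degree_two_le h' (by simp; omega)
  have key : ∀ X : List ℕ, X.count 2 = 0 → (∀ a ∈ X, 2 ≤ a) → ∀ a ∈ X, 3 ≤ a := by
    intro X hX hX2 a ha
    have := hX2 a ha
    by_contra hlt
    obtain rfl : a = 2 := by omega
    exact (List.count_eq_zero.1 hX) ha
  refine ⟨A, B, C, hr, ⟨?_, ?_, ?_⟩, ⟨?_, ?_, ?_⟩, h'⟩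
  · exact hP.degree_segment_ne_nil
        (by rintro rfl; simp at hlen ⊢; omega) h'
  · refine hP.degree_segment_ne_nil (A := B) (R := C ++ 2 :: A)
        (by rintro rfl; simp at hlen ⊢; omega)
      (hP.degree_isRotated h' ?_)
    simpa using List.isRotated_append (l := 2 :: A) (l' := 2 :: (B ++ 2 :: C))
  · exact hP.degree_last_segment_ne_nil (R := A ++ 2 :: B)
        (by rintro rfl; simp at hlen ⊢; omega) (by simpa using h')
  · exact key A hA fun a ha => hge a (by simp [ha])
  · exact key B hB fun a ha => hge a (by simp [ha])
  · exact key C hC fun a ha => hge a (by simp [ha])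

theorem degree_four_segments (hP : TriSystem P) {l : List ℕ} (h : DegreeWord P l hs)
    (h2 : l.count 2 = 4) :
    ∃ A B C D, l ~r 2 :: (A ++ 2 :: (B ++ 2 :: (C ++ 2 :: D))) ∧
      (A ≠ [] ∧ B ≠ [] ∧ C ≠ [] ∧ D ≠ []) ∧
      ((∀ a ∈ A, 3 ≤ a) ∧ (∀ a ∈ B, 3 ≤ a) ∧ (∀ a ∈ C, 3 ≤ a) ∧ (∀ a ∈ D, 3 ≤ a)) ∧
      DegreeWord P (2 :: (A ++ 2 :: (B ++ 2 :: (C ++ 2 :: D)))) hs := by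
  obtain ⟨A, B, C, D, hr, hA, hB, hC, hD⟩ := exists_four_segments h2
  have h' := hP.degree_isRotated h hr
  have hlen := hr.perm.length_eq
  have hge := hP.degree_two_le h' (by simp; omega)
  have key : ∀ X : List ℕ, X.count 2 = 0 → (∀ a ∈ X, 2 ≤ a) → ∀ a ∈ X, 3 ≤ a := by
    intro X hX hX2 a ha
    have := hX2 a ha
    by_contra hlt
    obtain rfl : a = 2 := by omega
    exact (List.count_eq_zero.1 hX) ha
  refine ⟨A, B, C, D, hr, ⟨?_, ?_, ?_, ?_⟩, ⟨?_, ?_, ?_, ?_⟩, h'⟩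
  · exact hP.degree_segment_ne_nil
        (by rintro rfl; simp at hlen ⊢; omega) h'
  · refine hP.degree_segment_ne_nil (A := B) (R := C ++ 2 :: (D ++ 2 :: A))
        (by rintro rfl; simp at hlen ⊢; omega)
      (hP.degree_isRotated h' ?_)
    simpa using List.isRotated_append (l := 2 :: A) (l' := 2 :: (B ++ 2 :: (C ++ 2 :: D)))
  · refine hP.degree_segment_ne_nil (A := C) (R := D ++ 2 :: (A ++ 2 :: B))
        (by rintro rfl; simp at hlen ⊢; omega)
      (hP.degree_isRotated h' ?_)
    simpa using List.isRotated_append (l := 2 :: (A ++ 2 :: B)) (l' := 2 :: (C ++ 2 :: D))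
  · exact hP.degree_last_segment_ne_nil (R := A ++ 2 :: (B ++ 2 :: C))
        (by rintro rfl; simp at hlen ⊢; omega)
      (by simpa using h')
  · exact key A hA fun a ha => hge a (by simp [ha])
  · exact key B hB fun a ha => hge a (by simp [ha])
  · exact key C hC fun a ha => hge a (by simp [ha])
  · exact key D hD fun a ha => hge a (by simp [ha])

theorem degree_wheel (hP : TriSystem P) {h : ℕ} (hw : DegreeWord P ds [h]) (hn : 3 ≤ ds.length)
    (h2 : 2 ∉ ds) : ds = List.replicate h 3 := by
  obtain ⟨w, H, hw, rfl, hH⟩ := hw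
  obtain ⟨⟨e, l⟩, rfl, rfl⟩ : ∃ e, H = [e] ∧ e.2.length = h := by
    rcases H with _ | ⟨e, _ | _⟩ <;> simp_all
  obtain ⟨h3, h4⟩ := hP.wheel hw (by simpa using hn) (by
    intro e he h3
    exact h2 (List.mem_map.2 ⟨e, he, h3⟩))
  rw [List.eq_replicate_iff]
  constructor
  · have := h4.perm.length_eq
    simpa using this.symm
  · intro b hb
    obtain ⟨e, he, rfl⟩ := List.mem_map.1 hb
    obtain ⟨p, q, h5⟩ := h3 e he
    simp [h5]

theorem degree_double_wheel (hP : TriSystem P) (hw : DegreeWord P ds [7, 7]) (hn : 3 ≤ ds.length)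
    (h2 : 2 ∉ ds) (h4 : ∀ a ∈ ds, a ≤ 4) : ds ~r [4, 3, 3, 3, 3, 4, 3, 3, 3, 3] := by
  obtain ⟨w, H, hw, rfl, hH⟩ := hw
  obtain ⟨e₁, e₂, rfl, h7, h7'⟩ : ∃ e₁ e₂, H = [e₁, e₂] ∧ e₁.2.length = 7 ∧ e₂.2.length = 7 := by
    rcases H with _ | ⟨e, _ | ⟨e', _ | _⟩⟩
    · simp at hH
    · simp at hH
    · simp at hH
      exact ⟨e, e', rfl, hH⟩
    · simp at hH
  obtain ⟨h, g, c, c', R, S, -, hr, hR, hS, ⟨_, _, hc⟩, ⟨_, _, hc'⟩, i1, i2, -, -⟩ :=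
    hP.double_wheel hw (by simpa using hn) (by
      intro e he h3
      exact h2 (List.mem_map.2 ⟨e, he, h3⟩)) (by
      intro e he
      exact h4 _ (List.mem_map.2 ⟨e, he, rfl⟩)) h7 h7'
  refine (hr.map _).trans ?_
  have hR3 : R.map (fun e => e.2.length) = List.replicate 4 3 := by
    rw [List.eq_replicate_iff]
    refine ⟨by simpa using hR, ?_⟩
    intro b hb
    obtain ⟨e, he, rfl⟩ := List.mem_map.1 hb
    obtain ⟨p, q, h5⟩ := i1 e he
    simp [h5]
  have hS3 : S.map (fun e => e.2.length) = List.replicate 4 3 := by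
    rw [List.eq_replicate_iff]
    refine ⟨by simpa using hS, ?_⟩
    intro b hb
    obtain ⟨e, he, rfl⟩ := List.mem_map.1 hb
    obtain ⟨p, q, h5⟩ := i2 e he
    simp [h5]
  simp only [List.map_cons, List.map_append, hR3, hS3, hc, hc']
  exact List.IsRotated.refl _

/-- If there are interior vertices, and the boundary vertices have at most one neighbour in excess
of four, then no vertex with four neighbours lies between two ears. -/
theorem degree_not_two_four_two (hP : TriSystem P) (hH : hs ≠ []) {R : List ℕ}
    (h3 : R.count 3 = 0 ∨ excess R = 0) (hex : excess R ≤ 1) (hn : 3 ≤ R.length) :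
    ¬ DegreeWord P (2 :: 4 :: 2 :: R) hs := by
  intro h
  obtain ⟨y, R, rfl⟩ := List.exists_cons_of_ne_nil (l := R) (by rintro rfl; simp at hn)
  obtain ⟨m, x, rfl⟩ := exists_snoc (l := R) (by rintro rfl; simp at hn)
  have hm : m ≠ [] := by rintro rfl; simp at hn
  have hm1 := List.length_pos_iff.2 hm
  have h1 := hP.degree_cut_two (A := [4]) (B := [y]) (C := m ++ [x]) (by simp)
    (by simp) (by simp) (hs := hs) (by simpa using h)
  have hyx : 3 ≤ y ∧ 3 ≤ x := by
    constructor
    · by_contra hlt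
      have := hP.degree_two_le h (by simp) y (by simp)
      obtain rfl : y = 2 := by omega
      refine hP.degree_ears_not_adjacent (r := m ++ [x] ++ [2, 4]) (by simp) (hs := hs) ?_
      exact hP.degree_append_comm (l := [2, 4]) (by simpa using h)
    · by_contra hlt
      have := hP.degree_two_le h (by simp) x (by simp)
      obtain rfl : x = 2 := by omega
      refine hP.degree_ears_not_adjacent (r := 4 :: 2 :: y :: m) (by simp) (hs := hs) ?_
      exact hP.degree_append_comm (l' := [2]) (l := 2 :: 4 :: 2 :: y :: m) (by simpa using h)
  simp only [decLast_singleton, decHead_cons, decLast_snoc, List.cons_append, List.nil_append] at h1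
  norm_num at h1
  obtain ⟨a1, a2⟩ := hP.degree_neighbors_of_ear hm h1
  simp only [excess_cons, excess_append, excess_nil] at hex h3
  by_cases hx : y - 4 + excess m + (x - 4) = 0
  · obtain ⟨b1, b2⟩ := hP.degree_neighbors_eq_four hH h1 (by
      have hm4 := le_four_of_excess (l := m) (by omega)
      intro a ha
      simp only [List.mem_cons, List.mem_append, List.not_mem_nil, or_false] at ha
      rcases ha with rfl | ha | rfl
      · omega
      · exact hm4 a ha
      · omega)
    omega
  · simp only [List.count_cons, List.count_append, List.count_nil, beq_iff_eq] at h3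
    have hy3 : y ≠ 3 ∧ x ≠ 3 := by
      constructor <;> rintro rfl <;> · simp at h3; omega
    by_cases hx' : excess m = 0
    · obtain ⟨b1, b2⟩ := hP.degree_neighbors_eq_four hH h1 (by
        have hm4 := le_four_of_excess hx'
        intro a ha
        simp only [List.mem_cons, List.mem_append, List.not_mem_nil, or_false] at ha
        rcases ha with rfl | ha | rfl
        · omega
        · exact hm4 a ha
        · omega)
      omega
    · obtain rfl : y = 4 := by omega
      obtain rfl : x = 4 := by omega
      have h2 := hP.degree_ear h1
      exact hP.degree_ears_not_adjacent (r := m) (hs := hs) (by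
        by_contra hlt
        obtain ⟨c, rfl⟩ := List.length_eq_one_iff.1 (by omega : m.length = 1)
        have hs1 := hP.degree_sum h2
        have hs2 := hP.degree_length_le h2
        have hs3 := List.length_pos_iff.2 hH
        have hs4 := hP.degree_two_le h2 (by simp) c (by simp)
        simp at hs1
        omega)
        (hP.degree_append_comm (l := 2 :: m) (l' := [2]) (by simpa using h2))

end TriSystem

end DegreeClassification

section DegreeClassification

variable {α : Type*}

theorem excess_eq_of_isRotated {l l' : List ℕ} (h : l ~r l') : excess l = excess l' :=
  (h.perm.map _).sum_eq

theorem eq_four_cons_snoc {X : List ℕ} (h : ∀ a ∈ trim X, a = 3) (h2 : ∀ a ∈ X, 3 ≤ a)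
    (hX : X ≠ []) : X = [5] ∨ ∃ k, X = 4 :: (List.replicate k 3 ++ [4]) := by
  rcases eq_singleton_or hX with ⟨a, rfl⟩ | ⟨a, m, b, rfl⟩
  · simp at h h2
    left
    congr 1
    omega
  · right
    simp only [trim_cons_snoc, List.mem_cons, List.mem_append, List.not_mem_nil, or_false] at h
    have ha := h (a - 1) (by simp)
    have hb := h (b - 1) (by simp)
    obtain rfl : a = 4 := by omega
    obtain rfl : b = 4 := by omega
    refine ⟨m.length, ?_⟩
    congr 2
    exact List.eq_replicate_iff.2 ⟨rfl, fun c hc => h c (by simp [hc])⟩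

theorem count_two_add_count_three_le (l : List ℕ) : l.count 2 + l.count 3 ≤ l.length := by
  induction l with
  | nil => simp
  | cons a l ih =>
    simp only [List.count_cons, List.length_cons, beq_iff_eq]
    split_ifs <;> omega

namespace TriSystem

variable {P : List (α × List α) → List (α × List α) → Prop} {ds hs : List ℕ}

/-- The possible numbers of ears, of vertices with three neighbours, of surplus neighbours, and of
interior vertices, for a disc in which exactly four boundary vertices have less than four
neighbours. -/
theorem degree_cases (hP : TriSystem P) (h : DegreeWord P ds hs) (hn : 3 ≤ ds.length)
    (hl : ds.count 2 + ds.count 3 = 4) :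
    (hs = [] ∧ ds.count 2 = 2 ∧ ds.count 3 = 2 ∧ excess ds = 0) ∨
    (hs = [] ∧ ds.count 2 = 3 ∧ ds.count 3 = 1 ∧ excess ds = 1) ∨
    (hs = [] ∧ ds.count 2 = 4 ∧ ds.count 3 = 0 ∧ excess ds = 2) ∨
    (hs = [7] ∧ ds.count 2 = 3 ∧ ds.count 3 = 1 ∧ excess ds = 0) ∨
    (hs = [7] ∧ ds.count 2 = 4 ∧ ds.count 3 = 0 ∧ excess ds = 1) ∨
    (hs = [8] ∧ ds.count 2 = 4 ∧ ds.count 3 = 0 ∧ excess ds = 0) ∨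
    (hs = [7, 7] ∧ ds.count 2 = 4 ∧ ds.count 3 = 0 ∧ excess ds = 0) := by
  have h1 := hP.degree_sum h
  rw [sum_four_sub (hP.degree_two_le h hn)] at h1
  have h2 := hP.degree_length_le h
  have h3 := hP.degree_seven_le h
  rcases hs with _ | ⟨a, _ | ⟨b, _ | ⟨c, hs⟩⟩⟩
  · simp only [List.map_nil, List.sum_nil] at h1
    have : ds.count 2 = 2 ∨ ds.count 2 = 3 ∨ ds.count 2 = 4 := by omega
    simp only [true_and, List.nil_eq, reduceCtorEq, false_and, or_false]
    omega
  · have ha := h3 a (by simp)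
    simp only [List.map_cons, List.map_nil, List.sum_cons, List.sum_nil] at h1
    simp only [List.cons.injEq, and_true, reduceCtorEq, false_and, false_or, and_false, or_false]
    omega
  · have ha := h3 a (by simp)
    have hb := h3 b (by simp)
    simp only [List.map_cons, List.map_nil, List.sum_cons, List.sum_nil] at h1
    simp only [List.cons.injEq, and_true, reduceCtorEq, false_and, false_or, and_false]
    omega
  · simp only [List.map_cons, List.sum_cons, List.length_cons] at h1 h2
    push_cast at h2
    omega

/-- With three ears and no interior vertices, one vertex between two ears has four neighbours.
When these two ears are cut off, the new disc has two ears, and no vertex with more than four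
neighbours. -/
theorem degree_three_ears (hP : TriSystem P) (h : DegreeWord P ds []) (h2 : ds.count 2 = 3)
    (h3 : ds.count 3 = 1) (hex : excess ds = 1) :
    ∃ B C, ds ~r 2 :: 4 :: 2 :: (B ++ 2 :: C) ∧ B ≠ [] ∧ C ≠ [] ∧ 3 ≤ B.length + C.length ∧
      (∀ a ∈ decHead B ++ decLast C, 3 ≤ a ∧ a ≤ 4) := by
  have hn : 4 ≤ ds.length := by
    have := count_two_add_count_three_le ds
    omega
  obtain ⟨A, B, C, hr, ⟨hA, hB, hC⟩, ⟨gA, gB, gC⟩, h'⟩ := hP.degree_three_segments h hn h2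
  -- after a rotation, the first segment is the vertex between two ears
  obtain ⟨A, B, C, hr, ⟨hA, hB, hC⟩, ⟨gA, gB, gC⟩, h', rfl⟩ : ∃ A B C,
      ds ~r 2 :: (A ++ 2 :: (B ++ 2 :: C)) ∧ (A ≠ [] ∧ B ≠ [] ∧ C ≠ []) ∧
      ((∀ a ∈ A, 3 ≤ a) ∧ (∀ a ∈ B, 3 ≤ a) ∧ (∀ a ∈ C, 3 ≤ a)) ∧
      DegreeWord P (2 :: (A ++ 2 :: (B ++ 2 :: C))) [] ∧ A = [4] := by
    have h1 := hP.degree_cut_three hA hB hC h'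
    have hlA := List.length_pos_iff.2 hA
    have hlB := List.length_pos_iff.2 hB
    have hlC := List.length_pos_iff.2 hC
    have g := hP.degree_two_le h1 (by simp; omega)
    have c1 := count_trim gA fun a ha => g a (by simp [ha])
    have c2 := count_trim gB fun a ha => g a (by simp [ha])
    have c3 := count_trim gC fun a ha => g a (by simp [ha])
    have hcount : 2 ≤ (trim A ++ (trim B ++ trim C)).count 2 := by
      by_cases h4 : 4 ≤ A.length + (B.length + C.length)
      · exact hP.two_le_count_ears h1 (by simpa using h4)
      · obtain ⟨a, rfl⟩ := List.length_eq_one_iff.1 (by omega : A.length = 1)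
        obtain ⟨b, rfl⟩ := List.length_eq_one_iff.1 (by omega : B.length = 1)
        obtain ⟨c, rfl⟩ := List.length_eq_one_iff.1 (by omega : C.length = 1)
        have hs := hP.degree_sum h1
        have g1 := g (a - 2) (by simp)
        have g2 := g (b - 2) (by simp)
        have g3 := g (c - 2) (by simp)
        simp at hs
        have e1 : a - 2 = 2 := by omega
        have e2 : b - 2 = 2 := by omega
        simp [e1, e2]
    have h3' := h3
    rw [hr.perm.count_eq] at h3'
    simp only [List.count_cons, List.count_append, beq_iff_eq] at h3' hcount
    norm_num at h3'
    by_cases hA4 : A = [4]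
    · exact ⟨A, B, C, hr, ⟨hA, hB, hC⟩, ⟨gA, gB, gC⟩, h', hA4⟩
    · rw [if_neg hA4] at c1
      by_cases hB4 : B = [4]
      · have hr' : 2 :: (A ++ 2 :: (B ++ 2 :: C)) ~r 2 :: (B ++ 2 :: (C ++ 2 :: A)) := by
          simpa using List.isRotated_append (l := 2 :: A) (l' := 2 :: (B ++ 2 :: C))
        exact ⟨B, C, A, hr.trans hr', ⟨hB, hC, hA⟩, ⟨gB, gC, gA⟩, hP.degree_isRotated h' hr', hB4⟩
      · rw [if_neg hB4] at c2
        by_cases hC4 : C = [4]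
        · have hr' : 2 :: (A ++ 2 :: (B ++ 2 :: C)) ~r 2 :: (C ++ 2 :: (A ++ 2 :: B)) := by
            simpa using List.isRotated_append (l := 2 :: (A ++ 2 :: B)) (l' := 2 :: C)
          exact ⟨C, A, B, hr.trans hr', ⟨hC, hA, hB⟩, ⟨gC, gA, gB⟩, hP.degree_isRotated h' hr', hC4⟩
        · rw [if_neg hC4] at c3
          omega
  have e3 := hr.perm.count_eq 3
  have eex := excess_eq_of_isRotated hr
  simp [h3, hex] at e3 eex
  have h1 := hP.degree_cut_two (A := [4]) hA hB (C := 2 :: C) (by simp) h'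
  rw [decLast_cons _ hC] at h1
  have c2B : B.count 2 = 0 := List.count_eq_zero.2 fun h => absurd (gB 2 h) (by norm_num)
  have c2C : C.count 2 = 0 := List.count_eq_zero.2 fun h => absurd (gC 2 h) (by norm_num)
  obtain ⟨b, B, rfl⟩ := List.exists_cons_of_ne_nil hB
  obtain ⟨C, c, rfl⟩ := exists_snoc hC
  have h4 : DegreeWord P (2 :: (b - 1) :: ((B ++ 2 :: C) ++ [c - 1])) [] := by simpa using h1
  obtain ⟨gb, gc⟩ := hP.degree_neighbors_of_ear (by simp) h4
  simp only [List.count_cons, List.count_append, List.count_nil, excess_append, excess_cons,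
    beq_iff_eq, excess_nil] at e3 eex c2B c2C
  have hlen : 3 ≤ (b :: B).length + (C ++ [c]).length := by
    by_contra hlt
    simp at hlt
    obtain rfl := List.length_eq_zero_iff.1 (by omega : B.length = 0)
    obtain rfl := List.length_eq_zero_iff.1 (by omega : C.length = 0)
    simp at e3
    rw [if_neg (by omega), if_neg (by omega)] at e3
    omega
  have h5 := hP.degree_two_ears (by simp at hlen ⊢; omega)
    (by simp only [List.count_append, List.count_cons, beq_self_eq_true, if_true]; omega) h4
  have h6 := hP.degree_sum h4
  rw [sum_four_sub (hP.degree_two_le h4 (by simp; omega))] at h6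
  simp only [List.map_nil, List.sum_nil, List.count_cons, List.count_append, List.count_nil,
    beq_iff_eq, excess_append, excess_cons, excess_nil] at h6
  norm_num at h6
  refine ⟨b :: B, C ++ [c], hr, hB, hC, hlen, ?_⟩
  have hB4 := le_four_of_excess (l := B)
  have hC4 := le_four_of_excess (l := C)
  have hfin : b - 1 ≤ 4 ∧ c - 1 ≤ 4 ∧ excess B = 0 ∧ excess C = 0 := by
    split_ifs at h6 e3 c2B c2C <;> omega
  intro a ha
  simp only [decHead_cons, decLast_snoc, List.mem_cons, List.mem_append, List.not_mem_nil,
    or_false, List.cons_append] at ha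
  rcases ha with rfl | ha | ha | rfl
  · exact ⟨gb, hfin.1⟩
  · exact ⟨gB a (by simp [ha]), hB4 hfin.2.2.1 a ha⟩
  · exact ⟨gC a (by simp [ha]), hC4 hfin.2.2.2 a ha⟩
  · exact ⟨gc, hfin.2.1⟩

/-- With four ears and no interior vertices, two vertices between ears have four neighbours. -/
theorem degree_four_ears_segments (hP : TriSystem P) (h : DegreeWord P ds [])
    (h2 : ds.count 2 = 4) (h3 : ds.count 3 = 0) :
    ∃ A B C D,
      ds ~r 2 :: (A ++ 2 :: (B ++ 2 :: (C ++ 2 :: D))) ∧ (A ≠ [] ∧ B ≠ [] ∧ C ≠ [] ∧ D ≠ []) ∧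
      ((∀ a ∈ A, 3 ≤ a) ∧ (∀ a ∈ B, 3 ≤ a) ∧ (∀ a ∈ C, 3 ≤ a) ∧ (∀ a ∈ D, 3 ≤ a)) ∧
      DegreeWord P (2 :: (A ++ 2 :: (B ++ 2 :: (C ++ 2 :: D)))) [] ∧ A = [4] ∧ C = [4] := by
  obtain ⟨A, B, C, D, hr, ⟨hA, hB, hC, hD⟩, ⟨gA, gB, gC, gD⟩, h'⟩ :=
    hP.degree_four_segments h h2
  have e3 := hr.perm.count_eq 3
  have h1 := hP.degree_cut_four hA hB hC hD h'
  have hlA := List.length_pos_iff.2 hA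
  have hlB := List.length_pos_iff.2 hB
  have hlC := List.length_pos_iff.2 hC
  have hlD := List.length_pos_iff.2 hD
  have g := hP.degree_two_le h1 (by simp; omega)
  have c1 := count_trim gA fun a ha => g a (by simp [ha])
  have c2 := count_trim gB fun a ha => g a (by simp [ha])
  have c3 := count_trim gC fun a ha => g a (by simp [ha])
  have c4 := count_trim gD fun a ha => g a (by simp [ha])
  have hcount := hP.two_le_count_ears h1 (by simp; omega)
  simp only [h3, List.count_cons, List.count_append, beq_iff_eq] at e3 hcount
  norm_num at e3
  -- two consecutive segments `[4]` would reduce to adjacent ears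
  have key : ∀ X Y Z W : List ℕ, X = [4] → Y = [4] → 2 ≤ Z.length + W.length →
      ¬ DegreeWord P (trim X ++ (trim Y ++ (trim Z ++ trim W))) [] := by
    rintro X Y Z W rfl rfl hl h
    exact hP.degree_ears_not_adjacent (r := trim Z ++ trim W) (by simpa using hl)
      (by simpa using h)
  have h1a := hP.degree_isRotated h1
    (List.isRotated_append (l := trim A) (l' := trim B ++ (trim C ++ trim D)))
  have h1b := hP.degree_isRotated h1a (ds' := trim C ++ (trim D ++ (trim A ++ trim B)))
    (by simpa using List.isRotated_append (l := trim B) (l' := trim C ++ (trim D ++ trim A)))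
  have h1c := hP.degree_isRotated h1b (ds' := trim D ++ (trim A ++ (trim B ++ trim C)))
    (by simpa using List.isRotated_append (l := trim C) (l' := trim D ++ (trim A ++ trim B)))
  have n1 : ¬ (A = [4] ∧ B = [4]) := fun h => key A B C D h.1 h.2 (by omega) h1
  have n2 : ¬ (B = [4] ∧ C = [4]) := fun h =>
    key B C D A h.1 h.2 (by omega) (by simpa using h1a)
  have n3 : ¬ (C = [4] ∧ D = [4]) := fun h => key C D A B h.1 h.2 (by omega) h1b
  have n4 : ¬ (D = [4] ∧ A = [4]) := fun h => key D A B C h.1 h.2 (by omega) h1c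
  by_cases hAC : A = [4] ∧ C = [4]
  · exact ⟨A, B, C, D, hr, ⟨hA, hB, hC, hD⟩, ⟨gA, gB, gC, gD⟩, h', hAC.1, hAC.2⟩
  by_cases hBD : B = [4] ∧ D = [4]
  · have hr' : 2 :: (A ++ 2 :: (B ++ 2 :: (C ++ 2 :: D))) ~r
        2 :: (B ++ 2 :: (C ++ 2 :: (D ++ 2 :: A))) := by
      simpa using List.isRotated_append (l := 2 :: A) (l' := 2 :: (B ++ 2 :: (C ++ 2 :: D)))
    exact ⟨B, C, D, A, hr.trans hr', ⟨hB, hC, hD, hA⟩, ⟨gB, gC, gD, gA⟩,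
      hP.degree_isRotated h' hr', hBD.1, hBD.2⟩
  -- otherwise, at most one segment reduces to an ear, but a disc has two
  exfalso
  have z : ∀ X : List ℕ, X.count 3 = 0 →
      ((trim X).count 2 ≤ if X = [4] then 1 else X.count 3) →
      (trim X).count 2 ≤ 1 ∧ (X ≠ [4] → (trim X).count 2 = 0) := by
    intro X h0 hX
    split_ifs at hX with hX4
    · exact ⟨hX, fun h => absurd hX4 h⟩
    · omega
  obtain ⟨z1, y1⟩ := z A (by omega) c1
  obtain ⟨z2, y2⟩ := z B (by omega) c2
  obtain ⟨z3, y3⟩ := z C (by omega) c3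
  obtain ⟨z4, y4⟩ := z D (by omega) c4
  by_cases hA4 : A = [4]
  · have := y2 fun h => n1 ⟨hA4, h⟩
    have := y3 fun h => hAC ⟨hA4, h⟩
    have := y4 fun h => n4 ⟨h, hA4⟩
    omega
  have := y1 hA4
  by_cases hB4 : B = [4]
  · have := y3 fun h => n2 ⟨hB4, h⟩
    have := y4 fun h => hBD ⟨hB4, h⟩
    omega
  have := y2 hB4
  by_cases hC4 : C = [4]
  · have := y4 fun h => n3 ⟨hC4, h⟩
    omega
  have := y3 hC4
  omega

/-- When the four ears of a disc without interior vertices are cut off, the new disc has two ears,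
and no vertex with more than four neighbours. -/
theorem degree_four_ears (hP : TriSystem P) (h : DegreeWord P ds []) (h2 : ds.count 2 = 4)
    (h3 : ds.count 3 = 0) :
    ∃ B D, ds ~r 2 :: 4 :: 2 :: (B ++ 2 :: 4 :: 2 :: D) ∧ B ≠ [] ∧ D ≠ [] ∧
      (∀ a ∈ trim B ++ trim D, 3 ≤ a ∧ a ≤ 4) := by
  obtain ⟨A, B, C, D, hr, ⟨hA, hB, hC, hD⟩, ⟨gA, gB, gC, gD⟩, h', rfl, rfl⟩ :=
    hP.degree_four_ears_segments h h2 h3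
  refine ⟨B, D, by simpa using hr, hB, hD, ?_⟩
  have e3 := hr.perm.count_eq 3
  simp [h3] at e3
  have h4 : DegreeWord P (2 :: (trim B ++ 2 :: trim D)) [] := by
    simpa using hP.degree_cut_four hA hB hC hD h'
  have hlB := List.length_pos_iff.2 hB
  have hlD := List.length_pos_iff.2 hD
  have gd := hP.degree_two_le h4 (by simp; omega)
  have c2 := count_trim gB fun a ha => gd a (by simp [ha])
  have c4 := count_trim gD fun a ha => gd a (by simp [ha])
  have nB : B ≠ [4] := by
    rintro rfl
    exact hP.degree_ears_not_adjacent (r := 2 :: trim D) (by simp; omega) (by simpa using h4)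
  have nD : D ≠ [4] := by
    rintro rfl
    exact hP.degree_ears_not_adjacent (r := 2 :: trim B) (by simp; omega)
      (hP.degree_append_comm (l' := [2, 2]) (l := 2 :: trim B) (by simpa using h4))
  rw [if_neg nB] at c2
  rw [if_neg nD] at c4
  have h6 := hP.degree_sum h4
  rw [sum_four_sub gd] at h6
  simp only [List.map_nil, List.sum_nil, List.count_cons, List.count_append,
    beq_iff_eq, excess_append, excess_cons] at h6
  norm_num at h6
  -- by curvature, the number of threes exceeds the excess by two
  suffices hc : (trim B).count 3 + (trim D).count 3 ≤ 2 by
    have k1 := le_four_of_excess (l := trim B) (by omega)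
    have k2 := le_four_of_excess (l := trim D) (by omega)
    have key : ∀ X : List ℕ, X.count 2 = 0 → (∀ a ∈ X, 2 ≤ a) → ∀ a ∈ X, 3 ≤ a := by
      intro X hX hX2 a ha
      have := hX2 a ha
      by_contra hlt
      obtain rfl : a = 2 := by omega
      exact (List.count_eq_zero.1 hX) ha
    have k3 := key (trim B) (by omega) fun a ha => gd a (by simp [ha])
    have k4 := key (trim D) (by omega) fun a ha => gd a (by simp [ha])
    intro a ha
    rcases List.mem_append.1 ha with ha | ha
    · exact ⟨k3 a ha, k1 a ha⟩
    · exact ⟨k4 a ha, k2 a ha⟩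
  have four : ∀ X : List ℕ, X.count 3 = 0 → (∀ a ∈ X, 3 ≤ a) → ∀ a ∈ X, 4 ≤ a := by
    intro X hX hX2 a ha
    have := hX2 a ha
    by_contra hlt
    obtain rfl : a = 3 := by omega
    exact (List.count_eq_zero.1 hX) ha
  have fB := four B (by omega) gB
  have fD := four D (by omega) gD
  have none : ∀ X : List ℕ, (∀ a ∈ X, 4 ≤ a) → X.count 2 = 0 ∧ X.count 3 = 0 := by
    intro X hX
    constructor <;> rw [List.count_eq_zero] <;> intro h <;> have := hX _ h <;> omega
  clear c2 c4 h6 e3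
  -- entries three occur only at the ends of a segment, hence next to an ear, and exactly one
  -- neighbour of each of the two ears has three neighbours
  rcases eq_singleton_or hB with ⟨b, rfl⟩ | ⟨b, m, b', rfl⟩ <;>
    rcases eq_singleton_or hD with ⟨d, rfl⟩ | ⟨d, n, d', rfl⟩
  · simp only [trim_singleton, List.count_singleton]
    split_ifs <;> omega
  · have f1 := fD d (by simp)
    have f2 := fD d' (by simp)
    obtain ⟨n1, n2⟩ := none n fun a ha => fD a (by simp [ha])
    simp only [trim_singleton, trim_cons_snoc, List.count_cons, List.count_append, List.count_nil,
      beq_iff_eq, n2]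
    have h5 := hP.degree_two_ears (y := b - 2) (x := d' - 1) (mid := 2 :: (d - 1) :: n)
      (by simp) (by simp only [List.count_cons, n1, beq_iff_eq]; split_ifs <;> omega)
      (by simpa using h4)
    split_ifs <;> omega
  · have f1 := fB b (by simp)
    have f2 := fB b' (by simp)
    obtain ⟨n1, n2⟩ := none m fun a ha => fB a (by simp [ha])
    simp only [trim_singleton, trim_cons_snoc, List.count_cons, List.count_append, List.count_nil,
      beq_iff_eq, n2]
    have h5 := hP.degree_two_ears (y := b - 1) (x := d - 2) (mid := m ++ [b' - 1, 2])
      (by simp)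
      (by
        simp only [List.count_cons, List.count_append, List.count_nil, n1, beq_iff_eq]
        split_ifs <;> omega) (by simpa using h4)
    split_ifs <;> omega
  · have f1 := fD d (by simp)
    have f2 := fD d' (by simp)
    have f3 := fB b (by simp)
    have f4 := fB b' (by simp)
    obtain ⟨n1, n2⟩ := none n fun a ha => fD a (by simp [ha])
    obtain ⟨n3, n4⟩ := none m fun a ha => fB a (by simp [ha])
    simp only [trim_cons_snoc, List.count_cons, List.count_append, List.count_nil,
      beq_iff_eq, n2, n4]
    have h5 := hP.degree_two_ears (y := b - 1) (x := d' - 1)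
      (mid := m ++ (b' - 1) :: 2 :: (d - 1) :: n)
      (by simp; omega)
      (by
        simp only [List.count_cons, List.count_append, n1, n3, beq_iff_eq]
        split_ifs <;> omega) (by simpa using h4)
    have h7 := hP.degree_two_ears (y := d - 1) (x := b' - 1)
      (mid := n ++ (d' - 1) :: 2 :: (b - 1) :: m) (by simp; omega)
      (by
        simp only [List.count_cons, List.count_append, n1, n3, beq_iff_eq]
        split_ifs <;> omega)
      (by
        have := hP.degree_append_comm (l := 2 :: (b - 1) :: (m ++ [b' - 1]))
          (l' := 2 :: (d - 1) :: (n ++ [d' - 1])) (hs := []) (by simpa using h4)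
        simpa using this)
    split_ifs <;> omega

/-- With two ears and no interior vertices, one may assume, up to reflection, that the neighbour
preceding an ear has three neighbours. -/
theorem degree_ears_two (hP : TriSystem P) (h : DegreeWord P ds []) (h2 : ds.count 2 = 2)
    (hn : 4 ≤ ds.length) :
    ∃ y mid x, ds ~r 2 :: y :: (mid ++ [x]) ∧ mid.count 2 = 1 ∧ (x = 3 ∨ y = 3) := by
  obtain ⟨y, mid, x, hr⟩ := exists_isRotated_cons (w := ds) (by omega)
    (List.count_pos_iff.1 (by omega : 0 < ds.count 2))
  have h' := hP.degree_isRotated h hr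
  have hm : mid ≠ [] := by
    rintro rfl
    have := hr.perm.length_eq
    simp at this
    omega
  obtain ⟨hy, hx⟩ := hP.degree_neighbors_of_ear hm h'
  have hc := hr.perm.count_eq 2
  simp only [h2, List.count_cons, List.count_append, List.count_nil, beq_iff_eq] at hc
  have hm1 : mid.count 2 = 1 := by
    split_ifs at hc <;> omega
  refine ⟨y, mid, x, hr, hm1, ?_⟩
  by_cases hl : 2 ≤ mid.length
  · have := hP.degree_two_ears hl hm1 h'
    omega
  · have := List.length_pos_iff.2 hm
    obtain ⟨m, rfl⟩ := List.length_eq_one_iff.1 (by omega : mid.length = 1)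
    have hs := hP.degree_sum h'
    simp [List.count_singleton] at hm1 hs
    omega

end TriSystem

end DegreeClassification

section DegreeClassification

variable {α : Type*}

namespace TriSystem

variable {P : List (α × List α) → List (α × List α) → Prop} {ds hs : List ℕ}

/-- A segment between two ears, of a disc with interior vertices, does not reduce to an ear. -/
theorem degree_segment_ne_four (hP : TriSystem P) (hH : hs ≠ []) {A R : List ℕ}
    (h3 : R.count 3 = 0 ∨ excess R = 0) (hex : excess R ≤ 1) (hn : 3 ≤ R.length)
    (h : DegreeWord P (2 :: (A ++ 2 :: R)) hs) : A ≠ [4] := by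
  rintro rfl
  exact hP.degree_not_two_four_two hH h3 hex hn (by simpa using h)

theorem two_notMem_trim {X : List ℕ} (hX : X ≠ [4]) (h3 : ∀ a ∈ X, 3 ≤ a)
    (ha : X.head? ≠ some 3) (hb : X.getLast? ≠ some 3) : 2 ∉ trim X := by
  rcases eq_or_ne X [] with rfl | h
  · simp [trim, decLast, decHead]
  rcases eq_singleton_or h with ⟨a, rfl⟩ | ⟨a, m, b, rfl⟩
  · simp at hX ha h3 ⊢
    omega
  · have h1 := h3 a (by simp)
    have h2 := h3 b (by simp)
    simp [List.getLast?_cons] at ha hb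
    simp only [trim_cons_snoc, List.mem_cons, List.mem_append, List.not_mem_nil, or_false, not_or]
    refine ⟨by omega, ?_, by omega⟩
    intro hm
    have := h3 2 (by simp [hm])
    omega

/-- The neighbours of an ear have four neighbours, if there are interior vertices and no boundary
vertex has more than four neighbours. -/
theorem degree_ends_of_segment (hP : TriSystem P) (hH : hs ≠ []) {A R : List ℕ} (hA : A ≠ [])
    (hex : excess A = 0) (hexR : excess R = 0)
    (h : DegreeWord P (2 :: (A ++ 2 :: R)) hs) : A.head? = some 4 ∧ A.getLast? = some 4 := by
  have key : ∀ (A R : List ℕ), A ≠ [] → R ≠ [] → excess A = 0 → excess R = 0 →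
      DegreeWord P (2 :: (A ++ R)) hs → A.head? = some 4 ∧ R.getLast? = some 4 := by
    intro A R hA hR hexA hexR h
    obtain ⟨a, A, rfl⟩ := List.exists_cons_of_ne_nil hA
    obtain ⟨R, r, rfl⟩ := exists_snoc hR
    have := hP.degree_neighbors_eq_four hH (y := a) (mid := A ++ R) (x := r) (by simpa using h)
      (le_four_of_excess (by simp at hexA hexR ⊢; omega))
    simpa using this
  refine ⟨(key A (2 :: R) hA (by simp) hex (by simp [hexR]) h).1, ?_⟩
  have h' := hP.degree_append_comm (l := 2 :: A) (l' := 2 :: R) (by simpa using h)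
  refine (key (R ++ [2]) A (by simp) hA (by simp [hexR]) hex (by simpa using h')).2

/-- One interior vertex with seven neighbours, and three ears: cutting off the ears leaves a wheel,
all of whose rim vertices have three neighbours, and this determines the degrees. -/
theorem degree_one_hub_three_ears (hP : TriSystem P) (h : DegreeWord P ds [7])
    (h2 : ds.count 2 = 3) (h3 : ds.count 3 = 1) (hex : excess ds = 0) :
    ds ~r [3, 4, 2, 4, 4, 2, 4, 4, 2, 4] := by
  have hn : 4 ≤ ds.length := by
    have := count_two_add_count_three_le ds
    omega
  obtain ⟨A, B, C, hr, ⟨hA, hB, hC⟩, ⟨gA, gB, gC⟩, h'⟩ := hP.degree_three_segments h hn h2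
  have hlA := List.length_pos_iff.2 hA
  have hlB := List.length_pos_iff.2 hB
  have hlC := List.length_pos_iff.2 hC
  have e3 := hr.perm.count_eq 3
  have eex := excess_eq_of_isRotated hr
  simp [h3, hex] at e3 eex
  have hB' : DegreeWord P (2 :: (B ++ 2 :: (C ++ 2 :: A))) [7] := hP.degree_isRotated h' (by
    simpa using List.isRotated_append (l := 2 :: A) (l' := 2 :: (B ++ 2 :: C)))
  have hC' : DegreeWord P (2 :: (C ++ 2 :: (A ++ 2 :: B))) [7] := hP.degree_isRotated h' (by
    simpa using List.isRotated_append (l := 2 :: (A ++ 2 :: B)) (l' := 2 :: C))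
  have key : ∀ X Y Z : List ℕ, X ≠ [] → (∀ a ∈ X, 3 ≤ a) → 1 ≤ Y.length → 1 ≤ Z.length →
      excess X = 0 → excess Y = 0 → excess Z = 0 →
      DegreeWord P (2 :: (X ++ 2 :: (Y ++ 2 :: Z))) [7] → 2 ∉ trim X := by
    intro X Y Z hX hX3 hY hZ x0 y0 z0 h
    obtain ⟨k1, k2⟩ := hP.degree_ends_of_segment (by simp) hX x0 (by simp [y0, z0]) h
    refine two_notMem_trim ?_ hX3 (by simp [k1]) (by simp [k2])
    exact hP.degree_segment_ne_four (by simp) (Or.inr (by simp [y0, z0])) (by simp [y0, z0])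
      (by simp; omega) h
  have tA := key A B C hA gA hlB hlC (by omega) (by omega) (by omega) h'
  have tB := key B C A hB gB hlC hlA (by omega) (by omega) (by omega) hB'
  have tC := key C A B hC gC hlA hlB (by omega) (by omega) (by omega) hC'
  have hw := hP.degree_wheel (hP.degree_cut_three hA hB hC h') (by simp; omega)
    (by simp [tA, tB, tC])
  have hw3 : ∀ a ∈ trim A ++ (trim B ++ trim C), a = 3 := by
    rw [hw]; exact fun a ha => List.eq_of_mem_replicate ha
  have hl := congrArg List.length hw
  rcases eq_four_cons_snoc (fun a ha => hw3 a (by simp [ha])) gA hA with rfl | ⟨i, rfl⟩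
  · simp at eex; omega
  rcases eq_four_cons_snoc (fun a ha => hw3 a (by simp [ha])) gB hB with rfl | ⟨j, rfl⟩
  · simp at eex; omega
  rcases eq_four_cons_snoc (fun a ha => hw3 a (by simp [ha])) gC hC with rfl | ⟨k, rfl⟩
  · simp at eex
  simp at e3 hl
  have hijk : (i = 1 ∧ j = 0 ∧ k = 0) ∨ (i = 0 ∧ j = 1 ∧ k = 0) ∨ (i = 0 ∧ j = 0 ∧ k = 1) := by
    omega
  refine hr.trans ?_
  rcases hijk with ⟨rfl, rfl, rfl⟩ | ⟨rfl, rfl, rfl⟩ | ⟨rfl, rfl, rfl⟩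
  · exact ⟨2, rfl⟩
  · exact ⟨5, rfl⟩
  · exact ⟨8, rfl⟩

/-- One interior vertex, and four ears: cutting off the ears leaves a wheel, so that each segment
between two ears has the form `[5]` or `[4, 4]`. -/
theorem degree_one_hub_four_ears (hP : TriSystem P) {h₀ : ℕ} (h : DegreeWord P ds [h₀])
    (h2 : ds.count 2 = 4) (h3 : ds.count 3 = 0) (hex : excess ds ≤ 1) :
    ds ~r [4, 4, 2, 4, 4, 2, 4, 4, 2, 4, 4, 2] ∨ ds ~r [5, 2, 4, 4, 2, 4, 4, 2, 4, 4, 2] := by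
  obtain ⟨A, B, C, D, hr, ⟨hA, hB, hC, hD⟩, ⟨gA, gB, gC, gD⟩, h'⟩ := hP.degree_four_segments h h2
  have hlA := List.length_pos_iff.2 hA
  have hlB := List.length_pos_iff.2 hB
  have hlC := List.length_pos_iff.2 hC
  have hlD := List.length_pos_iff.2 hD
  have e3 := hr.perm.count_eq 3
  have eex := excess_eq_of_isRotated hr
  simp only [h3, List.count_cons, List.count_append, beq_iff_eq, excess_cons,
    excess_append] at e3 eex
  norm_num at e3 eex
  have hB' : DegreeWord P (2 :: (B ++ 2 :: (C ++ 2 :: (D ++ 2 :: A)))) [h₀] :=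
    hP.degree_isRotated h' (by
      simpa using List.isRotated_append (l := 2 :: A) (l' := 2 :: (B ++ 2 :: (C ++ 2 :: D))))
  have hC' : DegreeWord P (2 :: (C ++ 2 :: (D ++ 2 :: (A ++ 2 :: B)))) [h₀] :=
    hP.degree_isRotated h' (by
      simpa using List.isRotated_append (l := 2 :: (A ++ 2 :: B)) (l' := 2 :: (C ++ 2 :: D)))
  have hD' : DegreeWord P (2 :: (D ++ 2 :: (A ++ 2 :: (B ++ 2 :: C)))) [h₀] :=
    hP.degree_isRotated h' (by
      simpa using List.isRotated_append (l := 2 :: (A ++ 2 :: (B ++ 2 :: C))) (l' := 2 :: D))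
  have key : ∀ X Y Z W : List ℕ, (∀ a ∈ X, 3 ≤ a) → 1 ≤ Y.length →
      X.count 3 = 0 → Y.count 3 = 0 → Z.count 3 = 0 → W.count 3 = 0 →
      excess Y + excess Z + excess W ≤ 1 →
      DegreeWord P (2 :: (X ++ 2 :: (Y ++ 2 :: (Z ++ 2 :: W)))) [h₀] → 2 ∉ trim X := by
    intro X Y Z W hX3 hY x3 y3 z3 w3 hex h
    refine two_notMem_trim ?_ hX3 ?_ ?_
    · exact hP.degree_segment_ne_four (by simp) (Or.inl (by simp [y3, z3, w3]))
        (by simp; omega) (by simp; omega) h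
    · intro h0
      exact List.count_eq_zero.1 x3 (List.mem_of_mem_head? h0)
    · intro h0
      exact List.count_eq_zero.1 x3 (List.mem_of_getLast? h0)
  have tA := key A B C D gA hlB (by omega) (by omega) (by omega) (by omega) (by omega) h'
  have tB := key B C D A gB hlC (by omega) (by omega) (by omega) (by omega) (by omega) hB'
  have tC := key C D A B gC hlD (by omega) (by omega) (by omega) (by omega) (by omega) hC'
  have tD := key D A B C gD hlA (by omega) (by omega) (by omega) (by omega) (by omega) hD'
  have hw := hP.degree_wheel (hP.degree_cut_four hA hB hC hD h') (by simp; omega)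
    (by simp [tA, tB, tC, tD])
  have hw3 : ∀ a ∈ trim A ++ (trim B ++ (trim C ++ trim D)), a = 3 := by
    rw [hw]; exact fun a ha => List.eq_of_mem_replicate ha
  have seg : ∀ X : List ℕ, (∀ a ∈ trim X, a = 3) → (∀ a ∈ X, 3 ≤ a) → X ≠ [] → X.count 3 = 0 →
      (X = [5] ∧ excess X = 1) ∨ (X = [4, 4] ∧ excess X = 0) := by
    intro X x1 x2 x3 x4
    rcases eq_four_cons_snoc x1 x2 x3 with rfl | ⟨i, rfl⟩
    · exact Or.inl ⟨rfl, rfl⟩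
    · simp at x4
      subst x4
      exact Or.inr ⟨rfl, rfl⟩
  rcases seg A (fun a ha => hw3 a (by simp [ha])) gA hA (by omega) with ⟨rfl, xA⟩ | ⟨rfl, xA⟩ <;>
  rcases seg B (fun a ha => hw3 a (by simp [ha])) gB hB (by omega) with ⟨rfl, xB⟩ | ⟨rfl, xB⟩ <;>
  rcases seg C (fun a ha => hw3 a (by simp [ha])) gC hC (by omega) with ⟨rfl, xC⟩ | ⟨rfl, xC⟩ <;>
  rcases seg D (fun a ha => hw3 a (by simp [ha])) gD hD (by omega) with ⟨rfl, xD⟩ | ⟨rfl, xD⟩ <;>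
  first
    | (exfalso; omega)
    | exact Or.inl (hr.trans ⟨1, rfl⟩)
    | exact Or.inr (hr.trans ⟨1, rfl⟩)
    | exact Or.inr (hr.trans ⟨4, rfl⟩)
    | exact Or.inr (hr.trans ⟨7, rfl⟩)
    | exact Or.inr (hr.trans ⟨10, rfl⟩)

/-- Two interior vertices: cutting off the ears leaves two overlapping wheels, whose degrees
determine the lengths of the segments between the ears. -/
theorem degree_two_hubs (hP : TriSystem P) (h : DegreeWord P ds [7, 7])
    (h2 : ds.count 2 = 4) (h3 : ds.count 3 = 0) (hex : excess ds = 0) :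
    ds ~r [2, 4, 4, 4, 2, 4, 4, 2, 4, 4, 4, 2, 4, 4] := by
  obtain ⟨A, B, C, D, hr, ⟨hA, hB, hC, hD⟩, ⟨gA, gB, gC, gD⟩, h'⟩ := hP.degree_four_segments h h2
  have hlA := List.length_pos_iff.2 hA
  have hlB := List.length_pos_iff.2 hB
  have hlC := List.length_pos_iff.2 hC
  have hlD := List.length_pos_iff.2 hD
  have e3 := hr.perm.count_eq 3
  have eex := excess_eq_of_isRotated hr
  simp only [h3, hex, List.count_cons, List.count_append, beq_iff_eq, excess_cons,
    excess_append] at e3 eex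
  norm_num at e3 eex
  have hB' : DegreeWord P (2 :: (B ++ 2 :: (C ++ 2 :: (D ++ 2 :: A)))) [7, 7] :=
    hP.degree_isRotated h' (by
      simpa using List.isRotated_append (l := 2 :: A) (l' := 2 :: (B ++ 2 :: (C ++ 2 :: D))))
  have hC' : DegreeWord P (2 :: (C ++ 2 :: (D ++ 2 :: (A ++ 2 :: B)))) [7, 7] :=
    hP.degree_isRotated h' (by
      simpa using List.isRotated_append (l := 2 :: (A ++ 2 :: B)) (l' := 2 :: (C ++ 2 :: D)))
  have hD' : DegreeWord P (2 :: (D ++ 2 :: (A ++ 2 :: (B ++ 2 :: C)))) [7, 7] :=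
    hP.degree_isRotated h' (by
      simpa using List.isRotated_append (l := 2 :: (A ++ 2 :: (B ++ 2 :: C))) (l' := 2 :: D))
  have key : ∀ X Y Z W : List ℕ, X ≠ [] → (∀ a ∈ X, 3 ≤ a) → 1 ≤ Y.length → X.count 3 = 0 →
      excess X + excess Y + excess Z + excess W = 0 →
      DegreeWord P (2 :: (X ++ 2 :: (Y ++ 2 :: (Z ++ 2 :: W)))) [7, 7] →
      2 ∉ trim X ∧ ∃ j, X = 4 :: (List.replicate j 4 ++ [4]) := by
    intro X Y Z W hX hX3 hY x3 hex h
    have hX4 := hP.degree_segment_ne_four (by simp) (Or.inr (by simp; omega))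
        (by simp; omega) (by simp; omega) h
    have x4 : ∀ a ∈ X, a = 4 := by
      intro a ha
      have a1 := hX3 a ha
      have a2 := le_four_of_excess (l := X) (by omega) a ha
      have a3 : a ≠ 3 := by rintro rfl; exact List.count_eq_zero.1 x3 ha
      omega
    refine ⟨two_notMem_trim hX4 hX3 ?_ ?_, ?_⟩
    · intro h0
      exact List.count_eq_zero.1 x3 (List.mem_of_mem_head? h0)
    · intro h0
      exact List.count_eq_zero.1 x3 (List.mem_of_getLast? h0)
    · rcases eq_singleton_or hX with ⟨a, rfl⟩ | ⟨a, m, b, rfl⟩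
      · exact absurd (by rw [x4 a (by simp)]) hX4
      · refine ⟨m.length, ?_⟩
        rw [x4 a (by simp), x4 b (by simp)]
        congr 2
        exact List.eq_replicate_iff.2 ⟨rfl, fun c hc => x4 c (by simp [hc])⟩
  obtain ⟨tA, i, rfl⟩ := key A B C D hA gA hlB (by omega) (by omega) h'
  obtain ⟨tB, j, rfl⟩ := key B C D _ hB gB hlC (by omega) (by omega) hB'
  obtain ⟨tC, k, rfl⟩ := key C D _ _ hC gC hlD (by omega) (by omega) hC'
  obtain ⟨tD, l, rfl⟩ := key D _ _ _ hD gD hlA (by omega) (by omega) hD'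
  have hw := hP.degree_double_wheel (hP.degree_cut_four hA hB hC hD h') (by simp; omega)
    (by simp only [List.mem_append, tA, tB, tC, tD, or_self, not_false_iff]) (by
      intro a ha
      simp at ha
      rcases ha with rfl | ⟨-, rfl⟩ | rfl | ⟨-, rfl⟩ | rfl | ⟨-, rfl⟩ | rfl | ⟨-, rfl⟩ | rfl <;>
        norm_num)
  have hl := hw.perm.length_eq
  simp only [trim_cons_snoc] at hw
  simp at hl
  refine hr.trans ?_
  have hi : i ≤ 2 := by omega
  have hj : j ≤ 2 := by omega
  have hk : k ≤ 2 := by omega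
  have hll : l = 2 - i - j - k := by omega
  subst hll
  clear h' hB' hC' hD' key gA gB gC gD tA tB tC tD hA hB hC hD e3 eex hlA hlB hlC hlD hr
  interval_cases i <;> interval_cases j <;> interval_cases k <;>
    first
      | (exfalso; revert hl; norm_num; done)
      | (revert hw; decide)

end TriSystem

end DegreeClassification

/-! ### Shapes of boundary words -/

section Shapes

variable {α : Type*}

/-- The boundary word `w` with the interior vertices `H` is described by the gluing table `T`, in
which the vertices are numbered from `1`, and boundary vertices have additional neighbours `0`: two
if they have at most three neighbours, and one otherwise. -/
def Shape (w H : List (α × List α)) (T : List (List ℕ)) : Prop :=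
  ∃ v : ℕ → α, w.length + H.length = T.length ∧
    (∀ e ∈ w, ∃ k r row, T[k]? = some row ∧ e = (v (k + 1), r.map v) ∧
      (∀ j ∈ r, 1 ≤ j ∧ j ≤ T.length) ∧ row ~r (if r.length ≤ 3 then [0, 0] else [0]) ++ r) ∧
    ∀ e ∈ H, ∃ k r row, T[k]? = some row ∧ e = (v (k + 1), r.map v) ∧
      (∀ j ∈ r, 1 ≤ j ∧ j ≤ T.length) ∧ row ~r r

theorem Shape.of_isRotated {w w' H : List (α × List α)} {T : List (List ℕ)} (h : Shape w H T)
    (hr : w' ~r w) : Shape w' H T := by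
  obtain ⟨v, h1, h2, h3⟩ := h
  exact ⟨v, by rw [hr.perm.length_eq, h1], fun e he => h2 e (hr.mem_iff.1 he), h3⟩

theorem Shape.mirror {w H : List (α × List α)} {T : List (List ℕ)}
    (h : Shape (mirrorWord w) (H.map mirrorEntry) T) : Shape w H (T.map List.reverse) := by
  obtain ⟨v, h1, h2, h3⟩ := h
  refine ⟨v, by simpa using h1, ?_, ?_⟩
  · intro e he
    obtain ⟨k, r, row, i1, i2, i3, i4⟩ := h2 (mirrorEntry e) (by simpa using he)
    refine ⟨k, r.reverse, row.reverse, by simp [i1], ?_, by simpa using i3, ?_⟩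
    · rw [← mirrorEntry_mirrorEntry e, i2]
      simp [mirrorEntry]
    · refine i4.reverse.trans ?_
      rw [List.reverse_append, List.length_reverse]
      refine List.isRotated_append.trans ?_
      split_ifs <;> exact List.IsRotated.refl _
  · intro e he
    obtain ⟨k, r, row, i1, i2, i3, i4⟩ := h3 (mirrorEntry e) (List.mem_map_of_mem he)
    refine ⟨k, r.reverse, row.reverse, by simp [i1], ?_, by simpa using i3, i4.reverse⟩
    rw [← mirrorEntry_mirrorEntry e, i2]
    simp [mirrorEntry]

/-- Reading off a shape from explicit lists of labels. -/
theorem Shape.of_labels {w H : List (α × List α)} {T : List (List ℕ)} (v : ℕ → α)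
    (W K : List (ℕ × List ℕ)) (hw : w = W.map fun x => (v (x.1 + 1), x.2.map v))
    (hH : List.Forall₂ (fun e x => e.1 = v (x.1 + 1) ∧ e.2 ~r x.2.map v) H K)
    (hl : W.length + K.length = T.length)
    (hW : ∀ x ∈ W, x.1 < T.length ∧ (∀ j ∈ x.2, 1 ≤ j ∧ j ≤ T.length) ∧
      T.getD x.1 [] ~r (if x.2.length ≤ 3 then [0, 0] else [0]) ++ x.2)
    (hK : ∀ x ∈ K, x.1 < T.length ∧ (∀ j ∈ x.2, 1 ≤ j ∧ j ≤ T.length) ∧ T.getD x.1 [] ~r x.2) :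
    Shape w H T := by
  refine ⟨v, by rw [hw, hH.length_eq, List.length_map, hl], ?_, ?_⟩
  · subst hw
    intro e he
    obtain ⟨x, hx, rfl⟩ := List.mem_map.1 he
    obtain ⟨h1, h2, h3⟩ := hW x hx
    exact ⟨x.1, x.2, T.getD x.1 [], by simp [List.getD, h1], rfl, h2, h3⟩
  · intro e he
    obtain ⟨x, hx, h4, n, h5⟩ : ∃ x ∈ K, e.1 = v (x.1 + 1) ∧ x.2.map v ~r e.2 := by
      clear hl hK
      induction hH with
      | nil => simp at he
      | cons h _ ih =>
        rcases List.mem_cons.1 he with rfl | he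
        · exact ⟨_, by simp, h.1, h.2.symm⟩
        · obtain ⟨x, hx, h⟩ := ih he
          exact ⟨x, by simp [hx], h⟩
    obtain ⟨h1, h2, h3⟩ := hK x hx
    refine ⟨x.1, x.2.rotate n, T.getD x.1 [], by simp [List.getD, h1], ?_, by simpa using h2,
      h3.trans ⟨n, rfl⟩⟩
    rw [List.map_rotate, h5, ← h4]

namespace TriSystem

variable {P : List (α × List α) → List (α × List α) → Prop}

/-- Cutting off an ear `z` between `x` and `y`, with the lists of neighbours spelled out. -/
theorem peel (hP : TriSystem P) {z y x : α} {lz ly lx : List α} {mid H : List (α × List α)}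
    (h : P ((z, lz) :: (y, ly) :: (mid ++ [(x, lx)])) H) (hz : lz.length = 2) :
    ∃ ly' lx', lz = [x, y] ∧ ly = z :: ly' ∧ lx = lx' ++ [z] ∧
      P ((y, ly') :: (mid ++ [(x, lx')])) H := by
  obtain ⟨h1, h2, h3⟩ := hP.ear_data h hz
  exact ⟨_, _, h1, h2, h3, hP.ear h hz⟩

theorem isChain_adj (hP : TriSystem P) {e : α × List α} {w H : List (α × List α)}
    (h : P (e :: w) H) : List.IsChain (fun x y : α × List α =>
      x.2.getLast? = some y.1 ∧ y.2.head? = some x.1) (e :: w ++ [e]) := by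
  rw [List.isChain_iff_forall_rel_of_append_cons_cons]
  intro a b l₁ l₂ hl
  rcases List.eq_nil_or_concat l₂ with rfl | ⟨l₂, c, rfl⟩
  · have h1 : (e :: w) ++ [e] = (l₁ ++ [a]) ++ [b] := by simpa using hl
    obtain ⟨h2, h3⟩ := List.append_inj' h1 rfl
    obtain rfl : e = b := by simpa using h3
    rcases l₁ with _ | ⟨d, l₁⟩
    · simp at h2
      have := hP.two_le_length h
      simp [h2.2] at this
    · have h4 : e = d ∧ w = l₁ ++ [a] := by simpa using h2
      obtain ⟨rfl, rfl⟩ := h4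
      exact hP.adj (hP.append_comm (l := e :: l₁) (l' := [a]) (by simpa using h))
  · have h1 : (e :: w) ++ [e] = (l₁ ++ a :: b :: l₂) ++ [c] := by simpa using hl
    obtain ⟨h2, -⟩ := List.append_inj' h1 rfl
    rw [h2] at h
    exact hP.adj (hP.append_comm h)

/-- Cutting off the ears leaves a wheel, whose cyclic list of rim vertices determines the table. -/
theorem shape_E7a (hP : TriSystem P) {w H : List (α × List α)} (h : P w H)
    (hw : w.map (fun e => e.2.length) = [3, 4, 2, 4, 4, 2, 4, 4, 2, 4])
    (hH : H.map (fun e => e.2.length) = [7]) : Shape w H Extraordinary.E7a.table := by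
  simp only [List.map_eq_cons_iff, List.map_eq_nil_iff, Prod.exists] at hw hH
  obtain ⟨f2, l2, _, rfl, h2, f8, l8, _, rfl, h8, f11, l11, _, rfl, h11, f7, l7, _, rfl, h7,
    f6, l6, _, rfl, h6, f10, l10, _, rfl, h10, f5, l5, _, rfl, h5, f4, l4, _, rfl, h4,
    f9, l9, _, rfl, h9, f3, l3, _, rfl, h3, rfl⟩ := hw
  obtain ⟨f1, l1, _, rfl, -, rfl⟩ := hH
  obtain ⟨l7, l8, rfl, rfl, rfl, p₁⟩ := hP.peel (mid := [_, _, _, _, _, _, _])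
    (hP.append_comm (l := [_, _]) h) h11
  obtain ⟨l5, l6, rfl, rfl, rfl, p₂⟩ := hP.peel (mid := [_, _, _, _, _, _])
    (hP.append_comm (l := [_, _]) p₁) h10
  obtain ⟨l3, l4, rfl, rfl, rfl, p₃⟩ := hP.peel (mid := [_, _, _, _, _])
    (hP.append_comm (l := [_, _]) p₂) h9
  obtain ⟨i, hub⟩ := hP.wheel p₃ (by simp) (by simp at h3 h4 h5 h6 h7 h8 ⊢; omega)
  have hc := hP.isChain_adj p₃
  simp at i
  obtain ⟨⟨_, _, rfl⟩, ⟨_, _, rfl⟩, ⟨_, _, rfl⟩, ⟨_, _, rfl⟩, ⟨_, _, rfl⟩, ⟨_, _, rfl⟩, ⟨_, _,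
    rfl⟩⟩ := i
  simp at hc
  simp only [hc]
  refine Shape.of_labels
    (fun k => [f1, f1, f2, f3, f4, f5, f6, f7, f8, f9, f10, f11].getD k f1)
    [(1, [3, 1, 8]), (7, [2, 1, 7, 11]), (10, [8, 7]), (6, [11, 8, 1, 6]), (5, [7, 1, 5, 10]),
      (9, [6, 5]), (4, [10, 6, 1, 4]), (3, [5, 1, 3, 9]), (8, [4, 3]), (2, [9, 4, 1, 2])]
    [(0, [2, 3, 4, 5, 6, 7, 8])] rfl ?_ rfl (by decide) (by decide)
  refine List.Forall₂.cons ⟨rfl, hub.trans ?_⟩ List.Forall₂.nil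
  exact ⟨5, rfl⟩

theorem shape_E8 (hP : TriSystem P) {w H : List (α × List α)} (h : P w H)
    (hw : w.map (fun e => e.2.length) = [4, 4, 2, 4, 4, 2, 4, 4, 2, 4, 4, 2])
    (hH : H.map (fun e => e.2.length) = [8]) : Shape w H Extraordinary.E8.table := by
  simp only [List.map_eq_cons_iff, List.map_eq_nil_iff, Prod.exists] at hw hH
  obtain ⟨f2, l2, _, rfl, h2, f9, l9, _, rfl, h9, f13, l13, _, rfl, h13, f8, l8, _, rfl, h8, f7,
    l7, _, rfl, h7, f12, l12, _, rfl, h12, f6, l6, _, rfl, h6, f5, l5, _, rfl, h5, f11, l11, _,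
    rfl, h11, f4, l4, _, rfl, h4, f3, l3, _, rfl, h3, f10, l10, _, rfl, h10, rfl⟩ := hw
  obtain ⟨f1, l1, _, rfl, -, rfl⟩ := hH
  obtain ⟨l8, l9, rfl, rfl, rfl, p₁⟩ := hP.peel (mid := [_, _, _, _, _, _, _, _, _])
    (hP.append_comm (l := [_, _]) h) h13
  obtain ⟨l6, l7, rfl, rfl, rfl, p₂⟩ := hP.peel (mid := [_, _, _, _, _, _, _, _])
    (hP.append_comm (l := [_, _]) p₁) h12
  obtain ⟨l4, l5, rfl, rfl, rfl, p₃⟩ := hP.peel (mid := [_, _, _, _, _, _, _])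
    (hP.append_comm (l := [_, _]) p₂) h11
  obtain ⟨l2, l3, rfl, rfl, rfl, p₄⟩ := hP.peel (mid := [_, _, _, _, _, _])
    (hP.append_comm (l := [_, _]) p₃) h10
  obtain ⟨i, hub⟩ := hP.wheel p₄ (by simp) (by simp at h2 h3 h4 h5 h6 h7 h8 h9 ⊢; omega)
  have hc := hP.isChain_adj p₄
  simp at i
  obtain ⟨⟨_, _, rfl⟩, ⟨_, _, rfl⟩, ⟨_, _, rfl⟩, ⟨_, _, rfl⟩, ⟨_, _, rfl⟩, ⟨_, _, rfl⟩, ⟨_, _,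
    rfl⟩, ⟨_, _, rfl⟩⟩ := i
  simp at hc
  simp only [hc]
  refine Shape.of_labels
    (fun k => [f1, f1, f2, f3, f4, f5, f6, f7, f8, f9, f10, f11, f12, f13].getD k f1)
    [(1, [10, 3, 1, 9]), (8, [2, 1, 8, 13]), (12, [9, 8]), (7, [13, 9, 1, 7]), (6, [8, 1, 6, 12]),
    (11, [7, 6]), (5, [12, 7, 1, 5]), (4, [6, 1, 4, 11]), (10, [5, 4]), (3, [11, 5, 1, 3]), (2, [4,
    1, 2, 10]), (9, [3, 2])]
    [(0, [2, 3, 4, 5, 6, 7, 8, 9])] rfl ?_ rfl (by decide) (by decide)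
  refine List.Forall₂.cons ⟨rfl, hub.trans ?_⟩ List.Forall₂.nil
  exact ⟨7, rfl⟩

theorem shape_E7c (hP : TriSystem P) {w H : List (α × List α)} (h : P w H)
    (hw : w.map (fun e => e.2.length) = [5, 2, 4, 4, 2, 4, 4, 2, 4, 4, 2])
    (hH : H.map (fun e => e.2.length) = [7]) : Shape w H Extraordinary.E7c.table := by
  simp only [List.map_eq_cons_iff, List.map_eq_nil_iff, Prod.exists] at hw hH
  obtain ⟨f2, l2, _, rfl, h2, f12, l12, _, rfl, h12, f8, l8, _, rfl, h8, f7, l7, _, rfl, h7, f11,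
    l11, _, rfl, h11, f6, l6, _, rfl, h6, f5, l5, _, rfl, h5, f10, l10, _, rfl, h10, f4, l4, _,
    rfl, h4, f3, l3, _, rfl, h3, f9, l9, _, rfl, h9, rfl⟩ := hw
  obtain ⟨f1, l1, _, rfl, -, rfl⟩ := hH
  obtain ⟨l8, l2, rfl, rfl, rfl, p₁⟩ := hP.peel (mid := [_, _, _, _, _, _, _, _])
    (hP.append_comm (l := [_]) h) h12
  obtain ⟨l6, l7, rfl, rfl, rfl, p₂⟩ := hP.peel (mid := [_, _, _, _, _, _, _])
    (hP.append_comm (l := [_, _]) p₁) h11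
  obtain ⟨l4, l5, rfl, rfl, rfl, p₃⟩ := hP.peel (mid := [_, _, _, _, _, _])
    (hP.append_comm (l := [_, _]) p₂) h10
  obtain ⟨l2, l3, rfl, rfl, rfl, p₄⟩ := hP.peel (mid := [_, _, _, _, _])
    (hP.append_comm (l := [_, _]) p₃) h9
  obtain ⟨i, hub⟩ := hP.wheel p₄ (by simp) (by simp at h2 h3 h4 h5 h6 h7 h8 ⊢; omega)
  have hc := hP.isChain_adj p₄
  simp at i
  obtain ⟨⟨_, _, rfl⟩, ⟨_, _, rfl⟩, ⟨_, _, rfl⟩, ⟨_, _, rfl⟩, ⟨_, _, rfl⟩, ⟨_, _, rfl⟩, ⟨_, _,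
    rfl⟩⟩ := i
  simp at hc
  simp only [hc]
  refine Shape.of_labels
    (fun k => [f1, f1, f2, f3, f4, f5, f6, f7, f8, f9, f10, f11, f12].getD k f1)
    [(1, [9, 3, 1, 8, 12]), (11, [2, 8]), (7, [12, 2, 1, 7]), (6, [8, 1, 6, 11]), (10, [7, 6]), (5,
    [11, 7, 1, 5]), (4, [6, 1, 4, 10]), (9, [5, 4]), (3, [10, 5, 1, 3]), (2, [4, 1, 2, 9]), (8, [3,
    2])]
    [(0, [2, 3, 4, 5, 6, 7, 8])] rfl ?_ rfl (by decide) (by decide)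
  refine List.Forall₂.cons ⟨rfl, hub.trans ?_⟩ List.Forall₂.nil
  exact ⟨6, rfl⟩

end TriSystem

end Shapes

section Shapes

variable {α : Type*}

/-- The boundary word of two overlapping wheels with four ears attached, with explicit neighbours. -/
theorem Shape.double_wheel {f1 f2 f3 f4 f5 f6 f7 f8 f9 f10 f11 f12 f13 f14 f15 f16 : α}
    {l₁ l₂ : List α}
    (h₁ : l₁ ~r [f8, f2, f3, f4, f5, f6, f7]) (h₂ : l₂ ~r [f8, f12, f11, f10, f9, f3, f1]) :
    Shape [(f16, [f11, f12]), (f12, [f16, f11, f2, f8]), (f8, [f12, f2, f1, f7]), (f7, [f8, f1, f6,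
      f14]), (f14, [f7, f6]), (f6, [f14, f7, f1, f5]), (f5, [f6, f1, f4, f13]), (f13, [f5, f4]),
      (f4, [f13, f5, f1, f3]), (f3, [f4, f1, f2, f9]), (f9, [f3, f2, f10, f15]), (f15, [f9, f10]),
      (f10, [f15, f9, f2, f11]), (f11, [f10, f2, f12, f16])] [(f1, l₁), (f2, l₂)]
      Extraordinary.E7b.table := by
  refine Shape.of_labels
    (fun k => [f1, f1, f2, f3, f4, f5, f6, f7, f8, f9, f10, f11, f12, f13, f14, f15, f16].getD k f1)
    [(15, [11, 12]), (11, [16, 11, 2, 8]), (7, [12, 2, 1, 7]), (6, [8, 1, 6, 14]), (13, [7, 6]),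
      (5, [14, 7, 1, 5]), (4, [6, 1, 4, 13]), (12, [5, 4]), (3, [13, 5, 1, 3]), (2, [4, 1, 2, 9]),
      (8, [3, 2, 10, 15]), (14, [9, 10]), (9, [15, 9, 2, 11]), (10, [10, 2, 12, 16])]
    [(0, [2, 3, 4, 5, 6, 7, 8]), (1, [1, 8, 12, 11, 10, 9, 3])] rfl ?_ rfl (by decide) (by decide)
  exact List.Forall₂.cons ⟨rfl, h₁.trans ⟨1, rfl⟩⟩ (List.Forall₂.cons ⟨rfl, h₂.trans ⟨6, rfl⟩⟩
    List.Forall₂.nil)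

theorem Shape.hubs_comm {w : List (α × List α)} {e e' : α × List α} {T : List (List ℕ)}
    (h : Shape w [e, e'] T) : Shape w [e', e] T := by
  obtain ⟨v, h1, h2, h3⟩ := h
  exact ⟨v, h1, h2, fun x hx => h3 x (by simp at hx ⊢; tauto)⟩

theorem exists_eq_four {β : Type*} {l : List β} (h : l.length = 4) :
    ∃ a b c d, l = [a, b, c, d] := by
  rcases l with _ | ⟨a, _ | ⟨b, _ | ⟨c, _ | ⟨d, _ | _⟩⟩⟩⟩ <;> simp_all

namespace TriSystem

variable {P : List (α × List α) → List (α × List α) → Prop}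

theorem shape_E7b (hP : TriSystem P) {w H : List (α × List α)} (h : P w H)
    (hw : w.map (fun e => e.2.length) = [2, 4, 4, 4, 2, 4, 4, 2, 4, 4, 4, 2, 4, 4])
    (hH : H.map (fun e => e.2.length) = [7, 7]) : Shape w H Extraordinary.E7b.table := by
  simp only [List.map_eq_cons_iff, List.map_eq_nil_iff, Prod.exists] at hw hH
  obtain ⟨f16, l16, _, rfl, h16, f12, l12, _, rfl, h12, f8, l8, _, rfl, h8, f7, l7, _, rfl, h7,
      f14, l14, _, rfl, h14, f6, l6, _, rfl, h6, f5, l5, _, rfl, h5, f13, l13, _, rfl, h13, f4, l4,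
      _, rfl, h4, f3, l3, _, rfl, h3, f9, l9, _, rfl, h9, f15, l15, _, rfl, h15, f10, l10, _, rfl,
      h10, f11, l11, _, rfl, h11, rfl⟩ := hw
  obtain ⟨x₁, y₁, _, rfl, hx₁, x₂, y₂, _, rfl, hx₂, rfl⟩ := hH
  obtain ⟨l12, l11, rfl, rfl, rfl, p₁⟩ := hP.peel (mid := [_, _, _, _, _, _, _, _, _, _, _]) h h16
  obtain ⟨l6, l7, rfl, rfl, rfl, p₂⟩ := hP.peel (mid := [_, _, _, _, _, _, _, _, _, _])
    (hP.append_comm (l := [_, _, _]) p₁) h14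
  obtain ⟨l4, l5, rfl, rfl, rfl, p₃⟩ := hP.peel (mid := [_, _, _, _, _, _, _, _, _])
    (hP.append_comm (l := [_, _]) p₂) h13
  obtain ⟨l10, l9, rfl, rfl, rfl, p₄⟩ := hP.peel (mid := [_, _, _, _, _, _, _, _])
    (hP.append_comm (l := [_, _, _]) p₃) h15
  have p₅ := hP.append_comm (l := [_, _, _, _, _, _, _, _]) (l' := [_, _]) p₄
  simp only [List.length_cons, List.length_append, List.length_nil]
    at h3 h4 h5 h6 h7 h8 h9 h10 h11 h12
  obtain ⟨u, g, c, c', R, S, hug, ⟨n, hr⟩, hR, hS, ⟨_, _, hc⟩, ⟨_, _, hc'⟩, i1, i2, j1, j2⟩ :=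
    hP.double_wheel p₅ (by simp) (by simp; omega) (by simp; omega) hx₁ hx₂
  obtain ⟨a₁, a₂, a₃, a₄, rfl⟩ := exists_eq_four hR
  obtain ⟨b₁, b₂, b₃, b₄, rfl⟩ := exists_eq_four hS
  rw [← List.rotate_mod] at hr
  have hn := Nat.mod_lt n (by norm_num : 0 < 10)
  simp only [List.length_cons, List.length_append, List.length_nil, Nat.reduceAdd] at hr
  generalize n % 10 = m at hr hn
  have hch := hP.isChain_adj p₅
  clear hR hS h p₁ p₂ p₃ p₄ p₅ hx₁ hx₂
  simp only [List.forall_mem_cons] at i1 i2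
  obtain ⟨⟨_, _, e₁⟩, ⟨_, _, e₂⟩, ⟨_, _, e₃⟩, ⟨_, _, e₄⟩, -⟩ := i1
  obtain ⟨⟨_, _, e₅⟩, ⟨_, _, e₆⟩, ⟨_, _, e₇⟩, ⟨_, _, e₈⟩, -⟩ := i2
  -- the degrees leave two possibilities, which differ by a half turn
  have hm : m = 0 ∨ m = 5 := by
    have lc := congrArg List.length hc
    simp only [List.length_cons, List.length_nil] at lc
    clear hc hc' hch e₁ e₂ e₃ e₄ e₅ e₆ e₇ e₈ j1 j2
    interval_cases m <;>
      simp only [List.cons_append, List.nil_append, List.rotate_cons_succ, List.rotate_zero,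
        List.cons.injEq, and_true] at hr <;>
      obtain ⟨rfl, -⟩ := hr <;> simp only at lc <;> omega
  rcases hm with rfl | rfl <;>
    simp only [List.cons_append, List.nil_append, List.rotate_cons_succ, List.rotate_zero,
      List.cons.injEq, and_true] at hr <;>
    obtain ⟨rfl, rfl, rfl, rfl, rfl, rfl, rfl, rfl, rfl, rfl⟩ := hr <;>
    simp only at e₁ e₂ e₃ e₄ e₅ e₆ e₇ e₈ hc hc' <;>
    subst e₁ e₂ e₃ e₄ e₅ e₆ e₇ e₈ hc hc' <;>
    simp at hch <;>
    simp only [hch]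
  · have := Shape.double_wheel (f13 := f13) (f14 := f14) (f15 := f15) (f16 := f16) j1 j2
    rcases hug with ⟨rfl, rfl⟩ | ⟨rfl, rfl⟩
    · exact this
    · exact this.hubs_comm
  · have := Shape.double_wheel (f13 := f16) (f14 := f15) (f15 := f14) (f16 := f13) j1 j2
    rcases hug with ⟨rfl, rfl⟩ | ⟨rfl, rfl⟩
    · exact this.of_isRotated ⟨7, rfl⟩
    · exact this.hubs_comm.of_isRotated ⟨7, rfl⟩

end TriSystem

end Shapes

section Zippers

variable {α : Type*}

/-- The list `l` for odd `k`, and its reverse for even `k`. -/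
def orient {β : Type*} (k : ℕ) (l : List β) : List β := if k % 2 = 1 then l else l.reverse

theorem turn_eq_orient (k : ℕ) (l : List ℕ) : Zipper.turn k l = orient k l := rfl

theorem orient_map {β γ : Type*} (k : ℕ) (l : List β) (f : β → γ) :
    (orient k l).map f = orient k (l.map f) := by
  unfold orient; split_ifs <;> simp

theorem reverse_orient {β : Type*} (k : ℕ) (l : List β) :
    (orient k l).reverse = orient (k + 1) l := by
  unfold orient
  rcases Nat.mod_two_eq_zero_or_one k with h | h
  · rw [if_neg (by omega), if_pos (by omega), List.reverse_reverse]
  · rw [if_pos (by omega), if_neg (by omega)]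

theorem orient_add_two {β : Type*} (k : ℕ) (l : List β) : orient (k + 2) l = orient k l := by
  rw [← reverse_orient, ← reverse_orient, List.reverse_reverse]

theorem mem_orient {β : Type*} {k : ℕ} {l : List β} {a : β} : a ∈ orient k l ↔ a ∈ l := by
  unfold orient; split_ifs <;> simp

@[simp] theorem length_orient {β : Type*} (k : ℕ) (l : List β) :
    (orient k l).length = l.length := by
  unfold orient; split_ifs <;> simp

theorem orient_append_isRotated {β : Type*} (k : ℕ) (z l : List β) (hz : z.reverse = z) :
    orient k (z ++ l) ~r z ++ orient k l := by
  unfold orient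
  split_ifs
  · exact List.IsRotated.refl _
  · rw [List.reverse_append, hz]
    exact List.isRotated_append

theorem stripRow_mid {n k : ℕ} (hk : 3 ≤ k) (hn : k + 2 ≤ n) :
    stripRow n k = orient k [k - 2, k - 1, k + 1, k + 2] := by
  rw [stripRow, turn_eq_orient, List.filter_eq_self.2]
  simp
  omega

theorem stripRow_penultimate {n k : ℕ} (hk : 3 ≤ k) (hn : k + 1 = n) :
    stripRow n k = orient k [k - 2, k - 1, k + 1] := by
  have h1 : 1 ≤ k - 2 := by omega
  have h2 : 1 ≤ k - 1 := by omega
  have h3 : k - 2 ≤ n := by omega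
  have h4 : k - 1 ≤ n := by omega
  have h5 : k + 1 ≤ n := by omega
  have h6 : ¬ k + 2 ≤ n := by omega
  simp [stripRow, turn_eq_orient, h1, h2, h3, h4, h5, h6]

theorem stripRow_last {n : ℕ} (hn : 3 ≤ n) : stripRow n n = orient n [n - 2, n - 1] := by
  have h1 : 1 ≤ n - 2 := by omega
  have h2 : 1 ≤ n - 1 := by omega
  simp [stripRow, turn_eq_orient, h1, h2]

/-- The word `w` is that of the strip with vertices `v 1, …, v n`. -/
def IsStrip (v : ℕ → α) (n : ℕ) (w : List (α × List α)) : Prop :=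
  Set.InjOn v (Set.Icc 1 n) ∧ w.length = n ∧
    ∀ k, 1 ≤ k → k ≤ n → (v k, (stripRow n k).map v) ∈ w

/-- An injective numbering of the vertices of a word reaches all its entries. -/
theorem exists_of_injOn {v : ℕ → α} {n : ℕ} {w : List (α × List α)} {r : ℕ → List α}
    (hw : (w.map Prod.fst).Nodup) (hl : w.length = n) (hv : Set.InjOn v (Set.Icc 1 n))
    (h : ∀ k, 1 ≤ k → k ≤ n → (v k, r k) ∈ w) :
    ∀ e ∈ w, ∃ k, 1 ≤ k ∧ k ≤ n ∧ e = (v k, r k) := by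
  classical
  have h1 : (Finset.Icc 1 n).image v = (w.map Prod.fst).toFinset := by
    apply Finset.eq_of_subset_of_card_le
    · intro a ha
      obtain ⟨k, hk, rfl⟩ := Finset.mem_image.1 ha
      rw [Finset.mem_Icc] at hk
      exact List.mem_toFinset.2 (List.mem_map.2 ⟨_, h k hk.1 hk.2, rfl⟩)
    · rw [List.toFinset_card_of_nodup hw, Finset.card_image_of_injOn (by simpa using hv)]
      simp [hl]
  intro e he
  have h2 : e.1 ∈ (w.map Prod.fst).toFinset := List.mem_toFinset.2 (List.mem_map_of_mem he)
  rw [← h1] at h2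
  obtain ⟨k, hk, hk2⟩ := Finset.mem_image.1 h2
  rw [Finset.mem_Icc] at hk
  exact ⟨k, hk.1, hk.2, eq_of_fst_eq hw he (h k hk.1 hk.2) hk2.symm⟩

theorem Shape.of_injOn {v : ℕ → α} {w : List (α × List α)} {T : List (List ℕ)} (r : ℕ → List ℕ)
    (hw : (w.map Prod.fst).Nodup) (hl : w.length = T.length)
    (hv : Set.InjOn v (Set.Icc 1 T.length))
    (h : ∀ k, 1 ≤ k → k ≤ T.length → (v k, (r k).map v) ∈ w ∧
      (∀ j ∈ r k, 1 ≤ j ∧ j ≤ T.length) ∧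
      ∃ row, T[k - 1]? = some row ∧
        row ~r (if (r k).length ≤ 3 then [0, 0] else [0]) ++ r k) : Shape w [] T := by
  refine ⟨v, by simpa using hl, ?_, by simp⟩
  intro e he
  obtain ⟨k, hk, hk2, rfl⟩ := exists_of_injOn hw hl hv (fun k h1 h2 => (h k h1 h2).1) e he
  obtain ⟨-, h1, row, h2, h3⟩ := h k hk hk2
  refine ⟨k - 1, r k, row, h2, ?_, h1, h3⟩
  rw [Nat.sub_add_cancel hk]

namespace TriSystem

variable {P : List (α × List α) → List (α × List α) → Prop}

theorem exists_isStrip (hP : TriSystem P) {e : α × List α} {w : List (α × List α)}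
    (h : P (e :: w) []) {y : ℕ} {M : List ℕ}
    (hw : (e :: w).map (fun e => e.2.length) = 2 :: y :: (M ++ [3]))
    (h4 : ∀ a ∈ y :: (M ++ [3]), a ≤ 4) (hc : M.count 2 = 1) :
    ∃ v, IsStrip v (M.length + 3) (e :: w) ∧ v 1 = e.1 := by
  simp only [List.map_eq_cons_iff, List.map_eq_append_iff, List.map_eq_nil_iff] at hw
  obtain ⟨_, _, hew, he, y, _, rfl, rfl, mid, _, rfl, rfl, x, _, rfl, hx, rfl⟩ := hw
  obtain ⟨rfl, rfl⟩ := List.cons.inj hew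
  obtain ⟨v, v1, -, v2, v3⟩ := hP.exists_strip h he hx (by
    intro e he
    simp only [List.mem_cons, List.mem_append, List.not_mem_nil, or_false] at he
    rcases he with rfl | he | rfl
    · exact h4 _ (by simp)
    · exact h4 _ (List.mem_cons_of_mem _ (List.mem_append_left _ (List.mem_map_of_mem he)))
    · omega) hc
  rw [List.length_map]
  exact ⟨v, ⟨v2, by simp, v3⟩, v1⟩

/-- A vertex `s` with four neighbours between two ears `z`, `z'` becomes an ear when these are cut
off. -/
theorem crown (hP : TriSystem P) {z s z' : α × List α} {R H : List (α × List α)}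
    (h : P (z :: s :: z' :: R) H) (hz : z.2.length = 2) (hs : s.2.length = 4)
    (hz' : z'.2.length = 2) (hR : 2 ≤ R.length) :
    ∃ y x R', P ((s.1, [x, y]) :: R') H ∧ R'.map Prod.fst = R.map Prod.fst ∧
      R'.map (fun e => e.2.length) = trim (R.map fun e => e.2.length) ∧
      z = (z.1, [x, s.1]) ∧ s = (s.1, [z.1, x, y, z'.1]) ∧ z' = (z'.1, [s.1, y]) ∧
      (∀ e ∈ R', e.1 ≠ x → e.1 ≠ y → e ∈ R) ∧
      (∀ l, (y, l) ∈ R' → (y, z'.1 :: l) ∈ R) ∧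
      (∀ l, (x, l) ∈ R' → (x, l ++ [z.1]) ∈ R) := by
  obtain ⟨z, lz⟩ := z
  obtain ⟨s, ls⟩ := s
  obtain ⟨z', lz'⟩ := z'
  obtain ⟨⟨y, ly⟩, R, rfl⟩ := List.exists_cons_of_ne_nil (l := R) (by rintro rfl; simp at hR)
  obtain ⟨mid, ⟨x, lx⟩, rfl⟩ := exists_snoc (l := R) (by rintro rfl; simp at hR)
  obtain ⟨ls₁, lx, rfl, rfl, rfl, p₁⟩ := hP.peel (mid := (z', lz') :: (y, ly) :: mid) h hz
  obtain ⟨ly, ls₂, rfl, rfl, rfl, p₂⟩ := hP.peel (mid := mid ++ [(x, lx)])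
    (by simpa using hP.append_comm (l := [_]) p₁) hz'
  have hs2 : ls₂.length = 2 := by simpa using hs
  have p₃ : P ((s, ls₂) :: (y, ly) :: (mid ++ [(x, lx)])) H :=
    hP.append_comm (l := (y, ly) :: (mid ++ [(x, lx)])) (l' := [(s, ls₂)]) (by simpa using p₂)
  obtain ⟨e1, -, -⟩ := hP.ear_data p₃ hs2
  simp only at e1
  subst e1
  have hn := hP.nodup_word p₃
  refine ⟨y, x, (y, ly) :: (mid ++ [(x, lx)]), p₃, by simp, by simp, rfl, by simp, rfl, ?_, ?_, ?_⟩
  · intro e he h1 h2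
    simp only [List.mem_cons, List.mem_append, List.not_mem_nil, or_false] at he ⊢
    rcases he with rfl | he | rfl
    · exact absurd rfl h2
    · exact Or.inr (Or.inl he)
    · exact absurd rfl h1
  · intro l hl
    have := eq_of_fst_eq hn (List.mem_cons_of_mem _ hl) (e' := (y, ly)) (by simp) rfl
    simp only [Prod.mk.injEq, true_and] at this
    subst this
    simp
  · intro l hl
    have := eq_of_fst_eq hn (List.mem_cons_of_mem _ hl) (e' := (x, lx)) (by simp) rfl
    simp only [Prod.mk.injEq, true_and] at this
    subst this
    simp

/-- The situation of `TriSystem.crown`, described in a way that does not depend on the side of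
a strip on which the vertex lies. -/
theorem crown_orient (hP : TriSystem P) {z s z' : α × List α} {R R' H : List (α × List α)}
    {x y : α} (h : P (z :: s :: z' :: R) H) (hz : z = (z.1, [x, s.1]))
    (hs : s = (s.1, [z.1, x, y, z'.1])) (hz' : z' = (z'.1, [s.1, y]))
    (hR' : R'.map Prod.fst = R.map Prod.fst)
    (hR : ∀ e ∈ R', e.1 ≠ x → e.1 ≠ y → e ∈ R) (hy : ∀ l, (y, l) ∈ R' → (y, z'.1 :: l) ∈ R)
    (hx : ∀ l, (x, l) ∈ R' → (x, l ++ [z.1]) ∈ R) {i : ℕ} {p q : α}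
    (hpq : [x, y] = orient i [p, q]) :
    ∃ a b, (a ≠ b ∧ (∀ e ∈ (s.1, [x, y]) :: R', e.1 ≠ a ∧ e.1 ≠ b)) ∧
      (s.1, orient i [b, p, q, a]) ∈ z :: s :: z' :: R ∧
      (a, orient i [s.1, q]) ∈ z :: s :: z' :: R ∧ (b, orient i [p, s.1]) ∈ z :: s :: z' :: R ∧
      (∀ l, (q, orient (i + 1) l) ∈ R' → (q, orient (i + 1) (l ++ [a])) ∈ z :: s :: z' :: R) ∧
      (∀ l, (p, orient i l) ∈ R' → (p, orient i (l ++ [b])) ∈ z :: s :: z' :: R) ∧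
      ∀ e ∈ R', e.1 ≠ p → e.1 ≠ q → e ∈ z :: s :: z' :: R := by
  have hn := hP.nodup_word h
  simp only [List.map_cons, ← hR', List.nodup_cons, List.mem_cons, not_or] at hn
  obtain ⟨⟨n1, n2, n3⟩, ⟨n4, n5⟩, n6, n7⟩ := hn
  have n8 : ∀ e ∈ R', e.1 ≠ z.1 ∧ e.1 ≠ z'.1 := by
    intro e he
    exact ⟨fun h => n3 (h ▸ List.mem_map_of_mem he), fun h => n6 (h ▸ List.mem_map_of_mem he)⟩
  have hsub : ∀ e ∈ R, e ∈ z :: s :: z' :: R := fun e he => by simp [he]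
  unfold orient at *
  rcases Nat.mod_two_eq_zero_or_one i with hi | hi
  · have hi' : (i + 1) % 2 = 1 := by omega
    simp only [hi, hi', if_true, List.reverse_cons, List.reverse_nil, List.nil_append,
      List.cons_append, List.cons.injEq, and_true, zero_ne_one, if_false] at hpq ⊢
    obtain ⟨rfl, rfl⟩ := hpq
    refine ⟨z.1, z'.1, ⟨n2, ?_⟩, by rw [← hs]; simp, by rw [← hz]; simp, by rw [← hz']; simp,
      fun l hl => hsub _ (hx l hl), fun l hl => ?_, fun e he h1 h2 => hsub _ (hR e he h2 h1)⟩
    · intro e he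
      rcases List.mem_cons.1 he with rfl | he
      · exact ⟨fun h => n1 h.symm, n4⟩
      · exact n8 e he
    · rw [List.reverse_append]
      exact hsub _ (hy _ hl)
  · have hi' : (i + 1) % 2 ≠ 1 := by omega
    simp only [hi, hi', if_true, List.reverse_cons, List.reverse_nil, List.nil_append,
      List.cons_append, List.cons.injEq, and_true, if_false] at hpq ⊢
    obtain ⟨rfl, rfl⟩ := hpq
    refine ⟨z'.1, z.1, ⟨Ne.symm n2, ?_⟩, by rw [← hs]; simp, by rw [← hz']; simp,
      by rw [← hz]; simp,
      fun l hl => ?_, fun l hl => hsub _ (hx l hl), fun e he h1 h2 => hsub _ (hR e he h1 h2)⟩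
    · intro e he
      rcases List.mem_cons.1 he with rfl | he
      · exact ⟨n4, fun h => n1 h.symm⟩
      · exact (n8 e he).symm
    · rw [List.reverse_append]
      exact hsub _ (hy _ hl)

end TriSystem

end Zippers

section Zippers

variable {α : Type*}

open Zipper

theorem orient_pair {β : Type*} (k : ℕ) (x y : β) : orient k [x, y] = orient (k + 1) [y, x] := by
  rw [← reverse_orient]
  unfold orient; split_ifs <;> simp

@[simp] theorem length_teeth (k t : ℕ) : (teeth k t).length = t := by simp [teeth]

theorem getElem?_teeth_start {A B : List (List ℕ)} {k t i : ℕ} (h : i < A.length) :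
    (A ++ teeth k t ++ B)[i]? = A[i]? := by
  rw [List.append_assoc, List.getElem?_append_left h]

theorem getElem?_teeth_mid {A B : List (List ℕ)} {k t i : ℕ} (h : A.length ≤ i)
    (h' : i < A.length + t) :
    (A ++ teeth k t ++ B)[i]? = some (tooth (k + (i - A.length))) := by
  rw [List.append_assoc, List.getElem?_append_right h,
    List.getElem?_append_left (by simp; omega)]
  have : i - A.length < t := by omega
  simp [teeth, this]

theorem getElem?_teeth_end {A B : List (List ℕ)} {k t i j : ℕ} (h : i = A.length + t + j) :
    (A ++ teeth k t ++ B)[i]? = B[j]? := by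
  rw [List.getElem?_append_right (by simp; omega)]
  congr 1
  simp; omega

theorem isRotated_turn_zero (k : ℕ) (l : List ℕ) : turn k (0 :: l) ~r [0] ++ orient k l :=
  orient_append_isRotated k [0] l rfl

theorem isRotated_turn_zero_zero (k : ℕ) (l : List ℕ) :
    turn k (0 :: 0 :: l) ~r [0, 0] ++ orient k l :=
  orient_append_isRotated k [0, 0] l rfl

theorem Shape.oneOne {v : ℕ → α} {t : ℕ} {w : List (α × List α)} (hw : (w.map Prod.fst).Nodup)
    (h : IsStrip v (t + 4) w) : Shape w [] (table .oneOne t) := by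
  obtain ⟨h1, h2, h3⟩ := h
  have hl : (table .oneOne t).length = t + 4 := by simp [table]
  refine Shape.of_injOn (v := v) (stripRow (t + 4)) hw (by rw [hl, h2]) (by rwa [hl]) ?_
  rw [hl]
  intro k hk hk'
  refine ⟨h3 k hk hk', fun j hj => mem_stripRow hj, ?_⟩
  unfold table
  rcases (by omega : k = 1 ∨ k = 2 ∨ (3 ≤ k ∧ k ≤ t + 2) ∨ k = t + 3 ∨ k = t + 4) with
    rfl | rfl | ⟨h4, h5⟩ | rfl | rfl
  · rw [stripRow_one (by omega)]
    exact ⟨_, getElem?_teeth_start (i := 0) (by simp), isRotated_turn_zero_zero 1 _⟩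
  · rw [stripRow_two (by omega)]
    exact ⟨_, getElem?_teeth_start (i := 1) (by simp), isRotated_turn_zero_zero 2 _⟩
  · rw [stripRow_mid h4 (by omega)]
    refine ⟨_, getElem?_teeth_mid (by simp; omega) (by simp; omega), ?_⟩
    have e : 3 + (k - 1 - 2) = k := by omega
    simpa [tooth, e] using isRotated_turn_zero k _
  · rcases Nat.eq_zero_or_pos t with rfl | ht
    · refine ⟨_, getElem?_teeth_end (j := 0) (by simp), ?_⟩
      exact isRotated_turn_zero_zero 3 _
    · rw [stripRow_penultimate (by omega) rfl]
      exact ⟨_, getElem?_teeth_end (j := 0) (by simp; omega), by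
        simpa using isRotated_turn_zero_zero (t + 3) _⟩
  · rw [stripRow_last (by omega)]
    exact ⟨_, getElem?_teeth_end (j := 1) (by simp; omega), by
      simpa using isRotated_turn_zero_zero (t + 4) _⟩

/-- Extend a numbering `v 1, …, v n` by two further values. -/
def extend (v : ℕ → α) (n : ℕ) (a b : α) (k : ℕ) : α :=
  if k ≤ n then v k else if k = n + 1 then a else b

theorem extend_of_le {v : ℕ → α} {n : ℕ} {a b : α} {k : ℕ} (h : k ≤ n) :
    extend v n a b k = v k := if_pos h

@[simp] theorem extend_add_one {v : ℕ → α} {n : ℕ} {a b : α} : extend v n a b (n + 1) = a := by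
  simp [extend]

@[simp] theorem extend_add_two {v : ℕ → α} {n : ℕ} {a b : α} : extend v n a b (n + 2) = b := by
  simp [extend]

theorem injOn_extend {v : ℕ → α} {n : ℕ} {a b : α} (hv : Set.InjOn v (Set.Icc 1 n)) (hab : a ≠ b)
    (h : ∀ k, 1 ≤ k → k ≤ n → v k ≠ a ∧ v k ≠ b) :
    Set.InjOn (extend v n a b) (Set.Icc 1 (n + 2)) := by
  rintro i ⟨hi, hi'⟩ j ⟨hj, hj'⟩ hij
  unfold extend at hij
  split_ifs at hij with h1 h2 h3 h4 h5 h6 h7 h8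
  · exact hv ⟨hi, h1⟩ ⟨hj, h2⟩ hij
  · exact absurd hij (h i hi h1).1
  · exact absurd hij (h i hi h1).2
  · exact absurd hij.symm (h j hj h5).1
  · omega
  · exact absurd hij hab
  · exact absurd hij.symm (h j hj h7).2
  · exact absurd hij.symm hab
  · omega

namespace TriSystem

variable {P : List (α × List α) → List (α × List α) → Prop}

/-- The zipper with ends of different kinds: the vertex between two ears becomes the last vertex of
a strip. -/
theorem shape_oneTwo (hP : TriSystem P) {w : List (α × List α)} {B C : List ℕ}
    (h : P w []) (hd : w.map (fun e => e.2.length) = 2 :: 4 :: 2 :: (B ++ 2 :: C)) (hC : C ≠ [])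
    (hn : 3 ≤ B.length + C.length) (h4 : ∀ a ∈ decHead B ++ decLast C, 3 ≤ a ∧ a ≤ 4)
    (hB : ∃ M, decHead B = M ++ [3]) : ∃ t, Shape w [] (table .oneTwo t) := by
  obtain ⟨M, hM⟩ := hB
  have hB : B ≠ [] := by rintro rfl; simp [decHead] at hM
  simp only [List.map_eq_cons_iff] at hd
  obtain ⟨z, _, rfl, hz, s, _, rfl, hs, z', R, rfl, hz', hR⟩ := hd
  have hlen := congrArg List.length hR
  simp only [List.length_map, List.length_append, List.length_cons] at hlen
  obtain ⟨y, x, R', p, r1, r2, r3, r4, r5, r6, r7, r8⟩ := hP.crown h hz hs hz' (by omega)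
  have hB0 := List.length_pos_iff.2 hB
  have hC0 := List.length_pos_iff.2 hC
  rw [hR, trim, decLast_append _ (by simp), decLast_cons _ hC, decHead_append _ hB] at r2
  have r2' := r2
  simp only [List.map_eq_append_iff, List.map_eq_cons_iff] at r2'
  obtain ⟨B', _, rfl, hB', e, C', rfl, he, hC'⟩ := r2'
  obtain ⟨c, M', hc⟩ := List.exists_cons_of_ne_nil (decLast_ne_nil hC)
  have p' : P (e :: (C' ++ (s.1, [x, y]) :: B')) [] :=
    hP.append_comm (l := (s.1, [x, y]) :: B') (l' := e :: C') (by simpa using p)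
  have hM3 : ∀ a ∈ M, 3 ≤ a ∧ a ≤ 4 := fun a ha => h4 a (by simp [hM, ha])
  have hC3 : ∀ a ∈ c :: M', 3 ≤ a ∧ a ≤ 4 := fun a ha => h4 a (by simp [hc]; simp at ha; tauto)
  have hcount : ∀ X : List ℕ, (∀ a ∈ X, 3 ≤ a ∧ a ≤ 4) → X.count 2 = 0 := by
    intro X hX
    rw [List.count_eq_zero]
    intro h2
    have := hX 2 h2
    omega
  obtain ⟨v, ⟨v1, v2, v3⟩, v4⟩ := hP.exists_isStrip (y := c) (M := M' ++ 2 :: M) p' (by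
      simp [he, hC', hc, hB', hM]) (by
      intro a ha
      simp only [List.mem_cons, List.mem_append, List.not_mem_nil, or_false, or_assoc] at ha
      rcases ha with rfl | ha | rfl | ha | rfl
      · exact (hC3 _ (by simp)).2
      · exact (hC3 _ (by simp [ha])).2
      · omega
      · exact (hM3 _ ha).2
      · omega) (by
      have h5 := hcount M hM3
      have h6 := hcount M' fun a ha => hC3 a (by simp [ha])
      simp [h5, h6])
  have hnd := hP.nodup_word p'
  obtain ⟨t, ht⟩ : ∃ t, (M' ++ 2 :: M).length + 3 = t + 5 := by
    have e1 := congrArg List.length hc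
    have e2 := congrArg List.length hM
    simp at e1 e2
    exact ⟨(M' ++ 2 :: M).length - 2, by simp; omega⟩
  rw [ht] at v1 v2 v3
  -- the vertex between the two ears is the last one
  obtain ⟨k, hk1, hk2, hk⟩ := exists_of_injOn hnd v2 v1 v3 (s.1, [x, y]) (by simp)
  have hks : (stripRow (t + 5) k).length = 2 := by
    have := congrArg (fun e => e.2.length) hk
    simpa using this.symm
  obtain rfl : k = t + 5 := by
    by_contra hne
    rcases (by omega : k = 1 ∨ k = 2 ∨ (3 ≤ k ∧ k ≤ t + 3) ∨ k = t + 4) with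
      rfl | rfl | ⟨h5, h6⟩ | rfl
    · have h5 : s.1 = e.1 := by rw [← v4]; exact congrArg Prod.fst hk
      have h6 := hnd
      simp [h5] at h6
    · rw [stripRow_two (by omega)] at hks
      simp at hks
    · rw [stripRow_mid h5 (by omega)] at hks
      simp at hks
    · rw [stripRow_penultimate (by omega) rfl] at hks
      simp at hks
  rw [stripRow_last (by omega), orient_map] at hk
  simp only [Prod.mk.injEq] at hk
  obtain ⟨hsv, hxy⟩ := hk
  obtain ⟨a, b, ⟨q0, q0'⟩, q1, q2, q3, q4, q5, q6⟩ := hP.crown_orient h r3 r4 r5 r1 r6 r7 r8 hxy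
  refine ⟨t, ?_⟩
  have hl : (table .oneTwo t).length = t + 7 := by simp [table]
  have hmem : ∀ k, 1 ≤ k → k ≤ t + 4 → (v k, (stripRow (t + 5) k).map v) ∈ B' ++ e :: C' := by
    intro k h1 h2
    have h5 := v3 k h1 (by omega)
    have h6 : v k ≠ s.1 := by
      rw [hsv]
      intro h6
      have := v1 (by simp; omega) (by simp) h6
      omega
    simp only [List.mem_cons, List.mem_append, Prod.mk.injEq] at h5 ⊢
    tauto
  have hfresh : ∀ k, 1 ≤ k → k ≤ t + 5 → v k ≠ a ∧ v k ≠ b := by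
    intro k h1 h2
    refine q0' (v k, (stripRow (t + 5) k).map v) ?_
    have h5 := v3 k h1 h2
    simp only [List.mem_cons, List.mem_append] at h5 ⊢
    tauto
  refine Shape.of_injOn (v := extend v (t + 5) a b) (fun k => if k ≤ t + 2 then stripRow (t + 5) k
    else if k = t + 3 then orient (t + 3) [t + 1, t + 2, t + 4, t + 5, t + 7]
    else if k = t + 4 then orient (t + 4) [t + 2, t + 3, t + 5, t + 6]
    else if k = t + 5 then orient (t + 5) [t + 7, t + 3, t + 4, t + 6]
    else if k = t + 6 then orient (t + 6) [t + 4, t + 5] else orient (t + 3) [t + 3, t + 5])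
    (hP.nodup_word h) ?_ (by rw [hl]; exact injOn_extend v1 q0 hfresh) ?_
  · rw [hl]
    simp at v2 ⊢
    have := congrArg List.length hR
    have := congrArg List.length hB'
    have := congrArg List.length hC'
    simp at *
    omega
  rw [hl]
  intro k hk hk'
  have E1 : extend v (t + 5) a b (t + 6) = a := extend_add_one
  have E2 : extend v (t + 5) a b (t + 7) = b := extend_add_two
  have E3 : ∀ j, j ≤ 5 → extend v (t + 5) a b (t + j) = v (t + j) := fun j hj =>
    extend_of_le (by omega)
  have O5 : ∀ l : List α, orient (t + 5) l = orient (t + 3) l := orient_add_two (t + 3)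
  have O6 : ∀ l : List α, orient (t + 5 + 1) l = orient (t + 4) l := orient_add_two (t + 4)
  unfold table
  rcases (by omega : k ≤ t + 2 ∨ k = t + 3 ∨ k = t + 4 ∨ k = t + 5 ∨ k = t + 6 ∨ k = t + 7) with
    h5 | rfl | rfl | rfl | rfl | rfl
  · rw [if_pos h5]
    refine ⟨?_, fun j hj => ?_, ?_⟩
    · rw [extend_of_le (by omega), List.map_congr_left (g := v) fun j hj =>
        extend_of_le (mem_stripRow hj).2]
      have key : ∀ j, t + 3 ≤ j → j ≤ t + 5 → v k ≠ v j := by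
        intro j h6 h7 h8
        have := v1 (by simp; omega) (by simp; omega) h8
        omega
      exact q6 _ (hmem k hk (by omega)) (key _ (by omega) (by omega)) (key _ (by omega) (by omega))
    · have := mem_stripRow hj
      omega
    · rcases (by omega : k = 1 ∨ k = 2 ∨ 3 ≤ k) with rfl | rfl | h6
      · rw [stripRow_one (by omega)]
        exact ⟨_, getElem?_teeth_start (i := 0) (by simp), isRotated_turn_zero_zero 1 _⟩
      · rw [stripRow_two (by omega)]
        exact ⟨_, getElem?_teeth_start (i := 1) (by simp), isRotated_turn_zero_zero 2 _⟩
      · rw [stripRow_mid h6 (by omega)]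
        refine ⟨_, getElem?_teeth_mid (by simp; omega) (by simp; omega), ?_⟩
        have e : 3 + (k - 1 - 2) = k := by omega
        simpa [tooth, e] using isRotated_turn_zero k _
  · simp only [add_le_add_iff_left, Nat.reduceLeDiff, if_false, if_true]
    refine ⟨?_, fun j hj => ?_, _, getElem?_teeth_end (j := 0) (by simp; omega), ?_⟩
    · have h5 := hmem (t + 3) (by omega) (by omega)
      rw [stripRow_mid (by omega) (by omega), orient_map] at h5
      rw [orient_map, E3 _ (by omega)]
      rw [List.map_cons, List.map_cons, List.map_cons, List.map_cons, List.map_cons, List.map_nil,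
        E3 1 (by omega), E3 2 (by omega), E3 4 (by omega), E3 5 (by omega), E2]
      have h6 := q5 [v (t + 1), v (t + 2), v (t + 4), v (t + 5)] (by rw [O5]; exact h5)
      rwa [O5] at h6
    · rw [mem_orient] at hj
      simp at hj
      omega
    · simpa using isRotated_turn_zero (t + 3) _
  · simp only [add_le_add_iff_left, Nat.reduceLeDiff, if_false, if_true, Nat.reduceEqDiff,
      add_right_inj]
    refine ⟨?_, fun j hj => ?_, _, getElem?_teeth_end (j := 1) (by simp; omega), ?_⟩
    · have h5 := hmem (t + 4) (by omega) (by omega)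
      rw [stripRow_penultimate (by omega) rfl, orient_map] at h5
      rw [orient_map, E3 _ (by omega)]
      rw [List.map_cons, List.map_cons, List.map_cons, List.map_cons, List.map_nil,
        E3 2 (by omega), E3 3 (by omega), E3 5 (by omega), E1]
      have h6 := q4 [v (t + 2), v (t + 3), v (t + 5)] (by rw [O6]; exact h5)
      rwa [O6] at h6
    · rw [mem_orient] at hj
      simp at hj
      omega
    · simpa [tooth] using isRotated_turn_zero (t + 4) _
  · simp only [add_le_add_iff_left, Nat.reduceLeDiff, if_false, if_true, Nat.reduceEqDiff,
      add_right_inj]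
    refine ⟨?_, fun j hj => ?_, _, getElem?_teeth_end (j := 2) (by simp; omega), ?_⟩
    · rw [orient_map, E3 _ (by omega), ← hsv]
      rw [List.map_cons, List.map_cons, List.map_cons, List.map_cons, List.map_nil,
        E3 3 (by omega), E3 4 (by omega), E1, E2]
      exact q1
    · rw [mem_orient] at hj
      simp at hj
      omega
    · simpa using isRotated_turn_zero (t + 5) _
  · simp only [add_le_add_iff_left, Nat.reduceLeDiff, if_false, if_true, Nat.reduceEqDiff,
      add_right_inj]
    refine ⟨?_, fun j hj => ?_, _, getElem?_teeth_end (j := 3) (by simp; omega), ?_⟩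
    · rw [orient_map, E1]
      rw [List.map_cons, List.map_cons, List.map_nil, E3 4 (by omega), E3 5 (by omega), ← hsv,
        ← orient_pair]
      exact q2
    · rw [mem_orient] at hj
      simp at hj
      omega
    · simpa using isRotated_turn_zero_zero (t + 6) _
  · simp only [add_le_add_iff_left, Nat.reduceLeDiff, if_false, Nat.reduceEqDiff, add_right_inj]
    refine ⟨?_, fun j hj => ?_, _, getElem?_teeth_end (j := 4) (by simp; omega), ?_⟩
    · rw [orient_map, E2]
      rw [List.map_cons, List.map_cons, List.map_nil, E3 3 (by omega), E3 5 (by omega), ← hsv]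
      exact (O5 _) ▸ q3
    · rw [mem_orient] at hj
      simp at hj
      omega
    · simpa using isRotated_turn_zero_zero (t + 3) _

end TriSystem

end Zippers

section Zippers

variable {α : Type*}

open Zipper

/-- The word `w` is that of a strip `v 1, …, v n` with four further vertices: `a`, `b` are attached
to the edges from `v 1` to `v 2`, `v 3`, and `a'`, `b'` to those from `v n` to `v (n - 1)`,
`v (n - 2)`. -/
structure IsCrownedStrip (w : List (α × List α)) (n : ℕ) (v : ℕ → α) (a b a' b' : α) : Prop where
  injOn : Set.InjOn v (Set.Icc 1 n)
  ne : a ≠ b ∧ a' ≠ b' ∧ a ≠ a' ∧ a ≠ b' ∧ b ≠ a' ∧ b ≠ b'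
  fresh : ∀ k, 1 ≤ k → k ≤ n → v k ≠ a ∧ v k ≠ b ∧ v k ≠ a' ∧ v k ≠ b'
  mem_a : (a, [v 2, v 1]) ∈ w
  mem_b : (b, [v 1, v 3]) ∈ w
  mem_a' : (a', orient (n + 1) [v (n - 1), v n]) ∈ w
  mem_b' : (b', orient n [v (n - 2), v n]) ∈ w
  mem_one : (v 1, [a, v 2, v 3, b]) ∈ w
  mem_two : 5 ≤ n → (v 2, [v 4, v 3, v 1, a]) ∈ w
  mem_two_four : n = 4 → (v 2, [b', v 4, v 3, v 1, a]) ∈ w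
  mem_three : 6 ≤ n → (v 3, [b, v 1, v 2, v 4, v 5]) ∈ w
  mem_three_five : n = 5 → (v 3, [b, v 1, v 2, v 4, v 5, b']) ∈ w
  mem_three_four : n = 4 → (v 3, [b, v 1, v 2, v 4, a']) ∈ w
  mem_mid : ∀ k, 4 ≤ k → k + 3 ≤ n →
    (v k, orient k [v (k - 2), v (k - 1), v (k + 1), v (k + 2)]) ∈ w
  mem_sub_two : 6 ≤ n → (v (n - 2), orient n [v (n - 4), v (n - 3), v (n - 1), v n, b']) ∈ w
  mem_sub_one : 5 ≤ n → (v (n - 1), orient (n + 1) [v (n - 3), v (n - 2), v n, a']) ∈ w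
  mem_last : (v n, orient n [b', v (n - 2), v (n - 1), a']) ∈ w

namespace TriSystem

variable {P : List (α × List α) → List (α × List α) → Prop}

/-- A disc with four ears in two pairs is a crowned strip, if cutting off the ears leaves a disc in
which no vertex has more than four neighbours: that disc is a strip whose ends are the two vertices
between the ears of a pair. -/
theorem exists_isCrownedStrip (hP : TriSystem P) {w : List (α × List α)} {B D : List ℕ}
    (h : P w [])
    (hd : w.map (fun e => e.2.length) = 2 :: 4 :: 2 :: (B ++ 2 :: 4 :: 2 :: D))
    (hB : B ≠ []) (hD : D ≠ []) (h4 : ∀ a ∈ trim B ++ trim D, 3 ≤ a ∧ a ≤ 4)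
    (hB3 : ∃ M, trim B = M ++ [3]) :
    ∃ v a b a' b', IsCrownedStrip w (B.length + D.length + 2) v a b a' b' := by
  obtain ⟨M, hM⟩ := hB3
  have hB0 := List.length_pos_iff.2 hB
  have hD0 := List.length_pos_iff.2 hD
  simp only [List.map_eq_cons_iff] at hd
  obtain ⟨z, _, rfl, hz, s, _, rfl, hs, z', R, rfl, hz', hR⟩ := hd
  have hlen := congrArg List.length hR
  simp only [List.length_map, List.length_append, List.length_cons] at hlen
  obtain ⟨y, x, R', p, r1, r2, r3, r4, r5, r6, r7, r8⟩ := hP.crown h hz hs hz' (by omega)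
  rw [hR, trim, decLast_append _ (by simp), decLast_cons _ (by simp), decLast_cons _ (by simp),
    decLast_cons _ hD, decHead_append _ hB] at r2
  simp only [List.map_eq_append_iff, List.map_eq_cons_iff] at r2
  obtain ⟨B', _, rfl, hB', y₁, _, rfl, hy₁, u, _, rfl, hu, y₂, D', rfl, hy₂, hD'⟩ := r2
  have p' : P (y₁ :: u :: y₂ :: (D' ++ (s.1, [x, y]) :: B')) [] :=
    hP.append_comm (l := (s.1, [x, y]) :: B') (l' := y₁ :: u :: y₂ :: D') (by simpa using p)
  have hlB' := congrArg List.length hB'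
  have hlD' := congrArg List.length hD'
  simp only [List.length_map, length_decHead, length_decLast] at hlB' hlD'
  obtain ⟨y', x', R₂, p₂, t1, t2, t3, t4, t5, t6, t7, t8⟩ := hP.crown p' hy₁ hu hy₂ (by
    simp; omega)
  have ht2 : R₂.map (fun e => e.2.length) = trim D ++ 2 :: trim B := by
    rw [t2, List.map_append, List.map_cons, hB', hD', trim, decLast_append _ (by simp),
      decLast_cons _ (decHead_ne_nil hB), decHead_append _ (decLast_ne_nil hD), decLast_decHead,
      trim]
    rfl
  obtain ⟨c, M', hc⟩ := List.exists_cons_of_ne_nil (trim_ne_nil hD)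
  have hM3 : ∀ a ∈ M, 3 ≤ a ∧ a ≤ 4 := fun a ha => h4 a (by simp [hM, ha])
  have hC3 : ∀ a ∈ c :: M', 3 ≤ a ∧ a ≤ 4 := fun a ha => h4 a (by simp [hc]; simp at ha; tauto)
  have hcount : ∀ X : List ℕ, (∀ a ∈ X, 3 ≤ a ∧ a ≤ 4) → X.count 2 = 0 := by
    intro X hX
    rw [List.count_eq_zero]
    intro h2
    have := hX 2 h2
    omega
  obtain ⟨v, ⟨v1, v2, v3⟩, v4⟩ := hP.exists_isStrip (y := c) (M := M' ++ 2 :: M) p₂ (by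
      simp [ht2, hc, hM]) (by
      intro a ha
      simp only [List.mem_cons, List.mem_append, List.not_mem_nil, or_false, or_assoc] at ha
      rcases ha with rfl | ha | rfl | ha | rfl
      · exact (hC3 _ (by simp)).2
      · exact (hC3 _ (by simp [ha])).2
      · omega
      · exact (hM3 _ ha).2
      · omega) (by
      have h5 := hcount M hM3
      have h6 := hcount M' fun a ha => hC3 a (by simp [ha])
      simp [h5, h6])
  have hnd := hP.nodup_word p₂
  have hnd' := hP.nodup_word p'
  obtain ⟨n, hn, hn4⟩ : ∃ n, (M' ++ 2 :: M).length + 3 = n ∧ n = B.length + D.length + 2 := by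
    have e1 := congrArg List.length hc
    have e2 := congrArg List.length hM
    simp at e1 e2
    exact ⟨_, rfl, by simp; omega⟩
  rw [hn] at v1 v2 v3
  rw [← hn4]
  have hn5 : 4 ≤ n := by omega
  -- the other vertex between two ears is the last one of the strip
  have hsn : s.1 = v n := by
    simp only [List.map_eq_append_iff, List.map_eq_cons_iff] at ht2
    obtain ⟨D₂, _, rfl, hD₂, e, B₂, rfl, he, hB₂⟩ := ht2
    have hes : e.1 = s.1 := by
      rw [List.map_append, List.map_append] at t1
      have := (List.append_inj t1 (by
        have := congrArg List.length hD₂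
        simp at this ⊢
        omega)).2
      simp at this
      exact this.1
    obtain ⟨k, hk1, hk2, hk⟩ := exists_of_injOn hnd v2 v1 v3 e (by simp)
    have hks : (stripRow n k).length = 2 := by
      have := congrArg (fun e => e.2.length) hk
      simpa [he] using this.symm
    obtain rfl : k = n := by
      by_contra hne
      rcases (by omega : k = 1 ∨ k = 2 ∨ (3 ≤ k ∧ k + 2 ≤ n) ∨ (3 ≤ k ∧ k + 1 = n)) with
        rfl | rfl | ⟨h5, h6⟩ | ⟨h5, h6⟩
      · have h5 : e.1 = u.1 := by rw [← v4]; exact congrArg Prod.fst hk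
        simp [h5] at hnd
      · rw [stripRow_two (by omega)] at hks
        simp at hks
      · rw [stripRow_mid h5 (by omega)] at hks
        simp at hks
      · rw [stripRow_penultimate h5 h6] at hks
        simp at hks
    rw [← hes, hk]
  have hinj : ∀ i j, 1 ≤ i → i ≤ n → 1 ≤ j → j ≤ n → i ≠ j → v i ≠ v j :=
    fun i j h1 h2 h3 h4 h5 h6 => h5 (v1 ⟨h1, h2⟩ ⟨h3, h4⟩ h6)
  have hu1 := v3 1 le_rfl (by omega)
  rw [stripRow_one (by omega)] at hu1
  have hu2 := eq_of_fst_eq hnd hu1 (e' := (u.1, [x', y'])) (by simp) v4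
  simp only [List.map_cons, List.map_nil, Prod.mk.injEq, List.cons.injEq, and_true] at hu2
  obtain ⟨hu2, hx', hy'⟩ := hu2
  obtain ⟨a, b, ⟨f0, f0'⟩, f1, f2, f3, f4, f5, f6⟩ :=
    hP.crown_orient p' t3 t4 t5 t1 t6 t7 t8 (i := 0) (p := v 3) (q := v 2) (by
      simp [orient, hx', hy'])
  rw [← hu2] at f1 f2 f3
  simp only [orient, Nat.zero_mod, zero_ne_one, if_false, zero_add, Nat.reduceMod, if_true,
    List.reverse_cons, List.reverse_nil, List.nil_append, List.cons_append, List.reverse_append]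
    at f1 f2 f3 f4 f5
  have hR₂ : ∀ k, 2 ≤ k → k ≤ n → (v k, (stripRow n k).map v) ∈ R₂ := by
    intro k h1 h2
    have := v3 k (by omega) h2
    rw [List.mem_cons, Prod.mk.injEq, ← hu2] at this
    exact this.resolve_left fun h => hinj k 1 (by omega) h2 le_rfl (by omega) (by omega) h.1
  have k2 : (v 2, [v 4, v 3, v 1, a]) ∈ y₁ :: u :: y₂ :: (D' ++ (s.1, [x, y]) :: B') := by
    have := hR₂ 2 le_rfl (by omega)
    rw [stripRow_two (by omega)] at this
    exact f4 _ this
  have k4 : ∀ k, 4 ≤ k → k ≤ n →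
      (v k, (stripRow n k).map v) ∈ y₁ :: u :: y₂ :: (D' ++ (s.1, [x, y]) :: B') :=
    fun k h1 h2 => f6 _ (hR₂ k (by omega) h2)
      (hinj _ _ (by omega) h2 (by omega) (by omega) (by omega))
      (hinj _ _ (by omega) h2 (by omega) (by omega) (by omega))
  have hxy : [x, y] = orient n [v (n - 2), v (n - 1)] := by
    have h5 := k4 n hn5 le_rfl
    have h6 := eq_of_fst_eq hnd' h5 (e' := (s.1, [x, y])) (by simp) hsn.symm
    rw [stripRow_last (by omega), orient_map] at h6
    exact (congrArg Prod.snd h6).symm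
  obtain ⟨a', b', ⟨g0, g0'⟩, g1, g2, g3, g4, g5, g6⟩ :=
    hP.crown_orient h r3 r4 r5 r1 r6 r7 r8 hxy
  rw [hsn] at g1 g2 g3
  have hw1 : ∀ e ∈ y₁ :: u :: y₂ :: (D' ++ (s.1, [x, y]) :: B'),
      e ∈ (s.1, [x, y]) :: (B' ++ y₁ :: u :: y₂ :: D') := by
    intro e he
    simp only [List.mem_cons, List.mem_append] at he ⊢
    tauto
  have hR'' : ∀ e ∈ y₁ :: u :: y₂ :: (D' ++ (s.1, [x, y]) :: B'), e.1 ≠ v n →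
      e ∈ B' ++ y₁ :: u :: y₂ :: D' := by
    intro e he h5
    refine (List.mem_cons.1 (hw1 e he)).resolve_left ?_
    rintro rfl
    exact h5 hsn
  have hfa : ∀ k, 1 ≤ k → k ≤ n → v k ≠ a ∧ v k ≠ b := fun k h1 h2 => f0' _ (v3 k h1 h2)
  have hsub : ∀ e ∈ y₁ :: u :: y₂ :: (D' ++ (s.1, [x, y]) :: B'), e.1 ≠ v n → e.1 ≠ v (n - 2) →
      e.1 ≠ v (n - 1) → e ∈ z :: s :: z' :: R :=
    fun e he h1 h2 h3 => g6 e (hR'' e he h1) h2 h3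
  have hfw : ∀ k, 1 ≤ k → k ≤ n → ∃ l, (v k, l) ∈
      y₁ :: u :: y₂ :: (D' ++ (s.1, [x, y]) :: B') := by
    intro k h1 h2
    rcases (by omega : k = 1 ∨ k = 2 ∨ k = 3 ∨ 4 ≤ k) with rfl | rfl | rfl | h5
    · exact ⟨_, f1⟩
    · exact ⟨_, k2⟩
    · exact ⟨_, f5 ((stripRow n 3).map v).reverse (by
        rw [List.reverse_reverse]; exact hR₂ 3 (by omega) (by omega))⟩
    · exact ⟨_, k4 k h5 h2⟩
  have hsv : ∀ k l, 1 ≤ k → k + 3 ≤ n → (v k, l) ∈ y₁ :: u :: y₂ :: (D' ++ (s.1, [x, y]) :: B') →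
      (v k, l) ∈ z :: s :: z' :: R := fun k l h1 h2 hl => hsub _ hl
    (hinj _ _ h1 (by omega) (by omega) le_rfl (by omega))
    (hinj _ _ h1 (by omega) (by omega) (by omega) (by omega))
    (hinj _ _ h1 (by omega) (by omega) (by omega) (by omega))
  have hlast : ∀ c, (∀ k, 1 ≤ k → k ≤ n → v k ≠ c) → ∀ l,
      (c, l) ∈ y₁ :: u :: y₂ :: (D' ++ (s.1, [x, y]) :: B') → (c, l) ∈ z :: s :: z' :: R :=
    fun c hc l hl => hsub _ hl (hc n (by omega) le_rfl).symm
      (hc (n - 2) (by omega) (by omega)).symm (hc (n - 1) (by omega) (by omega)).symm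
  have hsub_one : ∀ l, (v (n - 1), orient (n + 1) l) ∈
      y₁ :: u :: y₂ :: (D' ++ (s.1, [x, y]) :: B') →
      (v (n - 1), orient (n + 1) (l ++ [a'])) ∈ z :: s :: z' :: R :=
    fun l hl => g4 l (hR'' _ hl (hinj _ _ (by omega) (by omega) (by omega) (by omega) (by omega)))
  have hsub_two : ∀ l, (v (n - 2), orient n l) ∈
      y₁ :: u :: y₂ :: (D' ++ (s.1, [x, y]) :: B') →
      (v (n - 2), orient n (l ++ [b'])) ∈ z :: s :: z' :: R :=
    fun l hl => g5 l (hR'' _ hl (hinj _ _ (by omega) (by omega) (by omega) (by omega) (by omega)))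
  have k3 : 5 ≤ n → (v 3, [b, v 1, v 2, v 4, v 5]) ∈
      y₁ :: u :: y₂ :: (D' ++ (s.1, [x, y]) :: B') := by
    intro h1
    have := hR₂ 3 (by omega) (by omega)
    rw [stripRow_mid le_rfl (by omega)] at this
    exact f5 [v 5, v 4, v 2, v 1] this
  have k3' : n = 4 → (v 3, [b, v 1, v 2, v 4]) ∈
      y₁ :: u :: y₂ :: (D' ++ (s.1, [x, y]) :: B') := by
    intro h1
    have := hR₂ 3 (by omega) (by omega)
    rw [stripRow_penultimate le_rfl (by omega)] at this
    exact f5 [v 4, v 2, v 1] this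
  have hga : a' ≠ a ∧ a' ≠ b ∧ b' ≠ a ∧ b' ≠ b :=
    ⟨(g0' _ (hw1 _ f2)).1.symm, (g0' _ (hw1 _ f3)).1.symm, (g0' _ (hw1 _ f2)).2.symm,
      (g0' _ (hw1 _ f3)).2.symm⟩
  have hn2 : orient (n - 2) = (orient n : List α → List α) := by
    funext l
    conv_rhs => rw [← Nat.sub_add_cancel (show 2 ≤ n by omega), orient_add_two]
  have hn1 : orient (n - 1) = (orient (n + 1) : List α → List α) := by
    funext l
    conv_rhs => rw [← Nat.sub_add_cancel (show 1 ≤ n by omega), orient_add_two]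
  refine ⟨v, a, b, a', b',
    { injOn := v1
      ne := ⟨f0, g0, hga.1.symm, hga.2.2.1.symm, hga.2.1.symm, hga.2.2.2.symm⟩
      fresh := ?_
      mem_a := hlast a (fun k h1 h2 => (hfa k h1 h2).1) _ f2
      mem_b := hlast b (fun k h1 h2 => (hfa k h1 h2).2) _ f3
      mem_a' := by rw [← orient_pair]; exact g2
      mem_b' := g3
      mem_one := hsv 1 _ le_rfl (by omega) f1
      mem_two := fun h1 => hsv 2 _ (by omega) (by omega) k2
      mem_two_four := ?_
      mem_three := fun h1 => hsv 3 _ (by omega) (by omega) (k3 (by omega))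
      mem_three_five := ?_
      mem_three_four := ?_
      mem_mid := ?_
      mem_sub_two := ?_
      mem_sub_one := ?_
      mem_last := g1 }⟩
  · intro k h1 h2
    obtain ⟨l, hl⟩ := hfw k h1 h2
    exact ⟨(hfa k h1 h2).1, (hfa k h1 h2).2, (g0' _ (hw1 _ hl)).1, (g0' _ (hw1 _ hl)).2⟩
  · rintro h1
    rw [h1] at hsub_two
    exact hsub_two [a, v 1, v 3, v 4] k2
  · rintro h1
    have := k3 h1.ge
    rw [h1] at hsub_two
    exact hsub_two [b, v 1, v 2, v 4, v 5] this
  · rintro h1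
    have := k3' h1
    rw [h1] at hsub_one
    exact hsub_one [b, v 1, v 2, v 4] this
  · intro k h1 h2
    have := k4 k h1 (by omega)
    rw [stripRow_mid (by omega) (by omega), orient_map] at this
    exact hsv k _ (by omega) h2 this
  · intro h1
    have := k4 (n - 2) (by omega) (by omega)
    rw [stripRow_mid (by omega) (by omega), orient_map, hn2] at this
    have := hsub_two _ this
    rw [show n - 2 - 2 = n - 4 by omega, show n - 2 - 1 = n - 3 by omega,
      show n - 2 + 1 = n - 1 by omega, show n - 2 + 2 = n by omega] at this
    exact this
  · intro h1
    have := k4 (n - 1) (by omega) (by omega)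
    rw [stripRow_penultimate (by omega) (by omega), orient_map, hn1] at this
    have := hsub_one _ this
    rw [show n - 1 - 2 = n - 3 by omega, show n - 1 - 1 = n - 2 by omega,
      show n - 1 + 1 = n by omega] at this
    exact this

end TriSystem

end Zippers

section Zippers

variable {α : Type*}

open Zipper

/-- The numbering of a crowned strip that is used in the gluing tables. -/
def crownLabel (n : ℕ) (v : ℕ → α) (a b a' b' : α) (k : ℕ) : α :=
  if k = 1 then a else if k ≤ n + 1 then v (k - 1) else if k = n + 2 then a'
  else if k = n + 3 then b else b'

namespace IsCrownedStrip

variable {w : List (α × List α)} {n : ℕ} {v : ℕ → α} {a b a' b' : α}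

theorem injOn_crownLabel (h : IsCrownedStrip w n v a b a' b') :
    Set.InjOn (crownLabel n v a b a' b') (Set.Icc 1 (n + 4)) := by
  obtain ⟨h1, h2, h3, h4, h5, h6⟩ := h.ne
  have hv : ∀ i j, 1 ≤ i → i ≤ n → 1 ≤ j → j ≤ n → v i = v j → i = j :=
    fun i j i1 i2 j1 j2 hij => h.injOn ⟨i1, i2⟩ ⟨j1, j2⟩ hij
  have hf := h.fresh
  rintro i ⟨hi, hi'⟩ j ⟨hj, hj'⟩ hij
  have hi0 : i = 1 ∨ (i ≠ 1 ∧ i ≤ n + 1 ∧ v (i - 1) ≠ a ∧ v (i - 1) ≠ b ∧ v (i - 1) ≠ a' ∧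
      v (i - 1) ≠ b') ∨ n + 2 ≤ i := by
    rcases (by omega : i = 1 ∨ (i ≠ 1 ∧ i ≤ n + 1) ∨ n + 2 ≤ i) with h | h | h
    · exact Or.inl h
    · exact Or.inr (Or.inl ⟨h.1, h.2, hf (i - 1) (by omega) (by omega)⟩)
    · exact Or.inr (Or.inr h)
  have hj0 : j = 1 ∨ (j ≠ 1 ∧ j ≤ n + 1 ∧ v (j - 1) ≠ a ∧ v (j - 1) ≠ b ∧ v (j - 1) ≠ a' ∧
      v (j - 1) ≠ b') ∨ n + 2 ≤ j := by
    rcases (by omega : j = 1 ∨ (j ≠ 1 ∧ j ≤ n + 1) ∨ n + 2 ≤ j) with h | h | h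
    · exact Or.inl h
    · exact Or.inr (Or.inl ⟨h.1, h.2, hf (j - 1) (by omega) (by omega)⟩)
    · exact Or.inr (Or.inr h)
  have hij0 : i ≠ 1 → j ≠ 1 → i ≤ n + 1 → j ≤ n + 1 → v (i - 1) = v (j - 1) → i = j := by
    intro e1 e2 e3 e4 e5
    have := hv _ _ (by omega) (by omega) (by omega) (by omega) e5
    omega
  clear hv hf h
  unfold crownLabel at hij
  grind

/-- Reading off a shape from a crowned strip.  The gluing tables run through the strip in the
opposite orientation, which is why the lists are reversed. -/
theorem shape (h : IsCrownedStrip w n v a b a' b') {T : List (List ℕ)}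
    (hw : (w.map Prod.fst).Nodup) (hl : w.length = n + 4) (hT : T.length = n + 4)
    (r : ℕ → List ℕ) (hr : ∀ k, 1 ≤ k → k ≤ n + 4 →
      (crownLabel n v a b a' b' k, ((r k).map (crownLabel n v a b a' b')).reverse) ∈ w ∧
      (∀ j ∈ r k, 1 ≤ j ∧ j ≤ n + 4) ∧
      ∃ row, T[k - 1]? = some row ∧
        row ~r (if (r k).length ≤ 3 then [0, 0] else [0]) ++ r k) :
    Shape w [] (T.map List.reverse) := by
  apply Shape.mirror
  refine Shape.of_injOn (v := crownLabel n v a b a' b') r ?_ (by simp [hl, hT])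
    (by rw [hT]; exact h.injOn_crownLabel) ?_
  · have e : (Prod.fst ∘ mirrorEntry : α × List α → α) = Prod.fst := rfl
    simpa [mirrorWord, e] using List.nodup_reverse.2 hw
  · rw [hT]
    intro k h1 h2
    obtain ⟨h3, h4⟩ := hr k h1 h2
    exact ⟨by simpa [mirrorEntry] using h3, h4⟩

theorem shape_E5 (h : IsCrownedStrip w 4 v a b a' b') (hw : (w.map Prod.fst).Nodup)
    (hl : w.length = 8) : Shape w [] (Extraordinary.E5.table.map List.reverse) := by
  refine h.shape hw hl rfl (fun k => ((Extraordinary.E5.table.getD (k - 1) []).filter (· ≠ 0))) ?_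
  intro k h1 h2
  have m1 := h.mem_a
  have m2 := h.mem_one
  have m3 := h.mem_two_four rfl
  have m4 := h.mem_three_four rfl
  have m5 := h.mem_last
  have m6 := h.mem_a'
  have m7 := h.mem_b
  have m8 := h.mem_b'
  simp only [orient, Nat.reduceAdd, Nat.reduceMod, if_true, if_false, zero_ne_one, Nat.reduceSub,
    List.reverse_cons, List.reverse_nil, List.nil_append, List.cons_append]
    at m1 m2 m3 m4 m5 m6 m7 m8
  interval_cases k
  · exact ⟨m1, by decide, _, rfl, by decide⟩
  · exact ⟨m2, by decide, _, rfl, by decide⟩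
  · exact ⟨m3, by decide, _, rfl, by decide⟩
  · exact ⟨m4, by decide, _, rfl, by decide⟩
  · exact ⟨m5, by decide, _, rfl, by decide⟩
  · exact ⟨m6, by decide, _, rfl, by decide⟩
  · exact ⟨m7, by decide, _, rfl, by decide⟩
  · exact ⟨m8, by decide, _, rfl, by decide⟩

theorem shape_E6 (h : IsCrownedStrip w 5 v a b a' b') (hw : (w.map Prod.fst).Nodup)
    (hl : w.length = 9) : Shape w [] (Extraordinary.E6.table.map List.reverse) := by
  refine h.shape hw hl rfl (fun k => if k = 4 then [9, 6, 5, 3, 2, 8] else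
    if k = 6 then [7, 5, 4, 9] else
      ((Extraordinary.E6.table.getD (k - 1) []).filter (· ≠ 0))) ?_
  intro k h1 h2
  have m1 := h.mem_a
  have m2 := h.mem_one
  have m3 := h.mem_two le_rfl
  have m4 := h.mem_three_five rfl
  have m5 := h.mem_sub_one le_rfl
  have m6 := h.mem_last
  have m7 := h.mem_a'
  have m8 := h.mem_b
  have m9 := h.mem_b'
  simp only [orient, Nat.reduceAdd, Nat.reduceMod, if_true, if_false, zero_ne_one, Nat.reduceSub,
    List.reverse_cons, List.reverse_nil, List.nil_append, List.cons_append]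
    at m1 m2 m3 m4 m5 m6 m7 m8 m9
  interval_cases k
  · exact ⟨m1, by decide, _, rfl, by decide⟩
  · exact ⟨m2, by decide, _, rfl, by decide⟩
  · exact ⟨m3, by decide, _, rfl, by decide⟩
  · exact ⟨m4, by decide, _, rfl, by decide⟩
  · exact ⟨m5, by decide, _, rfl, by decide⟩
  · exact ⟨m6, by decide, _, rfl, by decide⟩
  · exact ⟨m7, by decide, _, rfl, by decide⟩
  · exact ⟨m8, by decide, _, rfl, by decide⟩
  · exact ⟨m9, by decide, _, rfl, by decide⟩

theorem shape_twoTwo {t : ℕ} (h : IsCrownedStrip w (t + 6) v a b a' b')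
    (hw : (w.map Prod.fst).Nodup) (hl : w.length = t + 10) :
    Shape w [] ((table .twoTwo t).map List.reverse) := by
  have hT : (table .twoTwo t).length = t + 10 := by simp [table]
  refine h.shape hw hl hT (fun k =>
    if k = 1 then [2, 3] else if k = 2 then orient 2 [1, 3, 4, t + 9]
    else if k = 3 then orient 3 [1, 2, 4, 5] else if k = 4 then orient 4 [t + 9, 2, 3, 5, 6]
    else if k ≤ t + 4 then orient k [k - 2, k - 1, k + 1, k + 2]
    else if k = t + 5 then orient (t + 5) [t + 3, t + 4, t + 6, t + 7, t + 10]
    else if k = t + 6 then orient (t + 6) [t + 4, t + 5, t + 7, t + 8]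
    else if k = t + 7 then orient (t + 7) [t + 10, t + 5, t + 6, t + 8]
    else if k = t + 8 then orient (t + 8) [t + 6, t + 7]
    else if k = t + 9 then orient 4 [2, 4] else orient (t + 5) [t + 5, t + 7]) ?_
  intro k h1 h2
  have O : ∀ k (l : List α), orient (k + 1 + 1) l = orient k l := fun k l => orient_add_two k l
  unfold table
  rcases (by omega : k = 1 ∨ k = 2 ∨ k = 3 ∨ k = 4 ∨ (5 ≤ k ∧ k ≤ t + 4) ∨ k = t + 5 ∨ k = t + 6 ∨
    k = t + 7 ∨ k = t + 8 ∨ k = t + 9 ∨ k = t + 10) with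
    rfl | rfl | rfl | rfl | ⟨h3, h4⟩ | rfl | rfl | rfl | rfl | rfl | rfl
  · refine ⟨by simpa [crownLabel] using h.mem_a, by simp, _, getElem?_teeth_start (by simp), ?_⟩
    exact isRotated_turn_zero_zero 1 _
  · refine ⟨by simpa [crownLabel, orient] using h.mem_one, by simp [orient], _,
      getElem?_teeth_start (by simp), ?_⟩
    exact isRotated_turn_zero 2 _
  · refine ⟨by simpa [crownLabel, orient] using h.mem_two (by omega), by simp [orient], _,
      getElem?_teeth_start (by simp), ?_⟩
    exact isRotated_turn_zero 3 _
  · refine ⟨by simpa [crownLabel, orient] using h.mem_three (by omega), by simp [orient], _,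
      getElem?_teeth_start (by simp), ?_⟩
    exact isRotated_turn_zero 4 _
  · simp only [show k ≠ 1 by omega, show k ≠ 2 by omega, show k ≠ 3 by omega, show k ≠ 4 by omega,
      if_false, h4, if_true, mem_orient]
    refine ⟨?_, by simp; omega, _, getElem?_teeth_mid (by simp; omega) (by simp; omega), ?_⟩
    · have := h.mem_mid (k - 1) (by omega) (by omega)
      obtain ⟨k, rfl⟩ := Nat.exists_eq_add_of_le' h3
      rw [orient_map, reverse_orient]
      simp [crownLabel, show k ≤ t by omega, show k ≤ t + 1 by omega, show k ≤ t + 2 by omega,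
        show k ≤ t + 3 by omega, show k ≤ t + 4 by omega] at this ⊢
      rw [show k + 5 + 1 = k + 4 + 2 by rfl, orient_add_two]
      exact this
    · have e : 5 + (k - 1 - 4) = k := by omega
      simpa [tooth, e] using isRotated_turn_zero k _
  · have e : ∀ i, i ≤ 4 → t + 5 ≠ i := fun i hi => by omega
    have e' : ¬ t + 5 ≤ t + 4 := by omega
    simp only [e 1 (by omega), e 2 (by omega), e 3 (by omega), e 4 (by omega), e', if_false,
      if_true, add_right_inj, Nat.reduceEqDiff, mem_orient]
    refine ⟨?_, by simp; try omega, _, getElem?_teeth_end (j := 0) (by simp; try omega), ?_⟩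
    · have := h.mem_sub_two (by omega)
      rw [orient_map, reverse_orient]
      simpa [crownLabel] using this
    · simpa [tooth] using isRotated_turn_zero (t + 5) _
  · have e : ∀ i, i ≤ 4 → t + 6 ≠ i := fun i hi => by omega
    have e' : ¬ t + 6 ≤ t + 4 := by omega
    simp only [e 1 (by omega), e 2 (by omega), e 3 (by omega), e 4 (by omega), e', if_false,
      if_true, add_right_inj, Nat.reduceEqDiff, mem_orient]
    refine ⟨?_, by simp; try omega, _, getElem?_teeth_end (j := 1) (by simp; try omega), ?_⟩
    · have := h.mem_sub_one (by omega)
      rw [orient_map, reverse_orient]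
      simpa [crownLabel] using this
    · simpa [tooth] using isRotated_turn_zero (t + 6) _
  · have e : ∀ i, i ≤ 4 → t + 7 ≠ i := fun i hi => by omega
    have e' : ¬ t + 7 ≤ t + 4 := by omega
    simp only [e 1 (by omega), e 2 (by omega), e 3 (by omega), e 4 (by omega), e', if_false,
      if_true, add_right_inj, Nat.reduceEqDiff, mem_orient]
    refine ⟨?_, by simp; try omega, _, getElem?_teeth_end (j := 2) (by simp; try omega), ?_⟩
    · have := h.mem_last
      rw [orient_map, reverse_orient, orient_add_two (t + 6)]
      simpa [crownLabel] using this
    · simpa [tooth] using isRotated_turn_zero (t + 7) _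
  · have e : ∀ i, i ≤ 4 → t + 8 ≠ i := fun i hi => by omega
    have e' : ¬ t + 8 ≤ t + 4 := by omega
    simp only [e 1 (by omega), e 2 (by omega), e 3 (by omega), e 4 (by omega), e', if_false,
      if_true, add_right_inj, Nat.reduceEqDiff, mem_orient]
    refine ⟨?_, by simp; try omega, _, getElem?_teeth_end (j := 3) (by simp; try omega), ?_⟩
    · have := h.mem_a'
      rw [orient_map, reverse_orient, orient_add_two (t + 6 + 1)]
      simpa [crownLabel] using this
    · simpa [tooth] using isRotated_turn_zero_zero (t + 8) _
  · have e : ∀ i, i ≤ 4 → t + 9 ≠ i := fun i hi => by omega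
    have e' : ¬ t + 9 ≤ t + 4 := by omega
    simp only [e 1 (by omega), e 2 (by omega), e 3 (by omega), e 4 (by omega), e', if_false,
      if_true, add_right_inj, Nat.reduceEqDiff, mem_orient]
    refine ⟨?_, by simp; try omega, _, getElem?_teeth_end (j := 4) (by simp; try omega), ?_⟩
    · simpa [crownLabel, orient] using h.mem_b
    · simpa [tooth] using isRotated_turn_zero_zero 4 _
  · have e : ∀ i, i ≤ 4 → t + 10 ≠ i := fun i hi => by omega
    have e' : ¬ t + 10 ≤ t + 4 := by omega
    simp only [e 1 (by omega), e 2 (by omega), e 3 (by omega), e 4 (by omega), e', if_false,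
      add_right_inj, Nat.reduceEqDiff, mem_orient]
    refine ⟨?_, by simp; try omega, _, getElem?_teeth_end (j := 5) (by simp; try omega), ?_⟩
    · have := h.mem_b'
      rw [orient_map, reverse_orient]
      simpa [crownLabel] using this
    · simpa [tooth] using isRotated_turn_zero_zero (t + 5) _

end IsCrownedStrip

end Zippers

/-! ### Classification of triangulated discs -/

section Classification

variable {α : Type*}

/-- The word is described, up to reflection, by the table of one of the configurations. -/
def HasListedShape (w H : List (α × List α)) : Prop :=
  ∃ T : List (List ℕ), ((∃ x : Extraordinary, T = x.table) ∨ ∃ e t, T = Zipper.table e t) ∧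
    (Shape w H T ∨ Shape w H (T.map List.reverse))

theorem HasListedShape.of_isRotated {w w' H : List (α × List α)} (h : HasListedShape w H)
    (hr : w' ~r w) : HasListedShape w' H := by
  obtain ⟨T, hT, h⟩ := h
  exact ⟨T, hT, h.imp (fun h => h.of_isRotated hr) fun h => h.of_isRotated hr⟩

theorem HasListedShape.mirror {w H : List (α × List α)}
    (h : HasListedShape (mirrorWord w) (H.map mirrorEntry)) : HasListedShape w H := by
  obtain ⟨T, hT, h⟩ := h
  refine ⟨T, hT, h.symm.imp (fun h => ?_) fun h => h.mirror⟩
  simpa [Function.comp_def] using h.mirror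

theorem HasListedShape.extraordinary {w H : List (α × List α)} (x : Extraordinary)
    (h : Shape w H x.table) : HasListedShape w H := ⟨_, Or.inl ⟨x, rfl⟩, Or.inl h⟩

theorem HasListedShape.zipper {w H : List (α × List α)} (e : Zipper.Ends) (t : ℕ)
    (h : Shape w H (Zipper.table e t)) : HasListedShape w H := ⟨_, Or.inr ⟨e, t, rfl⟩, Or.inl h⟩

theorem map_length_mirrorWord (w : List (α × List α)) :
    (mirrorWord w).map (fun e => e.2.length) = (w.map fun e => e.2.length).reverse := by
  simp [mirrorWord, mirrorEntry, Function.comp_def]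

namespace TriSystem

variable {P : List (α × List α) → List (α × List α) → Prop}

theorem exists_word (hP : TriSystem P) {w H : List (α × List α)} {ds : List ℕ} (h : P w H)
    (hr : w.map (fun e => e.2.length) ~r ds) :
    ∃ w', w ~r w' ∧ P w' H ∧ w'.map (fun e => e.2.length) = ds := by
  obtain ⟨n, hn⟩ := hr
  exact ⟨w.rotate n, ⟨n, rfl⟩, hP.isRotated h ⟨n, rfl⟩, by rw [← hn, List.map_rotate]⟩

/-- The word obtained by cutting off two ears that have a neighbour in common. -/
theorem degree_crown (hP : TriSystem P) {R hs : List ℕ} (hR : 2 ≤ R.length)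
    (h : DegreeWord P (2 :: 4 :: 2 :: R) hs) : DegreeWord P (2 :: trim R) hs := by
  obtain ⟨w, H, h, hw, rfl⟩ := h
  simp only [List.map_eq_cons_iff] at hw
  obtain ⟨z, _, rfl, hz, s, _, rfl, hs, z', R, rfl, hz', rfl⟩ := hw
  obtain ⟨y, x, R', p, -, r, -⟩ := hP.crown h hz hs hz' (by simpa using hR)
  exact ⟨_, H, p, by simp [r], rfl⟩

theorem listed_oneOne (hP : TriSystem P) {w : List (α × List α)} (h : P w [])
    (h4 : ∀ e ∈ w, e.2.length ≤ 4) {y : ℕ} {mid : List ℕ}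
    (hw : w.map (fun e => e.2.length) = 2 :: y :: (mid ++ [3])) (hm : mid.count 2 = 1) :
    HasListedShape w [] := by
  obtain ⟨e, w, rfl⟩ := List.exists_cons_of_ne_nil (l := w) (by rintro rfl; simp at hw)
  obtain ⟨v, hv, -⟩ := hP.exists_isStrip h hw (by
    intro a ha
    have : a ∈ (e :: w).map fun e => e.2.length := by rw [hw]; exact List.mem_cons_of_mem _ ha
    obtain ⟨e', he', rfl⟩ := List.mem_map.1 this
    exact h4 _ he') hm
  have hm1 : 1 ≤ mid.length := by
    have := List.count_le_length (a := 2) (l := mid)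
    omega
  obtain ⟨t, ht⟩ : ∃ t, mid.length + 3 = t + 4 := ⟨mid.length - 1, by omega⟩
  rw [ht] at hv
  exact .zipper .oneOne t (Shape.oneOne (hP.nodup_word h) hv)

theorem listed_two_ears (hP : TriSystem P) {w : List (α × List α)} (h : P w [])
    (hn : 4 ≤ w.length) (h2 : (w.map fun e => e.2.length).count 2 = 2)
    (hex : excess (w.map fun e => e.2.length) = 0) : HasListedShape w [] := by
  obtain ⟨y, mid, x, hr, hm, hxy⟩ := hP.degree_ears_two (degreeWord h) h2 (by simpa using hn)
  obtain ⟨w', hw', h', hd⟩ := hP.exists_word h hr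
  refine HasListedShape.of_isRotated ?_ hw'
  have h4 : ∀ e ∈ w', e.2.length ≤ 4 := fun e he =>
    le_four_of_excess hex _ (List.mem_map_of_mem (hw'.mem_iff.2 he))
  rcases hxy with rfl | rfl
  · exact hP.listed_oneOne h' h4 hd hm
  · have hP' := hP.mirror
    have p : P (mirrorWord (mirrorWord w')) (([] : List (α × List α)).map mirrorEntry) := by
      simpa using h'
    have hr' : (mirrorWord w').map (fun e => e.2.length) ~r 2 :: x :: (mid.reverse ++ [3]) := by
      rw [map_length_mirrorWord, hd]
      have e : (2 :: 3 :: (mid ++ [x])).reverse = (x :: (mid.reverse ++ [3])) ++ [2] := by simp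
      rw [e]
      exact List.isRotated_append
    obtain ⟨w₁, hw₁, h₁, hd₁⟩ := hP'.exists_word p hr'
    refine HasListedShape.mirror ?_
    refine HasListedShape.of_isRotated ?_ hw₁
    refine hP'.listed_oneOne h₁ (fun e he => ?_) hd₁ (by simpa using hm)
    have := hw₁.mem_iff.2 he
    rw [mem_mirrorWord] at this
    simpa [mirrorEntry] using h4 _ this

theorem listed_three_ears (hP : TriSystem P) {w : List (α × List α)} (h : P w [])
    (h2 : (w.map fun e => e.2.length).count 2 = 3)
    (h3 : (w.map fun e => e.2.length).count 3 = 1)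
    (hex : excess (w.map fun e => e.2.length) = 1) : HasListedShape w [] := by
  obtain ⟨B, C, hr, hB, hC, hn, h4⟩ := hP.degree_three_ears (degreeWord h) h2 h3 hex
  obtain ⟨w', hw', h', hd⟩ := hP.exists_word h hr
  refine HasListedShape.of_isRotated ?_ hw'
  have hB0 := List.length_pos_iff.2 hB
  have hC0 := List.length_pos_iff.2 hC
  have key := hP.degree_crown (by simp; omega) (hP.degree_isRotated (degreeWord h) hr)
  rw [trim, decLast_append _ (by simp), decLast_cons _ hC, decHead_append _ hB] at key
  obtain ⟨M, x, hM⟩ := exists_snoc (decHead_ne_nil hB)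
  obtain ⟨y, M', hM'⟩ := List.exists_cons_of_ne_nil (decLast_ne_nil hC)
  have e1 := congrArg List.length hM
  have e2 := congrArg List.length hM'
  simp at e1 e2
  have hcount : ∀ X : List ℕ, (∀ a ∈ X, 3 ≤ a ∧ a ≤ 4) → X.count 2 = 0 := by
    intro X hX
    rw [List.count_eq_zero]
    intro h2
    have := hX 2 h2
    omega
  have c1 := hcount M fun a ha => h4 a (by simp [hM, ha])
  have c2 := hcount M' fun a ha => h4 a (by simp [hM', ha])
  have key' : DegreeWord P (2 :: y :: ((M' ++ 2 :: M) ++ [x])) [] := by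
    rw [hM, hM'] at key
    simpa using hP.degree_append_comm (l := 2 :: (M ++ [x])) (l' := 2 :: (y :: M'))
      (by simpa using key)
  -- the strip left after cutting may start with either neighbour of its ear: reflect if necessary
  rcases hP.degree_two_ears (by simp; omega) (by simp [c1, c2]) key' with ⟨rfl, -⟩ | ⟨rfl, -⟩
  · have hP' := hP.mirror
    have p : P (mirrorWord (mirrorWord w')) (([] : List (α × List α)).map mirrorEntry) := by
      simpa using h'
    have hr' : (mirrorWord w').map (fun e => e.2.length) ~r
        2 :: 4 :: 2 :: (C.reverse ++ 2 :: B.reverse) := by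
      rw [map_length_mirrorWord, hd]
      simpa using List.isRotated_append (l := C.reverse ++ 2 :: B.reverse) (l' := [2, 4, 2])
    obtain ⟨w₁, hw₁, h₁, hd₁⟩ := hP'.exists_word p hr'
    refine HasListedShape.mirror ?_
    refine HasListedShape.of_isRotated ?_ hw₁
    obtain ⟨t, ht⟩ := hP'.shape_oneTwo h₁ hd₁ (by simpa using hB) (by simp; omega) (by
      rw [decHead_reverse, decLast_reverse]
      intro a ha
      apply h4
      simp at ha ⊢
      tauto) ⟨M'.reverse, by rw [decHead_reverse, hM']; simp⟩
    exact .zipper .oneTwo t ht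
  · obtain ⟨t, ht⟩ := hP.shape_oneTwo h' hd hC hn h4 ⟨M, hM⟩
    exact .zipper .oneTwo t ht

theorem listed_crownedStrip (hP : TriSystem P) {w : List (α × List α)} {B D : List ℕ}
    (h : P w [])
    (hd : w.map (fun e => e.2.length) = 2 :: 4 :: 2 :: (B ++ 2 :: 4 :: 2 :: D))
    (hB : B ≠ []) (hD : D ≠ []) (h4 : ∀ a ∈ trim B ++ trim D, 3 ≤ a ∧ a ≤ 4)
    (hB3 : ∃ M, trim B = M ++ [3]) : HasListedShape w [] := by
  obtain ⟨v, a, b, a', b', hw⟩ := hP.exists_isCrownedStrip h hd hB hD h4 hB3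
  have hl := congrArg List.length hd
  simp only [List.length_map, List.length_cons, List.length_append] at hl
  obtain ⟨n, hn⟩ : ∃ n, n = B.length + D.length + 2 := ⟨_, rfl⟩
  rw [← hn] at hw
  have hl : w.length = n + 4 := by omega
  have hB0 := List.length_pos_iff.2 hB
  have hD0 := List.length_pos_iff.2 hD
  rcases (by omega : n = 4 ∨ n = 5 ∨ 6 ≤ n) with rfl | rfl | hn6
  · exact ⟨_, Or.inl ⟨.E5, rfl⟩, Or.inr (hw.shape_E5 (hP.nodup_word h) hl)⟩
  · exact ⟨_, Or.inl ⟨.E6, rfl⟩, Or.inr (hw.shape_E6 (hP.nodup_word h) hl)⟩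
  · obtain ⟨t, rfl⟩ := Nat.exists_eq_add_of_le' hn6
    exact ⟨_, Or.inr ⟨.twoTwo, t, rfl⟩, Or.inr (hw.shape_twoTwo (hP.nodup_word h) hl)⟩

theorem listed_four_ears (hP : TriSystem P) {w : List (α × List α)} (h : P w [])
    (h2 : (w.map fun e => e.2.length).count 2 = 4)
    (h3 : (w.map fun e => e.2.length).count 3 = 0) : HasListedShape w [] := by
  obtain ⟨B, D, hr, hB, hD, h4⟩ := hP.degree_four_ears (degreeWord h) h2 h3
  obtain ⟨w', hw', h', hd⟩ := hP.exists_word h hr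
  refine HasListedShape.of_isRotated ?_ hw'
  have hB0 := List.length_pos_iff.2 hB
  have hD0 := List.length_pos_iff.2 hD
  have key := hP.degree_crown (by simp; omega) (hP.degree_isRotated (degreeWord h) hr)
  rw [trim, decLast_append _ (by simp), decLast_cons _ (by simp), decLast_cons _ (by simp),
    decLast_cons _ hD, decHead_append _ hB] at key
  replace key : DegreeWord P (2 :: 4 :: 2 :: (decLast D ++ 2 :: decHead B)) [] :=
    hP.degree_append_comm (l := 2 :: decHead B) (l' := 2 :: 4 :: 2 :: decLast D)
      (by simpa using key)
  replace key := hP.degree_crown (by simp; omega) key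
  rw [trim, decLast_append _ (by simp), decLast_cons _ (decHead_ne_nil hB),
    decHead_append _ (decLast_ne_nil hD), decLast_decHead] at key
  change DegreeWord P (2 :: (trim D ++ 2 :: trim B)) [] at key
  obtain ⟨M, x, hM⟩ := exists_snoc (trim_ne_nil hB)
  obtain ⟨y, M', hM'⟩ := List.exists_cons_of_ne_nil (trim_ne_nil hD)
  have e1 := congrArg List.length hM
  have e2 := congrArg List.length hM'
  simp at e1 e2
  have hcount : ∀ X : List ℕ, (∀ a ∈ X, 3 ≤ a ∧ a ≤ 4) → X.count 2 = 0 := by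
    intro X hX
    rw [List.count_eq_zero]
    intro h2
    have := hX 2 h2
    omega
  have c1 := hcount M fun a ha => h4 a (by simp [hM, ha])
  have c2 := hcount M' fun a ha => h4 a (by simp [hM', ha])
  have hx := h4 x (by simp [hM])
  have hy := h4 y (by simp [hM'])
  have key' : DegreeWord P (2 :: y :: ((M' ++ 2 :: M) ++ [x])) [] := by
    rw [hM, hM'] at key
    simpa using key
  have hxy : x = 3 ∨ y = 3 := by
    by_cases hl : 2 ≤ (M' ++ 2 :: M).length
    · have := hP.degree_two_ears hl (by simp [c1, c2]) key'
      omega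
    · have m1 : M = [] := List.length_eq_zero_iff.1 (by simp at hl; omega)
      have m2 : M' = [] := List.length_eq_zero_iff.1 (by simp at hl; omega)
      subst m1 m2
      have hs := hP.degree_sum key'
      simp at hs
      omega
  -- the second case is the reflection of the first
  rcases hxy with rfl | rfl
  · exact hP.listed_crownedStrip h' hd hB hD h4 ⟨M, hM⟩
  · have hP' := hP.mirror
    have p : P (mirrorWord (mirrorWord w')) (([] : List (α × List α)).map mirrorEntry) := by
      simpa using h'
    have hr' : (mirrorWord w').map (fun e => e.2.length) ~r
        2 :: 4 :: 2 :: (D.reverse ++ 2 :: 4 :: 2 :: B.reverse) := by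
      rw [map_length_mirrorWord, hd]
      simpa using List.isRotated_append (l := D.reverse ++ 2 :: 4 :: 2 :: B.reverse)
        (l' := [2, 4, 2])
    obtain ⟨w₁, hw₁, h₁, hd₁⟩ := hP'.exists_word p hr'
    refine HasListedShape.mirror ?_
    refine HasListedShape.of_isRotated ?_ hw₁
    refine hP'.listed_crownedStrip h₁ hd₁ (by simpa using hD) (by simpa using hB) ?_
      ⟨M'.reverse, by rw [trim_reverse, hM']; simp⟩
    rw [trim_reverse, trim_reverse]
    intro a ha
    apply h4
    simp at ha ⊢
    tauto

/-- A triangulated disc whose interior vertices have at least seven neighbours and which has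
exactly four boundary vertices with at most three neighbours is one of the listed
configurations. -/
theorem hasListedShape (hP : TriSystem P) {w H : List (α × List α)} (h : P w H)
    (hc : (w.map fun e => e.2.length).count 2 + (w.map fun e => e.2.length).count 3 = 4) :
    HasListedShape w H := by
  have hn : 4 ≤ w.length := by
    have := count_two_add_count_three_le (w.map fun e => e.2.length)
    rw [List.length_map] at this
    omega
  have hd := degreeWord h
  rcases hP.degree_cases hd (by simp; omega) hc with ⟨hH, h2, h3, hex⟩ | ⟨hH, h2, h3, hex⟩ |
    ⟨hH, h2, h3, hex⟩ | ⟨hH, h2, h3, hex⟩ | ⟨hH, h2, h3, hex⟩ | ⟨hH, h2, h3, hex⟩ |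
    ⟨hH, h2, h3, hex⟩
  · obtain rfl := List.map_eq_nil_iff.1 hH
    exact hP.listed_two_ears h hn h2 hex
  · obtain rfl := List.map_eq_nil_iff.1 hH
    exact hP.listed_three_ears h h2 h3 hex
  · obtain rfl := List.map_eq_nil_iff.1 hH
    exact hP.listed_four_ears h h2 h3
  · rw [hH] at hd
    obtain ⟨w', hw', h', hd'⟩ := hP.exists_word h (hP.degree_one_hub_three_ears hd h2 h3 hex)
    exact (HasListedShape.extraordinary .E7a (hP.shape_E7a h' hd' hH)).of_isRotated hw'
  · rw [hH] at hd
    rcases hP.degree_one_hub_four_ears hd h2 h3 (by omega) with hr | hr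
    · have := excess_eq_of_isRotated hr
      rw [hex] at this
      exact absurd this (by decide)
    · obtain ⟨w', hw', h', hd'⟩ := hP.exists_word h hr
      exact (HasListedShape.extraordinary .E7c (hP.shape_E7c h' hd' hH)).of_isRotated hw'
  · rw [hH] at hd
    rcases hP.degree_one_hub_four_ears hd h2 h3 (by omega) with hr | hr
    · obtain ⟨w', hw', h', hd'⟩ := hP.exists_word h hr
      exact (HasListedShape.extraordinary .E8 (hP.shape_E8 h' hd' hH)).of_isRotated hw'
    · have := excess_eq_of_isRotated hr
      rw [hex] at this
      exact absurd this (by decide)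
  · rw [hH] at hd
    obtain ⟨w', hw', h', hd'⟩ := hP.exists_word h (hP.degree_two_hubs hd h2 h3 hex)
    exact (HasListedShape.extraordinary .E7b (hP.shape_E7b h' hd' hH)).of_isRotated hw'

end TriSystem

end Classification

/-! ### Orbits of permutations -/

section Orbits

variable {D : Type*}

/-- Every orbit of a permutation of a finite set is listed by iterating the permutation. -/
theorem exists_orbit [Finite D] (π : Equiv.Perm D) (x : D) :
    ∃ l, (x :: l).Nodup ∧ (∀ y, y ∈ x :: l ↔ π.SameCycle x y) ∧
      (x :: l).IsChain (fun a b => b = π a) ∧ ∀ y, (x :: l).getLast? = some y → π y = x := by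
  have hpos : 0 < Function.minimalPeriod π x :=
    Function.minimalPeriod_pos_of_mem_periodicPts (π.injective.mem_periodicPts x)
  obtain ⟨m, hm⟩ := Nat.exists_eq_add_of_le' hpos
  have hcons : (List.range (m + 1)).map (fun i => π^[i] x) =
      x :: (List.range m).map (fun i => π^[i + 1] x) := by
    rw [List.range_succ_eq_map]
    simp [Function.comp_def]
  refine ⟨(List.range m).map (fun i => π^[i + 1] x), ?_⟩
  rw [← hcons]
  refine ⟨?_, fun y => ⟨?_, fun hy => ?_⟩, ?_, ?_⟩
  · refine List.Nodup.map_on ?_ List.nodup_range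
    intro i hi j hj hij
    refine Function.iterate_injOn_Iio_minimalPeriod (f := π) (x := x) ?_ ?_ hij
    · rw [hm]; simpa using hi
    · rw [hm]; simpa using hj
  · intro hy
    obtain ⟨i, -, rfl⟩ := List.mem_map.1 hy
    exact ⟨i, by simp [Equiv.Perm.iterate_eq_pow]⟩
  · obtain ⟨i, rfl⟩ := hy.exists_nat_pow_eq
    refine List.mem_map.2 ⟨i % (m + 1), by simpa using Nat.mod_lt _ (Nat.succ_pos m), ?_⟩
    have := Function.iterate_mod_minimalPeriod_eq (f := π) (x := x) (n := i)
    rw [hm] at this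
    rw [← Equiv.Perm.iterate_eq_pow]
    exact this
  · rw [List.isChain_map, List.isChain_range]
    intro i _
    exact Function.iterate_succ_apply' _ _ _
  · intro y hy
    rw [List.range_succ, List.map_append, List.map_singleton, List.getLast?_concat,
      Option.some.injEq] at hy
    rw [← hy, ← Function.iterate_succ_apply' π m x, Nat.succ_eq_add_one, ← hm]
    exact Function.iterate_minimalPeriod

theorem card_eq_length {p : D → Prop} {l : List D} (h1 : l.Nodup)
    (h2 : ∀ y, y ∈ l ↔ p y) : Nat.card {y // p y} = l.length := by
  classical
  rw [← List.toFinset_card_of_nodup h1, ← Nat.card_eq_finsetCard]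
  exact Nat.card_congr (Equiv.subtypeEquivRight fun y => by simp [h2])

theorem card_eq_sum_fibers {A B : Type*} [Finite A] (p : A → B) (S : B → Prop)
    [Fintype {b // S b}] :
    Nat.card {a // S (p a)} = ∑ b : {b // S b}, Nat.card {a // p a = b} := by
  let e : {a // S (p a)} ≃ Σ b : {b // S b}, {a // p a = b} :=
    { toFun := fun a => ⟨⟨p a, a.2⟩, a, rfl⟩
      invFun := fun x => ⟨x.2, by rw [x.2.2]; exact x.1.2⟩
      left_inv := fun _ => rfl
      right_inv := by
        rintro ⟨⟨b, hb⟩, a, ha⟩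
        have ha' : p a = b := ha
        subst ha'
        rfl }
  rw [Nat.card_congr e, Nat.card_sigma]

theorem card_fibers {A B : Type*} [Finite A] [Finite B] (p : A → B) (S : B → Prop) (k : ℕ)
    (h : ∀ b, S b → Nat.card {a // p a = b} = k) :
    k * Nat.card {b // S b} = Nat.card {a // S (p a)} := by
  have := Fintype.ofFinite {b // S b}
  rw [card_eq_sum_fibers p S, Finset.sum_congr rfl fun b _ => h b.1 b.2]
  simp [mul_comm]

theorem mul_card_le_fibers {A B : Type*} [Finite A] [Finite B] (p : A → B) (S : B → Prop) (k : ℕ)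
    (h : ∀ b, S b → k ≤ Nat.card {a // p a = b}) :
    k * Nat.card {b // S b} ≤ Nat.card {a // S (p a)} := by
  have := Fintype.ofFinite {b // S b}
  rw [card_eq_sum_fibers p S]
  refine le_trans (le_of_eq ?_) (Finset.sum_le_sum fun b _ => h b.1 b.2)
  simp [mul_comm]

theorem card_add_card_not {A : Type*} [Finite A] (p q : A → Prop) :
    Nat.card {a // p a ∧ q a} + Nat.card {a // p a ∧ ¬ q a} = Nat.card {a // p a} := by
  classical
  rw [← Nat.card_sum]
  refine Nat.card_congr ⟨Sum.elim (fun a => ⟨a, a.2.1⟩) fun a => ⟨a, a.2.1⟩,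
    fun a => if h : q a then Sum.inl ⟨a, a.2, h⟩ else Sum.inr ⟨a, a.2, h⟩, ?_, ?_⟩
  · rintro (⟨a, h1, h2⟩ | ⟨a, h1, h2⟩) <;> simp [h2]
  · rintro ⟨a, h1⟩
    by_cases h : q a <;> simp [h]

theorem card_add_card_not' {A : Type*} [Finite A] (q : A → Prop) :
    Nat.card {a // q a} + Nat.card {a // ¬ q a} = Nat.card A := by
  classical
  rw [← Nat.card_sum]
  exact Nat.card_congr (Equiv.sumCompl q)

/-- A function invariant under a permutation is constant on its orbits. -/
theorem eq_of_sameCycle {A B : Type*} {π : Equiv.Perm A} {φ : A → B} (h : ∀ x, φ (π x) = φ x)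
    {x y : A} (hxy : π.SameCycle x y) : φ x = φ y := by
  have := mk_eq_iff_sameCycle.2 hxy
  exact congrArg (Quot.lift φ (by rintro x _ rfl; exact (h x).symm)) this

end Orbits

/-! ### Darts, vertices and arcs -/

namespace Diagram

variable {D : Type*} [Finite D] (M : Diagram D)

instance : Finite M.Vertex := inferInstanceAs (Finite (Quotient _))

instance : Finite M.Region := inferInstanceAs (Finite (Quotient _))

instance : Finite M.Arc := inferInstanceAs (Finite (Quotient _))

theorem next_apply (d : D) : M.next d = M.rot (M.flip d) := rfl

theorem next_flip (d : D) : M.next (M.flip d) = M.rot d := by rw [next_apply, M.flip_flip]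

theorem vert_eq_iff {d d' : D} : M.vert d = M.vert d' ↔ M.rot.SameCycle d d' := Quotient.eq

theorem region_eq_iff {d d' : D} : M.region d = M.region d' ↔ M.next.SameCycle d d' := Quotient.eq

@[simp] theorem vert_rot (d : D) : M.vert (M.rot d) = M.vert d :=
  M.vert_eq_iff.2 (Equiv.Perm.SameCycle.symm ⟨1, by simp⟩)

@[simp] theorem region_next (d : D) : M.region (M.next d) = M.region d :=
  M.region_eq_iff.2 (Equiv.Perm.SameCycle.symm ⟨1, by simp⟩)

@[simp] theorem region_rot (d : D) : M.region (M.rot d) = M.region (M.flip d) := by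
  rw [← next_flip, region_next]

@[simp] theorem vert_next (d : D) : M.vert (M.next d) = M.vert (M.flip d) := vert_rot M _

theorem exists_vert (v : M.Vertex) : ∃ d, M.vert d = v := Quotient.exists_rep v

theorem exists_region (f : M.Region) : ∃ d, M.region d = f := Quotient.exists_rep f

theorem exists_valence (d : D) : ∃ l, (d :: l).Nodup ∧
    (d :: l).IsChain (fun a b => b = M.rot a) ∧ (∀ y, (d :: l).getLast? = some y → M.rot y = d) ∧
    M.valence (M.vert d) = l.length + 1 := by
  obtain ⟨l, h1, h2, h3, h4⟩ := exists_orbit M.rot d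
  refine ⟨l, h1, h3, h4, ?_⟩
  rw [← List.length_cons, ← card_eq_length h1 h2]
  exact Nat.card_congr (Equiv.subtypeEquivRight fun y => by rw [eq_comm, vert_eq_iff])

theorem rot_of_valence_two {d : D} (h : M.valence (M.vert d) = 2) :
    M.rot (M.rot d) = d ∧ M.rot d ≠ d := by
  obtain ⟨l, h1, h2, h3, h4⟩ := M.exists_valence d
  obtain ⟨x, rfl⟩ := List.length_eq_one_iff.1 (by omega : l.length = 1)
  have h5 := h3 x (by simp)
  simp at h1 h2
  subst h2
  exact ⟨h5, fun h => h1 h.symm⟩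

theorem rot_of_valence_three {d : D} (h : M.valence (M.vert d) = 3) :
    M.rot (M.rot (M.rot d)) = d ∧ M.rot d ≠ d ∧ M.rot (M.rot d) ≠ d := by
  obtain ⟨l, h1, h2, h3, h4⟩ := M.exists_valence d
  obtain ⟨x, y, rfl⟩ := List.length_eq_two.1 (by omega : l.length = 2)
  have h5 := h3 y (by simp)
  simp at h1 h2
  obtain ⟨rfl, rfl⟩ := h2
  exact ⟨h5, fun h => h1.1.1 h.symm, fun h => h1.1.2 h.symm⟩

theorem two_mul_card_edges :
    2 * Nat.card (Quotient (Equiv.Perm.SameCycle.setoid M.flip)) = Nat.card D := by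
  have key : ∀ d d', M.flip.SameCycle d d' ↔ d' = d ∨ d' = M.flip d := by
    intro d d'
    constructor
    · rintro ⟨n, rfl⟩
      rcases Int.even_or_odd' n with ⟨k, rfl | rfl⟩
      · left
        have : M.flip ^ (2 : ℤ) = 1 := by ext x; simp [zpow_ofNat, pow_two, M.flip_flip]
        rw [zpow_mul, this]
        simp
      · right
        have : M.flip ^ (2 : ℤ) = 1 := by ext x; simp [zpow_ofNat, pow_two, M.flip_flip]
        rw [zpow_add, zpow_mul, this]
        simp
    · rintro (rfl | rfl)
      · exact ⟨0, rfl⟩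
      · exact ⟨1, by simp⟩
  have := card_fibers
    (fun d : D => (Quotient.mk _ d : Quotient (Equiv.Perm.SameCycle.setoid M.flip)))
    (fun _ => True) 2 (by
      intro b _
      induction b using Quotient.inductionOn with | _ d => ?_
      have e : ∀ d', (Quotient.mk _ d' : Quotient (Equiv.Perm.SameCycle.setoid M.flip)) =
          Quotient.mk _ d ↔ d' ∈ ({d, M.flip d} : Set D) := by
        intro d'
        rw [eq_comm, Quotient.eq]
        exact key d d'
      rw [Nat.card_congr (Equiv.subtypeEquivRight e)]
      exact Set.ncard_pair (M.flip_ne d).symm)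
  rw [Nat.card_congr (Equiv.subtypeUnivEquiv fun _ => trivial),
    Nat.card_congr (Equiv.subtypeUnivEquiv fun _ => trivial)] at this
  exact this

/-- Euler's formula, with the number of edges expressed by that of the darts. -/
theorem euler_darts : 2 * Nat.card M.Vertex + 2 * Nat.card M.Region = Nat.card D + 4 := by
  have h1 := M.euler
  have h2 := M.two_mul_card_edges
  have h3 : Nat.card M.Vertex = Nat.card (Quotient (Equiv.Perm.SameCycle.setoid M.rot)) := rfl
  have h4 : Nat.card M.Region =
    Nat.card (Quotient (Equiv.Perm.SameCycle.setoid (M.flip.trans M.rot))) := rfl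
  omega

end Diagram

/-! ### Special quadrangles: corners and arcs -/

theorem List.IsRotated.exists_append {β : Type*} {l l' : List β} (h : l ~r l') :
    ∃ a b, l = a ++ b ∧ l' = b ++ a := by
  obtain ⟨n, rfl⟩ := h
  exact ⟨_, _, (List.take_append_drop (n % l.length) l).symm, List.rotate_eq_drop_append_take_mod⟩

theorem List.IsChain.apply_mem {β : Type*} {g : β → β} {a r : List β} {o x : β}
    (h : (a ++ o :: r).IsChain fun x y => y = g x) (hx : x ∈ a) : g x ∈ a ∨ g x = o := by
  obtain ⟨a₁, a₂, rfl⟩ := List.append_of_mem hx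
  rcases a₂ with _ | ⟨y, a₂⟩
  · simp only [List.append_assoc, List.cons_append, List.nil_append, List.isChain_append] at h
    have := h.2.1
    simp only [List.isChain_cons_cons] at this
    exact Or.inr this.1.symm
  · simp only [List.append_assoc, List.cons_append, List.isChain_append] at h
    have := h.2.1
    simp only [List.isChain_cons_cons] at this
    exact Or.inl (by simp [← this.1])

namespace Diagram

variable {D : Type*} [Finite D] {M : Diagram D}

theorem Traces.next_last {f : M.Region} {x y : D} {l : List D} (h : M.Traces f (x :: l))
    (hy : (x :: l).getLast? = some y) : M.next y = x := by
  obtain ⟨h1, h2, h3⟩ := h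
  have hp : M.next.symm x ∈ x :: l := by
    rw [h2, ← region_next, Equiv.apply_symm_apply]
    exact (h2 x).1 (by simp)
  obtain ⟨l₁, l₂, hl⟩ := List.append_of_mem hp
  rcases l₂ with _ | ⟨q, l₂⟩
  · rw [hl, List.getLast?_concat, Option.some.injEq] at hy
    rw [← hy, Equiv.apply_symm_apply]
  · rw [hl, List.isChain_append] at h3
    have h4 := h3.2.1
    simp only [List.isChain_cons_cons, Equiv.apply_symm_apply] at h4
    rw [hl, h4.1] at h1
    exfalso
    rcases l₁ with _ | ⟨z, l₁⟩
    · simp only [List.nil_append, List.cons.injEq] at hl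
      simp [← hl.1] at h1
    · simp only [List.cons_append, List.cons.injEq] at hl
      simp [← hl.1] at h1

theorem Traces.of_isRotated {f : M.Region} {l l' : List D} (h : M.Traces f l) (hr : l ~r l') :
    M.Traces f l' := by
  refine ⟨hr.nodup_iff.1 h.1, fun d => by rw [← hr.mem_iff, h.2.1], ?_⟩
  obtain ⟨a, b, rfl, rfl⟩ := hr.exists_append
  have h3 := h.2.2
  rw [List.isChain_append] at h3 ⊢
  refine ⟨h3.2.1, h3.1, fun x hx y hy => ?_⟩
  rcases a with _ | ⟨y', a⟩
  · simp at hy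
  · obtain rfl : y' = y := by simpa using hy
    refine (Traces.next_last h ?_).symm
    rcases b with _ | ⟨z, b⟩
    · simp at hx
    · have : (y' :: a ++ z :: b).getLast? = some x := by
        rw [List.getLast?_append_of_ne_nil _ (by simp)]
        exact hx
      exact this

/-- An outer dart at a corner of the diagram, that is, at a vertex of valence 2. -/
def IsCorner (M : Diagram D) (o : D) : Prop := M.region o = M.outer ∧ M.rot (M.rot o) = o

theorem next_flip_next {o : D} (h : M.rot (M.rot (M.next o)) = M.next o) :
    M.next (M.flip (M.next o)) = M.flip o := by
  rw [next_flip]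
  exact M.rot.injective h

/-- A property of outer darts that is preserved when the boundary passes a corner is constant along
exterior arcs, since an arc continues only through vertices of valence 2. -/
theorem arc_induction (hS : M.IsSimple)
    (hv : ∀ d, M.valence (M.vert d) = 2 → M.region d = M.outer ∨ M.region (M.rot d) = M.outer)
    (Q : D → Prop) (hQ : ∀ o, M.IsCorner (M.next o) → (Q o ↔ Q (M.next o)))
    {d d' : D} (h : M.arc d = M.arc d') (hd : M.region (M.flip d) = M.outer)
    (hd' : M.region (M.flip d') = M.outer) : Q (M.flip d) ↔ Q (M.flip d') := by
  have key : ∀ x y, Relation.EqvGen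
      (fun d d' : D => d' = M.flip d ∨ (d' = M.next d ∧ M.valence (M.vert d') = 2)) x y →
      (((M.region x = M.outer ∧ Q x) ∨ (M.region (M.flip x) = M.outer ∧ Q (M.flip x))) ↔
        ((M.region y = M.outer ∧ Q y) ∨ (M.region (M.flip y) = M.outer ∧ Q (M.flip y)))) := by
    intro x y hxy
    induction hxy with
    | refl => rfl
    | symm _ _ _ ih => exact ih.symm
    | trans _ _ _ _ _ ih ih' => exact ih.trans ih'
    | rel x y hxy =>
      rcases hxy with rfl | ⟨rfl, hval⟩
      · rw [M.flip_flip, or_comm]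
      · have hrot := (M.rot_of_valence_two hval).1
        rcases hv _ hval with h1 | h1
        · have h2 := h1
          rw [region_next] at h2
          have h3 := hS.2 _ h1
          have h4 := hS.2 _ h2
          have := hQ x ⟨h1, hrot⟩
          tauto
        · have e := next_flip_next hrot
          rw [region_rot] at h1
          have h2 : M.region (M.flip x) = M.outer := by rw [← e, region_next, h1]
          have h3 := hS.2 _ h1
          have h4 := hS.2 _ h2
          rw [M.flip_flip] at h3 h4
          have := hQ (M.flip (M.next x)) ⟨by rw [region_next, h1], by
            rw [next_flip]
            exact congrArg M.rot hrot⟩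
          rw [e] at this
          tauto
  have := key d d' (Quotient.exact h)
  have h1 := hS.2 _ hd
  have h2 := hS.2 _ hd'
  rw [M.flip_flip] at h1 h2
  tauto

section Special

variable {sides : List (List D)}

theorem IsSpecial.valence_eq (h : M.IsSpecial sides) (v : M.Vertex) :
    M.valence v = 3 ∨ (M.valence v = 2 ∧ M.IsDistinguished sides v) := by
  by_cases hv : M.IsDistinguished sides v
  · exact Or.inr ⟨hv.1, hv⟩
  · exact Or.inl (h.2.2.2.2.2 v hv)

theorem IsSpecial.rot_ne (h : M.IsSpecial sides) (d : D) : M.rot d ≠ d := by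
  rcases h.valence_eq (M.vert d) with h1 | ⟨h1, -⟩
  · exact (M.rot_of_valence_three h1).2.1
  · exact (M.rot_of_valence_two h1).2

theorem IsSpecial.rot_rot_eq_iff (h : M.IsSpecial sides) (d : D) :
    M.rot (M.rot d) = d ↔ M.valence (M.vert d) = 2 := by
  rcases h.valence_eq (M.vert d) with h1 | ⟨h1, -⟩
  · have := (M.rot_of_valence_three h1).2.2
    simp [this, h1]
  · have := (M.rot_of_valence_two h1).1
    simp [this, h1]

theorem IsSpecial.rot_three (h : M.IsSpecial sides) {d : D} (hd : M.rot (M.rot d) ≠ d) :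
    M.rot (M.rot (M.rot d)) = d := by
  rcases h.valence_eq (M.vert d) with h1 | ⟨h1, -⟩
  · exact (M.rot_of_valence_three h1).1
  · exact absurd (M.rot_of_valence_two h1).1 hd

theorem IsSpecial.outer_of_mem (h : M.IsSpecial sides) {s : List D} (hs : s ∈ sides) {o : D}
    (ho : o ∈ s) : M.region o = M.outer :=
  (h.2.1.2.1.2.1 o).1 (List.mem_flatten.2 ⟨s, hs, ho⟩)

theorem IsSpecial.exists_side (h : M.IsSpecial sides) {o : D} (ho : M.region o = M.outer) :
    ∃ s ∈ sides, o ∈ s := List.mem_flatten.1 ((h.2.1.2.1.2.1 o).2 ho)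

theorem IsSpecial.side_unique (h : M.IsSpecial sides) {s t : List D} (hs : s ∈ sides)
    (ht : t ∈ sides) {o : D} (hos : o ∈ s) (hot : o ∈ t) : s = t := by
  have h1 := (List.nodup_flatten.1 h.2.1.2.1.1).2
  by_contra hne
  obtain ⟨i, hi, rfl⟩ := List.getElem_of_mem hs
  obtain ⟨j, hj, rfl⟩ := List.getElem_of_mem ht
  rcases lt_trichotomy i j with hij | rfl | hij
  · exact List.pairwise_iff_getElem.1 h1 i j hi hj hij hos hot
  · exact hne rfl
  · exact List.pairwise_iff_getElem.1 h1 j i hj hi hij hot hos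

theorem IsSpecial.isChain_side (h : M.IsSpecial sides) {s : List D} (hs : s ∈ sides) :
    s.IsChain fun a b => b = M.next a := by
  obtain ⟨s₁, s₂, rfl⟩ := List.append_of_mem hs
  have := h.2.1.2.1.2.2
  rw [List.flatten_append, List.flatten_cons, List.isChain_append, List.isChain_append] at this
  exact this.2.1.1

/-- The vertex of an outer dart lies exactly on the sides that contain the dart or the outer dart
preceding it. -/
theorem IsSpecial.onSide_iff (h : M.IsSpecial sides) {o : D} (ho : M.region (M.next o) = M.outer)
    {s : List D} (hs : s ∈ sides) : M.OnSide (M.vert (M.next o)) s ↔ o ∈ s ∨ M.next o ∈ s := by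
  constructor
  · rintro ⟨d, hd, hv | hv⟩
    · right
      rwa [← h.2.2.1.1 d _ (h.outer_of_mem hs hd) ho hv]
    · left
      rw [← vert_next] at hv
      have := h.2.2.1.1 (M.next d) _ (by rw [region_next]; exact h.outer_of_mem hs hd) ho hv
      rwa [← M.next.injective this]
  · rintro (h1 | h1)
    · exact ⟨o, h1, Or.inr (vert_next M o).symm⟩
    · exact ⟨_, h1, Or.inl rfl⟩

theorem IsSpecial.exists_isCorner (h : M.IsSpecial sides) {d : D}
    (hd : M.rot (M.rot d) = d) : ∃ o, M.IsCorner o ∧ (d = o ∨ d = M.rot o) := by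
  have hv := (h.rot_rot_eq_iff d).1 hd
  rcases h.valence_eq (M.vert d) with h1 | ⟨-, -, s, hs, -, -, -, ⟨x, hx, hxv⟩, -⟩
  · omega
  have key : ∀ o, M.region o = M.outer → M.vert o = M.vert d →
      ∃ o, M.IsCorner o ∧ (d = o ∨ d = M.rot o) := by
    intro o ho hod
    have ho2 : M.rot (M.rot o) = o := (h.rot_rot_eq_iff o).2 (by rw [hod, hv])
    refine ⟨o, ⟨ho, ho2⟩, ?_⟩
    obtain ⟨n, rfl⟩ := (M.vert_eq_iff).1 hod
    have e : ∀ k : ℕ, (M.rot ^ k) o = o ∨ (M.rot ^ k) o = M.rot o := by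
      intro k
      induction k with
      | zero => simp
      | succ k ih =>
        rw [pow_succ', Equiv.Perm.mul_apply]
        rcases ih with ih | ih <;> simp [ih, ho2]
    obtain ⟨k, hk⟩ := Equiv.Perm.SameCycle.exists_nat_pow_eq (f := M.rot) ⟨n, rfl⟩
    rw [← hk]
    exact e k
  rcases hxv with hxv | hxv
  · exact key x (h.outer_of_mem hs hx) hxv
  · exact key (M.next x) (by rw [region_next]; exact h.outer_of_mem hs hx) (by rw [vert_next, hxv])

theorem IsSpecial.outer_or_outer (h : M.IsSpecial sides) (d : D)
    (hd : M.valence (M.vert d) = 2) : M.region d = M.outer ∨ M.region (M.rot d) = M.outer := by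
  obtain ⟨o, ho, rfl | rfl⟩ := h.exists_isCorner ((h.rot_rot_eq_iff d).2 hd)
  · exact Or.inl ho.1
  · right
    rw [ho.2, ho.1]

/-- Corners are first vertices of sides. -/
theorem IsSpecial.head_of_isCorner (h : M.IsSpecial sides) {o : D} (ho : M.IsCorner o) :
    ∃ l, o :: l ∈ sides := by
  obtain ⟨p, rfl⟩ := M.next.surjective o
  have hp : M.region (M.next p) = M.outer := ho.1
  rcases h.valence_eq (M.vert (M.next p)) with h1 | ⟨-, -, s, hs, t, ht, hst, h1, h2⟩
  · rw [h.rot_rot_eq_iff _ |>.1 ho.2] at h1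
    omega
  rw [h.onSide_iff hp hs] at h1
  rw [h.onSide_iff hp ht] at h2
  have key : ∀ s ∈ sides, ∀ t ∈ sides, s ≠ t → M.next p ∈ s → p ∈ t →
      ∃ l, M.next p :: l ∈ sides := by
    intro s hs t ht hst h1 h2
    obtain ⟨s₁, s₂, rfl⟩ := List.append_of_mem h1
    rcases List.eq_nil_or_concat s₁ with rfl | ⟨s₁, x, rfl⟩
    · exact ⟨s₂, hs⟩
    · exfalso
      have hc : (s₁ ++ [x] ++ M.next p :: s₂).IsChain fun a b => b = M.next a := by
        simpa using h.isChain_side hs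
      rw [List.append_assoc, List.isChain_append] at hc
      have h4 := hc.2.1
      simp only [List.cons_append, List.nil_append, List.isChain_cons_cons] at h4
      refine hst (h.side_unique hs ht (o := p) ?_ h2)
      rw [M.next.injective h4.1]
      simp
  rcases h1 with h1 | h1 <;> rcases h2 with h2 | h2
  · exact absurd (h.side_unique hs ht h1 h2) hst
  · exact key t ht s hs (Ne.symm hst) h2 h1
  · exact key s hs t ht hst h1 h2
  · exact absurd (h.side_unique hs ht h1 h2) hst

theorem IsSpecial.geodesic_of_isRotated (h : M.IsSpecial sides) {sides' : List (List D)}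
    (hr : sides ~r sides') : M.Traces M.outer sides'.flatten := by
  refine h.2.1.2.1.of_isRotated ?_
  obtain ⟨a, b, rfl, rfl⟩ := hr.exists_append
  rw [List.flatten_append, List.flatten_append]
  exact List.isRotated_append

/-- No side is empty, because an empty side could be concatenated with the next one. -/
theorem IsSpecial.nil_notMem (h : M.IsSpecial sides) : [] ∉ sides := by
  intro hnil
  obtain ⟨b, mid, x, hr⟩ := exists_isRotated_cons h.1 hnil
  refine h.2.2.2.1 ⟨[], b, mid ++ [x], hr, h.2.1.1, ?_, ?_, ?_⟩
  · simpa using h.geodesic_of_isRotated hr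
  · intro s hs
    exact h.2.1.2.2.1 s (hr.mem_iff.2 (by simp at hs ⊢; tauto))
  · intro f hf he ⟨s, hs, hd⟩
    exact h.2.1.2.2.2 f hf he ⟨s, hr.mem_iff.2 (by simp at hs ⊢; tauto), hd⟩

/-- As two consecutive sides cannot be concatenated, there is a corner of the diagram between them,
and the face at this corner violates the condition on the faces along a single side. -/
theorem IsSpecial.corner_of_isRotated (h : M.IsSpecial sides) {a b : List D} {o c : D}
    {c' : List D} {rest : List (List D)} (hr : sides ~r a :: (o :: b) :: (c :: c') :: rest) :
    M.IsCorner o ∧ M.exteriorDegree (M.region (M.flip o)) = 1 ∧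
      M.interiorDegree (M.region (M.flip o)) ≤ 3 ∧
      ∀ o', M.region o' = M.outer → M.region (M.flip o') = M.region (M.flip o) →
        o' ∈ a ++ o :: b := by
  have htr := h.geodesic_of_isRotated hr
  have hmem : ∀ s, s ∈ a :: (o :: b) :: (c :: c') :: rest → s ∈ sides := fun s hs => hr.mem_iff.2 hs
  have ho : M.region o = M.outer := h.outer_of_mem (hmem (o :: b) (by simp)) (by simp)
  simp only [List.flatten_cons] at htr
  obtain ⟨f, hf, he, ⟨s, hs, hd⟩, hi⟩ : ∃ f, f ≠ M.outer ∧ M.exteriorDegree f = 1 ∧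
      (∃ s ∈ (a ++ o :: b) :: (c :: c') :: rest,
        ∀ d, M.region d = f → M.region (M.flip d) = M.outer → M.flip d ∈ s) ∧
      ¬ 4 ≤ M.interiorDegree f := by
    by_contra hno
    refine h.2.2.2.1 ⟨a, o :: b, (c :: c') :: rest, hr, h.2.1.1, ?_, ?_, ?_⟩
    · simpa using htr
    · intro s hs
      rcases List.mem_cons.1 hs with rfl | hs
      · rw [List.isChain_append]
        refine ⟨h.2.1.2.2.1 _ (hmem _ (by simp)), h.2.1.2.2.1 _ (hmem _ (by simp)), ?_⟩
        intro x hx y hy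
        have h3 := htr.2.2
        rw [List.isChain_append] at h3
        have := h3.2.2 x hx y (by simpa using hy)
        rw [this, next_apply]
        exact h.rot_ne _
      · exact h.2.1.2.2.1 s (hmem _ (by simp at hs ⊢; tauto))
    · intro f hf he hs
      by_contra hi
      exact hno ⟨f, hf, he, hs, hi⟩
  have hab : ∀ d, M.region d = f → M.region (M.flip d) = M.outer → M.flip d ∈ a ++ o :: b := by
    rcases List.mem_cons.1 hs with rfl | hs
    · exact hd
    · exact absurd (h.2.1.2.2.2 f hf he ⟨s, hmem _ (by simp at hs ⊢; tauto), hd⟩) hi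
  have hna : ∀ s ∈ sides, ∃ d, M.region d = f ∧ M.region (M.flip d) = M.outer ∧ M.flip d ∉ s := by
    intro s hs
    by_contra hno
    push Not at hno
    exact hi (h.2.1.2.2.2 f hf he ⟨s, hs, hno⟩)
  obtain ⟨d₁, hd₁, hd₁', hd₁b⟩ := hna a (hmem _ (by simp))
  obtain ⟨d₂, hd₂, hd₂', hd₂a⟩ := hna (o :: b) (hmem _ (by simp))
  have hd₁b : M.flip d₁ ∈ o :: b := (List.mem_append.1 (hab d₁ hd₁ hd₁')).resolve_left hd₁b
  have hd₂a : M.flip d₂ ∈ a := (List.mem_append.1 (hab d₂ hd₂ hd₂')).resolve_right hd₂a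
  have harc : M.arc d₁ = M.arc d₂ := by
    have := (Nat.card_eq_one_iff_unique.1 he).1
    exact congrArg Subtype.val (Subsingleton.elim
      (⟨M.arc d₁, d₁, rfl, hd₁, Or.inr hd₁'⟩ : {a : M.Arc // ∃ d, M.arc d = a ∧ M.region d = f ∧
        M.IsExterior d}) ⟨M.arc d₂, d₂, rfl, hd₂, Or.inr hd₂'⟩)
  have hnd := htr.1
  have hanb : ∀ x ∈ a, x ∉ o :: b := by
    intro x hx hx'
    rw [List.nodup_append] at hnd
    exact hnd.2.2 x hx x (by simp at hx' ⊢; tauto) rfl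
  have hanc : c ∉ a := by
    intro hx
    rw [List.nodup_append] at hnd
    exact hnd.2.2 c hx c (by simp) rfl
  -- otherwise, the exterior arc of `f` could not pass from the first side to the second
  have key : M.IsCorner o ∧ M.region (M.flip o) = f := by
    by_contra hcon
    have hQ := arc_induction h.2.2.1 h.outer_or_outer
      (fun x => x ∈ a ∧ M.region (M.flip x) = f) ?_ harc hd₁' hd₂'
    · exact hanb _ (hQ.2 ⟨hd₂a, by rw [M.flip_flip, hd₂]⟩).1 hd₁b
    · intro x hx
      have hxo : M.region x = M.outer := by rw [← hx.1, region_next]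
      have e : M.region (M.flip (M.next x)) = M.region (M.flip x) := by
        rw [← next_flip_next hx.2, region_next]
      rw [e]
      constructor
      · rintro ⟨h1, h2⟩
        refine ⟨(htr.2.2.apply_mem h1).resolve_right fun h3 => ?_, h2⟩
        rw [h3] at hx e
        exact hcon ⟨hx, e.trans h2⟩
      · rintro ⟨h1, h2⟩
        refine ⟨?_, h2⟩
        have h3 := hab (M.flip x) h2 (by rw [M.flip_flip, hxo])
        rw [M.flip_flip] at h3
        refine (List.mem_append.1 h3).resolve_right fun h4 => ?_
        have h5 := htr.2.2
        rw [List.isChain_append] at h5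
        rcases List.IsChain.apply_mem (by simpa using h5.2.1) h4 with h6 | h6
        · exact hanb _ h1 h6
        · exact hanc (h6 ▸ h1)
  obtain ⟨hc, rfl⟩ := key
  refine ⟨hc, he, by omega, fun o' h1 h2 => ?_⟩
  have := hab (M.flip o') h2 (by rw [M.flip_flip, h1])
  rwa [M.flip_flip] at this

end Special

end Diagram

namespace Diagram

variable {D : Type*} [Finite D] {M : Diagram D}

theorem interiorDegree_le (f : M.Region) :
    M.interiorDegree f ≤ Nat.card {d // M.region d = f ∧ ¬ M.IsExterior d} := by
  refine Nat.card_le_card_of_surjective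
    (fun d : {d // M.region d = f ∧ ¬ M.IsExterior d} =>
      (⟨M.arc d, d, rfl, d.2⟩ : {a : M.Arc // ∃ d, M.arc d = a ∧ M.region d = f ∧
        ¬ M.IsExterior d})) ?_
  rintro ⟨a, d, rfl, hd⟩
  exact ⟨⟨d, hd⟩, rfl⟩

theorem isExterior_flip {d : D} : M.IsExterior (M.flip d) ↔ M.IsExterior d := by
  unfold IsExterior
  rw [M.flip_flip, or_comm]

section Special

variable {sides : List (List D)}

theorem IsSpecial.seven_le (h : M.IsSpecial sides) {f : M.Region} (hf : f ≠ M.outer)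
    (he : ∀ d, M.region d = f → ¬ M.IsExterior d) :
    7 ≤ Nat.card {d // M.region d = f ∧ ¬ M.IsExterior d} := by
  refine (h.2.1.1.2 f hf ?_).trans (interiorDegree_le f)
  have : IsEmpty {a : M.Arc // ∃ d, M.arc d = a ∧ M.region d = f ∧ M.IsExterior d} :=
    ⟨fun ⟨_, d, _, h1, h2⟩ => he d h1 h2⟩
  exact Nat.card_of_isEmpty

theorem IsSpecial.four_le (h : M.IsSpecial sides) {o : D} (ho : M.region o = M.outer)
    (he : ∀ o', M.region o' = M.outer → M.region (M.flip o') = M.region (M.flip o) → o' = o) :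
    4 ≤ Nat.card {d // M.region d = M.region (M.flip o) ∧ ¬ M.IsExterior d} := by
  have hf := h.2.2.1.2 o ho
  have key : ∀ d, M.region d = M.region (M.flip o) → M.region (M.flip d) = M.outer →
      M.flip d = o := fun d h1 h2 => he _ h2 (by rw [M.flip_flip, h1])
  refine (h.2.1.2.2.2 _ hf ?_ ?_).trans (interiorDegree_le _)
  · refine Nat.card_eq_one_iff_unique.2 ⟨⟨?_⟩, ⟨⟨_, M.flip o, rfl, rfl, Or.inr ?_⟩⟩⟩
    · have e : ∀ d, M.region d = M.region (M.flip o) → M.IsExterior d → d = M.flip o := by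
        intro d h1 h2
        rw [← key d h1 (h2.resolve_left (by rw [h1]; exact hf)), M.flip_flip]
      rintro ⟨_, d, rfl, h1, h2⟩ ⟨_, d', rfl, h1', h2'⟩
      rw [Subtype.mk.injEq, e d h1 h2, e d' h1' h2']
    · rw [M.flip_flip, ho]
  · obtain ⟨s, hs, hos⟩ := h.exists_side ho
    exact ⟨s, hs, fun d h1 h2 => by rwa [key d h1 h2]⟩

theorem IsSpecial.nodup_of_mem (h : M.IsSpecial sides) {s : List D} (hs : s ∈ sides) : s.Nodup :=
  (List.nodup_flatten.1 h.2.1.2.1.1).1 s hs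

/-- Every side starts at a corner, has at least two edges, and the face at the corner has one
exterior arc and at most three interior arcs. -/
theorem IsSpecial.corner (h : M.IsSpecial sides) (hquad : sides.length = 4) {o : D} {b : List D}
    (hb : o :: b ∈ sides) : M.IsCorner o ∧ b ≠ [] ∧
      M.exteriorDegree (M.region (M.flip o)) = 1 ∧
      M.interiorDegree (M.region (M.flip o)) ≤ 3 := by
  obtain ⟨c, mid, a, hr⟩ := exists_isRotated_cons h.1 hb
  have hlen := hr.perm.length_eq
  simp only [hquad, List.length_cons, List.length_append, List.length_nil] at hlen
  obtain ⟨e, rfl⟩ := List.length_eq_one_iff.1 (by omega : mid.length = 1)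
  have hne : ∀ s, s ∈ (o :: b) :: c :: ([e] ++ [a]) → ∃ x l, s = x :: l := fun s hs =>
    List.exists_cons_of_ne_nil fun h0 => h.nil_notMem (h0 ▸ hr.mem_iff.2 hs)
  obtain ⟨c, c', rfl⟩ := hne c (by simp)
  obtain ⟨e, e', rfl⟩ := hne e (by simp)
  have hr' : sides ~r a :: (o :: b) :: (c :: c') :: [e :: e'] :=
    hr.trans (by
      simpa using List.isRotated_append (l := [o :: b, c :: c', e :: e']) (l' := [a]))
  obtain ⟨h1, h2, h3, h4⟩ := h.corner_of_isRotated hr'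
  refine ⟨h1, ?_, h2, h3⟩
  rintro rfl
  obtain ⟨h5, -⟩ := h.corner_of_isRotated (a := [o]) (rest := [a]) (by simpa using hr)
  have htr := h.geodesic_of_isRotated hr'
  have hoc : M.next o = c := by
    have h6 := htr.2.2
    simp only [List.flatten_cons, List.isChain_append] at h6
    simpa using (h6.2.1.2.2 o (by simp) c (by simp)).symm
  have h7 := h4 c h5.1 (by
    have := next_flip_next (o := o) (by rw [hoc]; exact h5.2)
    rw [hoc] at this
    rw [← this, region_next])
  have hnd := htr.1
  simp only [List.flatten_cons, ← List.append_assoc] at hnd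
  rw [List.append_assoc, List.nodup_append] at hnd
  obtain ⟨hnd, -⟩ := hnd
  rw [List.nodup_append] at hnd
  exact hnd.2.2 c h7 c (by simp) rfl

theorem IsSpecial.isCorner_iff (h : M.IsSpecial sides) (hquad : sides.length = 4) {o : D} :
    M.IsCorner o ↔ ∃ l, o :: l ∈ sides :=
  ⟨h.head_of_isCorner, fun ⟨_, hl⟩ => (h.corner hquad hl).1⟩

/-- Every side contains at least two edges, so that corners are not adjacent. -/
theorem IsSpecial.not_isCorner_next (h : M.IsSpecial sides) (hquad : sides.length = 4) {o : D}
    (ho : M.IsCorner o) : ¬ M.IsCorner (M.next o) := by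
  intro ho'
  obtain ⟨l, hl⟩ := h.head_of_isCorner ho
  obtain ⟨x, l, rfl⟩ := List.exists_cons_of_ne_nil (h.corner hquad hl).2.1
  obtain ⟨l', hl'⟩ := h.head_of_isCorner ho'
  have hc := h.isChain_side hl
  have hn := h.nodup_of_mem hl
  simp only [List.isChain_cons_cons] at hc
  obtain rfl := hc.1
  have := h.side_unique hl hl' (o := M.next o) (by simp) (by simp)
  simp only [List.cons.injEq] at this
  rw [← this.1] at hn
  simp at hn

theorem IsSpecial.card_isCorner (h : M.IsSpecial sides) (hquad : sides.length = 4) :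
    Nat.card {o // M.IsCorner o} = 4 := by
  have hsub : ∀ S : List (List D), (S.flatMap (List.take 1)).Sublist S.flatten := by
    intro S
    induction S with
    | nil => simp
    | cons s S ih =>
      rw [List.flatMap_cons, List.flatten_cons]
      exact (List.take_sublist 1 s).append ih
  have hlen : ∀ S : List (List D), [] ∉ S → (S.flatMap (List.take 1)).length = S.length := by
    intro S
    induction S with
    | nil => simp
    | cons s S ih =>
      intro hS
      simp only [List.mem_cons, not_or] at hS
      rw [List.flatMap_cons, List.length_append, ih hS.2, List.length_cons, List.length_take]
      have := List.length_pos_iff.2 (Ne.symm hS.1)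
      omega
  rw [← hquad, ← hlen sides h.nil_notMem]
  refine card_eq_length ((hsub sides).nodup h.2.1.2.1.1) fun o => ?_
  rw [h.isCorner_iff hquad, List.mem_flatMap]
  constructor
  · rintro ⟨s, hs, ho⟩
    rcases s with _ | ⟨x, s⟩
    · simp at ho
    · obtain rfl : o = x := by simpa using ho
      exact ⟨s, hs⟩
  · rintro ⟨l, hl⟩
    exact ⟨_, hl, by simp⟩

/-- Two boundary edges in the same arc are equal or meet at a corner. -/
theorem IsSpecial.arc_eq (h : M.IsSpecial sides) (hquad : sides.length = 4) {o o' : D}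
    (ho : M.region o = M.outer) (ho' : M.region o' = M.outer)
    (harc : M.arc (M.flip o) = M.arc (M.flip o')) :
    o' = o ∨ (M.IsCorner o' ∧ o' = M.next o) ∨ (M.IsCorner o ∧ o = M.next o') := by
  have := arc_induction h.2.2.1 h.outer_or_outer
    (fun x => x = o ∨ (M.IsCorner x ∧ x = M.next o) ∨ (M.IsCorner o ∧ o = M.next x)) ?_ harc
    (by rw [M.flip_flip, ho]) (by rw [M.flip_flip, ho'])
  · rw [M.flip_flip, M.flip_flip] at this
    exact this.1 (Or.inl rfl)
  · intro x hx
    constructor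
    · rintro (rfl | ⟨h1, -⟩ | ⟨-, h2⟩)
      · exact Or.inr (Or.inl ⟨hx, rfl⟩)
      · exact absurd hx (h.not_isCorner_next hquad h1)
      · exact Or.inl h2.symm
    · rintro (h1 | ⟨-, h2⟩ | ⟨h1, h2⟩)
      · exact Or.inr (Or.inr ⟨h1 ▸ hx, h1.symm⟩)
      · exact Or.inl (M.next.injective h2)
      · rw [h2] at h1
        exact absurd h1 (h.not_isCorner_next hquad hx)

end Special

end Diagram

/-! ### Cutting a diagram along two boundary edges of a face -/

namespace Diagram

variable {D : Type*} [Finite D] {M : Diagram D}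

/-- The dart belongs to one of the edges of `e` and `e'`. -/
def OnEdges (M : Diagram D) (e e' x : D) : Prop := x = e ∨ x = M.flip e ∨ x = e' ∨ x = M.flip e'

theorem onEdges_flip {e e' x : D} : M.OnEdges e e' (M.flip x) ↔ M.OnEdges e e' x := by
  have h : ∀ y, M.flip x = y ↔ x = M.flip y := fun y =>
    ⟨fun h => by rw [← h, M.flip_flip], fun h => by rw [h, M.flip_flip]⟩
  unfold OnEdges
  rw [h, h, h, h, M.flip_flip, M.flip_flip]
  tauto

open Classical in
/-- The involution reversing all darts except those of the edges `e` and `e'`. -/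
noncomputable def cutFlip (M : Diagram D) (e e' : D) : Equiv.Perm D :=
  Function.Involutive.toPerm (fun x => if M.OnEdges e e' x then x else M.flip x) (by
    intro x
    by_cases h : M.OnEdges e e' x
    · simp [h]
    · simp [h, onEdges_flip, M.flip_flip])

theorem cutFlip_of_onEdges {e e' x : D} (h : M.OnEdges e e' x) : M.cutFlip e e' x = x := if_pos h

theorem cutFlip_of_not {e e' x : D} (h : ¬ M.OnEdges e e' x) : M.cutFlip e e' x = M.flip x :=
  if_neg h

theorem cutFlip_cutFlip (e e' x : D) : M.cutFlip e e' (M.cutFlip e e' x) = x := by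
  by_cases h : M.OnEdges e e' x
  · rw [cutFlip_of_onEdges h, cutFlip_of_onEdges h]
  · rw [cutFlip_of_not h, cutFlip_of_not (onEdges_flip.not.2 h), M.flip_flip]

theorem cutFlip_ne_iff {e e' x : D} : M.cutFlip e e' x ≠ x ↔ ¬ M.OnEdges e e' x := by
  by_cases h : M.OnEdges e e' x
  · simp [h, cutFlip_of_onEdges h]
  · simp [h, cutFlip_of_not h, M.flip_ne]

/-- Removing one boundary edge does not disconnect a simple diagram, because the rest of the
boundary joins its ends. -/
theorem IsSimple.eq_of_remove_edge (hS : M.IsSimple) {o : D} (ho : M.region o = M.outer)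
    {B : Type*} {φ : M.Vertex → B}
    (hφ : ∀ d, d ≠ o → d ≠ M.flip o → φ (M.vert d) = φ (M.vert (M.flip d))) (v w : M.Vertex) :
    φ v = φ w := by
  have houter : ∀ k : ℕ, M.region ((M.next ^ k) (M.next o)) = M.outer := by
    intro k
    induction k with
    | zero => simpa using ho
    | succ k ih => rw [pow_succ', Equiv.Perm.mul_apply, region_next, ih]
  have hwalk : ∀ k : ℕ, (∀ j < k, (M.next ^ j) (M.next o) ≠ o) →
      φ (M.vert ((M.next ^ k) (M.next o))) = φ (M.vert (M.next o)) := by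
    intro k
    induction k with
    | zero => simp
    | succ k ih =>
      intro hk
      rw [← ih fun j hj => hk j (by omega), pow_succ', Equiv.Perm.mul_apply, vert_next]
      refine (hφ _ (hk k (by omega)) ?_).symm
      intro h
      exact hS.2 o ho (by rw [← h, houter])
  have hoo : φ (M.vert o) = φ (M.vert (M.flip o)) := by
    classical
    have hex : ∃ k : ℕ, (M.next ^ k) (M.next o) = o :=
      Equiv.Perm.SameCycle.exists_nat_pow_eq (Equiv.Perm.SameCycle.symm ⟨1, by simp⟩)
    have := hwalk (Nat.find hex) fun j hj => Nat.find_min hex hj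
    rwa [Nat.find_spec hex, vert_next] at this
  have key : ∀ x y, Relation.ReflTransGen (fun x y => y = M.rot x ∨ y = M.flip x) x y →
      φ (M.vert x) = φ (M.vert y) := by
    intro x y hxy
    induction hxy with
    | refl => rfl
    | @tail z _ _ h ih =>
      rw [ih]
      rcases h with rfl | rfl
      · rw [vert_rot]
      · by_cases h1 : z = o
        · rw [h1, hoo]
        · by_cases h2 : z = M.flip o
          · rw [h2, M.flip_flip, hoo]
          · exact hφ z h1 h2
  obtain ⟨x, rfl⟩ := M.exists_vert v
  obtain ⟨y, rfl⟩ := M.exists_vert w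
  exact key x y (M.connected x y)

section Cut

variable {e e' : D}

theorem card_onEdges (hS : M.IsSimple) (hne : e ≠ e') (he : M.region (M.flip e) = M.outer)
    (he' : M.region (M.flip e') = M.outer) : Nat.card {x // M.OnEdges e e' x} = 4 := by
  have h1 := hS.2 _ he
  have h2 := hS.2 _ he'
  rw [M.flip_flip] at h1 h2
  have h3 : e ≠ M.flip e' := fun h => h1 (h ▸ he')
  have h4 : M.flip e ≠ e' := fun h => h2 (h ▸ he)
  have h5 : M.flip e ≠ M.flip e' := fun h => hne (M.flip.injective h)
  refine card_eq_length (l := [e, M.flip e, e', M.flip e']) ?_ fun y => by simp [OnEdges]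
  simp [hne, h3, h4, h5, (M.flip_ne e).symm, (M.flip_ne e').symm]

/-- Removing two boundary edges leaves at most two components: removing the first leaves the diagram
connected. -/
theorem card_adjAway_le (hS : M.IsSimple) (he : M.region (M.flip e) = M.outer) :
    Nat.card (Quot (M.AdjAway e e')) ≤ 2 := by
  refine (card_quot_le_insert _ (M.vert e') (M.vert (M.flip e'))).trans ?_
  have : Subsingleton (Quot fun x y => M.AdjAway e e' x y ∨
      x = M.vert e' ∧ y = M.vert (M.flip e')) := by
    refine ⟨fun a b => ?_⟩
    induction a using Quot.inductionOn with | _ v => ?_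
    induction b using Quot.inductionOn with | _ w => ?_
    refine hS.eq_of_remove_edge he (φ := fun v => Quot.mk (fun x y => M.AdjAway e e' x y ∨
      x = M.vert e' ∧ y = M.vert (M.flip e')) v) (fun d h1 h2 => ?_) v w
    rw [M.flip_flip] at h2
    by_cases h3 : d = e'
    · exact Quot.sound (Or.inr (by rw [h3]; simp))
    · by_cases h4 : d = M.flip e'
      · subst h4
        rw [M.flip_flip]
        exact (Quot.sound (r := fun x y => M.AdjAway e e' x y ∨
          x = M.vert e' ∧ y = M.vert (M.flip e')) (Or.inr ⟨rfl, rfl⟩)).symm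
      · exact Quot.sound (Or.inl ⟨d, h2, h1, h3, h4, rfl, rfl⟩)
  have := Finite.card_le_one_iff_subsingleton.2 this
  omega

/-- The function on darts that records the region, where the regions of `e` and the unbounded region
are identified, is invariant under walking along the regions of the diagram without `e`, `e'`. -/
theorem region_cut {x : D} (he : M.region (M.flip e) = M.outer)
    (he' : M.region (M.flip e') = M.outer) (hf : M.region e' = M.region e) :
    M.region (M.rot (M.cutFlip e e' x)) = M.region x ∨
      ((M.region x = M.region e ∨ M.region x = M.outer) ∧
        (M.region (M.rot (M.cutFlip e e' x)) = M.region e ∨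
          M.region (M.rot (M.cutFlip e e' x)) = M.outer)) := by
  by_cases h : M.OnEdges e e' x
  · right
    rw [cutFlip_of_onEdges h, region_rot]
    rcases h with rfl | rfl | rfl | rfl <;> simp [he, he', hf, M.flip_flip]
  · left
    rw [cutFlip_of_not h, ← next_apply, region_next]

/-- Removing two boundary edges of the same face separates the diagram: it only merges the face and the
unbounded region, so that two edges but at most one region are lost. -/
theorem two_le_card_adjAway (hS : M.IsSimple) (hne : e ≠ e')
    (he : M.region (M.flip e) = M.outer) (he' : M.region (M.flip e') = M.outer)
    (hf : M.region e' = M.region e) : 2 ≤ Nat.card (Quot (M.AdjAway e e')) := by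
  have h1 := genus_inequality M.rot (M.cutFlip e e') (cutFlip_cutFlip e e')
  have h2 := M.euler_darts
  have h3 := card_onEdges hS hne he he'
  have h4 := card_add_card_not' (M.OnEdges e e')
  have h5 : numCycles M.rot = Nat.card M.Vertex := numCycles_eq _
  have h6 : Nat.card {x // M.cutFlip e e' x ≠ x} = Nat.card {x // ¬ M.OnEdges e e' x} :=
    Nat.card_congr (Equiv.subtypeEquivRight fun _ => cutFlip_ne_iff)
  have h7 : numOrbits M.rot (M.cutFlip e e') ≤ Nat.card (Quot (M.AdjAway e e')) := by
    have hs : ∀ x y, M.vert x = M.vert y → Quot.mk (fun x y => y = M.rot x ∨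
        y = M.cutFlip e e' x) x = Quot.mk _ y := fun x y hxy =>
      eq_of_sameCycle (fun x => (Quot.sound (r := fun x y => y = M.rot x ∨
        y = M.cutFlip e e' x) (Or.inl rfl)).symm) (M.vert_eq_iff.1 hxy)
    let φ : M.Vertex → Quot (fun x y => y = M.rot x ∨ y = M.cutFlip e e' x) :=
      fun v => Quot.mk _ (M.exists_vert v).choose
    have hφ : ∀ x, φ (M.vert x) = Quot.mk _ x := fun x => hs _ _ (M.exists_vert _).choose_spec
    refine Nat.card_le_card_of_surjective (Quot.lift φ ?_) ?_
    · rintro _ _ ⟨d, d1, d2, d3, d4, rfl, rfl⟩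
      rw [hφ, hφ]
      refine Quot.sound (Or.inr (cutFlip_of_not ?_).symm)
      rintro (h | h | h | h)
      exacts [d1 h, d2 h, d3 h, d4 h]
    · intro q
      induction q using Quot.inductionOn with | _ x => ?_
      exact ⟨Quot.mk _ (M.vert x), hφ x⟩
  have h8 : Nat.card M.Region ≤ numCycles (M.rot * M.cutFlip e e') + 1 := by
    have i1 : Nat.card M.Region ≤ Nat.card (Quot fun _ _ : M.Region => False) :=
      Nat.card_le_card_of_surjective (Quot.lift id fun _ _ h => h.elim) fun g => ⟨Quot.mk _ g, rfl⟩
    have i2 := card_quot_le_insert (fun _ _ : M.Region => False) (M.region e) M.outer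
    have i3 : Nat.card (Quot fun x y : M.Region => False ∨ x = M.region e ∧ y = M.outer) ≤
        numCycles (M.rot * M.cutFlip e e') := by
      refine Nat.card_le_card_of_surjective (Quot.lift (fun x => Quot.mk _ (M.region x)) ?_) ?_
      · rintro x _ rfl
        have i4 : Quot.mk (fun x y : M.Region => False ∨ x = M.region e ∧ y = M.outer)
          (M.region e) = Quot.mk _ M.outer := Quot.sound (Or.inr ⟨rfl, rfl⟩)
        rw [Equiv.Perm.mul_apply]
        rcases region_cut (x := x) he he' hf with h | ⟨h | h, h' | h'⟩
        · rw [h]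
        all_goals simp only [h, h', i4]
      · intro q
        induction q using Quot.inductionOn with | _ g => ?_
        obtain ⟨x, rfl⟩ := M.exists_region g
        exact ⟨Quot.mk _ x, rfl⟩
    omega
  omega

end Cut

end Diagram

namespace Diagram

variable {D : Type*} [Finite D] {M : Diagram D} {e e' : D}

section Component

variable {K : D → Prop}

theorem component_next_iff (hrot : ∀ x, K (M.rot x) ↔ K x)
    (hflip : ∀ x, ¬ M.OnEdges e e' x → (K (M.flip x) ↔ K x))
    (he : M.region (M.flip e) = M.outer) (he' : M.region (M.flip e') = M.outer)
    (hf : M.region e' = M.region e) {x y : D} (hxy : M.region x = M.region y)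
    (hx : ¬ (M.region x = M.region e ∨ M.region x = M.outer)) : K x ↔ K y := by
  have := eq_of_sameCycle (π := M.next) (φ := fun x => ¬ (M.region x = M.region e ∨
    M.region x = M.outer) ∧ K x) (fun x => ?_) (M.region_eq_iff.1 hxy)
  · simp only [← hxy, hx, not_false_eq_true, true_and, eq_iff_iff] at this
    exact this
  · simp only [region_next, eq_iff_iff, and_congr_right_iff]
    intro hx
    rw [next_apply, hrot]
    refine hflip x fun h => hx ?_
    rcases h with rfl | rfl | rfl | rfl <;> simp [he, he', hf]

/-- A component `K` of a simple diagram cut along two boundary edges of a face, with connected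
complement, contains a vertex of valence 2 or a region for which the number of edges plus the number
of boundary edges is at most five.  This is a Gauss–Bonnet argument: the genus inequality for the
complement of `K`, together with Euler's formula, bounds the number of regions in `K` from below. -/
theorem component_contradiction (hS : M.IsSimple) (hne : e ≠ e')
    (he : M.region (M.flip e) = M.outer) (he' : M.region (M.flip e') = M.outer)
    (hf : M.region e' = M.region e) (hrot : ∀ x, K (M.rot x) ↔ K x)
    (hflip : ∀ x, ¬ M.OnEdges e e' x → (K (M.flip x) ↔ K x))
    (hval : ∀ x, K x → M.valence (M.vert x) = 3) (hex : ∃ x, M.OnEdges e e' x ∧ ¬ K x)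
    (hs : Nat.card {x // M.OnEdges e e' x ∧ K x} ≤ 2)
    (hconn : ∀ x y : {x // ¬ K x}, Relation.EqvGen (fun x y : {x // ¬ K x} =>
      y.1 = M.rot x.1 ∨ (y.1 = M.flip x.1 ∧ ¬ M.OnEdges e e' x.1)) x y)
    (hdeg : ∀ x, K x → ¬ (M.region x = M.region e ∨ M.region x = M.outer) →
      6 ≤ Nat.card {y // M.region y = M.region x} +
        Nat.card {y // M.region y = M.region x ∧ M.region (M.flip y) = M.outer}) : False := by
  have hreg : ∀ {x y : D}, M.region x = M.region y →
      ¬ (M.region x = M.region e ∨ M.region x = M.outer) → (K x ↔ K y) :=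
    fun h1 h2 => component_next_iff hrot hflip he he' hf h1 h2
  have hvert : ∀ {x y : D}, M.vert x = M.vert y → (K x ↔ K y) := fun h1 =>
    (eq_of_sameCycle (φ := K) (fun x => propext (hrot x)) (M.vert_eq_iff.1 h1)).to_iff
  have heo : M.region e ≠ M.outer := by
    have := hS.2 _ he
    rwa [M.flip_flip] at this
  have hspec : ∀ x, M.OnEdges e e' x → M.region x = M.region e ∨ M.region x = M.outer := by
    rintro x (rfl | rfl | rfl | rfl) <;> simp [he, he', hf]
  have hcut : ∀ x, ¬ K (M.cutFlip e e' x) ↔ ¬ K x := by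
    intro x
    by_cases h : M.OnEdges e e' x
    · rw [cutFlip_of_onEdges h]
    · rw [cutFlip_of_not h, hflip x h]
  -- the complement of `K` as a pair of permutations
  let σ : Equiv.Perm {x // ¬ K x} := M.rot.subtypePerm fun x => not_congr (hrot x)
  let α : Equiv.Perm {x // ¬ K x} := (M.cutFlip e e').subtypePerm hcut
  have h1 := genus_inequality σ α fun x => Subtype.ext (cutFlip_cutFlip e e' x.1)
  have h2 : numOrbits σ α ≤ 1 := by
    refine Finite.card_le_one_iff_subsingleton.2 ⟨fun a b => ?_⟩
    induction a using Quot.inductionOn with | _ x => ?_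
    induction b using Quot.inductionOn with | _ y => ?_
    refine Quot.eqvGen_sound ((hconn x y).mono fun x y h => ?_)
    refine h.imp (fun h => Subtype.ext h) fun h => Subtype.ext ?_
    rw [h.1]
    exact (cutFlip_of_not h.2).symm
  have h3 : Nat.card {v : M.Vertex // ¬ ∃ x, K x ∧ M.vert x = v} ≤ numCycles σ := by
    refine Nat.card_le_card_of_surjective (Quot.lift (fun x => ⟨M.vert x.1, ?_⟩) ?_) ?_
    · rintro ⟨y, hy, hyx⟩
      exact x.2 ((hvert hyx).1 hy)
    · rintro x _ rfl
      exact Subtype.ext (vert_rot M x.1).symm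
    · rintro ⟨v, hv⟩
      obtain ⟨x, rfl⟩ := M.exists_vert v
      exact ⟨Quot.mk _ ⟨x, fun hx => hv ⟨x, hx, rfl⟩⟩, rfl⟩
  have h4 : Nat.card {g : M.Region // g = M.outer ∨ (¬ (g = M.region e ∨ g = M.outer) ∧
      ¬ ∃ x, K x ∧ M.region x = g)} ≤ numCycles (σ * α) := by
    classical
    refine Nat.card_le_card_of_surjective (Quot.lift (fun x => ⟨if M.region x.1 = M.region e then
      M.outer else M.region x.1, ?_⟩) ?_) ?_
    · split_ifs with h
      · exact Or.inl rfl
      · by_cases h' : M.region x.1 = M.outer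
        · exact Or.inl h'
        · refine Or.inr ⟨by tauto, ?_⟩
          rintro ⟨y, hy, hyx⟩
          exact x.2 ((hreg hyx (by rw [hyx]; tauto)).1 hy)
    · rintro x _ rfl
      refine Subtype.ext ?_
      change _ = if M.region (M.rot (M.cutFlip e e' x.1)) = M.region e then _ else
        M.region (M.rot (M.cutFlip e e' x.1))
      rcases region_cut (x := x.1) he he' hf with h | ⟨h | h, h' | h'⟩
      · rw [h]
      all_goals simp [h, h']
    · rintro ⟨g, rfl | ⟨h5, h6⟩⟩
      · obtain ⟨x, hx, hx'⟩ := hex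
        refine ⟨Quot.mk _ ⟨x, hx'⟩, Subtype.ext ?_⟩
        rcases hspec x hx with h | h <;> simp [h]
      · obtain ⟨x, rfl⟩ := M.exists_region g
        refine ⟨Quot.mk _ ⟨x, fun hx => h6 ⟨x, hx, rfl⟩⟩, Subtype.ext ?_⟩
        exact if_neg (by tauto)
  have h5 : Nat.card {x : {x // ¬ K x} // α x ≠ x} =
      Nat.card {x // ¬ K x ∧ ¬ M.OnEdges e e' x} := by
    rw [← Nat.card_congr (Equiv.subtypeSubtypeEquivSubtypeInter (fun x => ¬ K x)
      fun x => ¬ M.OnEdges e e' x)]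
    refine Nat.card_congr (Equiv.subtypeEquivRight fun x => ?_)
    rw [← cutFlip_ne_iff]
    exact not_congr Subtype.ext_iff
  -- counts of vertices, darts and regions
  have c1 := card_add_card_not' (fun v : M.Vertex => ∃ x, K x ∧ M.vert x = v)
  have c2 := card_add_card_not' K
  have c3 := card_add_card_not (fun x => ¬ K x) (M.OnEdges e e')
  have c4 := card_add_card_not (M.OnEdges e e') K
  rw [card_onEdges hS hne he he'] at c4
  have c5 : Nat.card {x // ¬ K x ∧ M.OnEdges e e' x} = Nat.card {x // M.OnEdges e e' x ∧ ¬ K x} :=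
    Nat.card_congr (Equiv.subtypeEquivRight fun x => and_comm)
  have c6 : 3 * Nat.card {v : M.Vertex // ∃ x, K x ∧ M.vert x = v} = Nat.card {x // K x} := by
    have := card_fibers M.vert (fun v => ∃ x, K x ∧ M.vert x = v) 3 (by
      rintro _ ⟨x, hx, rfl⟩
      exact hval x hx)
    rw [this]
    exact Nat.card_congr (Equiv.subtypeEquivRight fun x =>
      ⟨fun ⟨y, hy, hyx⟩ => (hvert hyx).1 hy, fun hx => ⟨x, hx, rfl⟩⟩)
  have c7 : Nat.card {g : M.Region // g = M.region e ∨ g = M.outer} = 2 := Set.ncard_pair heo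
  have c8 := card_add_card_not' (fun g : M.Region => g = M.region e ∨ g = M.outer)
  have c9 := card_add_card_not (fun g : M.Region => ¬ (g = M.region e ∨ g = M.outer))
    (fun g => ∃ x, K x ∧ M.region x = g)
  have c10 := card_add_card_not (fun g : M.Region => g = M.outer ∨
    (¬ (g = M.region e ∨ g = M.outer) ∧ ¬ ∃ x, K x ∧ M.region x = g)) (fun g => g = M.outer)
  have c11 : Nat.card {g : M.Region // (g = M.outer ∨
      (¬ (g = M.region e ∨ g = M.outer) ∧ ¬ ∃ x, K x ∧ M.region x = g)) ∧ g = M.outer} = 1 := by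
    rw [Nat.card_congr (Equiv.subtypeEquivRight (q := fun g => g = M.outer) fun g => by tauto)]
    simp
  have c12 : Nat.card {g : M.Region // (g = M.outer ∨
      (¬ (g = M.region e ∨ g = M.outer) ∧ ¬ ∃ x, K x ∧ M.region x = g)) ∧ ¬ g = M.outer} =
      Nat.card {g : M.Region // ¬ (g = M.region e ∨ g = M.outer) ∧
        ¬ ∃ x, K x ∧ M.region x = g} :=
    Nat.card_congr (Equiv.subtypeEquivRight fun g => by tauto)
  have hE := M.euler_darts
  -- each region in `K` contributes at least six
  have d1 : 6 * Nat.card {g : M.Region // ¬ (g = M.region e ∨ g = M.outer) ∧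
      ∃ x, K x ∧ M.region x = g} ≤
      Nat.card {x // K x ∧ ¬ (M.region x = M.region e ∨ M.region x = M.outer)} +
      Nat.card {x // (K x ∧ ¬ (M.region x = M.region e ∨ M.region x = M.outer)) ∧
        M.region (M.flip x) = M.outer} := by
    have := mul_card_le_fibers
      (Sum.elim M.region fun x : {x // M.region (M.flip x) = M.outer} => M.region x.1)
      (fun g => ¬ (g = M.region e ∨ g = M.outer) ∧ ∃ x, K x ∧ M.region x = g) 6 (by
        rintro _ ⟨hx', x, hx, rfl⟩
        refine (hdeg x hx hx').trans (le_of_eq ?_)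
        rw [Nat.card_congr Equiv.subtypeSum, Nat.card_sum]
        congr 1
        refine Eq.trans ?_ (Nat.card_congr (Equiv.subtypeSubtypeEquivSubtypeInter
          (fun x => M.region (M.flip x) = M.outer) fun y => M.region y = M.region x)).symm
        exact Nat.card_congr (Equiv.subtypeEquivRight fun x => and_comm))
    refine this.trans (le_of_eq ?_)
    have hS' : ∀ x, (¬ (M.region x = M.region e ∨ M.region x = M.outer) ∧
        ∃ y, K y ∧ M.region y = M.region x) ↔
        K x ∧ ¬ (M.region x = M.region e ∨ M.region x = M.outer) := by
      intro x
      constructor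
      · rintro ⟨h1, y, hy, hyx⟩
        exact ⟨(hreg hyx (by rwa [hyx])).1 hy, h1⟩
      · rintro ⟨h1, h2⟩
        exact ⟨h2, x, h1, rfl⟩
    rw [Nat.card_congr Equiv.subtypeSum, Nat.card_sum]
    congr 1
    · exact Nat.card_congr (Equiv.subtypeEquivRight hS')
    · refine (Nat.card_congr (Equiv.subtypeSubtypeEquivSubtypeInter
        (fun x => M.region (M.flip x) = M.outer) fun x => ¬ (M.region x = M.region e ∨
          M.region x = M.outer) ∧ ∃ y, K y ∧ M.region y = M.region x)).trans ?_
      exact Nat.card_congr (Equiv.subtypeEquivRight fun x => by rw [hS', and_comm])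
  have d2 := card_add_card_not K (fun x => M.region x = M.region e ∨ M.region x = M.outer)
  have d3 : Nat.card {x // (K x ∧ ¬ (M.region x = M.region e ∨ M.region x = M.outer)) ∧
        M.region (M.flip x) = M.outer} + Nat.card {x // M.OnEdges e e' x ∧ K x} ≤
      Nat.card {x // K x ∧ (M.region x = M.region e ∨ M.region x = M.outer)} := by
    rw [← Nat.card_sum]
    refine Nat.card_le_card_of_injective (Sum.elim
      (fun x => ⟨M.flip x.1, (hflip x.1 fun h => x.2.1.2 (hspec _ h)).2 x.2.1.1, Or.inr x.2.2⟩)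
      fun x => ⟨x.1, x.2.2, hspec _ x.2.1⟩) ?_
    rintro (⟨x, hx⟩ | ⟨x, hx⟩) (⟨y, hy⟩ | ⟨y, hy⟩) hxy
    · have := M.flip.injective (Subtype.ext_iff.1 hxy)
      subst this
      rfl
    · have : M.flip x = y := Subtype.ext_iff.1 hxy
      rw [← this, onEdges_flip] at hy
      exact absurd (hspec _ hy.1) hx.1.2
    · have : x = M.flip y := Subtype.ext_iff.1 hxy
      rw [this, onEdges_flip] at hx
      exact absurd (hspec _ hx.1) hy.1.2
    · have : x = y := Subtype.ext_iff.1 hxy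
      subst this
      rfl
  -- the genus inequality bounds the Euler characteristic of `K` from below, while `c6` and `d1` to
  -- `d3` bound it from above
  omega

end Component

end Diagram

namespace Diagram

variable {D : Type*} [Finite D] {M : Diagram D} {sides : List (List D)}

theorem card_region_eq {f : M.Region} (hf : f ≠ M.outer) :
    Nat.card {d // M.region d = f} = Nat.card {d // M.region d = f ∧ ¬ M.IsExterior d} +
      Nat.card {d // M.region d = f ∧ M.region (M.flip d) = M.outer} := by
  rw [← card_add_card_not (fun d => M.region d = f) M.IsExterior, add_comm]
  congr 1
  refine Nat.card_congr (Equiv.subtypeEquivRight fun d => and_congr_right fun h => ?_)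
  unfold IsExterior
  rw [h]
  simp [hf]

/-- At a vertex of valence 3, the dart following a boundary edge of a face is interior. -/
theorem IsSimple.not_isExterior_rot (hS : M.IsSimple) {o : D} (ho : M.region o = M.outer)
    (h3 : M.rot (M.rot (M.rot o)) = o) (h1 : M.rot o ≠ o) : ¬ M.IsExterior (M.rot o) := by
  rintro (h | h)
  · exact h1 (hS.1 _ _ h ho (vert_rot M o))
  · obtain ⟨p, hp⟩ := M.next.surjective o
    have e : M.flip p = M.rot (M.rot o) := M.rot.injective (by rw [h3]; exact hp)
    refine hS.2 p (by rw [← region_next, hp, ho]) ?_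
    rw [e, region_rot, h]

/-- A face all of whose boundary vertices have valence 3 has at least six edges, boundary edges
being counted twice. -/
theorem IsSpecial.six_le (h : M.IsSpecial sides) {f : M.Region} (hf : f ≠ M.outer)
    (hv : ∀ o, M.region o = M.outer → M.region (M.flip o) = f → M.valence (M.vert o) = 3) :
    6 ≤ Nat.card {d // M.region d = f} +
      Nat.card {d // M.region d = f ∧ M.region (M.flip d) = M.outer} := by
  have h1 := card_region_eq hf
  have h2 : Nat.card {d // M.region d = f ∧ M.region (M.flip d) = M.outer} ≤
      Nat.card {d // M.region d = f ∧ ¬ M.IsExterior d} := by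
    refine Nat.card_le_card_of_injective (fun d => ⟨M.next d.1, ?_⟩) ?_
    · obtain ⟨d, hd, hd'⟩ := d
      have := M.rot_of_valence_three (hv _ hd' (by rw [M.flip_flip, hd]))
      exact ⟨by rw [region_next, hd], h.2.2.1.not_isExterior_rot hd' this.1 this.2.1⟩
    · intro d d' hdd
      exact Subtype.ext (M.next.injective (Subtype.ext_iff.1 hdd))
  rcases (by omega : Nat.card {d // M.region d = f ∧ M.region (M.flip d) = M.outer} = 0 ∨
      Nat.card {d // M.region d = f ∧ M.region (M.flip d) = M.outer} = 1 ∨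
      2 ≤ Nat.card {d // M.region d = f ∧ M.region (M.flip d) = M.outer}) with h3 | h3 | h3
  · have := h.seven_le hf fun d hd hd' => by
      have hne : Nonempty {d // M.region d = f ∧ M.region (M.flip d) = M.outer} :=
        ⟨d, hd, hd'.resolve_left (by rw [hd]; exact hf)⟩
      exact Nat.card_pos.ne' h3
    omega
  · obtain ⟨⟨hs⟩, ⟨⟨d, hd, hd'⟩⟩⟩ := Nat.card_eq_one_iff_unique.1 h3
    have := h.four_le hd' fun o ho ho' => by
      rw [M.flip_flip, hd] at ho'
      have : M.flip o = d := Subtype.ext_iff.1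
        (hs ⟨M.flip o, ho', by rw [M.flip_flip, ho]⟩ ⟨d, hd, hd'⟩)
      rw [← this, M.flip_flip]
    rw [M.flip_flip, hd] at this
    omega
  · omega

/-- Two distinct boundary edges of the same face meet at a corner: otherwise, a face reduction would
be possible. -/
theorem IsSpecial.eq_or_corner (h : M.IsSpecial sides) (hquad : sides.length = 4) {o o' : D}
    (ho : M.region o = M.outer) (ho' : M.region o' = M.outer)
    (hf : M.region (M.flip o') = M.region (M.flip o)) :
    o' = o ∨ (M.IsCorner o' ∧ o' = M.next o) ∨ (M.IsCorner o ∧ o = M.next o') := by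
  have hS := h.2.2.1
  by_contra hcon
  have harc : M.arc (M.flip o) ≠ M.arc (M.flip o') := fun harc => hcon (h.arc_eq hquad ho ho' harc)
  obtain ⟨e, he⟩ : ∃ e, e = M.flip o := ⟨_, rfl⟩
  obtain ⟨e', he'⟩ : ∃ e', e' = M.flip o' := ⟨_, rfl⟩
  rw [← he, ← he'] at hf harc
  have heo : M.flip e = o := by rw [he, M.flip_flip]
  have heo' : M.flip e' = o' := by rw [he', M.flip_flip]
  have hee : e ≠ e' := fun h => harc (by rw [h])
  have ho1 : M.region (M.flip e) = M.outer := by rw [heo, ho]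
  have ho1' : M.region (M.flip e') = M.outer := by rw [heo', ho']
  have hfo : M.region e ≠ M.outer := he ▸ hS.2 o ho
  have hcard : Nat.card (Quot (M.AdjAway e e')) = 2 :=
    le_antisymm (card_adjAway_le hS ho1) (two_le_card_adjAway hS hee ho1 ho1' hf)
  refine h.2.2.2.2.1 (Or.inr (Or.inr ⟨M.region e, e, e', hfo, ?_, hee, rfl, hf, ho1, ho1', ?_, ?_,
    hcard, ?_⟩))
  · have : Nontrivial {a : M.Arc // ∃ d, M.arc d = a ∧ M.region d = M.region e ∧
        M.IsExterior d} :=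
      ⟨⟨M.arc e, e, rfl, rfl, Or.inr ho1⟩, ⟨M.arc e', e', rfl, hf, Or.inr ho1'⟩,
        fun h => harc (Subtype.ext_iff.1 h)⟩
    exact Finite.one_lt_card_iff_nontrivial.2 this
  · obtain ⟨s, hs, hos⟩ := h.exists_side ho1
    exact ⟨s, ⟨hs, hos⟩, fun t ht => h.side_unique ht.1 hs ht.2 hos⟩
  · obtain ⟨s, hs, hos⟩ := h.exists_side ho1'
    exact ⟨s, ⟨hs, hos⟩, fun t ht => h.side_unique ht.1 hs ht.2 hos⟩
  -- a component `c` without a distinguished vertex has only vertices of valence 3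
  · intro c
    by_contra hno
    push Not at hno
    have hadj : ∀ x, ¬ M.OnEdges e e' x → Quot.mk (M.AdjAway e e') (M.vert x) =
        Quot.mk (M.AdjAway e e') (M.vert (M.flip x)) := by
      intro x hx
      unfold OnEdges at hx
      push Not at hx
      exact Quot.sound ⟨x, hx.1, hx.2.1, hx.2.2.1, hx.2.2.2, rfl, rfl⟩
    obtain ⟨c', hc', hc2⟩ := (Nat.card_eq_two_iff' c).1 hcard
    have hval : ∀ x, Quot.mk (M.AdjAway e e') (M.vert x) = c → M.valence (M.vert x) = 3 := by
      intro x hx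
      rcases h.valence_eq (M.vert x) with h1 | ⟨-, h1⟩
      · exact h1
      · exact absurd hx (hno _ h1)
    -- not both ends of one of the two edges lie in the component `c`
    have hends : ∀ o₁ e₂, M.region o₁ = M.outer →
        (∀ x, x ≠ o₁ → x ≠ M.flip o₁ → x ≠ e₂ → x ≠ M.flip e₂ → ¬ M.OnEdges e e' x) →
        ¬ (Quot.mk (M.AdjAway e e') (M.vert e₂) = c ∧
          Quot.mk (M.AdjAway e e') (M.vert (M.flip e₂)) = c) := by
      rintro o₁ e₂ h2 h3 ⟨h4, h5⟩
      have := hS.eq_of_remove_edge h2 (φ := fun v => (Quot.mk (M.AdjAway e e') v = c))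
        (fun d d1 d2 => ?_)
      · obtain ⟨v, hv⟩ := Quot.exists_rep c'
        have h6 := this (M.vert e₂) v
        simp only [h4, eq_iff_iff, true_iff, hv] at h6
        exact hc' h6
      · by_cases d3 : d = e₂
        · rw [d3, h4, h5]
        by_cases d4 : d = M.flip e₂
        · rw [d4, M.flip_flip, h4, h5]
        rw [hadj d (h3 d d1 d2 d3 d4)]
    have hne1 := hends o e' ho fun x h1 h2 h3 h4 h5 => by
      rcases h5 with h5 | h5 | h5 | h5
      · exact h2 (h5.trans he)
      · exact h1 (h5.trans heo)
      · exact h3 h5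
      · exact h4 h5
    have hne2 := hends o' e ho' fun x h1 h2 h3 h4 h5 => by
      rcases h5 with h5 | h5 | h5 | h5
      · exact h3 h5
      · exact h4 h5
      · exact h2 (h5.trans he')
      · exact h1 (h5.trans heo')
    refine component_contradiction (K := fun x => Quot.mk (M.AdjAway e e') (M.vert x) = c) hS hee
      ho1 ho1' hf (fun x => by rw [vert_rot]) (fun x hx => by rw [hadj x hx]) hval ?_ ?_ ?_ ?_
    · by_contra hno2
      push Not at hno2
      exact hne2 ⟨hno2 e (by simp [OnEdges]), hno2 _ (by simp [OnEdges])⟩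
    -- each of the two edges has at most one end in `c`
    · classical
      have key : ∀ x, M.OnEdges e e' x ∧ Quot.mk (M.AdjAway e e') (M.vert x) = c →
          x = (if Quot.mk (M.AdjAway e e') (M.vert e) = c then e else M.flip e) ∨
          x = (if Quot.mk (M.AdjAway e e') (M.vert e') = c then e' else M.flip e') := by
        rintro x ⟨rfl | rfl | rfl | rfl, hx⟩
        · left; rw [if_pos hx]
        · left; rw [if_neg fun h => hne2 ⟨h, hx⟩]
        · right; rw [if_pos hx]
        · right; rw [if_neg fun h => hne1 ⟨h, hx⟩]
      refine (Nat.card_mono (Set.toFinite _) key).trans ?_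
      exact (Set.ncard_insert_le _ _).trans (Nat.succ_le_succ (Set.ncard_singleton _).le)
    -- the darts outside of `c` form the other component, so that they are connected
    · have hvert : ∀ x y : {x // ¬ Quot.mk (M.AdjAway e e') (M.vert x) = c},
          M.vert x.1 = M.vert y.1 → Relation.EqvGen (fun x y : {x //
            ¬ Quot.mk (M.AdjAway e e') (M.vert x) = c} => y.1 = M.rot x.1 ∨
              (y.1 = M.flip x.1 ∧ ¬ M.OnEdges e e' x.1)) x y := by
        rintro ⟨x, hx⟩ ⟨y, hy⟩ hxy
        obtain ⟨n, hn⟩ := Equiv.Perm.SameCycle.exists_nat_pow_eq (M.vert_eq_iff.1 hxy)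
        simp only at hn
        induction n generalizing y with
        | zero =>
          obtain rfl : x = y := by simpa using hn
          exact .refl _
        | succ n ih =>
          rw [pow_succ', Equiv.Perm.mul_apply] at hn
          have h6 : M.vert ((M.rot ^ n) x) = M.vert y := by rw [← hn, vert_rot]
          exact .trans _ _ _ (ih _ (by rw [h6]; exact hy) (by rw [h6]; exact hxy) rfl)
            (.rel _ _ (Or.inl hn.symm))
      intro x y
      have hxy : Quot.mk (M.AdjAway e e') (M.vert x.1) = Quot.mk _ (M.vert y.1) :=
        (hc2 _ x.2).trans (hc2 _ y.2).symm
      have key : ∀ v w, Relation.EqvGen (M.AdjAway e e') v w →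
          ∀ x y : {x // ¬ Quot.mk (M.AdjAway e e') (M.vert x) = c}, M.vert x.1 = v →
          M.vert y.1 = w → Relation.EqvGen (fun x y : {x //
            ¬ Quot.mk (M.AdjAway e e') (M.vert x) = c} => y.1 = M.rot x.1 ∨
              (y.1 = M.flip x.1 ∧ ¬ M.OnEdges e e' x.1)) x y := by
        intro v w hvw
        induction hvw with
        | refl v => exact fun x y h1 h2 => hvert x y (h1.trans h2.symm)
        | symm _ _ _ ih => exact fun x y h1 h2 => (ih y x h2 h1).symm
        | trans v u w h1 _ ih ih' =>
          intro x y hx hy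
          obtain ⟨z, rfl⟩ := M.exists_vert u
          have hz : ¬ Quot.mk (M.AdjAway e e') (M.vert z) = c := by
            rw [← Quot.eqvGen_sound h1, ← hx]
            exact x.2
          exact (ih x ⟨z, hz⟩ hx rfl).trans _ _ _ (ih' ⟨z, hz⟩ y rfl hy)
        | rel v w hvw =>
          obtain ⟨d, d1, d2, d3, d4, rfl, rfl⟩ := hvw
          intro x y hx hy
          have hd : ¬ Quot.mk (M.AdjAway e e') (M.vert d) = c := by
            rw [← hx]
            exact x.2
          have hd' : ¬ Quot.mk (M.AdjAway e e') (M.vert (M.flip d)) = c := by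
            rw [← hy]
            exact y.2
          refine .trans _ _ _ (hvert x ⟨d, hd⟩ hx) (.trans _ _ _ (.rel _ ⟨M.flip d, hd'⟩
            (Or.inr ⟨rfl, ?_⟩)) (hvert _ y hy.symm))
          rintro (h5 | h5 | h5 | h5)
          exacts [d1 h5, d2 h5, d3 h5, d4 h5]
      exact key _ _ (Quot.eqvGen_exact hxy) x y rfl rfl
    · intro x hx hx'
      refine h.six_le (fun h6 => hx' (Or.inr h6)) fun o₂ h6 h7 => hval _ ?_
      have h8 : ¬ M.OnEdges e e' (M.flip o₂) := by
        intro h9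
        refine hx' ?_
        rw [← h7]
        rcases h9 with h9 | h9 | h9 | h9 <;> simp [h9, ho1, ho1', hf]
      have h9 := hadj _ h8
      rw [M.flip_flip] at h9
      rw [← h9]
      refine (component_next_iff (K := fun x => Quot.mk (M.AdjAway e e') (M.vert x) = c)
        (fun x => by rw [vert_rot]) (fun x hx => by rw [hadj x hx]) ho1 ho1' hf h7.symm hx').1 hx

end Diagram

/-! ### Patches of faces -/

namespace Diagram

variable {D : Type*} [Finite D]

/-- The last edge of the first list of darts is the first edge of the second one. -/
def Meets (M : Diagram D) (x y : M.Region × List D) : Prop :=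
  ∃ a b, x.2.getLast? = some a ∧ y.2.head? = some b ∧ M.flip a = b

/-- The list of neighbours of a face, seen across the listed darts. -/
def entry (M : Diagram D) (x : M.Region × List D) : M.Region × List M.Region :=
  (x.1, x.2.map fun d => M.region (M.flip d))

/-- A disc made of faces of the diagram, thought of as the vertices of a triangulated disc.  The
lists `W` and `K` consist of its boundary and interior faces, each with the list of those of its
darts that belong to edges in the interior of the disc, in their order along the face. -/
structure IsPatch (M : Diagram D) (W K : List (M.Region × List D)) : Prop where
  nodup_fst : ((W ++ K).map Prod.fst).Nodup
  region_eq : ∀ x ∈ W ++ K, ∀ d ∈ x.2, M.region d = x.1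
  chain : ∀ x ∈ W ++ K, x.2.IsChain fun a b => b = M.next a
  nodup : ((W ++ K).flatMap Prod.snd).Nodup
  flip_mem : ∀ d ∈ (W ++ K).flatMap Prod.snd, M.flip d ∈ (W ++ K).flatMap Prod.snd
  rot_three : ∀ d ∈ (W ++ K).flatMap Prod.snd, M.rot (M.rot (M.rot d)) = d
  seven_le : ∀ x ∈ K, 7 ≤ x.2.length
  closed : ∀ x ∈ K, ∀ a b, x.2.getLast? = some a → x.2.head? = some b → M.next a = b
  meets : (W : Cycle (M.Region × List D)).Chain M.Meets
  sum : (W.map fun e => (4 : ℤ) - e.2.length).sum =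
    6 + (K.map fun e => (e.2.length : ℤ) - 6).sum

namespace IsPatch

variable {M : Diagram D} {W K : List (M.Region × List D)}

theorem of_isRotated (h : M.IsPatch W K) {W' : List (M.Region × List D)} (hr : W ~r W') :
    M.IsPatch W' K := by
  have hp : (W ++ K).Perm (W' ++ K) := hr.perm.append_right K
  have hf := hp.flatMap_right (f := Prod.snd)
  exact
    { nodup_fst := (hp.map Prod.fst).nodup_iff.1 h.nodup_fst
      region_eq := fun x hx => h.region_eq x (hp.mem_iff.2 hx)
      chain := fun x hx => h.chain x (hp.mem_iff.2 hx)
      nodup := hf.nodup_iff.1 h.nodup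
      flip_mem := fun d hd => hf.mem_iff.1 (h.flip_mem d (hf.mem_iff.2 hd))
      rot_three := fun d hd => h.rot_three d (hf.mem_iff.2 hd)
      seven_le := h.seven_le
      closed := h.closed
      meets := by
        have : (W : Cycle (M.Region × List D)) = W' := Quotient.sound hr
        rw [← this]
        exact h.meets
      sum := by rw [← (hr.perm.map _).sum_eq]; exact h.sum }

theorem eq_of_mem (h : M.IsPatch W K) {x y : M.Region × List D} (hx : x ∈ W ++ K)
    (hy : y ∈ W ++ K) {d : D} (hdx : d ∈ x.2) (hdy : d ∈ y.2) : x = y :=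
  eq_of_fst_eq h.nodup_fst hx hy (by rw [← h.region_eq x hx d hdx, h.region_eq y hy d hdy])

theorem two_le_length (h : M.IsPatch W K) : 2 ≤ W.length := by
  have h1 := h.sum
  have h2 : ∀ K : List (M.Region × List D), (∀ x ∈ K, 7 ≤ x.2.length) →
      0 ≤ (K.map fun e => (e.2.length : ℤ) - 6).sum := by
    intro K hK
    refine List.sum_nonneg fun a ha => ?_
    obtain ⟨x, hx, rfl⟩ := List.mem_map.1 ha
    have := hK x hx
    omega
  have h3 := h2 K h.seven_le
  by_contra hlt
  rcases W with _ | ⟨x, _ | ⟨y, W⟩⟩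
  · simp at h1
    omega
  · simp at h1
    omega
  · simp at hlt

theorem exists_neighbors (h : M.IsPatch W K) (hn : 3 ≤ W.length) {y : M.Region × List D}
    (hy : y ∈ W) : ∃ z mid x, W ~r y :: z :: (mid ++ [x]) ∧ M.Meets x y ∧ M.Meets y z ∧
      x ∈ W ∧ z ∈ W ∧ x ≠ z := by
  obtain ⟨z, mid, x, hr⟩ := exists_isRotated_cons hn hy
  have h' := h.of_isRotated hr
  have hm := h'.meets
  rw [Cycle.chain_coe_cons] at hm
  have hm2 := hm
  rw [List.cons_append, List.isChain_cons_cons] at hm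
  refine ⟨z, mid, x, hr, ?_, hm.1, hr.mem_iff.2 (by simp), hr.mem_iff.2 (by simp), ?_⟩
  · have e : y :: (z :: (mid ++ [x]) ++ [y]) = (y :: z :: mid) ++ [x, y] := by simp
    rw [e, List.isChain_append] at hm2
    simpa using hm2.2.1
  · rintro rfl
    have := h'.nodup_fst
    simp at this

theorem two_le (h : M.IsPatch W K) (hn : 3 ≤ W.length) : ∀ e ∈ W, 2 ≤ e.2.length := by
  intro e he
  obtain ⟨z, mid, x, hr, ⟨a, b, h1, h2, h3⟩, ⟨a', b', h4, h5, h6⟩, hx, hz, hxz⟩ :=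
    h.exists_neighbors hn he
  by_contra hlt
  rcases hl : e.2 with _ | ⟨d, _ | ⟨d', l⟩⟩
  · simp [hl] at h2
  · simp only [hl, List.head?_cons, List.getLast?_singleton, Option.some.injEq] at h2 h4
    subst h2 h4
    refine hxz (h.eq_of_mem (by simp [hx]) (by simp [hz]) (d := a) (List.mem_of_getLast? h1) ?_)
    rw [← h3, M.flip_flip] at h6
    rw [h6]
    exact List.mem_of_head? h5
  · simp [hl] at hlt

/-- Closure under reversal survives the removal of whole edges. -/
theorem flip_mem_of_perm {A A' B : List D} (hf : ∀ d ∈ A, M.flip d ∈ A) (hn : A.Nodup)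
    (hp : A.Perm (B ++ A')) (hB : ∀ d ∈ B, M.flip d ∈ B) : ∀ d ∈ A', M.flip d ∈ A' := by
  intro d hd
  have h1 := hf d (hp.mem_iff.2 (List.mem_append_right _ hd))
  refine (List.mem_append.1 (hp.mem_iff.1 h1)).resolve_left fun h2 => ?_
  have h3 := hB _ h2
  rw [M.flip_flip] at h3
  exact (List.nodup_append.1 (hp.nodup_iff.1 hn)).2.2 d h3 d hd rfl

/-- Cutting off a face with two interior edges. -/
theorem ear {z y x : M.Region × List D} {mid : List (M.Region × List D)}
    (h : M.IsPatch (z :: y :: (mid ++ [x])) K) (hz : z.2.length = 2) :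
    M.IsPatch ((y.1, y.2.tail) :: (mid ++ [(x.1, x.2.dropLast)])) K := by
  have h2 := h.two_le (by simp)
  obtain ⟨f, ly⟩ := y
  obtain ⟨g, lx⟩ := x
  obtain ⟨r, lz⟩ := z
  have hy2 := h2 (f, ly) (by simp)
  have hx2 := h2 (g, lx) (by simp)
  obtain ⟨p, q, rfl⟩ := List.length_eq_two.1 hz
  obtain ⟨yh, ly, rfl⟩ := List.exists_cons_of_ne_nil (l := ly) (by rintro rfl; simp at hy2)
  obtain ⟨y1, ly, rfl⟩ := List.exists_cons_of_ne_nil (l := ly) (by rintro rfl; simp at hy2)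
  obtain ⟨lx, xl, rfl⟩ := exists_snoc (l := lx) (by rintro rfl; simp at hx2)
  obtain ⟨lx, x1, rfl⟩ := exists_snoc (l := lx) (by rintro rfl; simp at hx2)
  simp only [List.tail_cons, List.dropLast_concat]
  have hm := h.meets
  rw [Cycle.chain_coe_cons, List.cons_append, List.isChain_cons_cons] at hm
  obtain ⟨⟨a, b, m1, m2, m3⟩, hm⟩ := hm
  obtain rfl : q = a := by simpa using m1
  obtain rfl : yh = b := by simpa using m2
  have hm' := hm
  rw [List.append_assoc, ← List.cons_append, List.isChain_append] at hm'
  simp only [List.cons_append, List.nil_append, List.isChain_cons_cons] at hm'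
  obtain ⟨a, b, n1, n2, n3⟩ := hm'.2.1.1
  obtain rfl : xl = a := by simpa using n1
  obtain rfl : p = b := by simpa using n2
  have hperm : (((r, [p, q]) :: (f, yh :: y1 :: ly) :: (mid ++ [(g, lx ++ [x1] ++ [xl])]) ++
      K).flatMap Prod.snd).Perm ([p, q, yh, xl] ++
        (((f, y1 :: ly) :: (mid ++ [(g, lx ++ [x1])]) ++ K).flatMap Prod.snd)) := by
    classical
    rw [List.perm_iff_count]
    intro a
    simp [List.count_cons, List.flatMap_append]
    ring
  have e1 : M.next x1 = xl := by
    have := h.chain (g, lx ++ [x1] ++ [xl]) (by simp)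
    simp only [List.append_assoc, List.cons_append, List.nil_append] at this
    rw [List.isChain_append] at this
    have h3 := this.2.1
    simp only [List.isChain_cons_cons] at h3
    exact h3.1.symm
  have e2 : q = M.next p := by simpa using h.chain (r, [p, q]) (by simp)
  have e3 : y1 = M.next yh := by
    have := h.chain (f, yh :: y1 :: ly) (by simp)
    simp only [List.isChain_cons_cons] at this
    exact this.1
  have e4 : M.flip x1 = y1 := by
    apply M.rot.injective
    rw [← next_apply, e1, e3, ← m3, next_flip, e2, next_apply, ← n3, M.flip_flip]
    exact (h.rot_three xl (by simp)).symm
  exact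
    { nodup_fst := by
        have := h.nodup_fst
        simp only [List.cons_append, List.map_cons, List.nodup_cons] at this ⊢
        simpa using this.2
      region_eq := by
        intro u hu d hd
        simp only [List.cons_append, List.mem_cons, List.mem_append, List.not_mem_nil,
          or_false] at hu
        rcases hu with rfl | (hu | rfl) | hu
        · exact h.region_eq (f, yh :: y1 :: ly) (by simp) d (List.mem_cons_of_mem _ hd)
        · exact h.region_eq u (by simp [hu]) d hd
        · exact h.region_eq (g, lx ++ [x1] ++ [xl]) (by simp) d (List.mem_append_left _ hd)
        · exact h.region_eq u (by simp [hu]) d hd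
      chain := by
        intro u hu
        simp only [List.cons_append, List.mem_cons, List.mem_append, List.not_mem_nil,
          or_false] at hu
        rcases hu with rfl | (hu | rfl) | hu
        · exact (h.chain (f, yh :: y1 :: ly) (by simp)).tail
        · exact h.chain u (by simp [hu])
        · exact (List.isChain_append.1 (h.chain (g, lx ++ [x1] ++ [xl]) (by simp))).1
        · exact h.chain u (by simp [hu])
      nodup := (List.nodup_append.1 (hperm.nodup_iff.1 h.nodup)).2.1
      flip_mem := by
        refine flip_mem_of_perm h.flip_mem h.nodup hperm ?_
        intro d hd
        simp only [List.mem_cons, List.not_mem_nil, or_false] at hd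
        rcases hd with rfl | rfl | rfl | rfl
        · simp [← n3, M.flip_flip]
        · simp [m3]
        · simp [← m3, M.flip_flip]
        · simp [n3]
      rot_three := fun d hd => h.rot_three d (hperm.mem_iff.2 (List.mem_append_right _ hd))
      seven_le := h.seven_le
      closed := h.closed
      meets := by
        have hstart : ∀ u, M.Meets (f, yh :: y1 :: ly) u → M.Meets (f, y1 :: ly) u := by
          rintro u ⟨a, b, h1, h2⟩
          exact ⟨a, b, by simpa [List.getLast?_cons_cons] using h1, h2⟩
        have hend : ∀ u, M.Meets u (g, lx ++ [x1] ++ [xl]) → M.Meets u (g, lx ++ [x1]) := by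
          rintro u ⟨a, b, h1, h2, h3⟩
          refine ⟨a, b, h1, ?_, h3⟩
          rcases lx with _ | ⟨c, lx⟩ <;> simpa using h2
        have hnew : M.Meets (g, lx ++ [x1]) (f, y1 :: ly) := ⟨x1, y1, by simp, by simp, e4⟩
        rw [Cycle.chain_coe_cons]
        rcases mid with _ | ⟨u, mid⟩
        · simp only [List.nil_append, List.cons_append, List.isChain_cons_cons,
            List.isChain_singleton, and_true] at hm ⊢
          exact ⟨hend _ (hstart _ hm.1), hnew⟩
        · rw [List.cons_append, List.cons_append, List.isChain_cons_cons] at hm ⊢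
          refine ⟨hstart _ hm.1, ?_⟩
          have hm2 := hm.2
          rw [List.append_assoc, ← List.cons_append, List.isChain_append] at hm2 ⊢
          refine ⟨hm2.1, by simpa using hnew, fun a ha b hb => ?_⟩
          obtain rfl : (g, lx ++ [x1]) = b := by simpa using hb
          exact hend _ (hm2.2.2 a ha _ (by simp))
      sum := by
        have := h.sum
        simp at this ⊢
        linarith }

end IsPatch

end Diagram

/-! ### Opening an interior face of a patch -/

theorem List.IsChain.rotate {α : Type*} {R : α → α → Prop} {s t : List α} {c : α}
    (h : (s ++ c :: t).IsChain R)
    (hc : ∀ a b, (s ++ c :: t).getLast? = some a → (s ++ c :: t).head? = some b → R a b) :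
    (c :: (t ++ s)).IsChain R ∧ ∀ a, (c :: (t ++ s)).getLast? = some a → R a c := by
  have h1 : ((s ++ c :: t : List α) : Cycle α).Chain R := by
    rcases hs : s ++ c :: t with _ | ⟨b, l⟩
    · simp
    · rw [hs] at h hc
      rw [Cycle.chain_coe_cons, ← List.cons_append, List.isChain_append]
      exact ⟨h, by simp, fun a ha b' hb => by
        obtain rfl : b = b' := by simpa using hb
        exact hc a b ha rfl⟩
  have h2 : ((s ++ c :: t : List α) : Cycle α) = (c :: (t ++ s) : List α) :=
    Cycle.coe_eq_coe.2 (by simpa using List.isRotated_append (l := s) (l' := c :: t))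
  rw [h2, Cycle.chain_coe_cons, ← List.cons_append, List.isChain_append] at h1
  exact ⟨h1.1, fun a ha => h1.2.2 a ha c (by simp)⟩

namespace Diagram.IsPatch

variable {D : Type*} [Finite D] {M : Diagram D} {W K : List (M.Region × List D)}

/-- The triangle of consecutive faces `x` and `y` of the boundary has a third corner, which is
reached from `y` across its second edge and from `x` across its last but one edge. -/
theorem rot_eq_flip (h : M.IsPatch W K) {f g : M.Region} {yh ys x1 xl : D} {ly lx : List D}
    (hy : (f, yh :: ys :: ly) ∈ W) (hx : (g, lx ++ [x1, xl]) ∈ W) (hm : M.flip xl = yh) :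
    M.rot ys = M.flip x1 := by
  have e1 : xl = M.next x1 := by
    have := h.chain _ (List.mem_append_left K hx)
    rw [List.isChain_append] at this
    have h3 := this.2.1
    simp only [List.isChain_cons_cons] at h3
    exact h3.1
  have e3 : ys = M.next yh := by
    have := h.chain _ (List.mem_append_left K hy)
    simp only [List.isChain_cons_cons] at this
    exact this.1
  have e4 : M.rot (M.flip x1) = xl := by rw [← next_apply, ← e1]
  rw [e3, ← hm, next_flip, ← e4]
  refine h.rot_three _ (h.flip_mem _ (List.mem_flatMap.2 ⟨_, List.mem_append_left K hx, ?_⟩))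
  simp

/-- An interior face in a triangle at the boundary can be moved to the boundary. -/
theorem opening {y x : M.Region × List D} {mid H₁ H₂ : List (M.Region × List D)}
    {r : M.Region} {s t : List D} {c : D}
    (h : M.IsPatch (y :: (mid ++ [x])) (H₁ ++ (r, s ++ c :: t) :: H₂))
    {f g : M.Region} {yh ys x1 xl : D} {ly lx : List D} (hmid : mid ≠ [])
    (hy : y = (f, yh :: ys :: ly)) (hx : x = (g, lx ++ [x1, xl])) (hm : M.flip xl = yh)
    (hc : c = M.flip x1) :
    M.IsPatch ((r, c :: (t ++ s)) :: (y.1, y.2.tail) :: (mid ++ [(x.1, x.2.dropLast)]))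
      (H₁ ++ H₂) := by
  have hrot : M.rot ys = M.flip x1 :=
    h.rot_eq_flip (f := f) (g := g) (ly := ly) (lx := lx) (by simp [hy]) (by simp [hx]) hm
  subst hy hx
  have hdl : (lx ++ [x1, xl]).dropLast = lx ++ [x1] := by
    rw [show lx ++ [x1, xl] = (lx ++ [x1]) ++ [xl] by simp, List.dropLast_concat]
  simp only [List.tail_cons, hdl]
  have hch := h.chain (r, s ++ c :: t) (by simp)
  obtain ⟨hnh, hlast⟩ := hch.rotate fun a b ha hb =>
    (h.closed (r, s ++ c :: t) (by simp) a b ha hb).symm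
  have hperm : (((f, yh :: ys :: ly) :: (mid ++ [(g, lx ++ [x1, xl])]) ++
      (H₁ ++ (r, s ++ c :: t) :: H₂)).flatMap Prod.snd).Perm ([yh, xl] ++
        (((r, c :: (t ++ s)) :: (f, ys :: ly) :: (mid ++ [(g, lx ++ [x1])]) ++
          (H₁ ++ H₂)).flatMap Prod.snd)) := by
    classical
    rw [List.perm_iff_count]
    intro a
    simp [List.count_cons, List.flatMap_append]
    ring
  have hp1 : (((f, yh :: ys :: ly) :: (mid ++ [(g, lx ++ [x1, xl])]) ++
      (H₁ ++ (r, s ++ c :: t) :: H₂)).map Prod.fst).Perm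
        (((r, c :: (t ++ s)) :: (f, ys :: ly) :: (mid ++ [(g, lx ++ [x1])]) ++
          (H₁ ++ H₂)).map Prod.fst) := by
    classical
    rw [List.perm_iff_count]
    intro a
    simp [List.count_cons]
    ring
  have hmt := h.meets
  rw [Cycle.chain_coe_cons] at hmt
  exact
    { nodup_fst := hp1.nodup_iff.1 h.nodup_fst
      region_eq := by
        intro u hu d hd
        simp only [List.cons_append, List.mem_cons, List.mem_append, List.not_mem_nil,
          or_false] at hu
        rcases hu with rfl | rfl | (hu | rfl) | hu | hu
        · refine h.region_eq (r, s ++ c :: t) (by simp) d ?_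
          simp at hd ⊢
          tauto
        · exact h.region_eq (f, yh :: ys :: ly) (by simp) d (List.mem_cons_of_mem _ hd)
        · exact h.region_eq u (by simp [hu]) d hd
        · refine h.region_eq (g, lx ++ [x1, xl]) (by simp) d ?_
          simp at hd ⊢
          tauto
        · exact h.region_eq u (by simp [hu]) d hd
        · exact h.region_eq u (by simp [hu]) d hd
      chain := by
        intro u hu
        simp only [List.cons_append, List.mem_cons, List.mem_append, List.not_mem_nil,
          or_false] at hu
        rcases hu with rfl | rfl | (hu | rfl) | hu | hu
        · exact hnh
        · exact (h.chain (f, yh :: ys :: ly) (by simp)).tail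
        · exact h.chain u (by simp [hu])
        · have := h.chain (g, lx ++ [x1, xl]) (by simp)
          rw [show lx ++ [x1, xl] = (lx ++ [x1]) ++ [xl] by simp] at this
          exact (List.isChain_append.1 this).1
        · exact h.chain u (by simp [hu])
        · exact h.chain u (by simp [hu])
      nodup := (List.nodup_append.1 (hperm.nodup_iff.1 h.nodup)).2.1
      flip_mem := by
        refine flip_mem_of_perm h.flip_mem h.nodup hperm ?_
        intro d hd
        simp only [List.mem_cons, List.not_mem_nil, or_false] at hd
        rcases hd with rfl | rfl
        · simp [← hm, M.flip_flip]
        · simp [hm]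
      rot_three := fun d hd => h.rot_three d (hperm.mem_iff.2 (List.mem_append_right _ hd))
      seven_le := fun u hu => h.seven_le u (by simp at hu ⊢; tauto)
      closed := fun u hu => h.closed u (by simp at hu ⊢; tauto)
      meets := by
        have hnew : M.Meets (r, c :: (t ++ s)) (f, ys :: ly) := by
          obtain ⟨a, ha⟩ : ∃ a, (c :: (t ++ s)).getLast? = some a :=
            ⟨_, List.getLast?_eq_some_getLast (by simp)⟩
          refine ⟨a, ys, ha, rfl, M.rot.injective ?_⟩
          rw [← next_apply, ← hlast a ha, hrot, hc]
        have hnew' : M.Meets (g, lx ++ [x1]) (r, c :: (t ++ s)) :=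
          ⟨x1, c, by simp, by simp, hc.symm⟩
        have hstart : ∀ u, M.Meets (f, yh :: ys :: ly) u → M.Meets (f, ys :: ly) u := by
          rintro u ⟨a, b, h1, h2⟩
          exact ⟨a, b, by simpa [List.getLast?_cons_cons] using h1, h2⟩
        have hend : ∀ u, M.Meets u (g, lx ++ [x1, xl]) → M.Meets u (g, lx ++ [x1]) := by
          rintro u ⟨a, b, h1, h2, h3⟩
          refine ⟨a, b, h1, ?_, h3⟩
          rcases lx with _ | ⟨c, lx⟩ <;> simpa using h2
        rw [Cycle.chain_coe_cons]
        obtain ⟨u, mid, rfl⟩ := List.exists_cons_of_ne_nil hmid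
        rw [List.cons_append, List.cons_append, List.isChain_cons_cons] at hmt
        rw [List.cons_append, List.cons_append, List.cons_append, List.isChain_cons_cons,
          List.isChain_cons_cons]
        refine ⟨hnew, hstart _ hmt.1, ?_⟩
        have hm2 := hmt.2
        rw [List.append_assoc, ← List.cons_append, List.isChain_append] at hm2 ⊢
        refine ⟨hm2.1, by simpa using hnew', fun a ha b hb => ?_⟩
        obtain rfl : (g, lx ++ [x1]) = b := by simpa using hb
        exact hend _ (hm2.2.2 a ha _ (by simp))
      sum := by
        have := h.sum
        simp at this ⊢
        linarith }

/-- If no boundary face has just two interior edges, the triangle of some pair of consecutive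
boundary faces has an interior face as its third corner: otherwise these corners would belong to
boundary faces, and each boundary face with `m` edges inside the patch would take at most `m - 3` of
them, which makes too many edges for the total curvature of the patch. -/
theorem exists_opening (h : M.IsPatch W K) (hn : 3 ≤ W.length)
    (h3 : ∀ e ∈ W, 3 ≤ e.2.length) :
    ∃ y ∈ W, ∃ e ∈ K, ∃ yh ys ly, y.2 = yh :: ys :: ly ∧ M.rot ys ∈ e.2 := by
  classical
  by_contra hno
  push Not at hno
  have hnd : ∀ e ∈ W, e.2.Nodup := fun e he =>
    (List.nodup_flatMap.1 h.nodup).1 e (List.mem_append_left K he)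
  let s : M.Region × List D → D := fun e => e.2.tail.headD M.root
  have hs : ∀ y ∈ W, ∃ yh ly, y.2 = yh :: s y :: ly ∧ ly ≠ [] := by
    intro y hy
    have := h3 y hy
    rcases hl : y.2 with _ | ⟨a, _ | ⟨b, _ | ⟨c, l⟩⟩⟩
    · simp [hl] at this
    · simp [hl] at this
    · simp [hl] at this
    · exact ⟨a, c :: l, by simp [s, hl], by simp⟩
  have hsm : ∀ y ∈ W, s y ∈ y.2 := by
    intro y hy
    obtain ⟨yh, ly, hl, -⟩ := hs y hy
    rw [hl]
    simp
  have key : ∀ y ∈ W, ∃ e ∈ W, M.rot (s y) ∈ (e.2.drop 2).dropLast := by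
    intro y hy
    obtain ⟨z, mid, x, hr, ⟨xl, yh', m1, m2, m3⟩, -, hx, hz, hxz⟩ := h.exists_neighbors hn hy
    obtain ⟨yh, ly, hl, hly⟩ := hs y hy
    obtain rfl : yh = yh' := by simpa [hl] using m2
    have hx3 := h3 x hx
    obtain ⟨lx, xl', hlx⟩ := exists_snoc (l := x.2) (by rintro h0; simp [h0] at hx3)
    obtain ⟨lx, x1, rfl⟩ := exists_snoc (l := lx) (by rintro rfl; simp [hlx] at hx3)
    have hlx0 : lx ≠ [] := by rintro rfl; simp [hlx] at hx3
    obtain rfl : xl' = xl := by simpa [hlx] using m1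
    have hrot : M.rot (s y) = M.flip x1 :=
      h.rot_eq_flip (f := y.1) (g := x.1) (ly := ly) (lx := lx) (by rw [← hl]; exact hy)
        (by have : lx ++ [x1, xl'] = x.2 := by simp [hlx]
            rw [this]; exact hx) m3
    have hx1 : x1 ∈ x.2 := by simp [hlx]
    have hc := h.flip_mem x1 (List.mem_flatMap.2 ⟨x, List.mem_append_left K hx, hx1⟩)
    rw [← hrot, List.mem_flatMap] at hc
    obtain ⟨e, he, hce⟩ := hc
    have heW : e ∈ W := (List.mem_append.1 he).resolve_right fun heK =>
      hno y hy e heK yh (s y) ly hl hce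
    refine ⟨e, heW, ?_⟩
    obtain ⟨z', -, x', -, ⟨a, b, n1, n2, n3⟩, ⟨a', b', n4, n5, n6⟩, hx', hz', -⟩ :=
      h.exists_neighbors hn heW
    obtain ⟨eh, le, hle, hle0⟩ := hs e heW
    obtain rfl : eh = b := by simpa [hle] using n2
    obtain ⟨le, el, rfl⟩ := exists_snoc hle0
    rw [hle, ← List.cons_append, ← List.cons_append, List.getLast?_concat,
      Option.some.injEq] at n4
    subst n4
    have hxn := hnd x hx
    have hyn := hnd y hy
    have c1 : M.rot (s y) ≠ eh := by
      intro h0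
      have h4 : a = x1 := M.flip.injective (by rw [n3, ← h0, hrot])
      subst h4
      have h5 : x = x' := h.eq_of_mem (by simp [hx]) (by simp [hx']) hx1
        (List.mem_of_getLast? n1)
      subst h5
      obtain rfl : xl' = a := by simpa [hlx] using n1
      simp [hlx, List.nodup_append] at hxn
    have c2 : M.rot (s y) ≠ s e := by
      intro h0
      have h4 : s e = M.next eh := by
        have := h.chain e he
        rw [hle, List.isChain_cons_cons] at this
        exact this.1
      rw [h4, next_apply] at h0
      have h5 := M.rot.injective h0
      have h6 : s y = a := M.flip.injective (by rw [n3, h5, M.flip_flip])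
      have h7 : y = x' := h.eq_of_mem (by simp [hy]) (by simp [hx']) (hsm y hy)
        (by rw [h6]; exact List.mem_of_getLast? n1)
      subst h7
      rw [hl, ← h6] at n1
      rw [hl] at hyn
      rw [List.getLast?_cons_cons, List.getLast?_cons_of_ne_nil hly] at n1
      have := List.mem_of_getLast? n1
      simp [this] at hyn
    have c3 : M.rot (s y) ≠ el := by
      intro h0
      have h4 : x1 = b' := by rw [← n6, ← h0, hrot, M.flip_flip]
      subst h4
      have h5 : x = z' := h.eq_of_mem (by simp [hx]) (by simp [hz']) hx1
        (List.mem_of_head? n5)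
      subst h5
      obtain ⟨d, lx, rfl⟩ := List.exists_cons_of_ne_nil hlx0
      obtain rfl : d = x1 := by simpa [hlx] using n5
      simp [hlx] at hxn
    rw [hle] at hce ⊢
    simp only [List.drop_succ_cons, List.drop_zero, List.dropLast_concat]
    simpa [c1, c2, c3] using hce
  have hlen : (W.map fun y => M.rot (s y)).length ≤
      (W.flatMap fun e => (e.2.drop 2).dropLast).length := by
    refine (List.Nodup.subperm ?_ ?_).length_le
    · refine List.Nodup.map_on ?_ ?_
      · intro a ha b hb hab
        refine h.eq_of_mem (by simp [ha]) (by simp [hb]) (hsm a ha) ?_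
        rw [M.rot.injective hab]
        exact hsm b hb
      · have := h.nodup_fst
        rw [List.map_append] at this
        exact (List.nodup_append.1 this).1.of_map _
    · intro d hd
      obtain ⟨y, hy, rfl⟩ := List.mem_map.1 hd
      obtain ⟨e, he, hd⟩ := key y hy
      exact List.mem_flatMap.2 ⟨e, he, hd⟩
  have hsum : ∀ V : List (M.Region × List D), (∀ e ∈ V, 3 ≤ e.2.length) →
      ((V.flatMap fun e => (e.2.drop 2).dropLast).length : ℤ) =
        V.length - (V.map fun e => (4 : ℤ) - e.2.length).sum := by
    intro V hV
    induction V with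
    | nil => simp
    | cons e V ih =>
      have h1 := hV e (by simp)
      have h2 := ih fun e he => hV e (by simp [he])
      simp only [List.flatMap_cons, List.length_append, List.length_dropLast, List.length_drop,
        List.length_cons, List.map_cons, List.sum_cons]
      push_cast
      rw [h2]
      omega
  have h4 := hsum W h3
  have h5 : 0 ≤ (K.map fun e => (e.2.length : ℤ) - 6).sum := by
    refine List.sum_nonneg fun a ha => ?_
    obtain ⟨x, hx, rfl⟩ := List.mem_map.1 ha
    have := h.seven_le x hx
    omega
  have h6 := h.sum
  rw [List.length_map] at hlen
  omega

theorem exists_step (h : M.IsPatch W K) (hn : 3 ≤ W.length) :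
    (∃ e ∈ W, e.2.length = 2) ∨ ∃ y mid x r l nh H₁ H₂, W ~r (y :: (mid ++ [x])) ∧
      K = H₁ ++ (r, l) :: H₂ ∧ nh ~r l ∧
      M.IsPatch ((r, nh) :: (y.1, y.2.tail) :: (mid ++ [(x.1, x.2.dropLast)])) (H₁ ++ H₂) := by
  by_cases h2 : ∃ e ∈ W, e.2.length = 2
  · exact Or.inl h2
  push Not at h2
  have h3 : ∀ e ∈ W, 3 ≤ e.2.length := fun e he => by
    have := h.two_le hn e he
    have := h2 e he
    omega
  right
  obtain ⟨y, hy, e, he, yh, ys, ly, hl, hmem⟩ := h.exists_opening hn h3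
  obtain ⟨z, mid, x, hr, ⟨xl, yh', m1, m2, m3⟩, -, hx, hz, hxz⟩ := h.exists_neighbors hn hy
  obtain rfl : yh = yh' := by simpa [hl] using m2
  have hx3 := h3 x hx
  obtain ⟨lx, xl', hlx⟩ := exists_snoc (l := x.2) (by rintro h0; simp [h0] at hx3)
  obtain ⟨lx, x1, rfl⟩ := exists_snoc (l := lx) (by rintro rfl; simp [hlx] at hx3)
  obtain rfl : xl' = xl := by simpa [hlx] using m1
  have hlx' : x = (x.1, lx ++ [x1, xl']) := by
    rw [show lx ++ [x1, xl'] = x.2 by simp [hlx]]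
  have hly' : y = (y.1, yh :: ys :: ly) := by rw [← hl]
  have hrot : M.rot ys = M.flip x1 :=
    h.rot_eq_flip (f := y.1) (g := x.1) (by rw [← hly']; exact hy)
      (by rw [← hlx']; exact hx) m3
  obtain ⟨H₁, H₂, rfl⟩ := List.append_of_mem he
  obtain ⟨r, l⟩ := e
  obtain ⟨s, t, hst⟩ := List.append_of_mem hmem
  obtain rfl : l = s ++ M.rot ys :: t := hst
  refine ⟨y, z :: mid, x, r, _, M.rot ys :: (t ++ s), H₁, H₂, hr, rfl, ?_, ?_⟩
  · simpa using List.isRotated_append (l := M.rot ys :: t) (l' := s)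
  · exact (h.of_isRotated hr).opening (by simp) hly' hlx' m3 hrot

end Diagram.IsPatch

namespace Diagram

variable {D : Type*} [Finite D]

/-- The patches of a diagram form a system of boundary words. -/
theorem triSystem (M : Diagram D) :
    TriSystem fun w H => ∃ W K, M.IsPatch W K ∧ w = W.map M.entry ∧ H = K.map M.entry where
  rotate := by
    rintro e w H ⟨W, K, h, hw, rfl⟩
    obtain ⟨x, V, rfl, rfl, rfl⟩ : ∃ x V, W = x :: V ∧ e = M.entry x ∧ w = V.map M.entry := by
      rcases W with _ | ⟨x, V⟩
      · simp at hw
      · simp only [List.map_cons, List.cons.injEq] at hw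
        exact ⟨x, V, rfl, hw.1, hw.2⟩
    exact ⟨V ++ [x], K, h.of_isRotated (by simpa using List.isRotated_append (l := [x]) (l' := V)),
      by simp, rfl⟩
  nodup := by
    rintro w H ⟨W, K, h, rfl, rfl⟩
    simpa [entry, Function.comp_def] using h.nodup_fst
  two_le_length := by
    rintro w H ⟨W, K, h, rfl, rfl⟩
    simpa using h.two_le_length
  two_le := by
    rintro w H ⟨W, K, h, rfl, rfl⟩ hn e he
    obtain ⟨x, hx, rfl⟩ := List.mem_map.1 he
    simpa [entry] using h.two_le (by simpa using hn) x hx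
  seven_le := by
    rintro w H ⟨W, K, h, rfl, rfl⟩ e he
    obtain ⟨x, hx, rfl⟩ := List.mem_map.1 he
    simpa [entry] using h.seven_le x hx
  adj := by
    rintro x y w H ⟨W, K, h, hw, rfl⟩
    rcases W with _ | ⟨u, _ | ⟨v, W⟩⟩
    · simp at hw
    · simp at hw
    simp only [List.map_cons, List.cons.injEq] at hw
    obtain ⟨rfl, rfl, rfl⟩ := hw
    have hm := h.meets
    rw [Cycle.chain_coe_cons, List.cons_append, List.isChain_cons_cons] at hm
    obtain ⟨a, b, h1, h2, h3⟩ := hm.1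
    simp only [entry, List.getLast?_map, List.head?_map, h1, h2, Option.map_some,
      Option.some.injEq]
    refine ⟨?_, ?_⟩
    · rw [h3]
      exact h.region_eq v (by simp) b (List.mem_of_head? h2)
    · rw [← h3, M.flip_flip]
      exact h.region_eq u (by simp) a (List.mem_of_getLast? h1)
  ear := by
    rintro z y mid x H ⟨W, K, h, hw, rfl⟩ hz
    obtain ⟨z, y, mid, x, rfl, rfl, rfl, rfl, rfl⟩ : ∃ z' y' mid' x',
        W = z' :: y' :: (mid' ++ [x']) ∧ z = M.entry z' ∧ y = M.entry y' ∧
          mid = mid'.map M.entry ∧ x = M.entry x' := by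
      rcases W with _ | ⟨u, _ | ⟨v, W⟩⟩
      · simp at hw
      · simp at hw
      simp only [List.map_cons, List.cons.injEq] at hw
      rcases List.eq_nil_or_concat W with rfl | ⟨W, t, rfl⟩
      · simp at hw
      rw [List.concat_eq_append, List.map_append, List.map_singleton] at hw
      have h2 := List.append_inj' hw.2.2 (by simp)
      exact ⟨u, v, W, t, by simp, hw.1, hw.2.1, h2.1, by simpa using h2.2⟩
    exact ⟨_, K, h.ear (by simpa [entry] using hz), by simp [entry, List.map_dropLast], rfl⟩
  sum := by
    rintro w H ⟨W, K, h, rfl, rfl⟩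
    simpa [entry, Function.comp_def] using h.sum
  exists_step := by
    rintro w H ⟨W, K, h, rfl, rfl⟩ hn
    rcases h.exists_step (by simpa using hn) with ⟨e, he, h2⟩ |
      ⟨y, mid, x, r, l, nh, H₁, H₂, hr, rfl, hnh, hP⟩
    · exact Or.inl ⟨M.entry e, List.mem_map_of_mem he, by simpa [entry] using h2⟩
    · refine Or.inr ⟨M.entry y, mid.map M.entry, M.entry x, M.entry (r, l),
        (M.entry (r, nh)).2, H₁.map M.entry, H₂.map M.entry, ?_, by simp, ?_, ?_⟩
      · simpa using hr.map M.entry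
      · exact hnh.map _
      · exact ⟨_, _, hP, by simp [entry, List.map_dropLast], by simp⟩

end Diagram

/-! ### The patch of all faces of a special quadrangle -/

theorem List.IsChain.filter_skip {D : Type*} {g : D → D} {C : D → Prop} [DecidablePred C]
    (hC : ∀ x, C x → ¬ C (g x)) {x : D} {l : List D} (hx : ¬ C x)
    (h : (x :: l).IsChain fun a b => b = g a) :
    (x :: l.filter fun y => ¬ C y).IsChain fun a b =>
      (¬ C (g a) ∧ b = g a) ∨ (C (g a) ∧ b = g (g a)) := by
  induction hn : l.length using Nat.strong_induction_on generalizing x l with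
  | _ n ih =>
    rcases l with _ | ⟨y, l⟩
    · simp
    rw [List.isChain_cons_cons] at h
    obtain ⟨rfl, h⟩ := h
    by_cases hy : C (g x)
    · rcases l with _ | ⟨z, l⟩
      · simp [hy]
      rw [List.isChain_cons_cons] at h
      obtain ⟨rfl, h⟩ := h
      have hz := hC _ hy
      have := ih l.length (by simp at hn; omega) hz h rfl
      rw [List.filter_cons_of_neg (by simpa using hy), List.filter_cons_of_pos (by simpa using hz),
        List.isChain_cons_cons]
      exact ⟨Or.inr ⟨hy, rfl⟩, this⟩
    · have := ih l.length (by simp at hn; omega) hy h rfl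
      rw [List.filter_cons_of_pos (by simpa using hy), List.isChain_cons_cons]
      exact ⟨Or.inl ⟨hy, rfl⟩, this⟩

namespace Diagram

variable {D : Type*} [Finite D] {M : Diagram D} {sides : List (List D)}

theorem exists_traces (M : Diagram D) (d : D) : ∃ l, M.Traces (M.region d) (d :: l) := by
  obtain ⟨l, h1, h2, h3, -⟩ := exists_orbit M.next d
  exact ⟨l, h1, fun x => by rw [h2, eq_comm, region_eq_iff], h3⟩

theorem rot_next_eq {a p : D} (h : M.next a = M.flip p)
    (h3 : M.rot (M.rot (M.rot (M.next p))) = M.next p) : M.flip a = M.rot (M.next p) := by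
  apply M.rot.injective
  apply M.rot.injective
  rw [h3, ← next_apply, h, next_apply]

/-- The boundary of a face along the boundary of the diagram: it consists of the edges of the
exterior arc, of which there are two if the arc contains a corner and one otherwise, followed by
the interior edges. -/
theorem IsSpecial.exists_interior (h : M.IsSpecial sides) (hquad : sides.length = 4) {o : D}
    (ho : M.region o = M.outer) (hc : ¬ M.IsCorner o) :
    ∃ E, E.head? = some (M.rot o) ∧ (∀ d ∈ E, ¬ M.IsExterior d) ∧
      ((¬ M.IsCorner (M.next o) ∧ M.Traces (M.region (M.flip o)) (M.flip o :: E)) ∨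
        (M.IsCorner (M.next o) ∧
          M.Traces (M.region (M.flip o)) (M.flip (M.next o) :: M.flip o :: E))) := by
  have hf := h.2.2.1.2 o ho
  have hcc : M.rot (M.rot o) ≠ o := fun h0 => hc ⟨ho, h0⟩
  have hrot := h.2.2.1.not_isExterior_rot ho (h.rot_three hcc) (h.rot_ne o)
  obtain ⟨l, hl⟩ := M.exists_traces (M.flip o)
  have hext : ∀ o', M.region o' = M.outer → M.IsExterior (M.flip o') := fun o' ho' =>
    Or.inr (by rw [M.flip_flip, ho'])
  have hl0 : l ≠ [] := by
    rintro rfl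
    have := hl.next_last (y := M.flip o) (by simp)
    rw [next_flip] at this
    exact hrot (this ▸ hext o ho)
  obtain ⟨x, l, rfl⟩ := List.exists_cons_of_ne_nil hl0
  obtain rfl : x = M.rot o := by
    have := hl.2.2
    rw [List.isChain_cons_cons, next_flip] at this
    exact this.1
  have hkey : ∀ d, M.region d = M.region (M.flip o) → M.IsExterior d → d = M.flip o ∨
      (M.IsCorner (M.next o) ∧ d = M.flip (M.next o)) := by
    rintro d hd (hd' | hd')
    · exact absurd (hd ▸ hd') hf
    rcases h.eq_or_corner hquad ho hd' (by rw [M.flip_flip, hd]) with h1 | ⟨h1, h2⟩ | ⟨h1, -⟩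
    · left
      rw [← h1, M.flip_flip]
    · right
      rw [← h2]
      exact ⟨h1, (M.flip_flip d).symm⟩
    · exact absurd h1 hc
  by_cases hn : M.IsCorner (M.next o)
  · have hfn := next_flip_next hn.2
    obtain ⟨y, hy⟩ : ∃ y, (M.flip o :: M.rot o :: l).getLast? = some y :=
      ⟨_, List.getLast?_eq_some_getLast (by simp)⟩
    have hy' := hl.next_last hy
    rw [← hfn] at hy'
    have hy'' := M.next.injective hy'
    subst hy''
    have hl1 : l ≠ [] := by
      rintro rfl
      have h1 : M.rot o = M.flip (M.next o) := by simpa using hy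
      exact hrot (h1 ▸ hext _ hn.1)
    obtain ⟨l, z, rfl⟩ := exists_snoc hl1
    obtain rfl : z = M.flip (M.next o) := by
      rw [← List.cons_append, ← List.cons_append, List.getLast?_concat, Option.some.injEq] at hy
      exact hy
    have htr : M.Traces (M.region (M.flip o)) (M.flip (M.next o) :: M.flip o :: M.rot o :: l) :=
      hl.of_isRotated (by
        simpa using List.isRotated_append (l := M.flip o :: M.rot o :: l)
          (l' := [M.flip (M.next o)]))
    refine ⟨M.rot o :: l, by simp, fun d hd he => ?_, Or.inr ⟨hn, htr⟩⟩
    have hnd := htr.1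
    simp only [List.nodup_cons] at hnd
    rcases hkey d ((htr.2.1 d).1 (by simp at hd ⊢; tauto)) he with rfl | ⟨-, rfl⟩
    · exact hnd.2.1 hd
    · exact hnd.1 (List.mem_cons_of_mem _ hd)
  · refine ⟨M.rot o :: l, by simp, fun d hd he => ?_, Or.inl ⟨hn, hl⟩⟩
    rcases hkey d ((hl.2.1 d).1 (List.mem_cons_of_mem _ hd)) he with rfl | ⟨h1, -⟩
    · exact (List.nodup_cons.1 hl.1).1 hd
    · exact hn h1

theorem IsSpecial.rot_three_of_interior (h : M.IsSpecial sides) {d : D}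
    (hd : ¬ M.IsExterior d) : M.rot (M.rot (M.rot d)) = d := by
  refine h.rot_three fun h2 => hd ?_
  obtain ⟨o, ho, rfl | rfl⟩ := h.exists_isCorner h2
  · exact Or.inl ho.1
  · right
    rw [← region_rot, ho.2, ho.1]

/-- An interior arc consists of a single edge. -/
theorem IsSpecial.eq_or_eq_flip (h : M.IsSpecial sides) {d d' : D} (hd : ¬ M.IsExterior d)
    (harc : M.arc d = M.arc d') : d' = d ∨ d' = M.flip d := by
  have key : ∀ x y, Relation.EqvGen
      (fun d d' : D => d' = M.flip d ∨ (d' = M.next d ∧ M.valence (M.vert d') = 2)) x y →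
      ((x = d ∨ x = M.flip d) ↔ (y = d ∨ y = M.flip d)) := by
    intro x y hxy
    induction hxy with
    | refl => rfl
    | symm _ _ _ ih => exact ih.symm
    | trans _ _ _ _ _ ih1 ih2 => exact ih1.trans ih2
    | rel x y hxy =>
      rcases hxy with rfl | ⟨rfl, hv⟩
      · constructor
        · rintro (rfl | rfl)
          · exact Or.inr rfl
          · exact Or.inl (M.flip_flip _)
        · rintro (h1 | h1)
          · right
            rw [← h1, M.flip_flip]
          · left
            exact M.flip.injective h1
      · have hint : ∀ z, z = d ∨ z = M.flip d → ¬ M.IsExterior z := by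
          rintro z (rfl | rfl)
          · exact hd
          · rwa [isExterior_flip]
        have hr := (h.rot_rot_eq_iff _).2 hv
        have h1 : M.IsExterior (M.next x) := by
          rcases h.outer_or_outer _ hv with h1 | h1
          · exact Or.inl h1
          · exact Or.inr (by rw [← region_rot, h1])
        have h2 : M.IsExterior x := by
          rcases h.outer_or_outer _ hv with h1 | h1
          · left
            rwa [region_next] at h1
          · right
            have : M.rot (M.next x) = M.flip x := M.rot.injective hr
            rwa [this] at h1
        exact ⟨fun h3 => absurd h2 (hint _ h3), fun h3 => absurd h1 (hint _ h3)⟩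
  have := (key d d' (Quotient.exact harc)).1 (Or.inl rfl)
  exact this

theorem IsSpecial.exists_not_isCorner (h : M.IsSpecial sides) (hquad : sides.length = 4)
    {f : M.Region} {e : D} (he : M.region e = f) (hf : f ≠ M.outer) (hext : M.IsExterior e) :
    ∃ o, M.region o = M.outer ∧ ¬ M.IsCorner o ∧ M.region (M.flip o) = f := by
  have ho := hext.resolve_left (he ▸ hf)
  by_cases hc : M.IsCorner (M.flip e)
  · obtain ⟨p, hp⟩ := M.next.surjective (M.flip e)
    rw [← hp] at hc
    refine ⟨p, by rw [← region_next, hp, ho], fun h1 => h.not_isCorner_next hquad h1 hc, ?_⟩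
    rw [← next_flip_next hc.2, region_next, hp, M.flip_flip, he]
  · exact ⟨M.flip e, ho, hc, by rw [M.flip_flip, he]⟩

/-- The number of interior darts, from Euler's formula. -/
theorem IsSpecial.card_not_isExterior (h : M.IsSpecial sides) (hquad : sides.length = 4) :
    Nat.card {d // ¬ M.IsExterior d} + 2 * Nat.card {o // M.region o = M.outer} + 4 =
      6 * Nat.card M.Region := by
  have e0 := M.euler_darts
  have e1 := card_fibers M.vert (fun v => M.valence v = 3) 3 fun _ hv => hv
  have e2 := card_fibers M.vert (fun v => M.valence v = 2) 2 fun _ hv => hv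
  have e3 : Nat.card {v // M.valence v = 2} = 4 := by
    rw [← h.card_isCorner hquad]
    refine (Nat.card_congr (Equiv.ofBijective (fun o : {o // M.IsCorner o} =>
      (⟨M.vert o.1, (h.rot_rot_eq_iff _).1 o.2.2⟩ : {v // M.valence v = 2})) ⟨?_, ?_⟩)).symm
    · intro a b hab
      exact Subtype.ext (h.2.2.1.1 _ _ a.2.1 b.2.1 (congrArg Subtype.val hab))
    · rintro ⟨v, hv⟩
      obtain ⟨d, rfl⟩ := M.exists_vert v
      obtain ⟨o, ho, rfl | rfl⟩ := h.exists_isCorner ((h.rot_rot_eq_iff d).2 hv)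
      · exact ⟨⟨_, ho⟩, rfl⟩
      · exact ⟨⟨_, ho⟩, Subtype.ext (vert_rot M o).symm⟩
  have e4 := card_add_card_not' fun v => M.valence v = 3
  have e5 := card_add_card_not' fun d => M.valence (M.vert d) = 3
  have e6 : ∀ v, ¬ M.valence v = 3 ↔ M.valence v = 2 := fun v => by
    rcases h.valence_eq v with h1 | ⟨h1, -⟩ <;> omega
  simp only [e6] at e4 e5
  have e7 := card_add_card_not' M.IsExterior
  have e8 := card_add_card_not M.IsExterior fun d => M.region d = M.outer
  have e9 : Nat.card {d // M.IsExterior d ∧ M.region d = M.outer} =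
      Nat.card {o // M.region o = M.outer} :=
    Nat.card_congr (Equiv.subtypeEquivRight fun d => ⟨fun h => h.2, fun h => ⟨Or.inl h, h⟩⟩)
  have e10 : Nat.card {d // M.IsExterior d ∧ ¬ M.region d = M.outer} =
      Nat.card {o // M.region o = M.outer} :=
    Nat.card_congr (M.flip.subtypeEquiv fun d =>
      ⟨fun h1 => h1.1.resolve_left h1.2, fun h1 => ⟨Or.inr h1, fun h2 => h.2.2.1.2 d h2 h1⟩⟩)
  omega

/-- The faces of a special quadrangle form a patch.  Exactly four of its boundary faces, those at
the corners, have two or three interior edges. -/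
theorem IsSpecial.exists_patch (h : M.IsSpecial sides) (hquad : sides.length = 4) :
    ∃ W K, M.IsPatch W K ∧
      (∀ x ∈ W, ∃ o, M.region o = M.outer ∧
        ((3 < x.2.length ∧ M.Traces x.1 (M.flip o :: x.2)) ∨
          (x.2.length ≤ 3 ∧ M.region (M.next o) = M.outer ∧
            M.Traces x.1 (M.flip (M.next o) :: M.flip o :: x.2)))) ∧
      (∀ x ∈ K, M.Traces x.1 x.2) ∧ (∀ f, f ≠ M.outer ↔ f ∈ (W ++ K).map Prod.fst) ∧
      (W.map fun x => x.2.length).count 2 + (W.map fun x => x.2.length).count 3 = 4 := by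
  classical
  choose! E hE using fun o (ho : M.region o = M.outer ∧ ¬ M.IsCorner o) =>
    h.exists_interior hquad ho.1 ho.2
  choose F hF using fun f : M.Region => show ∃ l, M.Traces f l by
    obtain ⟨d, rfl⟩ := M.exists_region f
    obtain ⟨l, hl⟩ := M.exists_traces d
    exact ⟨_, hl⟩
  have := Fintype.ofFinite M.Region
  obtain ⟨x, hx, hxc⟩ : ∃ x, M.region x = M.outer ∧ ¬ M.IsCorner x := by
    by_cases hc : M.IsCorner M.root
    · exact ⟨M.next M.root, region_next M _, h.not_isCorner_next hquad hc⟩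
    · exact ⟨M.root, rfl, hc⟩
  obtain ⟨l, hl⟩ := M.exists_traces x
  rw [hx] at hl
  obtain ⟨L, hLdef⟩ : ∃ L, L = x :: l.filter fun y => ¬ M.IsCorner y := ⟨_, rfl⟩
  have hLf : L = (x :: l).filter fun y => ¬ M.IsCorner y := by
    rw [hLdef, List.filter_cons_of_pos (by simpa using hxc)]
  have hLmem : ∀ o, o ∈ L ↔ M.region o = M.outer ∧ ¬ M.IsCorner o := fun o => by
    rw [hLf, List.mem_filter, hl.2.1]
    simp
  have hLnd : L.Nodup := hLf ▸ hl.1.filter _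
  have hLch : (L : Cycle D).Chain fun a b => (¬ M.IsCorner (M.next a) ∧ b = M.next a) ∨
      (M.IsCorner (M.next a) ∧ b = M.next (M.next a)) := by
    rw [hLdef, Cycle.chain_coe_cons]
    have h1 : (x :: (l ++ [x])).IsChain fun a b => b = M.next a := by
      rw [← List.cons_append, List.isChain_append]
      refine ⟨hl.2.2, by simp, fun a ha b hb => ?_⟩
      obtain rfl : x = b := by simpa using hb
      exact (hl.next_last ha).symm
    have h2 := h1.filter_skip (C := M.IsCorner) (fun _ => h.not_isCorner_next hquad) hxc
    rwa [List.filter_append, List.filter_cons_of_pos (by simpa using hxc), List.filter_nil] at h2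
  have hEmem : ∀ o ∈ L, ∀ d, d ∈ E o ↔ M.region d = M.region (M.flip o) ∧ ¬ M.IsExterior d := by
    intro o ho d
    have hoo := (hLmem o).1 ho
    obtain ⟨h1, h2, h3⟩ := hE o hoo
    have hext : ∀ o', M.region o' = M.outer → M.IsExterior (M.flip o') := fun o' ho' =>
      Or.inr (by rw [M.flip_flip, ho'])
    constructor
    · intro hd
      refine ⟨?_, h2 d hd⟩
      rcases h3 with ⟨-, h3⟩ | ⟨-, h3⟩
      · exact (h3.2.1 d).1 (by simp [hd])
      · exact (h3.2.1 d).1 (by simp [hd])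
    · rintro ⟨hd, hi⟩
      rcases h3 with ⟨-, h3⟩ | ⟨hn, h3⟩
      · rcases List.mem_cons.1 ((h3.2.1 d).2 hd) with rfl | h4
        · exact absurd (hext o hoo.1) hi
        · exact h4
      · rcases List.mem_cons.1 ((h3.2.1 d).2 hd) with rfl | h4
        · exact absurd (hext _ hn.1) hi
        rcases List.mem_cons.1 h4 with rfl | h4
        · exact absurd (hext o hoo.1) hi
        · exact h4
  have hEnd : ∀ o ∈ L, (E o).Nodup ∧ (E o).IsChain fun a b => b = M.next a := by
    intro o ho
    rcases (hE o ((hLmem o).1 ho)).2.2 with ⟨-, h3⟩ | ⟨-, h3⟩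
    · exact ⟨(List.nodup_cons.1 h3.1).2, h3.2.2.tail⟩
    · exact ⟨(List.nodup_cons.1 (List.nodup_cons.1 h3.1).2).2, h3.2.2.tail.tail⟩
  have hEcard : ∀ o ∈ L, Nat.card {d // M.region d = M.region (M.flip o) ∧ ¬ M.IsExterior d} =
      (E o).length := fun o ho => card_eq_length (hEnd o ho).1 (hEmem o ho)
  obtain ⟨R, hR⟩ : ∃ R : List M.Region, R = (Finset.univ.filter fun f : M.Region =>
      f ≠ M.outer ∧ ∀ d, M.region d = f → ¬ M.IsExterior d).toList := ⟨_, rfl⟩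
  have hRnd : R.Nodup := hR ▸ Finset.nodup_toList _
  have hRmem : ∀ f, f ∈ R ↔ f ≠ M.outer ∧ ∀ d, M.region d = f → ¬ M.IsExterior d := by
    intro f
    simp [hR]
  obtain ⟨W, hW⟩ : ∃ W, W = L.map fun o => (M.region (M.flip o), E o) := ⟨_, rfl⟩
  obtain ⟨K, hK⟩ : ∃ K, K = R.map fun f => (f, F f) := ⟨_, rfl⟩
  have hWL : ∀ u ∈ W, ∃ o ∈ L, (M.region (M.flip o), E o) = u := fun u hu => by
    rw [hW] at hu
    exact List.mem_map.1 hu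
  have hKR : ∀ u ∈ K, ∃ f ∈ R, (f, F f) = u := fun u hu => by
    rw [hK] at hu
    exact List.mem_map.1 hu
  have hfst : (W ++ K).map Prod.fst = L.map (fun o => M.region (M.flip o)) ++ R := by
    simp [hW, hK, Function.comp_def]
  have hnf : ((W ++ K).map Prod.fst).Nodup := by
    rw [hfst, List.nodup_append]
    refine ⟨List.Nodup.map_on ?_ hLnd, hRnd, ?_⟩
    · intro o ho o' ho' hoo
      rw [hLmem] at ho ho'
      rcases h.eq_or_corner hquad ho.1 ho'.1 hoo.symm with h1 | ⟨h1, -⟩ | ⟨h1, -⟩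
      · exact h1.symm
      · exact absurd h1 ho'.2
      · exact absurd h1 ho.2
    · rintro f hf g hg rfl
      obtain ⟨o, ho, rfl⟩ := List.mem_map.1 hf
      exact ((hRmem _).1 hg).2 (M.flip o) rfl (Or.inr (by rw [M.flip_flip, ((hLmem o).1 ho).1]))
  have hall : ∀ f, f ≠ M.outer ↔ f ∈ (W ++ K).map Prod.fst := by
    intro f
    rw [hfst, List.mem_append]
    constructor
    · intro hf
      by_cases he : ∀ d, M.region d = f → ¬ M.IsExterior d
      · exact Or.inr ((hRmem f).2 ⟨hf, he⟩)
      · push Not at he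
        obtain ⟨e, he1, he2⟩ := he
        obtain ⟨o, ho, hc, rfl⟩ := h.exists_not_isCorner hquad he1 hf he2
        exact Or.inl (List.mem_map.2 ⟨o, (hLmem o).2 ⟨ho, hc⟩, rfl⟩)
    · rintro (hf | hf)
      · obtain ⟨o, ho, rfl⟩ := List.mem_map.1 hf
        exact h.2.2.1.2 o ((hLmem o).1 ho).1
      · exact ((hRmem f).1 hf).1
  have hreg : ∀ u ∈ W ++ K, ∀ d, d ∈ u.2 ↔ M.region d = u.1 ∧ ¬ M.IsExterior d := by
    intro u hu d
    rcases List.mem_append.1 hu with hu | hu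
    · obtain ⟨o, ho, rfl⟩ := hWL u hu
      exact hEmem o ho d
    · obtain ⟨f, hf, rfl⟩ := hKR u hu
      rw [(hF f).2.1]
      exact ⟨fun h1 => ⟨h1, ((hRmem f).1 hf).2 d h1⟩, fun h1 => h1.1⟩
  have halive : ∀ d, d ∈ (W ++ K).flatMap Prod.snd ↔ ¬ M.IsExterior d := by
    intro d
    rw [List.mem_flatMap]
    constructor
    · rintro ⟨u, hu, hd⟩
      exact ((hreg u hu d).1 hd).2
    · intro hd
      obtain ⟨u, hu, h1⟩ := List.mem_map.1 ((hall (M.region d)).1 fun h0 => hd (Or.inl h0))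
      exact ⟨u, hu, (hreg u hu d).2 ⟨h1.symm, hd⟩⟩
  have hnd : ((W ++ K).flatMap Prod.snd).Nodup := by
    rw [List.nodup_flatMap]
    constructor
    · intro u hu
      rcases List.mem_append.1 hu with hu | hu
      · obtain ⟨o, ho, rfl⟩ := hWL u hu
        exact (hEnd o ho).1
      · obtain ⟨f, hf, rfl⟩ := hKR u hu
        exact (hF f).1
    · refine (List.pairwise_map.1 hnf).imp_of_mem ?_
      intro u v hu hv huv d hdu hdv
      exact huv (((hreg u hu d).1 hdu).1 ▸ ((hreg v hv d).1 hdv).1)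
  have hLlen : L.length + 4 = Nat.card {o // M.region o = M.outer} := by
    have e1 := card_add_card_not (fun o => M.region o = M.outer) M.IsCorner
    have e2 : Nat.card {o // M.region o = M.outer ∧ M.IsCorner o} = 4 := by
      rw [← h.card_isCorner hquad]
      exact Nat.card_congr (Equiv.subtypeEquivRight fun o => ⟨fun h => h.2, fun h => ⟨h.1, h⟩⟩)
    have e3 := card_eq_length hLnd hLmem
    omega
  have hFcard : L.length + R.length + 1 = Nat.card M.Region := by
    have e1 := card_eq_length hnf fun f => (hall f).symm
    have e2 := card_add_card_not' fun f => f ≠ M.outer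
    have e3 : Nat.card {f // ¬ f ≠ M.outer} = 1 := by simp
    rw [hfst, List.length_append, List.length_map] at e1
    omega
  have hpatch : M.IsPatch W K :=
    { nodup_fst := hnf
      region_eq := fun u hu d hd => ((hreg u hu d).1 hd).1
      chain := by
        intro u hu
        rcases List.mem_append.1 hu with hu | hu
        · obtain ⟨o, ho, rfl⟩ := hWL u hu
          exact (hEnd o ho).2
        · obtain ⟨f, hf, rfl⟩ := hKR u hu
          exact (hF f).2.2
      nodup := hnd
      flip_mem := fun d hd => by
        rw [halive] at hd ⊢
        rwa [isExterior_flip]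
      rot_three := fun d hd => h.rot_three_of_interior ((halive d).1 hd)
      seven_le := by
        intro u hu
        obtain ⟨f, hf, rfl⟩ := hKR u hu
        have hf' := (hRmem f).1 hf
        rw [← card_eq_length (hF f).1 (hreg _ (List.mem_append_right W hu))]
        exact h.seven_le hf'.1 hf'.2
      closed := by
        intro u hu a b ha hb
        obtain ⟨f, hf, rfl⟩ := hKR u hu
        have h1 := hF f
        obtain ⟨c, t, ht⟩ := List.exists_cons_of_ne_nil (l := F f)
          (by rintro h0; simp [h0] at hb)
        simp only [ht] at ha hb
        rw [ht] at h1
        obtain rfl : c = b := by simpa using hb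
        exact h1.next_last ha
      meets := by
        rw [hW, ← Cycle.map_coe, Cycle.chain_map]
        rw [hLdef, Cycle.chain_coe_cons] at hLch ⊢
        have hm : ∀ a, a ∈ x :: ((l.filter fun y => ¬ M.IsCorner y) ++ [x]) → a ∈ L := by
          intro a ha
          rw [hLdef]
          simp only [List.mem_cons, List.mem_append, List.not_mem_nil, or_false] at ha ⊢
          tauto
        refine hLch.imp_of_mem_imp fun a b ha hb hab => ?_
        have ha' := (hLmem a).1 (hm a ha)
        have hb' := (hLmem b).1 (hm b hb)
        obtain ⟨ha1, -, ha3⟩ := hE a ha'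
        have hb3 : M.rot (M.rot (M.rot b)) = b := h.rot_three fun h0 => hb'.2 ⟨hb'.1, h0⟩
        obtain ⟨c, t, ht⟩ := List.exists_cons_of_ne_nil (l := E a)
          (by rintro h0; simp [h0] at ha1)
        obtain ⟨z, hz⟩ : ∃ z, (E a).getLast? = some z :=
          ⟨_, List.getLast?_eq_some_getLast (by simp [ht])⟩
        refine ⟨z, M.rot b, hz, (hE b hb').1, ?_⟩
        rcases ha3 with ⟨hn, ha3⟩ | ⟨hn, ha3⟩
        · obtain rfl : b = M.next a := by tauto
          exact rot_next_eq (ha3.next_last (by simpa [ht, List.getLast?_cons_cons] using hz)) hb3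
        · obtain rfl : b = M.next (M.next a) := by tauto
          exact rot_next_eq (ha3.next_last (by simpa [ht, List.getLast?_cons_cons] using hz)) hb3
      sum := by
        have e1 : ((W ++ K).flatMap Prod.snd).length = Nat.card {d // ¬ M.IsExterior d} :=
          (card_eq_length hnd halive).symm
        have e2 := h.card_not_isExterior hquad
        have e3 : ∀ (V : List (M.Region × List D)) (c : ℤ),
            (V.map fun e => c - e.2.length).sum =
              c * V.length - ((V.flatMap Prod.snd).length : ℤ) := by
          intro V c
          induction V with
          | nil => simp
          | cons e V ih =>
            simp only [List.map_cons, List.sum_cons, ih, List.flatMap_cons, List.length_append,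
              List.length_cons]
            push_cast
            ring
        have e4 : (K.map fun e => (e.2.length : ℤ) - 6).sum =
            -(K.map fun e => (6 : ℤ) - e.2.length).sum := by
          clear * -
          induction K with
          | nil => simp
          | cons e K ih =>
            simp only [List.map_cons, List.sum_cons, ih]
            ring
        have e5 : W.length = L.length := by simp [hW]
        have e6 : K.length = R.length := by simp [hK]
        rw [List.flatMap_append, List.length_append] at e1
        rw [e4, e3, e3, e5, e6]
        omega }
  have hfour : 4 ≤ W.length := by
    rw [hW, List.length_map, ← card_eq_length hLnd hLmem, ← h.card_isCorner hquad]
    refine Nat.card_le_card_of_injective (fun o => ⟨M.next o.1, ?_, ?_⟩) ?_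
    · rw [region_next, o.2.1]
    · exact h.not_isCorner_next hquad o.2
    · intro a b hab
      exact Subtype.ext (M.next.injective (congrArg Subtype.val hab))
  have hlight : ∀ o ∈ L, (M.IsCorner (M.next o) → (E o).length = 2 ∨ (E o).length = 3) ∧
      (¬ M.IsCorner (M.next o) → 3 < (E o).length) := by
    intro o ho
    have hoo := (hLmem o).1 ho
    have hmem : (M.region (M.flip o), E o) ∈ W := by
      rw [hW]
      exact List.mem_map_of_mem ho
    constructor
    · intro hn
      have h2 := hpatch.two_le (by omega) _ hmem
      obtain ⟨b, hb⟩ := h.head_of_isCorner hn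
      have h3 := (h.corner hquad hb).2.2.2
      rw [show M.region (M.flip (M.next o)) = M.region (M.flip o) by
        rw [← next_flip_next hn.2, region_next]] at h3
      have h4 : (E o).length ≤ M.interiorDegree (M.region (M.flip o)) := by
        rw [← hEcard o ho]
        refine Nat.card_le_card_of_injective (fun d => ⟨M.arc d.1, d.1, rfl, d.2⟩) ?_
        rintro ⟨d, hd⟩ ⟨d', hd'⟩ hdd
        rcases h.eq_or_eq_flip hd.2 (congrArg Subtype.val hdd) with h5 | h5
        · exact Subtype.ext h5.symm
        · refine absurd ?_ (M.triSystem.notMem_self ⟨W, K, hpatch, rfl, rfl⟩ _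
            (List.mem_map_of_mem hmem))
          refine List.mem_map.2 ⟨d, (hEmem o ho d).2 hd, ?_⟩
          show M.region (M.flip d) = M.region (M.flip o)
          rw [← h5, hd'.1]
      simp only at h2
      omega
    · intro hn
      rw [← hEcard o ho]
      refine h.four_le hoo.1 fun o' ho' hr => ?_
      rcases h.eq_or_corner hquad hoo.1 ho' hr with h1 | ⟨h1, h2⟩ | ⟨h1, -⟩
      · exact h1
      · exact absurd (h2 ▸ h1) hn
      · exact absurd h1 hoo.2
  refine ⟨W, K, hpatch, ?_, ?_, hall, ?_⟩
  · intro u hu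
    obtain ⟨o, ho, rfl⟩ := hWL u hu
    have hoo := (hLmem o).1 ho
    refine ⟨o, hoo.1, ?_⟩
    rcases (hE o hoo).2.2 with ⟨h1, h2⟩ | ⟨h1, h2⟩
    · exact Or.inl ⟨(hlight o ho).2 h1, h2⟩
    · refine Or.inr ⟨?_, h1.1, h2⟩
      have := (hlight o ho).1 h1
      simp only
      omega
  · intro u hu
    obtain ⟨f, hf, rfl⟩ := hKR u hu
    exact hF f
  · have e1 : ∀ l : List ℕ, l.count 2 + l.count 3 = l.countP fun n => n = 2 ∨ n = 3 := by
      intro l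
      induction l with
      | nil => rfl
      | cons a l ih =>
        simp only [List.count_cons, List.countP_cons, ← ih]
        by_cases h2 : a = 2
        · subst h2
          simp
          omega
        · by_cases h3 : a = 3
          · subst h3
            simp
            omega
          · simp [h2, h3]
    rw [e1, hW, List.map_map, List.countP_map, List.countP_eq_length_filter,
      ← h.card_isCorner hquad]
    rw [← card_eq_length (p := fun o => M.IsCorner (M.next o)) (hLnd.filter _)]
    · exact Nat.card_congr (M.next.subtypeEquiv fun o => Iff.rfl)
    · intro o
      rw [List.mem_filter, hLmem]
      simp only [Function.comp_apply, decide_eq_true_eq]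
      constructor
      · rintro ⟨h1, h2⟩
        by_contra hn
        have := (hlight o ((hLmem o).2 h1)).2 hn
        omega
      · intro hn
        have h1 : M.region o = M.outer ∧ ¬ M.IsCorner o :=
          ⟨by rw [← region_next, hn.1], fun h0 => h.not_isCorner_next hquad h0 hn⟩
        exact ⟨h1, (hlight o ((hLmem o).2 h1)).1 hn⟩

end Diagram

/-! ### The gluing table of a special quadrangle -/

namespace Diagram

variable {D : Type*} [Finite D] {M : Diagram D} {sides : List (List D)}

theorem exists_label {T : List (List ℕ)} {l : List M.Region} (hnd : l.Nodup)
    (hmem : ∀ f, f ≠ M.outer ↔ f ∈ l) (hlen : l.length = T.length) {v : ℕ → M.Region}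
    (hv : ∀ f ∈ l, ∃ k < T.length, v (k + 1) = f) :
    ∃ label : M.Region → ℕ, Function.Injective label ∧ label M.outer = 0 ∧
      (∀ k, (∃ f, label f = k) ↔ k ≤ T.length) ∧
      ∀ k < T.length, label (v (k + 1)) = k + 1 := by
  classical
  choose! κ hκ using hv
  have hbij : Function.Bijective
      fun f : {f // f ≠ M.outer} => (⟨κ f.1, (hκ f.1 ((hmem f.1).1 f.2)).1⟩ : Fin T.length) := by
    rw [Nat.bijective_iff_injective_and_card]
    refine ⟨fun f g hfg => Subtype.ext ?_, ?_⟩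
    · have h1 := (hκ f.1 ((hmem f.1).1 f.2)).2
      have h2 := (hκ g.1 ((hmem g.1).1 g.2)).2
      rw [← h1, ← h2, show κ f.1 = κ g.1 from congrArg Fin.val hfg]
    · rw [card_eq_length hnd fun f => (hmem f).symm, hlen, Nat.card_fin]
  refine ⟨fun f => if f = M.outer then 0 else κ f + 1, ?_, by simp, ?_, ?_⟩
  · intro f g hfg
    by_cases hf : f = M.outer <;> by_cases hg : g = M.outer
    · rw [hf, hg]
    · simp [hf, hg] at hfg
    · simp [hf, hg] at hfg
    · simp only [hf, hg, if_false, Nat.add_right_cancel_iff] at hfg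
      exact congrArg Subtype.val (@hbij.1 ⟨f, hf⟩ ⟨g, hg⟩ (Fin.ext hfg))
  · intro k
    constructor
    · rintro ⟨f, rfl⟩
      by_cases hf : f = M.outer
      · simp [hf]
      · simpa [hf] using (hκ f ((hmem f).1 hf)).1
    · intro hk
      rcases k with _ | k
      · exact ⟨M.outer, by simp⟩
      · obtain ⟨⟨f, hf⟩, h1⟩ := hbij.2 ⟨k, hk⟩
        exact ⟨f, by simpa [hf] using congrArg Fin.val h1⟩
  · intro k hk
    obtain ⟨⟨f, hf⟩, h1⟩ := hbij.2 ⟨k, hk⟩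
    have h2 : κ f = k := congrArg Fin.val h1
    have h3 := (hκ f ((hmem f).1 hf)).2
    rw [h2] at h3
    simp [h3, hf, h2]

theorem Traces.exists_map_eq {f : M.Region} {l : List D} (h : M.Traces f l) {g : D → ℕ}
    {row : List ℕ} (hr : row ~r l.map g) : ∃ l', M.Traces f l' ∧ row = l'.map g := by
  obtain ⟨n, hn⟩ := hr.symm
  exact ⟨l.rotate n, h.of_isRotated ⟨n, rfl⟩, by rw [List.map_rotate, hn]⟩

/-- A diagram whose faces form a patch is glued according to any table that lists the neighbours
of the faces of the patch. -/
theorem realizes_of_shape {W K : List (M.Region × List D)} {T : List (List ℕ)}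
    (hP : M.IsPatch W K)
    (hW : ∀ x ∈ W, ∃ o, M.region o = M.outer ∧
      ((3 < x.2.length ∧ M.Traces x.1 (M.flip o :: x.2)) ∨
        (x.2.length ≤ 3 ∧ M.region (M.next o) = M.outer ∧
          M.Traces x.1 (M.flip (M.next o) :: M.flip o :: x.2))))
    (hK : ∀ x ∈ K, M.Traces x.1 x.2) (hall : ∀ f, f ≠ M.outer ↔ f ∈ (W ++ K).map Prod.fst)
    (hT : Shape (W.map M.entry) (K.map M.entry) T) : M.Realizes T := by
  obtain ⟨v, hlen, hw, hk⟩ := hT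
  obtain ⟨label, h1, h2, h3, h4⟩ := M.exists_label (T := T) (v := v) hP.nodup_fst hall
    (by simpa using hlen) (by
      intro f hf
      obtain ⟨x, hx, rfl⟩ := List.mem_map.1 hf
      rcases List.mem_append.1 hx with hx | hx
      · obtain ⟨k, r, row, e1, e2, -⟩ := hw _ (List.mem_map_of_mem hx)
        exact ⟨k, (List.getElem?_eq_some_iff.1 e1).1, (congrArg Prod.fst e2).symm⟩
      · obtain ⟨k, r, row, e1, e2, -⟩ := hk _ (List.mem_map_of_mem hx)
        exact ⟨k, (List.getElem?_eq_some_iff.1 e1).1, (congrArg Prod.fst e2).symm⟩)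
  have hrow : ∀ {x : M.Region × List D} {k : ℕ} {r row : List ℕ}, T[k]? = some row →
      M.entry x = (v (k + 1), r.map v) → (∀ j ∈ r, 1 ≤ j ∧ j ≤ T.length) →
      T[label x.1 - 1]? = some row ∧
        x.2.map (fun d => label (M.region (M.flip d))) = r := by
    intro x k r row e1 e2 e3
    have e4 : x.1 = v (k + 1) := congrArg Prod.fst e2
    have e5 : x.2.map (fun d => M.region (M.flip d)) = r.map v := congrArg Prod.snd e2
    refine ⟨by rw [e4, h4 k (List.getElem?_eq_some_iff.1 e1).1, Nat.add_sub_cancel, e1], ?_⟩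
    have e6 : x.2.map (fun d => label (M.region (M.flip d))) =
        (x.2.map fun d => M.region (M.flip d)).map label := by simp
    rw [e6, e5, List.map_map]
    conv_rhs => rw [← List.map_id r]
    refine List.map_congr_left fun j hj => ?_
    obtain ⟨e7, e8⟩ := e3 j hj
    obtain ⟨j, rfl⟩ := Nat.exists_eq_add_of_le' e7
    exact h4 j e8
  refine ⟨label, h1, h2, h3, fun f hf => ?_⟩
  obtain ⟨x, hx, rfl⟩ := List.mem_map.1 ((hall f).1 hf)
  rcases List.mem_append.1 hx with hx | hx
  · obtain ⟨k, r, row, e1, e2, e3, e4⟩ := hw _ (List.mem_map_of_mem hx)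
    obtain ⟨e5, e6⟩ := hrow e1 e2 e3
    have e7 : r.length = x.2.length := by rw [← e6, List.length_map]
    obtain ⟨o, ho, ⟨h5, h6⟩ | ⟨h5, h6, h7⟩⟩ := hW x hx
    · rw [if_neg (by omega), ← e6] at e4
      obtain ⟨l, h8, h9⟩ := h6.exists_map_eq (g := fun d => label (M.region (M.flip d)))
        (row := row) (by simpa [M.flip_flip, ho, h2] using e4)
      exact ⟨l, h8, by rw [e5, h9]⟩
    · rw [if_pos (by omega), ← e6] at e4
      obtain ⟨l, h8, h9⟩ := h7.exists_map_eq (g := fun d => label (M.region (M.flip d)))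
        (row := row) (by simpa [M.flip_flip, ho, h6, h2] using e4)
      exact ⟨l, h8, by rw [e5, h9]⟩
  · obtain ⟨k, r, row, e1, e2, e3, e4⟩ := hk _ (List.mem_map_of_mem hx)
    obtain ⟨e5, e6⟩ := hrow e1 e2 e3
    rw [← e6] at e4
    obtain ⟨l, h8, h9⟩ := (hK x hx).exists_map_eq e4
    exact ⟨l, h8, by rw [e5, h9]⟩

theorem IsSpecial.hasShape (h : M.IsSpecial sides) (hquad : sides.length = 4) :
    ∃ T, ((∃ x : Extraordinary, T = x.table) ∨ ∃ e t, T = Zipper.table e t) ∧ M.HasShape T := by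
  obtain ⟨W, K, hP, hW, hK, hall, hc⟩ := h.exists_patch hquad
  obtain ⟨T, hT, hs⟩ := M.triSystem.hasListedShape ⟨W, K, hP, rfl, rfl⟩
    (by simpa [entry, Function.comp_def] using hc)
  exact ⟨T, hT, hs.imp (realizes_of_shape hP hW hK hall) (realizes_of_shape hP hW hK hall)⟩

end Diagram

theorem theorem3 {D : Type*} [Finite D] (M : Diagram D) (sides : List (List D))
    (hquad : sides.length = 4) (hspecial : M.IsSpecial sides) :
    (∃ x : Extraordinary, M.HasShape x.table) ∨
    ∃ (ends : Zipper.Ends) (parity : Fin 2), ∃ T ∈ zipperedFamily ends parity, M.HasShape T := by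
  obtain ⟨T, ⟨x, rfl⟩ | ⟨e, t, rfl⟩, hT⟩ := hspecial.hasShape hquad
  · exact Or.inl ⟨x, hT⟩
  · refine Or.inr ⟨e, ⟨t % 2, Nat.mod_lt t two_pos⟩, _, ⟨t / 2, ?_⟩, hT⟩
    rw [Nat.div_add_mod]
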